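/- **Setting.** Let $d\in\mathbb N$, and let $\dot\Delta_l=\varphi(2^{-l}D)$, $\dot S_l=\chi(2^{-l}D)$ ($l\in\mathbb Z$) be a homogeneous Littlewood–Paley decomposition of $\mathbb R^d$: $\chi$ is smooth, radial, nonincreasing in the radius, supported in $\bar B(0,\frac43)$, equal to $1$ near $\bar B(0,\frac34)$, and $\varphi(\xi)=\chi(\xi/2)-\chi(\xi)$, which is supported in $\{\frac34\le|\xi|\le C_0\}$, $C_0=\frac83$. Let $\mathcal S_h'$ be the set of tempered distributions $f$ with $\|\dot S_lf\|_{L^\infty}\to0$ as $l\to-\infty$, and let $\dot B^\sigma_{2,1}$ be the space of all $f\in\mathcal S_h'$ with $\|f\|_{\dot B^\sigma_{2,1}}=\sum_{l\in\mathbb Z}2^{l\sigma}\|\dot\Delta_lf\|_{L^2}<\infty$. For $\rho\in\{1,\infty\}$ put $\|f\|_{\widetilde L^\rho_t\dot B^\sigma_{2,1}}=\sum_l2^{l\sigma}\|\dot\Delta_lf\|_{L^\rho([0,t];L^2)}$. Fix $\gamma>0$ with $\frac{1-e^{-z}}z\ge\frac12$ for $0<z\le\gamma$, and for $\varepsilon>0$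 let $l_\varepsilon=\left\lfloor\frac12\log_2\frac{\gamma}{C_0\varepsilon^2}-1\right\rfloor$ and $$\|f\|_{\widetilde L^1_t\dot B^{\sigma_1,\sigma_2}_\varepsilon}=\sum_{l\le l_\varepsilon}2^{l\sigma_1}\|\dot\Delta_lf\|_{L^1([0,t];L^2)}+\frac1{\varepsilon^2}\sum_{l>l_\varepsilon}2^{l\sigma_2}\|\dot\Delta_lf\|_{L^1([0,t];L^2)} .$$ Norms of vector fields are sums over the components. Let $\phi_\varepsilon(x)=\varepsilon^{-d}(4\pi)^{-d/2}e^{-|x|^2/(4\varepsilon^2)}$, so that $\widehat{\phi_\varepsilon}(\xi)=e^{-\varepsilon^2|\xi|^2}$, and $\mathcal Au=\mu\Delta u+(\lambda+\mu)\nabla\operatorname{div}u$. **Proposition.** Let $\mu>0$, $\nu=\lambda+2\mu>0$, $p>0$, $k>0$ and $1-\frac d2<s\le1+\frac d2$. There is a constant $C>0$, depending only on $d,s,\mu,\lambda,p,k$ and on $\chi,\gamma$, such that the following holds for every $\varepsilon>0$ and every interval $I=[0,T)$, $0<T\le\infty$. Let $v\in L^1(I;\dot B^{d/2+1}_{2,1})\cap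 L^2(I;\dot B^{d/2}_{2,1})$ be a real vector field, let $F$ and $G$ be a scalar and a vector field, measurable in time with values in the tempered distributions, and let $(q,u)$ be a solution on $I$ of $$(LR_\varepsilon)\qquad\begin{cases}\partial_tq+v\cdot\nabla q+\operatorname{div}u=F,\\ \partial_tu+v\cdot\nabla u-\mathcal Au+p\nabla q-\frac k{\varepsilon^2}\nabla(\phi_\varepsilon*q-q)=G,\end{cases}$$ with $q\in L^\infty_{\rm loc}(I;\dot B^{s-1}_{2,1}\cap\dot B^s_{2,1})$ and $u\in L^\infty_{\rm loc}(I;\dot B^{s-1}_{2,1})$ (that is, bounded on $[0,t]$ for every $t\in I$). The equations are understood in the sense of tempered distributions in $x$, integrated in time from $0$ to $t$ for all $t\in I$; in particular the time integrand is integrable against each test function. The products $ab$ in $v\cdot\nabla q$ and $v\cdot\nabla u$ are the limits of $\dot S_na\,\dot S_nb$ in $\mathcal S'$ as $n\to\infty$. Then, with $q_0=q(0)$ and $u_0=u(0)$, for all $t\in I$, $$\begin{aligned}&\|u\|_{\widetilde L^\infty_t\dot B^{s-1}_{2,1}}+\|q\|_{\widetilde L^\infty_t\dot B^{s-1}_{2,1}}+\|q\|_{\widetilde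 L^\infty_t\dot B^{s}_{2,1}}+\|u\|_{\widetilde L^1_t\dot B^{s+1}_{2,1}}+\|q\|_{\widetilde L^1_t\dot B^{s+1,s}_\varepsilon}+\|q\|_{\widetilde L^1_t\dot B^{s+2,s}_\varepsilon}\\ &\quad\le C\,e^{C\int_0^t(\|\nabla v(\tau)\|_{\dot B^{d/2}_{2,1}}+\|v(\tau)\|^2_{\dot B^{d/2}_{2,1}})\,d\tau}\Big(\|u_0\|_{\dot B^{s-1}_{2,1}}+\|q_0\|_{\dot B^{s-1}_{2,1}}+\|q_0\|_{\dot B^{s}_{2,1}}\\ &\qquad\qquad+\|F\|_{\widetilde L^1_t\dot B^{s-1}_{2,1}}+\|F\|_{\widetilde L^1_t\dot B^{s}_{2,1}}+\|G\|_{\widetilde L^1_t\dot B^{s-1}_{2,1}}\Big).\end{aligned}$$ -/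

import Mathlib

open MeasureTheory Filter Topology TemperedDistribution
open scoped ENNReal SchwartzMap ContDiff LineDeriv Laplacian

noncomputable section

namespace LinearCapillary

/-- The space `ℝ^d` with its Euclidean norm. -/
abbrev Space (d : ℕ) := EuclideanSpace ℝ (Fin d)

/-- Tempered distributions on `ℝ^d`. -/
abbrev Distr (d : ℕ) := 𝓢'(Space d, ℂ)

variable {d : ℕ}

/-! ### Fourier multipliers, Littlewood-Paley decomposition, Besov norms -/

/-- The operator `m(D)`, `D = -i∇`, i.e. multiplication by `m(ξ)` of the Fourier transform
`∫ e^{-i x·ξ} f(x) dx`. Mathlib's Fourier transform has the kernel `e^{-2πi x·η}`,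
so that `ξ = 2π η`. -/
def multiplier (m : Space d → ℝ) (f : Distr d) : Distr d :=
  fourierMultiplierCLM ℂ (fun η ↦ ((m ((2 * Real.pi) • η) : ℝ) : ℂ)) f

/-- The function `χ` from which the Littlewood-Paley decomposition is built: smooth, radial and
nonincreasing in the radius, supported in the ball of radius `4/3`,
equal to `1` near the ball of radius `3/4`. -/
structure IsCutoff (χ : Space d → ℝ) : Prop where
  smooth : ContDiff ℝ ∞ χ
  radial_antitone : ∀ ξ ζ : Space d, ‖ξ‖ ≤ ‖ζ‖ → χ ζ ≤ χ ξ
  support_subset : Function.support χ ⊆ Metric.closedBall 0 (4 / 3)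
  eq_one : ∀ᶠ ξ in 𝓝ˢ (Metric.closedBall (0 : Space d) (3 / 4)), χ ξ = 1

/-- `φ(ξ) = χ(ξ/2) - χ(ξ)`, supported in the annulus `3/4 ≤ |ξ| ≤ 8/3`. -/
def annulusFun (χ : Space d → ℝ) (ξ : Space d) : ℝ := χ ((1 / 2 : ℝ) • ξ) - χ ξ

/-- The outer radius `C₀` of the annulus supporting `annulusFun χ`. -/
def outerRadius : ℝ := 8 / 3

/-- The dyadic block `Δ̇_l = φ(2^{-l} D)`. -/
def dyadicBlock (χ : Space d → ℝ) (l : ℤ) (f : Distr d) : Distr d :=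
  multiplier (fun ξ ↦ annulusFun χ ((2 : ℝ) ^ (-l) • ξ)) f

/-- The low frequency cut-off `Ṡ_l = χ(2^{-l} D)`. -/
def lowFreq (χ : Space d → ℝ) (l : ℤ) (f : Distr d) : Distr d :=
  multiplier (fun ξ ↦ χ ((2 : ℝ) ^ (-l) • ξ)) f

/-- The `L^p` norm of a tempered distribution, `∞` if it is not given by an `L^p` function. -/
def distrLpNorm (p : ℝ≥0∞) [Fact (1 ≤ p)] (f : Distr d) : ℝ≥0∞ :=
  ⨅ (g : Lp ℂ p (volume : Measure (Space d))) (_ : Lp.toTemperedDistribution g = f), ‖g‖ₑ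

/-- The class `𝓢'_h`: tempered distributions with `‖Ṡ_l f‖_{L^∞} → 0` as `l → -∞`. -/
def IsSh (χ : Space d → ℝ) (f : Distr d) : Prop :=
  Tendsto (fun l : ℤ ↦ distrLpNorm ∞ (lowFreq χ l f)) atBot (𝓝 0)

/-- The weight `2^{l s}`. -/
def dyadicWeight (s : ℝ) (l : ℤ) : ℝ≥0∞ := ENNReal.ofReal ((2 : ℝ) ^ ((l : ℝ) * s))

/-- The homogeneous Besov norm `‖f‖_{Ḃ^s_{2,1}}`. -/
def besovNorm (χ : Space d → ℝ) (s : ℝ) (f : Distr d) : ℝ≥0∞ :=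
  ∑' l : ℤ, dyadicWeight s l * distrLpNorm 2 (dyadicBlock χ l f)

/-- `‖w‖_{Ḃ^s_{2,1}}` of a vector field: the sum over the components. -/
def besovNormVec (χ : Space d → ℝ) (s : ℝ) (w : Fin d → Distr d) : ℝ≥0∞ :=
  ∑ i, besovNorm χ s (w i)

/-- The norm of `f` in `L̃^ρ_t(Ḃ^s_{2,1})`, for functions of time `τ ∈ [0,t]`. -/
def tildeNorm (χ : Space d → ℝ) (ρ : ℝ≥0∞) (s t : ℝ) (f : ℝ → Distr d) : ℝ≥0∞ :=
  ∑' l : ℤ, dyadicWeight s l *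
    eLpNorm (fun τ ↦ distrLpNorm 2 (dyadicBlock χ l (f τ))) ρ (volume.restrict (Set.Icc 0 t))

/-- The norm of a vector field in `L̃^ρ_t(Ḃ^s_{2,1})`: the sum over the components. -/
def tildeNormVec (χ : Space d → ℝ) (ρ : ℝ≥0∞) (s t : ℝ) (w : ℝ → Fin d → Distr d) : ℝ≥0∞ :=
  ∑ i, tildeNorm χ ρ s t (fun τ ↦ w τ i)

/-- The frequency threshold `l_ε = [½ log₂(γ / (C₀ ε²)) - 1]`. -/
def threshold (γ ε : ℝ) : ℤ := ⌊1 / 2 * Real.logb 2 (γ / (outerRadius * ε ^ 2)) - 1⌋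

/-- The weight of the hybrid space `Ḃ_ε^{s₁,s₂}`: `2^{l s₁}` for `l ≤ l_ε` and `ε⁻² 2^{l s₂}`
for `l > l_ε`. -/
def hybridWeight (γ ε s₁ s₂ : ℝ) (l : ℤ) : ℝ≥0∞ :=
  if l ≤ threshold γ ε then dyadicWeight s₁ l
  else ENNReal.ofReal (1 / ε ^ 2) * dyadicWeight s₂ l

/-- The norm of `f` in `L̃^ρ_t(Ḃ_ε^{s₁,s₂})`. -/
def tildeHybridNorm (χ : Space d → ℝ) (γ ε : ℝ) (ρ : ℝ≥0∞) (s₁ s₂ t : ℝ) (f : ℝ → Distr d) :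
    ℝ≥0∞ :=
  ∑' l : ℤ, hybridWeight γ ε s₁ s₂ l *
    eLpNorm (fun τ ↦ distrLpNorm 2 (dyadicBlock χ l (f τ))) ρ (volume.restrict (Set.Icc 0 t))

/-! ### Differential operators, the nonlocal operator, products -/

/-- The partial derivative `∂_i`. -/
def partialD (i : Fin d) (f : Distr d) : Distr d := ∂_{EuclideanSpace.single i (1 : ℝ)} f

/-- The divergence. -/
def divergence (w : Fin d → Distr d) : Distr d := ∑ i, partialD i (w i)

/-- `‖∇w‖_{Ḃ^s_{2,1}}` of a vector field. -/
def besovNormGrad (χ : Space d → ℝ) (s : ℝ) (w : Fin d → Distr d) : ℝ≥0∞ :=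
  ∑ j, ∑ i, besovNorm χ s (partialD j (w i))

/-- The `i`-th component of `𝓐 w = μ Δ w + (λ + μ) ∇ div w`. -/
def viscosity (μ lam : ℝ) (w : Fin d → Distr d) (i : Fin d) : Distr d :=
  (μ : ℂ) • Δ (w i) + ((lam + μ : ℝ) : ℂ) • partialD i (divergence w)

/-- The kernel `φ_ε(x) = ε^{-d} φ(x/ε)` with `φ(x) = (4π)^{-d/2} e^{-|x|²/4}`. -/
def capillaryKernel (ε : ℝ) (x : Space d) : ℝ :=
  ε ^ (-(d : ℤ)) * ((4 * Real.pi) ^ (-(d : ℝ) / 2) * Real.exp (-‖(1 / ε) • x‖ ^ 2 / 4))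

/-- The Fourier transform of `φ_ε` is `e^{-ε²|ξ|²}`, where `ξ = 2π η`. -/
theorem fourier_capillaryKernel {ε : ℝ} (hε : 0 < ε) (η : Space d) :
    FourierTransform.fourier (fun x : Space d ↦ (capillaryKernel ε x : ℂ)) η
      = (Real.exp (-(ε ^ 2 * ‖(2 * Real.pi) • η‖ ^ 2)) : ℝ) := by
  have hb : 0 < (((1 / (4 * ε ^ 2) : ℝ)) : ℂ).re := by
    rw [Complex.ofReal_re]; positivity
  have key := fourier_gaussian_innerProductSpace (V := Space d) hb η
  have h1 : (fun x : Space d ↦ (capillaryKernel ε x : ℂ)) =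
      ((ε ^ (-(d : ℤ)) * (4 * Real.pi) ^ (-(d : ℝ) / 2) : ℝ) : ℂ) •
        (fun x : Space d ↦ Complex.exp (-((1 / (4 * ε ^ 2) : ℝ) : ℂ) * ‖x‖ ^ 2)) := by
    funext x
    simp only [capillaryKernel, Pi.smul_apply, smul_eq_mul, norm_smul]
    rw [← mul_assoc]
    push_cast
    congr 2
    rw [Real.norm_of_nonneg (by positivity : 0 ≤ 1 / ε)]
    push_cast
    field_simp
  have h2 : FourierTransform.fourier (((ε ^ (-(d : ℤ)) * (4 * Real.pi) ^ (-(d : ℝ) / 2) : ℝ) : ℂ) •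
        (fun x : Space d ↦ Complex.exp (-((1 / (4 * ε ^ 2) : ℝ) : ℂ) * ‖x‖ ^ 2))) η =
      ((ε ^ (-(d : ℤ)) * (4 * Real.pi) ^ (-(d : ℝ) / 2) : ℝ) : ℂ) *
      FourierTransform.fourier
        (fun x : Space d ↦ Complex.exp (-((1 / (4 * ε ^ 2) : ℝ) : ℂ) * ‖x‖ ^ 2)) η := by
    rw [Real.fourier_eq, Real.fourier_eq, ← smul_eq_mul (a := ((_ : ℝ) : ℂ)), ← integral_smul]
    refine integral_congr_ae (ae_of_all _ fun x ↦ ?_)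
    simp only [Pi.smul_apply]
    rw [smul_comm]
  rw [h1, h2, key]
  have h3 : ((Real.pi : ℂ) / ((1 / (4 * ε ^ 2) : ℝ) : ℂ)) ^ ((Module.finrank ℝ (Space d) : ℂ) / 2)
      = (((4 * Real.pi) ^ ((d : ℝ) / 2) * ε ^ (d : ℕ) : ℝ) : ℂ) := by
    have : (Real.pi : ℂ) / ((1 / (4 * ε ^ 2) : ℝ) : ℂ) = ((4 * Real.pi * ε ^ 2 : ℝ) : ℂ) := by
      push_cast; field_simp
    rw [this, finrank_euclideanSpace_fin,
      show ((d : ℂ) / 2) = (((d : ℝ) / 2 : ℝ) : ℂ) by push_cast; rfl,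
      ← Complex.ofReal_cpow (by positivity), Real.mul_rpow (by positivity) (by positivity),
      ← Real.rpow_natCast ε 2, ← Real.rpow_mul hε.le]
    congr 2
    rw [show ((2 : ℕ) : ℝ) * ((d : ℝ) / 2) = (d : ℝ) by push_cast; ring, Real.rpow_natCast]
  rw [h3, ← mul_assoc, ← Complex.ofReal_mul]
  have h4 : ε ^ (-(d : ℤ)) * (4 * Real.pi) ^ (-(d : ℝ) / 2) *
      ((4 * Real.pi) ^ ((d : ℝ) / 2) * ε ^ (d : ℕ)) = 1 := by
    rw [neg_div, Real.rpow_neg (by positivity), zpow_neg, zpow_natCast]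
    have : (4 * Real.pi) ^ ((d : ℝ) / 2) ≠ 0 := by positivity
    field_simp
  rw [h4, Complex.ofReal_one, one_mul, Complex.ofReal_exp, norm_smul,
    Real.norm_of_nonneg (by positivity : 0 ≤ 2 * Real.pi)]
  congr 1
  push_cast
  field_simp
  ring

/-- The symbol of `φ_ε * ·` is an admissible Fourier multiplier. -/
theorem hasTemperateGrowth_capillarySymbol (ε : ℝ) :
    (fun η : Space d ↦ ((Real.exp (-(ε ^ 2 * ‖(2 * Real.pi) • η‖ ^ 2)) : ℝ) : ℂ)).HasTemperateGrowth
    := by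
  have hre : (fun η : Space d ↦ Real.exp (-(ε ^ 2 * ‖(2 * Real.pi) • η‖ ^ 2))).HasTemperateGrowth
      := by
    have hf : (fun η : Space d ↦ -(ε ^ 2 * ‖(2 * Real.pi) • η‖ ^ 2)).HasTemperateGrowth := by
      simp only [norm_smul, mul_pow]
      fun_prop
    refine ⟨Real.contDiff_exp.comp hf.1, fun n ↦ ?_⟩
    obtain ⟨m, K, hK, hb⟩ := hf.norm_iteratedFDeriv_le_uniform n
    refine ⟨m * n, n.factorial * 1 * (1 + K) ^ n, fun x ↦ ?_⟩
    have h1 : (1 : ℝ) ≤ (1 + ‖x‖) ^ m := one_le_pow₀ (by linarith [norm_nonneg x])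
    have h2 : (1 : ℝ) ≤ (1 + K) * (1 + ‖x‖) ^ m := by nlinarith
    have := norm_iteratedFDeriv_comp_le (𝕜 := ℝ) (g := Real.exp) (n := n) (N := ∞) (C := 1)
      (D := (1 + K) * (1 + ‖x‖) ^ m) Real.contDiff_exp hf.1 (by exact_mod_cast le_top) x
      (fun i _ ↦ ?_) (fun i hi1 hi ↦ ?_)
    · calc _ ≤ _ := this
        _ = _ := by rw [mul_pow, pow_mul]; ring
    · rw [norm_iteratedFDeriv_eq_norm_iteratedDeriv, iteratedDeriv_eq_iterate, Real.iter_deriv_exp,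
        Real.norm_of_nonneg (Real.exp_pos _).le, Real.exp_le_one_iff]
      have : 0 ≤ ε ^ 2 * ‖(2 * Real.pi) • x‖ ^ 2 := by positivity
      linarith
    · calc _ ≤ K * (1 + ‖x‖) ^ m := hb i hi x
        _ ≤ (1 + K) * (1 + ‖x‖) ^ m := by nlinarith
        _ ≤ _ := le_self_pow₀ h2 (by omega)
  exact Complex.ofRealCLM.hasTemperateGrowth.comp hre

/-- The convolution `φ_ε * f`, defined by `(φ_ε * f)^(ξ) = e^{-ε²|ξ|²} f^(ξ)`; the function
`e^{-ε²|ξ|²}` is the Fourier transform of `φ_ε`, see `fourier_capillaryKernel`. -/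
def capillaryConv (ε : ℝ) (f : Distr d) : Distr d :=
  multiplier (fun ξ ↦ Real.exp (-(ε ^ 2 * ‖ξ‖ ^ 2))) f

/-- `c` is the product `a b` of two tempered distributions: the products of the smooth
functions `Ṡ_n a` with `Ṡ_n b` converge to `c` as tempered distributions. -/
def IsProduct (χ : Space d → ℝ) (a b c : Distr d) : Prop :=
  ∃ (A : ℕ → Space d → ℂ) (hA : ∀ n, (A n).HasTemperateGrowth),
    (∀ n, (hA n).toTemperedDistribution volume = lowFreq χ (n : ℤ) a) ∧
    Tendsto (fun n : ℕ ↦ smulLeftCLM ℂ (A n) (lowFreq χ (n : ℤ) b)) atTop (𝓝 c)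

/-- `c = v · ∇ f = ∑ i, v_i ∂_i f`. -/
def IsConvection (χ : Space d → ℝ) (v : Fin d → Distr d) (f c : Distr d) : Prop :=
  ∃ P : Fin d → Distr d, (∀ i, IsProduct χ (v i) (partialD i f) (P i)) ∧ c = ∑ i, P i

/-- A real-valued distribution: it takes real values at real test functions. -/
def IsRealDistr (f : Distr d) : Prop :=
  ∀ ψ : 𝓢(Space d, ℂ), (∀ x, (ψ x).im = 0) → (f ψ).im = 0

/-! ### The linear system with convection -/

/-- The time interval `I = [0, T)`, where `T = ∞` is allowed. -/
def timeInterval (T : ℝ≥0∞) : Set ℝ := {t | 0 ≤ t ∧ ENNReal.ofReal t < T}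

/-- The weak equation `∂_t f = g` on `I = [0, T)` in time-integrated form:
`f(t) = f(0) + ∫_0^t g(τ) dτ`, tested with any Schwartz function. -/
def WeakEvolution (T : ℝ≥0∞) (f g : ℝ → Distr d) : Prop :=
  ∀ t ∈ timeInterval T, ∀ ψ : 𝓢(Space d, ℂ),
    IntervalIntegrable (fun τ ↦ g τ ψ) volume 0 t ∧ f t ψ = f 0 ψ + ∫ τ in (0 : ℝ)..t, g τ ψ

/-- `f(τ)` is measurable in time on `I = [0, T)`. -/
def WeaklyMeasurable (T : ℝ≥0∞) (f : ℝ → Distr d) : Prop :=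
  ∀ ψ : 𝓢(Space d, ℂ), AEStronglyMeasurable (fun τ ↦ f τ ψ) (volume.restrict (timeInterval T))

/-- `f ∈ L^∞_loc(I; Ḃ^s_{2,1})`, `I = [0, T)`. -/
def LocallyBoundedBesov (χ : Space d → ℝ) (T : ℝ≥0∞) (s : ℝ) (f : ℝ → Distr d) : Prop :=
  (∀ t ∈ timeInterval T, IsSh χ (f t)) ∧
  ∀ t ∈ timeInterval T, (⨆ τ ∈ Set.Icc 0 t, besovNorm χ s (f τ)) < ⊤

/-- The convection field: a real vector field `v ∈ L¹(I; Ḃ^{d/2+1}_{2,1}) ∩ L²(I; Ḃ^{d/2}_{2,1})`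
with `I = [0, T)`. -/
structure IsConvectionField (χ : Space d → ℝ) (T : ℝ≥0∞) (v : ℝ → Fin d → Distr d) : Prop where
  measurable : ∀ i, WeaklyMeasurable T (fun τ ↦ v τ i)
  real : ∀ᵐ τ ∂(volume.restrict (timeInterval T)), ∀ i, IsRealDistr (v τ i)
  sh : ∀ᵐ τ ∂(volume.restrict (timeInterval T)), ∀ i, IsSh χ (v τ i)
  integrable : (∫⁻ τ in timeInterval T, besovNormVec χ ((d : ℝ) / 2 + 1) (v τ)) < ⊤
  square_integrable : (∫⁻ τ in timeInterval T, besovNormVec χ ((d : ℝ) / 2) (v τ) ^ 2) < ⊤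

/-- `(q, u)` solves, on `I = [0, T)`,
`∂_t q + v·∇q + div u = F`,
`∂_t u + v·∇u - 𝓐 u + p ∇q - (k/ε²) ∇(φ_ε * q - q) = G`,
with `q ∈ L^∞_loc(I; Ḃ^{s-1}_{2,1} ∩ Ḃ^s_{2,1})` and `u ∈ L^∞_loc(I; Ḃ^{s-1}_{2,1})`. -/
structure IsSolution (χ : Space d → ℝ) (μ lam p k ε s : ℝ) (T : ℝ≥0∞)
    (v : ℝ → Fin d → Distr d) (F : ℝ → Distr d) (G : ℝ → Fin d → Distr d)
    (q : ℝ → Distr d) (u : ℝ → Fin d → Distr d) : Prop where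
  density_low : LocallyBoundedBesov χ T (s - 1) q
  density_high : LocallyBoundedBesov χ T s q
  velocity : ∀ i, LocallyBoundedBesov χ T (s - 1) (fun τ ↦ u τ i)
  mass : ∃ N : ℝ → Distr d,
    (∀ᵐ τ ∂(volume.restrict (timeInterval T)), IsConvection χ (v τ) (q τ) (N τ)) ∧
    WeakEvolution T q (fun τ ↦ F τ - N τ - divergence (u τ))
  momentum : ∀ i, ∃ N : ℝ → Distr d,
    (∀ᵐ τ ∂(volume.restrict (timeInterval T)), IsConvection χ (v τ) (u τ i) (N τ)) ∧
    WeakEvolution T (fun τ ↦ u τ i) (fun τ ↦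
      G τ i - N τ + viscosity μ lam (u τ) i - (p : ℂ) • partialD i (q τ)
        + ((k / ε ^ 2 : ℝ) : ℂ) • partialD i (capillaryConv ε (q τ) - q τ))

end LinearCapillary

end

open LinearCapillary

/-!
# A priori estimate for the linearized capillary system with a nonlocal capillarity

Everything takes place on the Fourier side. There the pressure and capillarity terms become the
multiplier `K(ξ) = p + k (1 - e^{-ε²|ξ|²}) / ε²` (`capSymbol`), which lies between `p` and
`p + k |ξ|²`. At a fixed frequency the energy is the sum of the squares of `√(2K) q`, of `u`, and of
`w = u + i ν ξ q`, the Fourier transform of the effective velocity `u + ν ∇q`. The identity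
`re_energy_identity` shows that the last component dissipates the density; in the dyadic block of
index `l` the whole energy therefore decays at the rate `blockRate`, the minimum of `|ξ|²` and `K`,
with a constant that does not depend on `ε` (`energy_linPart_le`). This energy controls `q`, `∇q`
and `u`. The velocity alone obeys a heat equation with source `K |ξ| q`, and the decay of the energy
makes this source integrable whenever the rate is not already parabolic (`velocity_absorb`). Below
the threshold `l_ε` the rate is comparable to `4 ^ l` at least, above it to `ε⁻²` at least, which are
the weights of the hybrid norms (`exists_blockRate_bounds`, `norms_le`).

For a real field `v`, the convection `v · ∇` is antisymmetric up to `div v`. In the energy of a block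
what is left are commutators of `v · ∇` with the block and with the symbols of the three components
of the energy. These symbols grow like the weights of the unknowns and vary slowly, uniformly
in `ε`, so that the commutators cost one derivative of `v` and none of the unknowns
(`exists_convection_energy_le`, `exists_component_balance`). The resulting trilinear forms are
summed over the blocks by the product law `Ḃ^{d/2} · Ḃ^σ ⊂ Ḃ^σ`, `σ = s - 1`, which is where
`-d/2 < σ ≤ d/2` is needed (`exists_tsum_paraSum_le`).

The weak formulation has to be turned into an energy inequality. An element of `𝓢'_h` with finite
norm in `Ḃ^σ_{2,1}`, `σ ≤ d/2`, has a locally integrable Fourier transform (`exists_hasFourier`), and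
the Fourier transform of the product `v · ∇ f`, defined as a limit, is the corresponding convolution
(`HasFourier.product`). Tested against smooth functions, the equation says that each block is weakly
a primitive in time of an `L²`-valued function with integrable norm; by Pettis' theorem it is one in
`L²` (`primitive_of_weak`, `block_primitive`), and the energy inequality follows for its square root
(`block_energy`). Block norms are measurable in time because they are countable suprema of pairings
with test functions (`exists_distrLpNorm_dyadicBlock_eq_iSup`).

Altogether each block satisfies `exists_block_estimate`. Summation over the blocks and Gronwall's
inequality with an integrable coefficient give `exists_tsum_blockSize_estimate`. It involves the
norm of `∇v` only; the term with `‖v‖²` in the exponent can only increase the right side. If the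
norm of the source is infinite there is nothing to prove, and otherwise the source is integrable in
each block.
-/

namespace LinearCapillary

open MeasureTheory Filter Topology Set
open scoped ENNReal

/-! ### Absolutely continuous functions of time -/

/-- A function whose increments are controlled by those of an absolutely continuous function
is absolutely continuous. -/
theorem AbsolutelyContinuousOnInterval.of_dist_le {X Y : Type*} [PseudoMetricSpace X]
    [PseudoMetricSpace Y] {f : ℝ → X} {P : ℝ → Y} {a b : ℝ} {L : ℝ}
    (hP : AbsolutelyContinuousOnInterval P a b)
    (h : ∀ x ∈ uIcc a b, ∀ y ∈ uIcc a b, dist (f x) (f y) ≤ L * dist (P x) (P y)) :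
    AbsolutelyContinuousOnInterval f a b := by
  rw [absolutelyContinuousOnInterval_iff] at hP ⊢
  intro ε hε
  have hL : 0 < |L| + 1 := by positivity
  obtain ⟨δ, hδ, H⟩ := hP (ε / (|L| + 1)) (by positivity)
  refine ⟨δ, hδ, fun E hE hlt ↦ ?_⟩
  have h1 := H E hE hlt
  rw [lt_div_iff₀ hL] at h1
  refine lt_of_le_of_lt ?_ h1
  rw [Finset.sum_mul]
  refine Finset.sum_le_sum fun i hi ↦ ?_
  have := hE.1 i hi
  refine (h _ this.1 _ this.2).trans ?_
  rw [mul_comm]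
  gcongr
  linarith [le_abs_self L]

/-- The fundamental theorem of calculus for absolutely continuous functions, for a prescribed
almost everywhere derivative. -/
theorem sub_eq_integral_of_ae_hasDerivAt {y z : ℝ → ℝ} {a b : ℝ}
    (hy : AbsolutelyContinuousOnInterval y a b)
    (hz : ∀ᵐ x, x ∈ uIcc a b → HasDerivAt y (z x) x) :
    IntervalIntegrable z volume a b ∧ ∫ x in a..b, z x = y b - y a := by
  have h : ∀ᵐ x, x ∈ uIoc a b → deriv y x = z x := by
    filter_upwards [hz] with x hx hm
    exact (hx (uIoc_subset_uIcc hm)).deriv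
  refine ⟨hy.intervalIntegrable_deriv.congr_ae ?_, ?_⟩
  · exact (ae_restrict_iff' measurableSet_uIoc).2 h
  · rw [← hy.integral_deriv_eq_sub]
    exact intervalIntegral.integral_congr_ae (by filter_upwards [h] with x hx hm using (hx hm).symm)

section Primitive

variable {H : Type*} [NormedAddCommGroup H] {f g : ℝ → H} {T : ℝ}

theorem absolutelyContinuous_norm_primitive (hg : IntervalIntegrable g volume 0 T) :
    AbsolutelyContinuousOnInterval (fun x ↦ ∫ τ in (0 : ℝ)..x, ‖g τ‖) 0 T :=
  hg.norm.absolutelyContinuousOnInterval_intervalIntegral (by simp)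

variable [NormedSpace ℝ H]

theorem dist_primitive_le (hT : 0 ≤ T) (hg : IntervalIntegrable g volume 0 T)
    (hf : ∀ t ∈ Icc 0 T, f t = f 0 + ∫ τ in (0 : ℝ)..t, g τ) :
    ∀ x ∈ uIcc 0 T, ∀ y ∈ uIcc 0 T, dist (f x) (f y) ≤
      dist (∫ τ in (0 : ℝ)..x, ‖g τ‖) (∫ τ in (0 : ℝ)..y, ‖g τ‖) := by
  intro x hx y hy
  have hsub : ∀ z ∈ uIcc 0 T, IntervalIntegrable g volume 0 z := fun z hz ↦
    hg.mono_set (uIcc_subset_uIcc (by simp) hz)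
  rw [hf x (by rwa [uIcc_of_le hT] at hx), hf y (by rwa [uIcc_of_le hT] at hy),
    dist_add_left, dist_eq_norm, dist_eq_norm,
    intervalIntegral.integral_interval_sub_left (hsub x hx) (hsub y hy),
    intervalIntegral.integral_interval_sub_left (hsub x hx).norm (hsub y hy).norm]
  exact intervalIntegral.norm_integral_le_abs_integral_norm

theorem continuousOn_of_primitive (hT : 0 ≤ T) (hg : IntervalIntegrable g volume 0 T)
    (hf : ∀ t ∈ Icc 0 T, f t = f 0 + ∫ τ in (0 : ℝ)..t, g τ) : ContinuousOn f (Icc 0 T) := by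
  have : AbsolutelyContinuousOnInterval f 0 T :=
    AbsolutelyContinuousOnInterval.of_dist_le (L := 1) (absolutelyContinuous_norm_primitive hg)
      (by simpa using dist_primitive_le hT hg hf)
  simpa [uIcc_of_le hT] using this.continuousOn

variable [CompleteSpace H]

theorem ae_hasDerivAt_of_primitive (hT : 0 ≤ T) (hg : IntervalIntegrable g volume 0 T)
    (hf : ∀ t ∈ Icc 0 T, f t = f 0 + ∫ τ in (0 : ℝ)..t, g τ) :
    ∀ᵐ x, x ∈ uIcc 0 T → HasDerivAt f (g x) x := by
  have h1 : ∀ᵐ x : ℝ, x ≠ 0 := by simp [ae_iff, measure_singleton]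
  have h2 : ∀ᵐ x : ℝ, x ≠ T := by simp [ae_iff, measure_singleton]
  filter_upwards [hg.ae_hasDerivAt_integral, h1, h2] with x hx hx0 hxT hm
  have hd := (hx hm 0 (by simp)).const_add (f 0)
  rw [uIcc_of_le hT] at hm
  refine hd.congr_of_eventuallyEq ?_
  have : Ioo 0 T ∈ 𝓝 x := Ioo_mem_nhds (lt_of_le_of_ne hm.1 (Ne.symm hx0)) (lt_of_le_of_ne hm.2 hxT)
  filter_upwards [this] with t ht
  exact hf t (Ioo_subset_Icc_self ht)

/-- The chain rule, in integrated form, for a Lipschitz differentiable function of a primitive. -/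
theorem integral_deriv_comp_of_primitive (hT : 0 ≤ T) (hg : IntervalIntegrable g volume 0 T)
    (hf : ∀ t ∈ Icc 0 T, f t = f 0 + ∫ τ in (0 : ℝ)..t, g τ)
    {Φ : H → ℝ} {Φ' : H → H → ℝ} {L : ℝ} {s : Set H} (hs : ∀ t ∈ Icc 0 T, f t ∈ s)
    (hL : ∀ x ∈ s, ∀ y ∈ s, dist (Φ x) (Φ y) ≤ L * dist x y)
    (hΦ : ∀ (γ : ℝ → H) (γ' : H) (x : ℝ), HasDerivAt γ γ' x → γ x ∈ s →
      HasDerivAt (fun t ↦ Φ (γ t)) (Φ' (γ x) γ') x) :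
    IntervalIntegrable (fun τ ↦ Φ' (f τ) (g τ)) volume 0 T ∧
      Φ (f T) = Φ (f 0) + ∫ τ in (0 : ℝ)..T, Φ' (f τ) (g τ) := by
  have hac : AbsolutelyContinuousOnInterval (fun t ↦ Φ (f t)) 0 T := by
    refine AbsolutelyContinuousOnInterval.of_dist_le (L := |L|)
      (absolutelyContinuous_norm_primitive hg) fun x hx y hy ↦ ?_
    have hx' := hx
    have hy' := hy
    rw [uIcc_of_le hT] at hx' hy'
    refine (hL _ (hs x hx') _ (hs y hy')).trans ?_
    refine mul_le_mul (le_abs_self L) (dist_primitive_le hT hg hf x hx y hy) dist_nonneg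
      (abs_nonneg L)
  have hder : ∀ᵐ x, x ∈ uIcc 0 T → HasDerivAt (fun t ↦ Φ (f t)) (Φ' (f x) (g x)) x := by
    filter_upwards [ae_hasDerivAt_of_primitive hT hg hf] with x hx hm
    exact hΦ f (g x) x (hx hm) (hs x (by rwa [uIcc_of_le hT] at hm))
  obtain ⟨h1, h2⟩ := sub_eq_integral_of_ae_hasDerivAt hac hder
  exact ⟨h1, by rw [h2]; ring⟩

end Primitive

/-- The energy identity for a primitive with values in a Hilbert space. -/
theorem norm_sq_of_primitive {H : Type*} [NormedAddCommGroup H] [InnerProductSpace ℂ H]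
    [CompleteSpace H] {f g : ℝ → H} {T : ℝ} (hT : 0 ≤ T)
    (hg : IntervalIntegrable g volume 0 T)
    (hf : ∀ t ∈ Icc 0 T, f t = f 0 + ∫ τ in (0 : ℝ)..t, g τ) :
    IntervalIntegrable (fun τ ↦ 2 * (inner ℂ (f τ) (g τ)).re) volume 0 T ∧
      ‖f T‖ ^ 2 = ‖f 0‖ ^ 2 + ∫ τ in (0 : ℝ)..T, 2 * (inner ℂ (f τ) (g τ)).re := by
  let _ : InnerProductSpace ℝ H := InnerProductSpace.rclikeToReal ℂ H
  obtain ⟨M, hM⟩ := isCompact_Icc.exists_bound_of_continuousOn (continuousOn_of_primitive hT hg hf)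
  refine integral_deriv_comp_of_primitive hT hg hf (Φ := fun x ↦ ‖x‖ ^ 2)
    (Φ' := fun x y ↦ 2 * (inner ℂ x y).re) (L := 2 * M) (s := {x | ‖x‖ ≤ M}) hM ?_ ?_
  · intro x hx y hy
    simp only [Set.mem_ofPred_eq] at hx hy
    rw [Real.dist_eq, sq_sub_sq, abs_mul, abs_of_nonneg (by positivity), dist_eq_norm]
    exact mul_le_mul (by linarith) (abs_norm_sub_norm_le x y) (abs_nonneg _)
      (by linarith [norm_nonneg x])
  · intro γ γ' x hγ _
    exact hγ.norm_sq

/-- From `y' ≤ -2 a y + 2 √y r` follows `√y(T) + a ∫ √y ≤ √y(0) + ∫ r`. -/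
theorem sqrt_add_integral_sqrt_le {y z r : ℝ → ℝ} {T a : ℝ} (hT : 0 ≤ T) (ha : 0 ≤ a)
    (hz : IntervalIntegrable z volume 0 T) (hr : IntervalIntegrable r volume 0 T)
    (hy : ∀ t ∈ Icc 0 T, y t = y 0 + ∫ τ in (0 : ℝ)..t, z τ) (hy0 : ∀ t, 0 ≤ y t)
    (hr0 : ∀ t, 0 ≤ r t)
    (hle : ∀ᵐ τ, τ ∈ Icc 0 T → z τ ≤ -2 * a * y τ + 2 * √(y τ) * r τ) :
    √(y T) + a * ∫ τ in (0 : ℝ)..T, √(y τ) ≤ √(y 0) + ∫ τ in (0 : ℝ)..T, r τ := by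
  have hyc : ContinuousOn y (Icc 0 T) := continuousOn_of_primitive hT hz hy
  have hsq : IntervalIntegrable (fun τ ↦ √(y τ)) volume 0 T :=
    ContinuousOn.intervalIntegrable (by rw [uIcc_of_le hT]; exact hyc.sqrt)
  -- `√` is not Lipschitz at `0`: the chain rule is applied to `√(y + δ ^ 2)`, and `δ` tends to `0`
  -- at the end.
  have key : ∀ δ > 0, √(y T) + a * ∫ τ in (0 : ℝ)..T, √(y τ) ≤
      √(y 0) + (∫ τ in (0 : ℝ)..T, r τ) + (1 + a * T) * δ := by
    intro δ hδ
    have hpos : ∀ w : ℝ, 0 ≤ w → 0 < √(w + δ ^ 2) := fun w hw ↦ by positivity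
    have hL : ∀ u ∈ Ici (0 : ℝ), ∀ w ∈ Ici (0 : ℝ),
        dist √(u + δ ^ 2) √(w + δ ^ 2) ≤ 1 / δ * dist u w := by
      intro u hu w hw
      simp only [mem_Ici] at hu hw
      have hu' := hpos u hu
      have hw' := hpos w hw
      have a1 : δ ≤ √(u + δ ^ 2) := Real.le_sqrt_of_sq_le (by linarith)
      have b1 : δ ≤ √(w + δ ^ 2) := Real.le_sqrt_of_sq_le (by linarith)
      rw [Real.dist_eq, Real.dist_eq, one_div, ← div_eq_inv_mul, le_div_iff₀ hδ]
      have : u - w = (√(u + δ ^ 2) - √(w + δ ^ 2)) * (√(u + δ ^ 2) + √(w + δ ^ 2)) := by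
        have a2 := Real.sq_sqrt (show 0 ≤ u + δ ^ 2 by positivity)
        have b2 := Real.sq_sqrt (show 0 ≤ w + δ ^ 2 by positivity)
        linear_combination -a2 + b2
      rw [this, abs_mul, abs_of_pos (show 0 < √(u + δ ^ 2) + √(w + δ ^ 2) by positivity)]
      exact mul_le_mul_of_nonneg_left (by linarith) (abs_nonneg _)
    have hd : ∀ (γ : ℝ → ℝ) (γ' x : ℝ), HasDerivAt γ γ' x → γ x ∈ Ici (0 : ℝ) →
        HasDerivAt (fun t ↦ √(γ t + δ ^ 2)) (γ' / (2 * √(γ x + δ ^ 2))) x := by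
      intro γ γ' x hγ hx
      exact (hγ.add_const (δ ^ 2)).sqrt (Real.sqrt_pos.1 (hpos _ hx)).ne'
    obtain ⟨h1, h2⟩ := integral_deriv_comp_of_primitive hT hz hy
      (Φ := fun w ↦ √(w + δ ^ 2)) (Φ' := fun w v ↦ v / (2 * √(w + δ ^ 2)))
      (L := 1 / δ) (s := Ici 0) (fun t _ ↦ hy0 t) hL hd
    have hmono : ∫ τ in (0 : ℝ)..T, z τ / (2 * √(y τ + δ ^ 2)) ≤
        ∫ τ in (0 : ℝ)..T, (-a * √(y τ) + a * δ + r τ) := by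
      refine intervalIntegral.integral_mono_ae_restrict hT h1
        (((hsq.const_mul _).add intervalIntegrable_const).add hr) ?_
      refine (ae_restrict_iff' measurableSet_Icc).2 ?_
      filter_upwards [hle] with τ hτ hm
      have hτ := hτ hm
      set Y := √(y τ) with hY
      set S := √(y τ + δ ^ 2) with hS
      have hYy : Y ^ 2 = y τ := Real.sq_sqrt (hy0 τ)
      have hSy : S ^ 2 = y τ + δ ^ 2 := Real.sq_sqrt (by have := hy0 τ; positivity)
      have hY0 : 0 ≤ Y := Real.sqrt_nonneg _
      have hSpos : 0 < S := hpos _ (hy0 τ)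
      have hYS : Y ≤ S := Real.sqrt_le_sqrt (by nlinarith)
      have hSY : S ≤ Y + δ := by nlinarith
      rw [div_le_iff₀ (by positivity)]
      rw [← hYy] at hτ
      have e1 : Y * r τ ≤ S * r τ := mul_le_mul_of_nonneg_right hYS (hr0 τ)
      have e2 : Y * S ≤ Y ^ 2 + δ * S := by nlinarith
      have e3 := mul_le_mul_of_nonneg_left e2 ha
      nlinarith
    have hint : ∫ τ in (0 : ℝ)..T, (-a * √(y τ) + a * δ + r τ) =
        -a * (∫ τ in (0 : ℝ)..T, √(y τ)) + T * (a * δ) + ∫ τ in (0 : ℝ)..T, r τ := by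
      rw [intervalIntegral.integral_add ((hsq.const_mul _).add intervalIntegrable_const) hr,
        intervalIntegral.integral_add (hsq.const_mul _) intervalIntegrable_const,
        intervalIntegral.integral_const_mul, intervalIntegral.integral_const]
      simp
    have e0 : √(y 0 + δ ^ 2) ≤ √(y 0) + δ := by
      refine Real.sqrt_le_iff.2 ⟨by positivity, ?_⟩
      nlinarith [Real.sq_sqrt (hy0 0), Real.sqrt_nonneg (y 0)]
    have eT : √(y T) ≤ √(y T + δ ^ 2) := Real.sqrt_le_sqrt (by nlinarith)
    linarith
  have hc : 0 < 1 + a * T := by positivity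
  refine le_of_forall_pos_le_add fun η hη ↦ ?_
  have := key (η / (1 + a * T)) (by positivity)
  rwa [mul_div_cancel₀ _ hc.ne'] at this

/-- Gronwall's inequality with a merely integrable coefficient and a bounded unknown. -/
theorem gronwall_integral {X V : ℝ → ℝ} {T A C M : ℝ} (hC : 0 < C) (hA : 0 ≤ A)
    (hV : IntervalIntegrable V volume 0 T) (hV0 : ∀ t, 0 ≤ V t)
    (hX0 : ∀ t ∈ Icc 0 T, 0 ≤ X t)
    (hXM : ∀ t ∈ Icc 0 T, X t ≤ M)
    (hXm : AEStronglyMeasurable X (volume.restrict (Icc 0 T)))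
    (h : ∀ t ∈ Icc 0 T, X t ≤ A + C * ∫ τ in (0 : ℝ)..t, V τ * X τ) :
    ∀ t ∈ Icc 0 T, X t ≤ 2 * A * Real.exp (2 * C * ∫ τ in (0 : ℝ)..t, V τ) := by
  intro t₀ ht₀
  have hT : 0 ≤ T := ht₀.1.trans ht₀.2
  set Φ : ℝ → ℝ := fun t ↦ ∫ τ in (0 : ℝ)..t, V τ with hΦ
  set b : ℝ → ℝ := fun t ↦ X t * Real.exp (-(2 * C * Φ t)) with hb
  have hM0 : 0 ≤ M := (hX0 0 ⟨le_rfl, hT⟩).trans (hXM 0 ⟨le_rfl, hT⟩)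
  have hVt : ∀ t ∈ Icc 0 T, IntervalIntegrable V volume 0 t := fun t ht ↦
    hV.mono_set (uIcc_subset_uIcc (by simp) (by rw [uIcc_of_le hT]; exact ht))
  have hΦ0 : ∀ t ∈ Icc 0 T, 0 ≤ Φ t := fun t ht ↦
    intervalIntegral.integral_nonneg ht.1 fun τ _ ↦ hV0 τ
  have hΦmono : ∀ t ∈ Icc 0 T, ∀ τ ∈ Icc 0 t, Φ τ ≤ Φ t := by
    intro t ht τ hτ
    exact intervalIntegral.integral_mono_interval le_rfl hτ.1 hτ.2
      (ae_of_all _ hV0) (hVt t ht)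
  -- a bound `S` for the weighted unknown improves to `A + S / 2`
  have step : ∀ S : ℝ, 0 ≤ S → (∀ t ∈ Icc 0 T, b t ≤ S) → ∀ t ∈ Icc 0 T, b t ≤ A + S / 2 := by
    intro S hS hbS t ht
    have hprim : ∀ τ ∈ Icc 0 t, Φ τ = Φ 0 + ∫ σ in (0 : ℝ)..τ, V σ := by
      intro τ _; simp [hΦ]
    have hs : ∀ τ ∈ Icc 0 t, Φ τ ∈ Icc 0 (Φ t) := by
      intro τ hτ
      exact ⟨hΦ0 τ ⟨hτ.1, hτ.2.trans ht.2⟩, hΦmono t ht τ hτ⟩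
    have hL : ∀ u ∈ Icc 0 (Φ t), ∀ w ∈ Icc 0 (Φ t),
        dist (Real.exp (2 * C * u)) (Real.exp (2 * C * w)) ≤
          Real.exp (2 * C * Φ t) * (2 * C) * dist u w := by
      intro u hu w hw
      have := Convex.norm_image_sub_le_of_norm_hasDerivWithin_le
        (f := fun w : ℝ ↦ Real.exp (2 * C * w)) (f' := fun w ↦ Real.exp (2 * C * w) * (2 * C))
        (C := Real.exp (2 * C * Φ t) * (2 * C)) (s := Icc 0 (Φ t)) (x := w) (y := u)
        (fun x _ ↦ by
          simpa using ((hasDerivAt_id x).const_mul (2 * C)).exp.hasDerivWithinAt)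
        (fun x hx ↦ by
          rw [Real.norm_of_nonneg (by positivity)]
          gcongr
          exact hx.2) (convex_Icc _ _) hw hu
      simpa [Real.dist_eq] using this
    have hd : ∀ (γ : ℝ → ℝ) (γ' x : ℝ), HasDerivAt γ γ' x → γ x ∈ Icc 0 (Φ t) →
        HasDerivAt (fun t ↦ Real.exp (2 * C * γ t)) (Real.exp (2 * C * γ x) * (2 * C * γ')) x := by
      intro γ γ' x hγ _
      simpa using (hγ.const_mul (2 * C)).exp
    obtain ⟨i1, i2⟩ := integral_deriv_comp_of_primitive ht.1 (hVt t ht) hprim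
      (Φ := fun w ↦ Real.exp (2 * C * w)) (Φ' := fun w v ↦ Real.exp (2 * C * w) * (2 * C * v))
      (L := Real.exp (2 * C * Φ t) * (2 * C)) (s := Icc 0 (Φ t)) hs hL hd
    have hle : ∫ τ in (0 : ℝ)..t, V τ * X τ ≤
        ∫ τ in (0 : ℝ)..t, S / (2 * C) * (Real.exp (2 * C * Φ τ) * (2 * C * V τ)) := by
      refine intervalIntegral.integral_mono_on ht.1 ?_ (i1.const_mul _) ?_
      · have hXb : IntervalIntegrable (fun τ ↦ V τ * X τ) volume 0 t := by
          rw [intervalIntegrable_iff_integrableOn_Ioc_of_le ht.1]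
          have hVi := (intervalIntegrable_iff_integrableOn_Ioc_of_le ht.1).1 (hVt t ht)
          refine Integrable.mul_bdd (c := M) hVi
            (hXm.mono_measure (Measure.restrict_mono
              ((Ioc_subset_Ioc_right ht.2).trans Ioc_subset_Icc_self) le_rfl)) ?_
          refine (ae_restrict_iff' measurableSet_Ioc).2 (ae_of_all _ fun x hx ↦ ?_)
          have hx' : x ∈ Icc 0 T := ⟨hx.1.le, hx.2.trans ht.2⟩
          rw [Real.norm_of_nonneg (hX0 x hx')]
          exact hXM x hx'
        exact hXb
      · intro τ hτ
        have hτ' : τ ∈ Icc 0 T := ⟨hτ.1, hτ.2.trans ht.2⟩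
        have h3 : X τ ≤ S * Real.exp (2 * C * Φ τ) := by
          have := hbS τ hτ'
          simp only [hb, Real.exp_neg] at this
          rwa [← div_eq_mul_inv, div_le_iff₀ (Real.exp_pos _)] at this
        calc V τ * X τ ≤ V τ * (S * Real.exp (2 * C * Φ τ)) :=
              mul_le_mul_of_nonneg_left h3 (hV0 τ)
          _ = _ := by field_simp
    rw [intervalIntegral.integral_const_mul] at hle
    have i3 : ∫ τ in (0 : ℝ)..t, Real.exp (2 * C * Φ τ) * (2 * C * V τ) ≤
        Real.exp (2 * C * Φ t) := by
      have : 0 < Real.exp (2 * C * Φ 0) := Real.exp_pos _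
      linarith
    have h4 := h t ht
    have h5 : C * ∫ τ in (0 : ℝ)..t, V τ * X τ ≤ S / 2 * Real.exp (2 * C * Φ t) := by
      calc C * ∫ τ in (0 : ℝ)..t, V τ * X τ
          ≤ C * (S / (2 * C) * Real.exp (2 * C * Φ t)) := by
            refine mul_le_mul_of_nonneg_left (hle.trans ?_) hC.le
            exact mul_le_mul_of_nonneg_left i3 (by positivity)
        _ = _ := by field_simp
    simp only [hb, Real.exp_neg]
    rw [← div_eq_mul_inv, div_le_iff₀ (Real.exp_pos _)]
    have h6 : A ≤ A * Real.exp (2 * C * Φ t) :=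
      le_mul_of_one_le_right hA (Real.one_le_exp (by have := hΦ0 t ht; positivity))
    linarith
  have hbM : ∀ t ∈ Icc 0 T, b t ≤ M := by
    intro t ht
    refine (mul_le_of_le_one_right (hX0 t ht) ?_).trans (hXM t ht)
    rw [Real.exp_le_one_iff]
    have := hΦ0 t ht
    have : 0 ≤ 2 * C * Φ t := by positivity
    linarith
  -- iterating `step` from the crude bound `M` gives the limit value `2 A`
  have hiter : ∀ n : ℕ, ∀ t ∈ Icc 0 T, b t ≤ 2 * A + M / 2 ^ n := by
    intro n
    induction n with
    | zero => intro t ht; have := hbM t ht; simp; linarith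
    | succ n ih =>
      intro t ht
      have := step (2 * A + M / 2 ^ n) (by positivity) ih t ht
      rw [pow_succ]
      calc b t ≤ _ := this
        _ = _ := by field_simp; ring
  have hlim : b t₀ ≤ 2 * A := by
    have : Tendsto (fun n : ℕ ↦ 2 * A + M / 2 ^ n) atTop (𝓝 (2 * A + 0)) := by
      refine tendsto_const_nhds.add ?_
      exact tendsto_const_nhds.div_atTop (tendsto_pow_atTop_atTop_of_one_lt one_lt_two)
    rw [add_zero] at this
    exact ge_of_tendsto' this fun n ↦ hiter n t₀ ht₀
  simp only [hb, Real.exp_neg] at hlim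
  rwa [← div_eq_mul_inv, div_le_iff₀ (Real.exp_pos _)] at hlim

end LinearCapillary

namespace LinearCapillary

open MeasureTheory Filter Topology Set
open scoped ENNReal InnerProductSpace ContDiff

/-! ### From weak to strong evolution in a separable Hilbert space -/

section Hilbert

variable {H : Type*} [NormedAddCommGroup H] [InnerProductSpace ℂ H] [CompleteSpace H]

theorem dense_span_of_separating {D : Set H}
    (hD : ∀ f : H, (∀ h ∈ D, ⟪h, f⟫_ℂ = 0) → f = 0) :
    (Submodule.span ℂ D).topologicalClosure = ⊤ := by
  rw [Submodule.topologicalClosure_eq_top_iff, Submodule.eq_bot_iff]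
  intro f hf
  refine hD f fun h hh ↦ ?_
  exact (Submodule.mem_orthogonal _ _).1 hf h (Submodule.subset_span hh)

/-- Weak measurability against a separating set of vectors. -/
theorem aestronglyMeasurable_inner_of_separating {α : Type*} [MeasurableSpace α] {μ : Measure α}
    {D : Set H} (hD : ∀ f : H, (∀ h ∈ D, ⟪h, f⟫_ℂ = 0) → f = 0) {g : α → H}
    (hg : ∀ h ∈ D, AEStronglyMeasurable (fun τ ↦ ⟪h, g τ⟫_ℂ) μ) (h : H) :
    AEStronglyMeasurable (fun τ ↦ ⟪h, g τ⟫_ℂ) μ := by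
  have h1 : ∀ h ∈ Submodule.span ℂ D, AEStronglyMeasurable (fun τ ↦ ⟪h, g τ⟫_ℂ) μ := by
    intro h hh
    induction hh using Submodule.span_induction with
    | mem x hx => exact hg x hx
    | zero => simpa using aestronglyMeasurable_const
    | add x y _ _ hx hy => exact (hx.add hy).congr (ae_of_all _ fun τ ↦ (inner_add_left _ _ _).symm)
    | smul c x _ hx => simpa only [inner_smul_left] using hx.const_mul _
  have h2 : h ∈ closure (Submodule.span ℂ D : Set H) := by
    have := dense_span_of_separating hD
    rw [← Submodule.topologicalClosure_coe, this]
    trivial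
  obtain ⟨x, hx, hlim⟩ := mem_closure_iff_seq_limit.1 h2
  refine aestronglyMeasurable_of_tendsto_ae atTop (fun n ↦ h1 (x n) (hx n)) (ae_of_all _ fun τ ↦ ?_)
  exact hlim.inner tendsto_const_nhds

/-- Pettis' theorem in a separable Hilbert space. -/
theorem aestronglyMeasurable_of_separating [TopologicalSpace.SeparableSpace H]
    {α : Type*} [MeasurableSpace α] {μ : Measure α}
    {D : Set H} (hD : ∀ f : H, (∀ h ∈ D, ⟪h, f⟫_ℂ = 0) → f = 0) {g : α → H}
    (hg : ∀ h ∈ D, AEStronglyMeasurable (fun τ ↦ ⟪h, g τ⟫_ℂ) μ) :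
    AEStronglyMeasurable g μ := by
  have hw := aestronglyMeasurable_inner_of_separating hD hg
  let U : ℕ → Submodule ℂ H := fun n ↦
    Submodule.span ℂ (TopologicalSpace.denseSeq H '' (Finset.range n : Set ℕ))
  have hfin : ∀ n, FiniteDimensional ℂ (U n) := fun n ↦
    FiniteDimensional.span_of_finite ℂ ((Finset.finite_toSet _).image _)
  have hmono : Monotone U := fun m n hmn ↦ Submodule.span_mono (Set.image_mono (by
    intro i hi; simp at hi ⊢; omega))
  have htop : ⊤ ≤ (⨆ n, U n).topologicalClosure := by
    intro x _
    have h1 : x ∈ closure (range (TopologicalSpace.denseSeq H)) :=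
      (TopologicalSpace.denseRange_denseSeq H) x
    refine closure_mono ?_ h1
    rintro _ ⟨n, rfl⟩
    exact Submodule.mem_iSup_of_mem (n + 1)
      (Submodule.subset_span ⟨n, by simp, rfl⟩)
  -- `g` is the limit of its projections to the finite dimensional spaces `U n`, whose coordinates
  -- are measurable
  refine aestronglyMeasurable_of_tendsto_ae atTop (f := fun n τ ↦ (U n).starProjection (g τ))
    (fun n ↦ ?_) (ae_of_all _ fun τ ↦ Submodule.starProjection_tendsto_self U hmono (g τ) htop)
  have : (fun τ ↦ (U n).starProjection (g τ)) = fun τ ↦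
      ∑ i, ⟪((stdOrthonormalBasis ℂ (U n)) i : H), g τ⟫_ℂ •
        ((stdOrthonormalBasis ℂ (U n)) i : H) := by
    funext τ
    rw [(stdOrthonormalBasis ℂ (U n)).starProjection_eq_sum_rankOne]
    simp
  rw [this]
  exact Finset.aestronglyMeasurable_fun_sum _ fun i _ ↦ (hw _).smul_const _

/-- A curve which is weakly a primitive of `g` is a primitive of `g` as soon as `g` is
integrable in norm. -/
theorem primitive_of_weak [TopologicalSpace.SeparableSpace H] {D : Set H}
    (hD : ∀ f : H, (∀ h ∈ D, ⟪h, f⟫_ℂ = 0) → f = 0) {f g : ℝ → H} {T : ℝ} (hT : 0 ≤ T)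
    {b : ℝ → ℝ≥0∞} (hb : ∫⁻ τ in Icc 0 T, b τ < ⊤)
    (hgb : ∀ᵐ τ ∂(volume.restrict (Icc 0 T)), ‖g τ‖ₑ ≤ b τ)
    (hgm : ∀ h ∈ D, AEStronglyMeasurable (fun τ ↦ ⟪h, g τ⟫_ℂ) (volume.restrict (Icc 0 T)))
    (hfg : ∀ h ∈ D, ∀ t ∈ Icc 0 T, ⟪h, f t⟫_ℂ = ⟪h, f 0⟫_ℂ + ∫ τ in (0 : ℝ)..t, ⟪h, g τ⟫_ℂ) :
    IntervalIntegrable g volume 0 T ∧ ∀ t ∈ Icc 0 T, f t = f 0 + ∫ τ in (0 : ℝ)..t, g τ := by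
  have hm := aestronglyMeasurable_of_separating hD hgm
  have hint : IntegrableOn g (Icc 0 T) := ⟨hm, (lintegral_mono_ae hgb).trans_lt hb⟩
  have hi : IntervalIntegrable g volume 0 T :=
    (intervalIntegrable_iff_integrableOn_Icc_of_le hT).2 hint
  refine ⟨hi, fun t ht ↦ ?_⟩
  have hit : IntervalIntegrable g volume 0 t :=
    hi.mono_set (uIcc_subset_uIcc (by simp) (by rw [uIcc_of_le hT]; exact ht))
  rw [← sub_eq_zero]
  refine hD _ fun h hh ↦ ?_
  have h3 : ∫ τ in (0 : ℝ)..t, ⟪h, g τ⟫_ℂ = ⟪h, ∫ τ in (0 : ℝ)..t, g τ⟫_ℂ := by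
    have := (innerSL ℂ h).intervalIntegral_comp_comm hit
    simpa using this
  rw [inner_sub_right, inner_add_right, hfg h hh t ht, h3, sub_self]

end Hilbert

/-- Smooth compactly supported real test functions separate the points of `L²`. -/
theorem eq_zero_of_inner_testFunction {d : ℕ} (f : Lp ℂ 2 (volume : Measure (Space d)))
    (hf : ∀ h ∈ {h : Lp ℂ 2 (volume : Measure (Space d)) | ∃ g : Space d → ℝ, ContDiff ℝ ∞ g ∧
      HasCompactSupport g ∧ h =ᵐ[volume] fun x ↦ (g x : ℂ)}, ⟪h, f⟫_ℂ = 0) : f = 0 := by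
  rw [Lp.eq_zero_iff_ae_eq_zero]
  refine ae_eq_zero_of_integral_contDiff_smul_eq_zero
    ((Lp.memLp f).locallyIntegrable (by norm_num)) fun g hg hgc ↦ ?_
  have hg2 : MemLp (fun x ↦ (g x : ℂ)) 2 volume :=
    (Complex.continuous_ofReal.comp hg.continuous).memLp_of_hasCompactSupport
      (hgc.comp_left Complex.ofReal_zero)
  have := hf (hg2.toLp _) ⟨g, hg, hgc, hg2.coeFn_toLp⟩
  rw [L2.inner_def] at this
  rw [← this]
  refine integral_congr_ae ?_
  filter_upwards [hg2.coeFn_toLp] with x hx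
  rw [hx]
  simp [mul_comm]

instance instSeparableSpaceLp {d : ℕ} :
    TopologicalSpace.SeparableSpace (Lp ℂ 2 (volume : Measure (Space d))) :=
  haveI : Fact ((2 : ℝ≥0∞) ≠ ⊤) := ⟨by norm_num⟩
  inferInstance

end LinearCapillary

namespace LinearCapillary

open MeasureTheory Filter Topology Set
open scoped ENNReal ContDiff

variable {d : ℕ}

/-! ### The symbols of the dyadic blocks -/

/-- The modulus of the frequency `ξ = 2π η`, in terms of the variable `η` of Mathlib's Fourier
transform. -/
noncomputable def freq (η : Space d) : ℝ := ‖(2 * Real.pi) • η‖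

/-- The symbol of `Ṡ_l` in the variable `η`. -/
noncomputable def lowSymbol (χ : Space d → ℝ) (l : ℤ) (η : Space d) : ℝ :=
  χ ((2 : ℝ) ^ (-l) • (2 * Real.pi) • η)

/-- The symbol of `Δ̇_l` in the variable `η`. -/
noncomputable def blockSymbol (χ : Space d → ℝ) (l : ℤ) (η : Space d) : ℝ :=
  annulusFun χ ((2 : ℝ) ^ (-l) • (2 * Real.pi) • η)

/-- The dyadic annulus `¾ 2^l ≤ |ξ| ≤ (8/3) 2^l`, which contains the support of the symbol
of `Δ̇_l`. -/
def annulus (d : ℕ) (l : ℤ) : Set (Space d) :=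
  {η | 3 / 4 * (2 : ℝ) ^ l ≤ freq η ∧ freq η ≤ 8 / 3 * (2 : ℝ) ^ l}

theorem freq_eq (η : Space d) : freq η = 2 * Real.pi * ‖η‖ := by
  rw [freq, norm_smul, Real.norm_of_nonneg (by positivity)]

theorem freq_nonneg (η : Space d) : 0 ≤ freq η := norm_nonneg _

theorem freq_add_le (η ζ : Space d) : freq (η + ζ) ≤ freq η + freq ζ := by
  simp only [freq, smul_add]; exact norm_add_le _ _

theorem freq_neg (η : Space d) : freq (-η) = freq η := by simp [freq]

theorem freq_sub_comm (η ζ : Space d) : freq (η - ζ) = freq (ζ - η) := by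
  rw [← freq_neg, neg_sub]

theorem freq_le_add_sub (η ζ : Space d) : freq η ≤ freq ζ + freq (η - ζ) := by
  simpa using freq_add_le ζ (η - ζ)

theorem continuous_freq : Continuous (freq : Space d → ℝ) := by
  unfold freq; fun_prop

theorem measurable_freq : Measurable (freq : Space d → ℝ) := continuous_freq.measurable

theorem freq_pos {η : Space d} (h : η ≠ 0) : 0 < freq η := by
  rw [freq_eq]; have := norm_pos_iff.2 h; positivity

theorem isClosed_annulus (l : ℤ) : IsClosed (annulus d l) :=
  (isClosed_le continuous_const continuous_freq).inter
    (isClosed_le continuous_freq continuous_const)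

theorem measurableSet_annulus (l : ℤ) : MeasurableSet (annulus d l) :=
  (isClosed_annulus l).measurableSet

theorem norm_le_freq (η : Space d) : ‖η‖ ≤ freq η := by
  rw [freq_eq]
  have := norm_nonneg η
  nlinarith [Real.pi_gt_three]

theorem annulus_subset_closedBall (l : ℤ) :
    annulus d l ⊆ Metric.closedBall 0 (8 / 3 * (2 : ℝ) ^ l) := by
  intro η hη
  rw [mem_closedBall_zero_iff]
  exact (norm_le_freq η).trans hη.2

theorem isCompact_annulus (l : ℤ) : IsCompact (annulus d l) :=
  (isCompact_closedBall _ _).of_isClosed_subset (isClosed_annulus l) (annulus_subset_closedBall l)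

theorem norm_dyadic_smul (l : ℤ) (η : Space d) :
    ‖(2 : ℝ) ^ (-l) • (2 * Real.pi) • η‖ = (2 : ℝ) ^ (-l) * freq η := by
  rw [norm_smul, Real.norm_of_nonneg (by positivity)]; rfl

theorem blockSymbol_eq (χ : Space d → ℝ) (l : ℤ) (η : Space d) :
    blockSymbol χ l η = lowSymbol χ (l + 1) η - lowSymbol χ l η := by
  simp only [blockSymbol, annulusFun, lowSymbol, smul_smul]
  congr 3
  rw [neg_add, zpow_add₀ (by norm_num)]
  norm_num
  ring

theorem sum_blockSymbol (χ : Space d → ℝ) (N : ℕ) (η : Space d) :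
    ∑ l ∈ Finset.Ico (-(N : ℤ)) N, blockSymbol χ l η =
      lowSymbol χ N η - lowSymbol χ (-N) η := by
  induction N with
  | zero => simp
  | succ n ih =>
    have h1 : Finset.Ico (-((n + 1 : ℕ) : ℤ)) ((n + 1 : ℕ) : ℤ) =
        insert (-(n : ℤ) - 1) (insert (n : ℤ) (Finset.Ico (-(n : ℤ)) n)) := by
      ext l
      simp only [Finset.mem_Ico, Finset.mem_insert]
      push_cast
      omega
    rw [h1, Finset.sum_insert (by simp), Finset.sum_insert (by simp), ih,
      blockSymbol_eq, blockSymbol_eq]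
    push_cast
    rw [show -(n : ℤ) - 1 + 1 = -n by ring, show -((n : ℤ) + 1) = -n - 1 by ring]
    ring

namespace IsCutoff

variable {χ : Space d → ℝ} (hχ : IsCutoff χ)
include hχ

theorem eq_one_of_norm_le {ξ : Space d} (h : ‖ξ‖ ≤ 3 / 4) : χ ξ = 1 :=
  hχ.eq_one.self_of_nhdsSet ξ (by simpa using h)

theorem eq_zero_of_lt_norm {ξ : Space d} (h : 4 / 3 < ‖ξ‖) : χ ξ = 0 := by
  by_contra h0
  have := hχ.support_subset h0
  rw [mem_closedBall_zero_iff] at this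
  linarith

theorem le_one (ξ : Space d) : χ ξ ≤ 1 := by
  rw [← hχ.eq_one_of_norm_le (ξ := 0) (by norm_num)]
  exact hχ.radial_antitone 0 ξ (by simp)

theorem nonneg (hd : 0 < d) (ξ : Space d) : 0 ≤ χ ξ := by
  let e : Space d := EuclideanSpace.single ⟨0, hd⟩ (2 + ‖ξ‖)
  have he : ‖e‖ = 2 + ‖ξ‖ := by
    simp only [e, PiLp.norm_single]
    exact Real.norm_of_nonneg (by positivity)
  rw [← hχ.eq_zero_of_lt_norm (ξ := e) (by rw [he]; linarith [norm_nonneg ξ])]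
  exact hχ.radial_antitone ξ e (by rw [he]; linarith)

theorem contDiff_lowSymbol (l : ℤ) : ContDiff ℝ ∞ (lowSymbol χ l) := by
  unfold lowSymbol
  exact hχ.smooth.comp (by fun_prop)

theorem lowSymbol_nonneg (hd : 0 < d) (l : ℤ) (η : Space d) : 0 ≤ lowSymbol χ l η :=
  hχ.nonneg hd _

theorem lowSymbol_le_one (l : ℤ) (η : Space d) : lowSymbol χ l η ≤ 1 := hχ.le_one _

theorem lowSymbol_eq_one {l : ℤ} {η : Space d} (h : freq η ≤ 3 / 4 * (2 : ℝ) ^ l) :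
    lowSymbol χ l η = 1 := by
  refine hχ.eq_one_of_norm_le ?_
  rw [norm_dyadic_smul, zpow_neg, inv_mul_le_iff₀ (by positivity)]
  linarith

theorem lowSymbol_eq_zero {l : ℤ} {η : Space d} (h : 4 / 3 * (2 : ℝ) ^ l < freq η) :
    lowSymbol χ l η = 0 := by
  refine hχ.eq_zero_of_lt_norm ?_
  rw [norm_dyadic_smul, zpow_neg, lt_inv_mul_iff₀ (by positivity)]
  linarith

theorem hasCompactSupport_lowSymbol (l : ℤ) : HasCompactSupport (lowSymbol χ l) := by
  refine HasCompactSupport.of_support_subset_isCompact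
    (isCompact_closedBall (0 : Space d) (4 / 3 * (2 : ℝ) ^ l)) fun η hη ↦ ?_
  rw [mem_closedBall_zero_iff]
  by_contra h
  exact hη (hχ.lowSymbol_eq_zero (by linarith [norm_le_freq η]))

theorem contDiff_blockSymbol (l : ℤ) : ContDiff ℝ ∞ (blockSymbol χ l) := by
  have : blockSymbol χ l = fun η ↦ lowSymbol χ (l + 1) η - lowSymbol χ l η :=
    funext (blockSymbol_eq χ l)
  rw [this]
  exact (hχ.contDiff_lowSymbol _).sub (hχ.contDiff_lowSymbol _)

theorem continuous_blockSymbol (l : ℤ) : Continuous (blockSymbol χ l) :=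
  (hχ.contDiff_blockSymbol l).continuous

theorem blockSymbol_nonneg (l : ℤ) (η : Space d) : 0 ≤ blockSymbol χ l η := by
  refine sub_nonneg.2 (hχ.radial_antitone _ _ ?_)
  rw [norm_smul]
  norm_num
  linarith [norm_nonneg ((2 : ℝ) ^ (-l) • (2 * Real.pi) • η), norm_nonneg
    (((2 : ℝ) ^ l)⁻¹ • (2 * Real.pi) • η)]

theorem blockSymbol_le_one (hd : 0 < d) (l : ℤ) (η : Space d) : blockSymbol χ l η ≤ 1 := by
  rw [blockSymbol_eq]
  linarith [hχ.lowSymbol_le_one (l + 1) η, hχ.lowSymbol_nonneg hd l η]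

theorem mem_annulus_of_blockSymbol_ne_zero {l : ℤ} {η : Space d} (h : blockSymbol χ l η ≠ 0) :
    η ∈ annulus d l := by
  have h2 : (2 : ℝ) ^ (l + 1) = 2 * 2 ^ l := by rw [zpow_add₀ (by norm_num)]; norm_num; ring
  have hp : (0 : ℝ) < 2 ^ l := by positivity
  constructor
  · by_contra hlt
    push Not at hlt
    apply h
    rw [blockSymbol_eq, hχ.lowSymbol_eq_one hlt.le, hχ.lowSymbol_eq_one (by rw [h2]; linarith),
      sub_self]
  · by_contra hlt
    push Not at hlt
    apply h
    rw [blockSymbol_eq, hχ.lowSymbol_eq_zero (by rw [h2]; linarith),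
      hχ.lowSymbol_eq_zero (by linarith), sub_self]

theorem blockSymbol_eq_zero {l : ℤ} {η : Space d} (h : η ∉ annulus d l) :
    blockSymbol χ l η = 0 := by
  by_contra h0; exact h (hχ.mem_annulus_of_blockSymbol_ne_zero h0)

theorem hasCompactSupport_blockSymbol (l : ℤ) : HasCompactSupport (blockSymbol χ l) :=
  HasCompactSupport.of_support_subset_isCompact (isCompact_annulus l)
    fun _ hη ↦ hχ.mem_annulus_of_blockSymbol_ne_zero hη

theorem exists_lipschitz_blockSymbol : ∃ Λ : ℝ, 0 < Λ ∧ ∀ (l : ℤ) (ξ η : Space d),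
    |blockSymbol χ l ξ - blockSymbol χ l η| ≤ Λ * ((2 : ℝ) ^ (-l) * freq (ξ - η)) := by
  have hc : HasCompactSupport χ := HasCompactSupport.of_support_subset_isCompact
    (isCompact_closedBall (0 : Space d) (4 / 3)) hχ.support_subset
  obtain ⟨K, hK⟩ := ContDiff.lipschitzWith_of_hasCompactSupport hc hχ.smooth (by simp)
  refine ⟨2 * K + 1, by positivity, fun l ξ η ↦ ?_⟩
  have key : ∀ x y : Space d, |χ x - χ y| ≤ K * ‖x - y‖ := fun x y ↦ by
    have := hK.dist_le_mul x y
    rwa [Real.dist_eq, dist_eq_norm] at this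
  have e0 : (2 : ℝ) ^ (-l) * freq (ξ - η) =
      ‖(2 : ℝ) ^ (-l) • (2 * Real.pi) • ξ - (2 : ℝ) ^ (-l) • (2 * Real.pi) • η‖ := by
    rw [← norm_dyadic_smul, smul_sub, smul_sub]
  rw [e0]
  set x := (2 : ℝ) ^ (-l) • (2 * Real.pi) • ξ
  set y := (2 : ℝ) ^ (-l) • (2 * Real.pi) • η
  have e1 : blockSymbol χ l ξ - blockSymbol χ l η =
      (χ ((1 / 2 : ℝ) • x) - χ ((1 / 2 : ℝ) • y)) - (χ x - χ y) := by
    simp only [blockSymbol, annulusFun]; ring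
  rw [e1]
  have h1 := key ((1 / 2 : ℝ) • x) ((1 / 2 : ℝ) • y)
  rw [← smul_sub, norm_smul, Real.norm_of_nonneg (by norm_num)] at h1
  have h2 := key x y
  have h3 := abs_sub (χ ((1 / 2 : ℝ) • x) - χ ((1 / 2 : ℝ) • y)) (χ x - χ y)
  have h4 : 0 ≤ (K : ℝ) * ‖x - y‖ := by positivity
  nlinarith [norm_nonneg (x - y)]

theorem exists_lowSymbol_eq_one (R : ℝ) :
    ∃ N₀ : ℕ, ∀ N : ℕ, N₀ ≤ N → ∀ η : Space d, freq η ≤ R → lowSymbol χ N η = 1 := by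
  obtain ⟨N₀, h⟩ := pow_unbounded_of_one_lt (4 / 3 * R) (one_lt_two : (1 : ℝ) < 2)
  refine ⟨N₀, fun N hN η hη ↦ hχ.lowSymbol_eq_one ?_⟩
  have : (2 : ℝ) ^ N₀ ≤ 2 ^ N := pow_le_pow_right₀ (by norm_num) hN
  rw [zpow_natCast]
  linarith

theorem exists_lowSymbol_neg_eq_zero {r : ℝ} (hr : 0 < r) :
    ∃ N₀ : ℕ, ∀ N : ℕ, N₀ ≤ N → ∀ η : Space d, r ≤ freq η → lowSymbol χ (-N) η = 0 := by
  obtain ⟨N₀, h⟩ := pow_unbounded_of_one_lt (4 / 3 / r) (one_lt_two : (1 : ℝ) < 2)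
  refine ⟨N₀, fun N hN η hη ↦ hχ.lowSymbol_eq_zero ?_⟩
  have : (2 : ℝ) ^ N₀ ≤ 2 ^ N := pow_le_pow_right₀ (by norm_num) hN
  rw [zpow_neg, zpow_natCast, ← div_eq_mul_inv, div_lt_iff₀ (by positivity)]
  rw [div_lt_iff₀ hr] at h
  have h2 := mul_le_mul this hη hr.le (by positivity)
  linarith

/-- The dyadic blocks form a partition of unity away from the zero frequency. -/
theorem one_le_tsum_blockSymbol {η : Space d} (hη : η ≠ 0) :
    1 ≤ ∑' l : ℤ, ENNReal.ofReal (blockSymbol χ l η) := by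
  obtain ⟨N₁, h1⟩ := hχ.exists_lowSymbol_eq_one (freq η)
  obtain ⟨N₂, h2⟩ := hχ.exists_lowSymbol_neg_eq_zero (freq_pos hη)
  set N := max N₁ N₂
  have h3 := sum_blockSymbol χ N η
  rw [h1 N (le_max_left _ _) η le_rfl, h2 N (le_max_right _ _) η le_rfl, sub_zero] at h3
  calc (1 : ℝ≥0∞) = ENNReal.ofReal (∑ l ∈ Finset.Ico (-(N : ℤ)) N, blockSymbol χ l η) := by
        rw [h3, ENNReal.ofReal_one]
    _ = ∑ l ∈ Finset.Ico (-(N : ℤ)) N, ENNReal.ofReal (blockSymbol χ l η) :=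
        ENNReal.ofReal_sum_of_nonneg fun l _ ↦ hχ.blockSymbol_nonneg l η
    _ ≤ _ := ENNReal.sum_le_tsum _

/-- The commutator kernel of a dyadic block and a derivative gains one derivative on the
coefficient. -/
theorem exists_commutator_bound (hd : 0 < d) : ∃ C : ℝ, 0 < C ∧ ∀ (l : ℤ) (ξ η : Space d),
    |blockSymbol χ l ξ - blockSymbol χ l η| * freq η ≤
      C * freq (ξ - η) * ((annulus d l).indicator 1 ξ + (annulus d l).indicator 1 η) := by
  obtain ⟨Λ, hΛ, hlip⟩ := hχ.exists_lipschitz_blockSymbol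
  refine ⟨8 * Λ + 2, by positivity, fun l ξ η ↦ ?_⟩
  have hp : (0 : ℝ) < 2 ^ l := by positivity
  have hf := freq_nonneg (ξ - η)
  have hn := freq_nonneg η
  by_cases hmem : ξ ∈ annulus d l ∨ η ∈ annulus d l
  · have hone : (1 : ℝ) ≤ (annulus d l).indicator 1 ξ + (annulus d l).indicator 1 η := by
      rcases hmem with h | h
      · rw [indicator_of_mem h]
        have : (0 : ℝ) ≤ (annulus d l).indicator 1 η := indicator_nonneg (by simp) _
        simpa using this
      · rw [indicator_of_mem h]
        have : (0 : ℝ) ≤ (annulus d l).indicator 1 ξ := indicator_nonneg (by simp) _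
        simpa using this
    refine le_trans ?_ (le_mul_of_one_le_right (by positivity) hone)
    -- At frequency `|η| ≲ 2 ^ l` the Lipschitz bound of the symbol suffices. Otherwise only `ξ`
    -- lies in the annulus, and `|η|` is comparable with `|ξ - η|`.
    by_cases hbig : freq η ≤ 8 * 2 ^ l
    · have h1 := hlip l ξ η
      calc |blockSymbol χ l ξ - blockSymbol χ l η| * freq η
          ≤ Λ * ((2 : ℝ) ^ (-l) * freq (ξ - η)) * (8 * 2 ^ l) := by gcongr
        _ = 8 * Λ * freq (ξ - η) := by rw [zpow_neg]; field_simp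
        _ ≤ _ := by nlinarith
    · push Not at hbig
      have hη : η ∉ annulus d l := fun h ↦ by have := h.2; linarith
      have hξ : ξ ∈ annulus d l := by tauto
      rw [hχ.blockSymbol_eq_zero hη, sub_zero, abs_of_nonneg (hχ.blockSymbol_nonneg l ξ)]
      have h1 := hχ.blockSymbol_le_one hd l ξ
      have h2 := freq_le_add_sub η ξ
      rw [freq_sub_comm] at h2
      have h3 := hξ.2
      have h4 : blockSymbol χ l ξ * freq η ≤ freq η := mul_le_of_le_one_left hn h1
      have h5 : 0 ≤ 8 * Λ * freq (ξ - η) := by positivity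
      linarith
  · push Not at hmem
    rw [hχ.blockSymbol_eq_zero hmem.1, hχ.blockSymbol_eq_zero hmem.2]
    simp [hmem.1, hmem.2]

end IsCutoff

end LinearCapillary

namespace LinearCapillary

open MeasureTheory Filter Topology Set TemperedDistribution
open scoped ENNReal ContDiff SchwartzMap LineDeriv Laplacian FourierTransform

variable {d : ℕ}

/-! ### Distributions whose Fourier transform is a function -/

/-- The Fourier transform of `T` is the locally integrable function `g`. Only compactly supported
test functions are used, so that no growth condition on `g` is needed. -/
structure HasFourier (T : Distr d) (g : Space d → ℂ) : Prop where
  measurable : Measurable g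
  locallyIntegrable : LocallyIntegrable g
  apply_fourier : ∀ ψ : 𝓢(Space d, ℂ), HasCompactSupport ψ → T (𝓕 ψ) = ∫ η, ψ η * g η

theorem locallyIntegrable_of_lintegral_closedBall {g : Space d → ℂ} (hg : Measurable g)
    (h : ∀ R : ℝ, ∫⁻ η in Metric.closedBall 0 R, ‖g η‖ₑ < ⊤) : LocallyIntegrable g := by
  rw [locallyIntegrable_iff]
  intro K hK
  obtain ⟨R, hR⟩ := hK.isBounded.subset_closedBall 0
  exact ⟨hg.aestronglyMeasurable, (lintegral_mono_set hR).trans_lt (h R)⟩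

theorem integrable_mul_of_hasCompactSupport {g : Space d → ℂ} (hg : LocallyIntegrable g)
    {ψ : 𝓢(Space d, ℂ)} (hψ : HasCompactSupport ψ) : Integrable fun η ↦ ψ η * g η := by
  have := hg.integrable_smul_left_of_hasCompactSupport ψ.continuous hψ
  simpa using this

theorem ae_eq_of_integral_schwartz_eq {g g' : Space d → ℂ} (hg : LocallyIntegrable g)
    (hg' : LocallyIntegrable g')
    (h : ∀ ψ : 𝓢(Space d, ℂ), HasCompactSupport ψ → ∫ η, ψ η * g η = ∫ η, ψ η * g' η) :
    g =ᵐ[volume] g' := by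
  refine ae_eq_of_integral_contDiff_smul_eq hg hg' fun b hb hbc ↦ ?_
  have hc : HasCompactSupport fun x ↦ (b x : ℂ) := hbc.comp_left Complex.ofReal_zero
  have hs : ContDiff ℝ ∞ fun x ↦ (b x : ℂ) := Complex.ofRealCLM.contDiff.comp hb
  simpa using! h (hc.toSchwartzMap hs) hc

theorem hasCompactSupport_smulLeftCLM {b : Space d → ℂ} {ψ : 𝓢(Space d, ℂ)}
    (h : HasCompactSupport ψ) : HasCompactSupport (SchwartzMap.smulLeftCLM ℂ b ψ) :=
  h.of_isClosed_subset (isClosed_tsupport _)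
    ((SchwartzMap.tsupport_smulLeftCLM_subset b ψ).trans inter_subset_left)

theorem hasCompactSupport_smulLeftCLM_left {b : Space d → ℂ} (ψ : 𝓢(Space d, ℂ))
    (h : HasCompactSupport b) : HasCompactSupport (SchwartzMap.smulLeftCLM ℂ b ψ) :=
  h.of_isClosed_subset (isClosed_tsupport _)
    ((SchwartzMap.tsupport_smulLeftCLM_subset b ψ).trans inter_subset_right)

theorem multiplier_apply_fourier (m : Space d → ℝ) (f : Distr d) (ψ : 𝓢(Space d, ℂ)) :
    multiplier m f (𝓕 ψ) =
      f (𝓕 (SchwartzMap.smulLeftCLM ℂ (fun η ↦ ((m ((2 * Real.pi) • η) : ℝ) : ℂ)) ψ)) := by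
  simp [multiplier]

theorem dyadicBlock_apply_fourier (χ : Space d → ℝ) (l : ℤ) (f : Distr d) (ψ : 𝓢(Space d, ℂ)) :
    dyadicBlock χ l f (𝓕 ψ) =
      f (𝓕 (SchwartzMap.smulLeftCLM ℂ (fun η ↦ (blockSymbol χ l η : ℂ)) ψ)) :=
  multiplier_apply_fourier _ f ψ

theorem lowFreq_apply_fourier (χ : Space d → ℝ) (l : ℤ) (f : Distr d) (ψ : 𝓢(Space d, ℂ)) :
    lowFreq χ l f (𝓕 ψ) =
      f (𝓕 (SchwartzMap.smulLeftCLM ℂ (fun η ↦ (lowSymbol χ l η : ℂ)) ψ)) :=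
  multiplier_apply_fourier _ f ψ

theorem IsCutoff.hasCompactSupport_ofReal_blockSymbol {χ : Space d → ℝ} (hχ : IsCutoff χ) (l : ℤ) :
    HasCompactSupport fun η ↦ (blockSymbol χ l η : ℂ) :=
  (hχ.hasCompactSupport_blockSymbol l).comp_left Complex.ofReal_zero

theorem IsCutoff.hasTemperateGrowth_blockSymbol {χ : Space d → ℝ} (hχ : IsCutoff χ) (l : ℤ) :
    (fun η ↦ (blockSymbol χ l η : ℂ)).HasTemperateGrowth :=
  (hχ.hasCompactSupport_ofReal_blockSymbol l).hasTemperateGrowth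
    (Complex.ofRealCLM.contDiff.comp (hχ.contDiff_blockSymbol l))

theorem IsCutoff.hasCompactSupport_ofReal_lowSymbol {χ : Space d → ℝ} (hχ : IsCutoff χ) (l : ℤ) :
    HasCompactSupport fun η ↦ (lowSymbol χ l η : ℂ) :=
  (hχ.hasCompactSupport_lowSymbol l).comp_left Complex.ofReal_zero

theorem IsCutoff.hasTemperateGrowth_lowSymbol {χ : Space d → ℝ} (hχ : IsCutoff χ) (l : ℤ) :
    (fun η ↦ (lowSymbol χ l η : ℂ)).HasTemperateGrowth :=
  (hχ.hasCompactSupport_ofReal_lowSymbol l).hasTemperateGrowth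
    (Complex.ofRealCLM.contDiff.comp (hχ.contDiff_lowSymbol l))

namespace HasFourier

variable {T T' : Distr d} {g g' : Space d → ℂ}

theorem integrable_mul (h : HasFourier T g) {ψ : 𝓢(Space d, ℂ)} (hψ : HasCompactSupport ψ) :
    Integrable fun η ↦ ψ η * g η :=
  integrable_mul_of_hasCompactSupport h.locallyIntegrable hψ

theorem add (h : HasFourier T g) (h' : HasFourier T' g') :
    HasFourier (T + T') (fun η ↦ g η + g' η) where
  measurable := h.measurable.add h'.measurable
  locallyIntegrable := h.locallyIntegrable.add h'.locallyIntegrable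
  apply_fourier ψ hψ := by
    simp only [mul_add]
    rw [integral_add (h.integrable_mul hψ) (h'.integrable_mul hψ), ← h.apply_fourier ψ hψ,
      ← h'.apply_fourier ψ hψ]
    rfl

theorem const_smul (h : HasFourier T g) (c : ℂ) : HasFourier (c • T) (fun η ↦ c * g η) where
  measurable := h.measurable.const_mul c
  locallyIntegrable := h.locallyIntegrable.smul c
  apply_fourier ψ hψ := by
    simp only [mul_left_comm _ c]
    rw [integral_const_mul, ← h.apply_fourier ψ hψ]
    rfl

theorem sub (h : HasFourier T g) (h' : HasFourier T' g') :
    HasFourier (T - T') (fun η ↦ g η - g' η) := by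
  have e : T - T' = T + (-1 : ℂ) • T' := by ext ψ; simp [sub_eq_add_neg]
  rw [e]
  simpa [sub_eq_add_neg] using! h.add (h'.const_smul (-1))

theorem zero : HasFourier (0 : Distr d) (fun _ ↦ 0) where
  measurable := measurable_const
  locallyIntegrable := locallyIntegrable_zero
  apply_fourier ψ hψ := by simp

theorem sum {ι : Type*} (s : Finset ι) {T : ι → Distr d} {g : ι → Space d → ℂ}
    (h : ∀ i ∈ s, HasFourier (T i) (g i)) :
    HasFourier (∑ i ∈ s, T i) (fun η ↦ ∑ i ∈ s, g i η) := by
  classical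
  induction s using Finset.induction_on with
  | empty => simpa using zero
  | insert a s ha ih =>
    simp only [Finset.sum_insert ha]
    exact (h a (by simp)).add (ih fun i hi ↦ h i (by simp [hi]))

theorem of_multiplier (h : HasFourier T g) {b : Space d → ℂ} (hb : b.HasTemperateGrowth)
    (hT : ∀ ψ : 𝓢(Space d, ℂ), T' (𝓕 ψ) = T (𝓕 (SchwartzMap.smulLeftCLM ℂ b ψ))) :
    HasFourier T' (fun η ↦ b η * g η) where
  measurable := hb.1.continuous.measurable.mul h.measurable
  locallyIntegrable := h.locallyIntegrable.continuous_smul hb.1.continuous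
  apply_fourier ψ hψ := by
    rw [hT, h.apply_fourier _ (hasCompactSupport_smulLeftCLM hψ)]
    refine integral_congr_ae (ae_of_all _ fun η ↦ ?_)
    simp only [SchwartzMap.smulLeftCLM_apply_apply hb, smul_eq_mul]
    ring

theorem lineDeriv (h : HasFourier T g) (m : Space d) :
    HasFourier (∂_{m} T) (fun η ↦ (2 * Real.pi * Complex.I * (inner ℝ η m : ℝ)) * g η) := by
  have hb : (fun η : Space d ↦ ((inner ℝ η m : ℝ) : ℂ)).HasTemperateGrowth := by fun_prop
  have h1 : HasFourier (fourierMultiplierCLM ℂ (fun η ↦ ((inner ℝ η m : ℝ) : ℂ)) T)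
      (fun η ↦ ((inner ℝ η m : ℝ) : ℂ) * g η) := h.of_multiplier hb fun ψ ↦ by simp
  have h2 := h1.const_smul (2 * Real.pi * Complex.I)
  rw [← TemperedDistribution.lineDeriv_eq_fourierMultiplierCLM] at h2
  simpa only [mul_assoc] using h2

theorem partialD (h : HasFourier T g) (i : Fin d) :
    HasFourier (partialD i T) (fun η ↦ (Complex.I * ((2 * Real.pi * η i : ℝ) : ℂ)) * g η) := by
  have := h.lineDeriv (EuclideanSpace.single i (1 : ℝ))
  refine (congrArg (HasFourier _) (funext fun η ↦ ?_)).mpr this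
  have e : inner ℝ η (EuclideanSpace.single i (1 : ℝ)) = η i := by
    rw [EuclideanSpace.inner_single_right]; simp
  rw [e]
  push_cast
  ring

theorem laplacian (h : HasFourier T g) :
    HasFourier (Δ T) (fun η ↦ (-((freq η ^ 2 : ℝ) : ℂ)) * g η) := by
  have hb : (fun η : Space d ↦ Complex.ofReal (‖η‖ ^ 2)).HasTemperateGrowth := by
    have : (fun η : Space d ↦ ‖η‖ ^ 2).HasTemperateGrowth := by fun_prop
    exact Complex.ofRealCLM.hasTemperateGrowth.comp this
  have h1 : HasFourier (fourierMultiplierCLM ℂ (fun η ↦ Complex.ofReal (‖η‖ ^ 2)) T)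
      (fun η ↦ Complex.ofReal (‖η‖ ^ 2) * g η) := h.of_multiplier hb fun ψ ↦ by simp
  have h2 := h1.const_smul (-(2 * Real.pi) ^ 2 : ℝ)
  have e : Δ T = ((-(2 * Real.pi) ^ 2 : ℝ) : ℂ) •
      fourierMultiplierCLM ℂ (fun η ↦ Complex.ofReal (‖η‖ ^ 2)) T := by
    rw [TemperedDistribution.laplacian_eq_fourierMultiplierCLM,
      ← Complex.coe_smul (-(2 * Real.pi) ^ 2)]
  rw [← e] at h2
  refine (congrArg (HasFourier (Δ T)) (funext fun η ↦ ?_)).mpr h2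
  rw [freq_eq]
  push_cast
  ring

theorem divergence {w : Fin d → Distr d} {g : Fin d → Space d → ℂ}
    (h : ∀ i, HasFourier (w i) (g i)) :
    HasFourier (divergence w)
      (fun η ↦ ∑ i, (Complex.I * ((2 * Real.pi * η i : ℝ) : ℂ)) * g i η) :=
  sum Finset.univ fun i _ ↦ (h i).partialD i

theorem capillaryConv (h : HasFourier T g) (ε : ℝ) :
    HasFourier (capillaryConv ε T)
      (fun η ↦ ((Real.exp (-(ε ^ 2 * freq η ^ 2)) : ℝ) : ℂ) * g η) :=
  h.of_multiplier (hasTemperateGrowth_capillarySymbol ε) (multiplier_apply_fourier _ T)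

end HasFourier

/-! ### `L²` distributions -/

/-- By Plancherel's theorem, a distribution whose Fourier transform is an `L²` function has the
`L²` norm of that function. -/
theorem distrLpNorm_two_eq {T : Distr d} {g : Space d → ℂ} (hg : MemLp g 2)
    (h : ∀ ψ : 𝓢(Space d, ℂ), T (𝓕 ψ) = ∫ η, ψ η * g η) :
    distrLpNorm 2 T = eLpNorm g 2 := by
  have hT : Lp.toTemperedDistribution (𝓕⁻ (hg.toLp g)) = T := by
    rw [← Lp.fourierInv_toTemperedDistribution_eq]
    ext ψ
    rw [TemperedDistribution.fourierInv_apply, Lp.toTemperedDistribution_apply]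
    have h1 := h (𝓕⁻ ψ)
    rw [FourierTransform.fourier_fourierInv_eq] at h1
    rw [h1]
    refine integral_congr_ae ?_
    filter_upwards [hg.coeFn_toLp] with x hx
    rw [hx, smul_eq_mul]
  have hnorm : ‖𝓕⁻ (hg.toLp g)‖ₑ = eLpNorm g 2 := by
    have : ‖𝓕⁻ (hg.toLp g)‖ = ‖hg.toLp g‖ := by
      rw [← Lp.norm_fourier_eq (𝓕⁻ (hg.toLp g)), FourierTransform.fourier_fourierInv_eq]
    rw [← ofReal_norm, this, ofReal_norm, Lp.enorm_toLp]
  refine le_antisymm ?_ ?_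
  · rw [← hnorm]
    exact iInf₂_le (𝓕⁻ (hg.toLp g)) hT
  · refine le_iInf₂ fun g' hg' ↦ ?_
    have hinj : g' = 𝓕⁻ (hg.toLp g) := by
      have hker := Lp.ker_toTemperedDistributionCLM_eq_bot (E := Space d) (F := ℂ)
        (μ := volume) (p := 2)
      refine LinearMap.ker_eq_bot.1 hker ?_
      change Lp.toTemperedDistribution g' = Lp.toTemperedDistribution (𝓕⁻ (hg.toLp g))
      rw [hg', hT]
    rw [hinj, hnorm]

/-- A distribution with finite `L²` norm has an `L²` Fourier transform. -/
theorem exists_fourier_of_distrLpNorm_lt_top {T : Distr d} (h : distrLpNorm 2 T < ⊤) :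
    ∃ g : Space d → ℂ, Measurable g ∧ MemLp g 2 ∧
      ∀ ψ : 𝓢(Space d, ℂ), T (𝓕 ψ) = ∫ η, ψ η * g η := by
  obtain ⟨f, hf⟩ : ∃ f : Lp ℂ 2 (volume : Measure (Space d)), Lp.toTemperedDistribution f = T := by
    by_contra hne
    push Not at hne
    refine h.ne ?_
    simp only [distrLpNorm, iInf_eq_top]
    intro g hg
    exact absurd hg (hne g)
  have hsm := (Lp.aestronglyMeasurable (𝓕 f)).aemeasurable
  refine ⟨hsm.mk _, hsm.measurable_mk, (memLp_congr_ae hsm.ae_eq_mk).1 (Lp.memLp (𝓕 f)),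
    fun ψ ↦ ?_⟩
  have h1 : T (𝓕 ψ) = Lp.toTemperedDistribution (𝓕 f) ψ := by
    rw [← Lp.fourier_toTemperedDistribution_eq, hf]; rfl
  rw [h1, Lp.toTemperedDistribution_apply]
  refine integral_congr_ae ?_
  filter_upwards [hsm.ae_eq_mk] with x hx
  rw [← hx, smul_eq_mul]

theorem enorm_apply_le_distrLpNorm_top (T : Distr d) (ψ : 𝓢(Space d, ℂ)) :
    ‖T ψ‖ₑ ≤ distrLpNorm ⊤ T * ∫⁻ x, ‖ψ x‖ₑ := by
  have hψ : ∫⁻ x, ‖ψ x‖ₑ ≠ ⊤ := ψ.integrable.2.ne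
  by_cases h0 : ∫⁻ x, ‖ψ x‖ₑ = 0
  · have hz : ∀ᵐ x, ψ x = 0 := by
      rw [lintegral_eq_zero_iff (by fun_prop)] at h0
      filter_upwards [h0] with x hx using by simpa using hx
    have : ψ = 0 := by
      ext x
      have := Continuous.ae_eq_iff_eq volume ψ.continuous continuous_const |>.1 hz
      exact congrFun this x
    simp [this]
  rw [← ENNReal.div_le_iff h0 hψ]
  refine le_iInf₂ fun g hg ↦ ?_
  rw [ENNReal.div_le_iff h0 hψ, ← hg, Lp.toTemperedDistribution_apply]
  refine (enorm_integral_le_lintegral_enorm _).trans ?_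
  rw [← lintegral_const_mul' _ _ (by simp)]
  refine lintegral_mono_ae ?_
  have hb : ∀ᵐ x, ‖g x‖ₑ ≤ ‖g‖ₑ := by
    have := ae_le_eLpNormEssSup (f := g) (μ := volume)
    rw [← eLpNorm_exponent_top, ← Lp.enorm_def] at this
    exact this
  filter_upwards [hb] with x hx
  rw [smul_eq_mul, enorm_mul, mul_comm]
  gcongr

end LinearCapillary

namespace LinearCapillary

open MeasureTheory Filter Topology Set TemperedDistribution
open scoped ENNReal ContDiff SchwartzMap FourierTransform

variable {d : ℕ}

/-! ### Dyadic weights and `L²` norms of nonnegative functions -/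

theorem dyadicWeight_add (a b : ℝ) (l : ℤ) :
    dyadicWeight (a + b) l = dyadicWeight a l * dyadicWeight b l := by
  rw [dyadicWeight, dyadicWeight, dyadicWeight, ← ENNReal.ofReal_mul (by positivity),
    ← Real.rpow_add (by norm_num), mul_add]

theorem dyadicWeight_ne_top (a : ℝ) (l : ℤ) : dyadicWeight a l ≠ ⊤ := ENNReal.ofReal_ne_top

theorem dyadicWeight_ne_zero (a : ℝ) (l : ℤ) : dyadicWeight a l ≠ 0 := by
  rw [dyadicWeight, Ne, ENNReal.ofReal_eq_zero, not_le]; positivity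

theorem dyadicWeight_zero (l : ℤ) : dyadicWeight 0 l = 1 := by simp [dyadicWeight]

theorem dyadicWeight_one (l : ℤ) : dyadicWeight 1 l = ENNReal.ofReal ((2 : ℝ) ^ l) := by
  simp [dyadicWeight, Real.rpow_intCast]

theorem dyadicWeight_neg_mul (a : ℝ) (l : ℤ) : dyadicWeight (-a) l * dyadicWeight a l = 1 := by
  rw [← dyadicWeight_add, neg_add_cancel, dyadicWeight_zero]

theorem dyadicWeight_mono {a : ℝ} (ha : 0 ≤ a) {l m : ℤ} (h : l ≤ m) :
    dyadicWeight a l ≤ dyadicWeight a m := by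
  refine ENNReal.ofReal_le_ofReal (Real.rpow_le_rpow_of_exponent_le (by norm_num) ?_)
  have : (l : ℝ) ≤ m := by exact_mod_cast h
  nlinarith

/-- Weights at indices differing by at most `n` are comparable. -/
theorem dyadicWeight_le_of_abs_sub_le (a : ℝ) {l m : ℤ} {n : ℝ} (h : |(l : ℝ) - m| ≤ n) :
    dyadicWeight a l ≤ ENNReal.ofReal ((2 : ℝ) ^ (n * |a|)) * dyadicWeight a m := by
  rw [dyadicWeight, dyadicWeight, ← ENNReal.ofReal_mul (by positivity),
    ← Real.rpow_add (by norm_num)]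
  refine ENNReal.ofReal_le_ofReal (Real.rpow_le_rpow_of_exponent_le (by norm_num) ?_)
  have h1 : ((l : ℝ) - m) * a ≤ |(l : ℝ) - m| * |a| := by
    rw [← abs_mul]; exact le_abs_self _
  nlinarith [abs_nonneg a]

/-- The `L²` norm of a nonnegative function. -/
noncomputable def l2 (f : Space d → ℝ≥0∞) : ℝ≥0∞ := (∫⁻ η, f η ^ (2 : ℝ)) ^ (1 / 2 : ℝ)

theorem eLpNorm_two_eq_l2 {F : Type*} [NormedAddCommGroup F] (g : Space d → F) :
    eLpNorm g 2 volume = l2 fun η ↦ ‖g η‖ₑ := by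
  rw [eLpNorm_eq_lintegral_rpow_enorm_toReal (by norm_num) (by norm_num)]
  simp [l2]

theorem l2_mono {f g : Space d → ℝ≥0∞} (h : ∀ᵐ η, f η ≤ g η) : l2 f ≤ l2 g := by
  refine ENNReal.rpow_le_rpow (lintegral_mono_ae ?_) (by norm_num)
  filter_upwards [h] with η hη using ENNReal.rpow_le_rpow hη (by norm_num)

theorem l2_const_mul {c : ℝ≥0∞} (hc : c ≠ ⊤) (f : Space d → ℝ≥0∞) :
    l2 (fun η ↦ c * f η) = c * l2 f := by
  simp only [l2, ENNReal.mul_rpow_of_nonneg _ _ (show (0 : ℝ) ≤ 2 by norm_num)]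
  rw [lintegral_const_mul' _ _ (ENNReal.rpow_ne_top_of_nonneg (by norm_num) hc),
    ENNReal.mul_rpow_of_nonneg _ _ (by norm_num), ← ENNReal.rpow_mul]
  norm_num

theorem l2_add_le {f g : Space d → ℝ≥0∞} (hf : AEMeasurable f) (hg : AEMeasurable g) :
    l2 (fun η ↦ f η + g η) ≤ l2 f + l2 g :=
  ENNReal.lintegral_Lp_add_le hf hg (by norm_num)

theorem l2_sum_le {ι : Type*} (s : Finset ι) {f : ι → Space d → ℝ≥0∞}
    (hf : ∀ i ∈ s, AEMeasurable (f i)) : l2 (fun η ↦ ∑ i ∈ s, f i η) ≤ ∑ i ∈ s, l2 (f i) := by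
  classical
  induction s using Finset.induction_on with
  | empty => simp [l2]
  | insert a s ha ih =>
    simp only [Finset.sum_insert ha]
    refine (l2_add_le (hf a (by simp)) ?_).trans ?_
    · exact Finset.aemeasurable_fun_sum _ fun i hi ↦ hf i (by simp [hi])
    · gcongr
      exact ih fun i hi ↦ hf i (by simp [hi])

theorem lintegral_mul_le_l2 {f g : Space d → ℝ≥0∞} (hf : AEMeasurable f) (hg : AEMeasurable g) :
    ∫⁻ η, f η * g η ≤ l2 f * l2 g :=
  ENNReal.lintegral_mul_le_Lp_mul_Lq volume (Real.HolderConjugate.two_two) hf hg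

theorem exists_volume_annulus_le (d : ℕ) : ∃ C : ℝ≥0∞, C ≠ ⊤ ∧ ∀ l : ℤ,
    volume (annulus d l) ≤ C * dyadicWeight d l := by
  refine ⟨ENNReal.ofReal ((8 / 3) ^ d) * volume (Metric.closedBall (0 : Space d) 1),
    ENNReal.mul_ne_top ENNReal.ofReal_ne_top measure_closedBall_lt_top.ne, fun l ↦ ?_⟩
  refine (measure_mono (annulus_subset_closedBall l)).trans ?_
  have h0 : (0 : ℝ) < 8 / 3 * 2 ^ l := by positivity
  rw [show (8 / 3 * (2 : ℝ) ^ l) = (8 / 3 * (2 : ℝ) ^ l) * 1 by ring,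
    Measure.addHaar_closedBall_mul _ _ h0.le zero_le_one, finrank_euclideanSpace_fin, mul_pow,
    ENNReal.ofReal_mul (by positivity), mul_right_comm]
  have : ((2 : ℝ) ^ l) ^ d = (2 : ℝ) ^ ((l : ℝ) * (d : ℝ)) := by
    rw [← Real.rpow_intCast, ← Real.rpow_natCast, ← Real.rpow_mul (by norm_num)]
  rw [this]
  rfl

/-- Bernstein's inequality: on a dyadic annulus the `L¹` norm is controlled by the `L²` norm. -/
theorem exists_lintegral_annulus_le (d : ℕ) : ∃ C : ℝ≥0∞, C ≠ ⊤ ∧ ∀ (l : ℤ)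
    (f : Space d → ℝ≥0∞), AEMeasurable f →
    ∫⁻ η in annulus d l, f η ≤ C * dyadicWeight ((d : ℝ) / 2) l * l2 f := by
  obtain ⟨C, hC, h⟩ := exists_volume_annulus_le d
  refine ⟨C ^ (1 / 2 : ℝ), ENNReal.rpow_ne_top_of_nonneg (by norm_num) hC, fun l f hf ↦ ?_⟩
  have h1 : ∫⁻ η in annulus d l, f η =
      ∫⁻ η, (annulus d l).indicator (fun _ ↦ 1) η * f η := by
    rw [← lintegral_indicator (measurableSet_annulus l)]
    congr 1
    funext η
    by_cases hη : η ∈ annulus d l <;> simp [hη]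
  rw [h1]
  refine (lintegral_mul_le_l2
    ((measurable_const.indicator (measurableSet_annulus l)).aemeasurable) hf).trans ?_
  gcongr
  have h2 : ∫⁻ η, (annulus d l).indicator (fun _ ↦ (1 : ℝ≥0∞)) η ^ (2 : ℝ) =
      volume (annulus d l) := by
    rw [← lintegral_indicator_one (measurableSet_annulus l)]
    congr 1
    funext η
    by_cases hη : η ∈ annulus d l <;> simp [hη]
  rw [l2, h2]
  refine (ENNReal.rpow_le_rpow (h l) (by norm_num)).trans_eq ?_
  rw [ENNReal.mul_rpow_of_nonneg _ _ (by norm_num)]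
  congr 1
  rw [dyadicWeight, ENNReal.ofReal_rpow_of_nonneg (by positivity) (by norm_num), dyadicWeight,
    ← Real.rpow_mul (by norm_num)]
  congr 2
  ring

/-! ### Dyadic blocks on the Fourier side -/

section Block

variable {χ : Space d → ℝ}

/-- The `L²` norm of a dyadic block of a function of frequency. -/
noncomputable def blockNorm (χ : Space d → ℝ) (l : ℤ) (f : Space d → ℝ≥0∞) : ℝ≥0∞ :=
  l2 fun η ↦ ENNReal.ofReal (blockSymbol χ l η) * f η

theorem blockNorm_mono (χ : Space d → ℝ) (l : ℤ) {f g : Space d → ℝ≥0∞} (h : ∀ η, f η ≤ g η) :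
    blockNorm χ l f ≤ blockNorm χ l g :=
  l2_mono (ae_of_all _ fun η ↦ by gcongr; exact h η)

theorem blockNorm_add_le (hχ : IsCutoff χ) (l : ℤ) {f g : Space d → ℝ≥0∞} (hf : Measurable f)
    (hg : Measurable g) :
    blockNorm χ l (fun η ↦ f η + g η) ≤ blockNorm χ l f + blockNorm χ l g := by
  have hm := (hχ.continuous_blockSymbol l).measurable.ennreal_ofReal
  simp only [blockNorm, mul_add]
  exact l2_add_le (hm.mul hf).aemeasurable (hm.mul hg).aemeasurable

theorem blockNorm_sum_le (hχ : IsCutoff χ) (l : ℤ) {ι : Type*} (s : Finset ι)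
    {f : ι → Space d → ℝ≥0∞} (hf : ∀ i, Measurable (f i)) :
    blockNorm χ l (fun η ↦ ∑ i ∈ s, f i η) ≤ ∑ i ∈ s, blockNorm χ l (f i) := by
  have hm := (hχ.continuous_blockSymbol l).measurable.ennreal_ofReal
  simp only [blockNorm, Finset.mul_sum]
  exact l2_sum_le s fun i _ ↦ (hm.mul (hf i)).aemeasurable

theorem blockNorm_const_mul (l : ℤ) {c : ℝ≥0∞} (hc : c ≠ ⊤) (f : Space d → ℝ≥0∞) :
    blockNorm χ l (fun η ↦ c * f η) = c * blockNorm χ l f := by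
  simp only [blockNorm, mul_left_comm _ c]
  exact l2_const_mul hc _

theorem IsCutoff.enorm_blockSymbol_mul (hχ : IsCutoff χ) (l : ℤ) (g : Space d → ℂ) (η : Space d) :
    ‖(blockSymbol χ l η : ℂ) * g η‖ₑ = ENNReal.ofReal (blockSymbol χ l η) * ‖g η‖ₑ := by
  rw [enorm_mul, ← ofReal_norm (blockSymbol χ l η : ℂ), Complex.norm_real,
    Real.norm_of_nonneg (hχ.blockSymbol_nonneg l η)]

theorem IsCutoff.blockNorm_eq_eLpNorm (hχ : IsCutoff χ) (l : ℤ) (g : Space d → ℂ) :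
    blockNorm χ l (fun η ↦ ‖g η‖ₑ) =
      eLpNorm (fun η ↦ (blockSymbol χ l η : ℂ) * g η) 2 volume := by
  rw [eLpNorm_two_eq_l2, blockNorm]
  simp only [hχ.enorm_blockSymbol_mul]

theorem HasFourier.dyadicBlock_apply (hχ : IsCutoff χ) {T : Distr d} {g : Space d → ℂ}
    (h : HasFourier T g) (l : ℤ) (ψ : 𝓢(Space d, ℂ)) :
    dyadicBlock χ l T (𝓕 ψ) = ∫ η, ψ η * ((blockSymbol χ l η : ℂ) * g η) := by
  rw [dyadicBlock_apply_fourier, h.apply_fourier _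
    (hasCompactSupport_smulLeftCLM_left ψ (hχ.hasCompactSupport_ofReal_blockSymbol l))]
  refine integral_congr_ae (ae_of_all _ fun η ↦ ?_)
  simp only [SchwartzMap.smulLeftCLM_apply_apply (hχ.hasTemperateGrowth_blockSymbol l),
    smul_eq_mul]
  ring

theorem HasFourier.distrLpNorm_dyadicBlock (hχ : IsCutoff χ) {T : Distr d} {g : Space d → ℂ}
    (h : HasFourier T g) (l : ℤ) :
    distrLpNorm 2 (dyadicBlock χ l T) = blockNorm χ l fun η ↦ ‖g η‖ₑ := by
  have hc : Continuous fun η ↦ (blockSymbol χ l η : ℂ) :=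
    Complex.continuous_ofReal.comp (hχ.continuous_blockSymbol l)
  rw [hχ.blockNorm_eq_eLpNorm]
  by_cases hfin : eLpNorm (fun η ↦ (blockSymbol χ l η : ℂ) * g η) 2 volume < ⊤
  · exact distrLpNorm_two_eq ⟨(hc.measurable.mul h.measurable).aestronglyMeasurable, hfin⟩
      (h.dyadicBlock_apply hχ l)
  · rw [not_lt_top_iff.1 hfin]
    by_contra hlt
    obtain ⟨G, -, hG, hGψ⟩ := exists_fourier_of_distrLpNorm_lt_top (lt_top_iff_ne_top.2 hlt)
    refine hfin ?_
    have : (fun η ↦ (blockSymbol χ l η : ℂ) * g η) =ᵐ[volume] G := by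
      refine ae_eq_of_integral_schwartz_eq (h.locallyIntegrable.continuous_smul hc)
        (hG.locallyIntegrable (by norm_num)) fun ψ _ ↦ ?_
      rw [← hGψ, h.dyadicBlock_apply hχ l]
    rw [eLpNorm_congr_ae this]
    exact hG.2

/-- If a block of a distribution is in `L²`, its Fourier transform is an `L²` function supported
in the annulus. -/
theorem exists_fourier_dyadicBlock (hχ : IsCutoff χ) {T : Distr d} {l : ℤ}
    (h : distrLpNorm 2 (dyadicBlock χ l T) < ⊤) :
    ∃ G : Space d → ℂ, Measurable G ∧ MemLp G 2 ∧ (∀ η, η ∉ annulus d l → G η = 0) ∧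
      (∀ ψ : 𝓢(Space d, ℂ), dyadicBlock χ l T (𝓕 ψ) = ∫ η, ψ η * G η) ∧
      distrLpNorm 2 (dyadicBlock χ l T) = l2 fun η ↦ ‖G η‖ₑ := by
  obtain ⟨G, hGm, hG, hψ⟩ := exists_fourier_of_distrLpNorm_lt_top h
  have hz : ∀ᵐ η, η ∈ (annulus d l)ᶜ → G η = 0 := by
    refine (isClosed_annulus l).isOpen_compl.ae_eq_zero_of_integral_contDiff_smul_eq_zero
      ((hG.locallyIntegrable (by norm_num)).locallyIntegrableOn _) fun b hb hbc hbs ↦ ?_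
    have hc : HasCompactSupport fun x ↦ (b x : ℂ) := hbc.comp_left Complex.ofReal_zero
    have hs : ContDiff ℝ ∞ fun x ↦ (b x : ℂ) := Complex.ofRealCLM.contDiff.comp hb
    have h1 := hψ (hc.toSchwartzMap hs)
    have h2 : SchwartzMap.smulLeftCLM ℂ (fun η ↦ (blockSymbol χ l η : ℂ))
        (hc.toSchwartzMap hs) = 0 := by
      ext x
      rw [SchwartzMap.smulLeftCLM_apply_apply (hχ.hasTemperateGrowth_blockSymbol l)]
      by_cases hx : x ∈ annulus d l
      · have : b x = 0 := by
          by_contra hne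
          exact hbs (subset_tsupport _ hne) hx
        simp [this]
      · simp [hχ.blockSymbol_eq_zero hx]
    rw [dyadicBlock_apply_fourier, h2] at h1
    simpa using! h1.symm
  have hae : (annulus d l).indicator G =ᵐ[volume] G := by
    filter_upwards [hz] with η hη
    by_cases hm : η ∈ annulus d l
    · simp [hm]
    · simp [hm, hη hm]
  have hG' : MemLp ((annulus d l).indicator G) 2 := (memLp_congr_ae hae).2 hG
  have hψ' : ∀ ψ : 𝓢(Space d, ℂ), dyadicBlock χ l T (𝓕 ψ) =
      ∫ η, ψ η * (annulus d l).indicator G η := fun ψ ↦ by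
    rw [hψ]
    refine integral_congr_ae ?_
    filter_upwards [hae] with η hη
    rw [hη]
  refine ⟨(annulus d l).indicator G, hGm.indicator (measurableSet_annulus l), hG',
    fun η hη ↦ indicator_of_notMem hη _, hψ', ?_⟩
  rw [distrLpNorm_two_eq hG' hψ', eLpNorm_two_eq_l2]

theorem finite_setOf_mem_annulus (η : Space d) : {l : ℤ | η ∈ annulus d l}.Finite := by
  by_cases h0 : freq η ≤ 0
  · convert Set.finite_empty
    ext l
    simp only [Set.mem_ofPred_eq, Set.mem_empty_iff_false, iff_false]
    intro h
    have := h.1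
    have : (0 : ℝ) < 2 ^ l := by positivity
    linarith
  · push Not at h0
    obtain ⟨a, ha⟩ := pow_unbounded_of_one_lt (4 / 3 * freq η) (one_lt_two : (1 : ℝ) < 2)
    obtain ⟨b, hb⟩ := pow_unbounded_of_one_lt (8 / 3 / freq η) (one_lt_two : (1 : ℝ) < 2)
    refine (Set.finite_Icc (-(b : ℤ)) a).subset fun l hl ↦ ?_
    simp only [Set.mem_ofPred_eq] at hl
    constructor
    · by_contra hlt
      push Not at hlt
      have h1 : (2 : ℝ) ^ l ≤ 2 ^ (-(b : ℤ)) := zpow_le_zpow_right₀ (by norm_num) hlt.le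
      rw [zpow_neg, zpow_natCast, ← one_div, le_div_iff₀ (by positivity)] at h1
      rw [div_lt_iff₀ h0] at hb
      have h2 : freq η * 2 ^ b ≤ 8 / 3 * 2 ^ l * 2 ^ b :=
        mul_le_mul_of_nonneg_right hl.2 (by positivity)
      nlinarith
    · by_contra hlt
      push Not at hlt
      have h1 : (2 : ℝ) ^ (a : ℤ) ≤ 2 ^ l := zpow_le_zpow_right₀ (by norm_num) hlt.le
      rw [zpow_natCast] at h1
      have := hl.1
      linarith

/-- The part of a weighted sum of annuli that meets a ball is controlled by a Besov norm of
regularity at most `d/2`. -/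
theorem tsum_lintegral_annulus_closedBall_lt_top {σ : ℝ} (hσ : σ ≤ (d : ℝ) / 2)
    {f : ℤ → Space d → ℝ≥0∞} (hf : ∀ l, Measurable (f l)) (R : ℝ)
    (h : ∑' l : ℤ, dyadicWeight σ l * l2 (f l) < ⊤) :
    ∑' l : ℤ, ∫⁻ η in Metric.closedBall 0 R ∩ annulus d l, f l η < ⊤ := by
  obtain ⟨C, hC, hb⟩ := exists_lintegral_annulus_le d
  obtain ⟨L, hL⟩ := pow_unbounded_of_one_lt (4 / 3 * (2 * Real.pi * R)) (one_lt_two : (1 : ℝ) < 2)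
  have key : ∀ l : ℤ, ∫⁻ η in Metric.closedBall 0 R ∩ annulus d l, f l η ≤
      C * dyadicWeight ((d : ℝ) / 2 - σ) L * (dyadicWeight σ l * l2 (f l)) := by
    intro l
    -- the annuli with `l > L` do not meet the ball, and for `l ≤ L` the excess weight of exponent
    -- `d / 2 - σ ≥ 0` is bounded by its value at `L`
    by_cases hl : l ≤ L
    · calc ∫⁻ η in Metric.closedBall 0 R ∩ annulus d l, f l η
          ≤ ∫⁻ η in annulus d l, f l η := lintegral_mono_set inter_subset_right
        _ ≤ C * dyadicWeight ((d : ℝ) / 2) l * l2 (f l) := hb l _ (hf l).aemeasurable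
        _ = C * dyadicWeight ((d : ℝ) / 2 - σ) l * (dyadicWeight σ l * l2 (f l)) := by
            rw [show (d : ℝ) / 2 = ((d : ℝ) / 2 - σ) + σ by ring, dyadicWeight_add]
            ring_nf
        _ ≤ _ := by
            gcongr
            exact dyadicWeight_mono (by linarith) hl
    · have : Metric.closedBall (0 : Space d) R ∩ annulus d l = ∅ := by
        ext η
        simp only [mem_inter_iff, mem_closedBall_zero_iff, Set.mem_empty_iff_false, iff_false,
          not_and]
        intro h1 h2
        push Not at hl
        have h3 : (2 : ℝ) ^ (L : ℤ) ≤ 2 ^ l := zpow_le_zpow_right₀ (by norm_num) hl.le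
        rw [zpow_natCast] at h3
        have h4 := h2.1
        rw [freq_eq] at h4
        have h5 : 2 * Real.pi * ‖η‖ ≤ 2 * Real.pi * R := by gcongr
        linarith
      rw [this]
      simp
  refine (ENNReal.tsum_le_tsum key).trans_lt ?_
  rw [ENNReal.tsum_mul_left]
  exact ENNReal.mul_lt_top (ENNReal.mul_lt_top hC.lt_top (dyadicWeight_ne_top _ _).lt_top) h

/-- An element of `𝓢'_h` with a finite Besov norm of regularity at most `d/2` has a locally
integrable Fourier transform. -/
theorem exists_hasFourier (hχ : IsCutoff χ) {σ : ℝ} (hσ : σ ≤ (d : ℝ) / 2) {T : Distr d}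
    (hsh : IsSh χ T) (hT : besovNorm χ σ T < ⊤) : ∃ g, HasFourier T g := by
  have hfin : ∀ l, distrLpNorm 2 (dyadicBlock χ l T) < ⊤ := fun l ↦ by
    have := (ENNReal.le_tsum l).trans_lt hT
    by_contra h
    rw [not_lt_top_iff.1 h, ENNReal.mul_top (dyadicWeight_ne_zero _ _)] at this
    exact this.ne rfl
  choose G hGm hG2 hGs hGψ hGn using fun l ↦ exists_fourier_dyadicBlock hχ (hfin l)
  have hsum : ∀ η, HasSum (fun l ↦ G l η) (∑' l, G l η) := fun η ↦ by
    refine (summable_of_hasFiniteSupport ?_).hasSum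
    refine (finite_setOf_mem_annulus η).subset fun l hl ↦ ?_
    by_contra h
    exact hl (hGs l η h)
  -- the candidate is the sum of the Fourier transforms of the blocks, which is locally finite away
  -- from `0`
  set g : Space d → ℂ := fun η ↦ ∑' l, G l η with hg
  have hgm : Measurable g :=
    measurable_of_tendsto_metrizable' (atTop : Filter (Finset ℤ))
      (f := fun (s : Finset ℤ) η ↦ ∑ l ∈ s, G l η)
      (fun s ↦ Finset.measurable_fun_sum _ fun l _ ↦ hGm l) (tendsto_pi_nhds.2 hsum)
  have hball : ∀ R : ℝ, ∑' l, ∫⁻ η in Metric.closedBall 0 R, ‖G l η‖ₑ < ⊤ := by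
    intro R
    have := tsum_lintegral_annulus_closedBall_lt_top hσ (f := fun l η ↦ ‖G l η‖ₑ)
      (fun l ↦ (hGm l).enorm) R (by simp only [← hGn]; exact hT)
    refine lt_of_le_of_lt (ENNReal.tsum_le_tsum fun l ↦ ?_) this
    rw [← lintegral_indicator measurableSet_closedBall,
      ← lintegral_indicator (measurableSet_closedBall.inter (measurableSet_annulus l))]
    refine lintegral_mono fun η ↦ ?_
    by_cases hm : η ∈ annulus d l
    · by_cases hb : η ∈ Metric.closedBall 0 R <;> simp [hb, hm, -Metric.mem_closedBall]
    · simp [hGs l η hm, indicator]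
  have hgle : ∀ η, ‖g η‖ₑ ≤ ∑' l, ‖G l η‖ₑ := fun η ↦ enorm_tsum_le_tsum_enorm
  have hloc : LocallyIntegrable g := locallyIntegrable_of_lintegral_closedBall hgm fun R ↦ by
    refine (lintegral_mono fun η ↦ hgle η).trans_lt ?_
    rw [lintegral_tsum fun l ↦ (hGm l).enorm.aemeasurable]
    exact hball R
  refine ⟨g, hgm, hloc, fun ψ hψ ↦ ?_⟩
  obtain ⟨R, hR⟩ := hψ.isCompact.isBounded.subset_closedBall 0
  obtain ⟨M, hM⟩ := ψ.continuous.bounded_above_of_compact_support hψ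
  have hlint : ∀ l, ∫⁻ η, ‖ψ η * G l η‖ₑ ≤
      ENNReal.ofReal M * ∫⁻ η in Metric.closedBall 0 R, ‖G l η‖ₑ := by
    intro l
    rw [← lintegral_const_mul' _ _ ENNReal.ofReal_ne_top,
      ← lintegral_indicator measurableSet_closedBall]
    refine lintegral_mono fun η ↦ ?_
    by_cases hb : η ∈ Metric.closedBall 0 R
    · rw [indicator_of_mem hb, enorm_mul]
      gcongr
      rw [← ofReal_norm]
      exact ENNReal.ofReal_le_ofReal (hM η)
    · have : ψ η = 0 := by
        by_contra h
        exact hb (hR (subset_tsupport _ h))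
      simp [this]
  have hi : ∀ l, Integrable fun η ↦ ψ η * G l η := fun l ↦
    ⟨(ψ.continuous.measurable.mul (hGm l)).aestronglyMeasurable, (hlint l).trans_lt
      (ENNReal.mul_lt_top ENNReal.ofReal_lt_top ((ENNReal.le_tsum l).trans_lt (hball R)))⟩
  have hs : Summable fun l ↦ ∫ η, ‖ψ η * G l η‖ := by
    have h1 : ∀ l, ∫ η, ‖ψ η * G l η‖ = (∫⁻ η, ‖ψ η * G l η‖ₑ).toReal := fun l ↦
      integral_norm_eq_lintegral_enorm (hi l).1
    simp only [h1]
    refine ENNReal.summable_toReal ?_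
    refine ((ENNReal.tsum_le_tsum hlint).trans_lt ?_).ne
    rw [ENNReal.tsum_mul_left]
    exact ENNReal.mul_lt_top ENNReal.ofReal_lt_top (hball R)
  have hH := hasSum_integral_of_summable_integral_norm hi hs
  simp only [tsum_mul_left] at hH
  -- partial sums over `-N ≤ l < N`
  have hpart : ∀ N : ℕ, ∑ l ∈ Finset.Ico (-(N : ℤ)) N, ∫ η, ψ η * G l η =
      lowFreq χ N T (𝓕 ψ) - lowFreq χ (-N) T (𝓕 ψ) := by
    intro N
    have e1 : SchwartzMap.smulLeftCLM ℂ (fun η ↦ (lowSymbol χ N η : ℂ)) ψ -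
        SchwartzMap.smulLeftCLM ℂ (fun η ↦ (lowSymbol χ (-N) η : ℂ)) ψ =
        ∑ l ∈ Finset.Ico (-(N : ℤ)) N,
          SchwartzMap.smulLeftCLM ℂ (fun η ↦ (blockSymbol χ l η : ℂ)) ψ := by
      ext η
      rw [sub_apply, sum_apply]
      simp only [SchwartzMap.smulLeftCLM_apply_apply (hχ.hasTemperateGrowth_blockSymbol _),
        SchwartzMap.smulLeftCLM_apply_apply (hχ.hasTemperateGrowth_lowSymbol _), ← sub_smul,
        ← Finset.sum_smul, ← Complex.ofReal_sub, ← Complex.ofReal_sum, sum_blockSymbol]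
    have e2 : ∀ l, ∫ η, ψ η * G l η =
        T (𝓕 (SchwartzMap.smulLeftCLM ℂ (fun η ↦ (blockSymbol χ l η : ℂ)) ψ)) := fun l ↦ by
      rw [← hGψ, dyadicBlock_apply_fourier]
    simp only [e2, lowFreq_apply_fourier]
    rw [← map_sub, ← FourierTransform.fourierCLM_apply (R := ℂ), ← FourierTransform.fourierCLM_apply (R := ℂ),
      ← map_sub, e1, map_sum, map_sum]
    simp
  have hIco : Tendsto (fun N : ℕ ↦ Finset.Ico (-(N : ℤ)) N) atTop atTop := by
    refine tendsto_atTop_finset_of_monotone (fun m n h ↦ Finset.Ico_subset_Ico (by omega) (by omega))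
      fun l ↦ ⟨l.natAbs + 1, by rw [Finset.mem_Ico]; omega⟩
  have hlim1 := hH.comp hIco
  -- The high frequencies exhaust the test function, as it has compact support, and the low
  -- frequencies vanish in the limit because `T` belongs to the space `𝓢'_h`.
  have hlim2 : Tendsto (fun N : ℕ ↦ lowFreq χ N T (𝓕 ψ) - lowFreq χ (-N) T (𝓕 ψ)) atTop
      (𝓝 (T (𝓕 ψ) - 0)) := by
    refine Tendsto.sub ?_ ?_
    · obtain ⟨N₀, hN₀⟩ := hχ.exists_lowSymbol_eq_one (2 * Real.pi * R)
      refine tendsto_const_nhds.congr' ?_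
      filter_upwards [eventually_ge_atTop N₀] with N hN
      rw [lowFreq_apply_fourier]
      congr 2
      ext η
      rw [SchwartzMap.smulLeftCLM_apply_apply (hχ.hasTemperateGrowth_lowSymbol _)]
      by_cases hb : ψ η = 0
      · simp [hb]
      · have := hR (subset_tsupport _ hb)
        rw [mem_closedBall_zero_iff] at this
        rw [hN₀ N hN η (by rw [freq_eq]; gcongr)]
        simp
    · rw [tendsto_zero_iff_enorm_tendsto_zero]
      have h1 : Tendsto (fun N : ℕ ↦ distrLpNorm ⊤ (lowFreq χ (-N) T) * ∫⁻ x, ‖(𝓕 ψ) x‖ₑ) atTop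
          (𝓝 (0 * ∫⁻ x, ‖(𝓕 ψ) x‖ₑ)) := by
        refine ENNReal.Tendsto.mul_const ?_ (Or.inr (𝓕 ψ).integrable.2.ne)
        exact hsh.comp (tendsto_neg_atTop_atBot.comp tendsto_natCast_atTop_atTop)
      rw [zero_mul] at h1
      exact tendsto_of_tendsto_of_tendsto_of_le_of_le tendsto_const_nhds h1 (fun _ ↦ zero_le)
        fun N ↦ enorm_apply_le_distrLpNorm_top _ _
  rw [sub_zero] at hlim2
  refine tendsto_nhds_unique hlim2 (hlim1.congr fun N ↦ ?_)
  exact hpart N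

end Block

end LinearCapillary

namespace LinearCapillary

open MeasureTheory Filter Topology Set
open scoped ENNReal

variable {d : ℕ}

/-! ### Trilinear estimates on the Fourier side -/

/-- The trilinear form `∬ A(ξ) B(ξ - η) C(η)` for nonnegative functions of frequency. -/
noncomputable def triForm (A B C : Space d → ℝ≥0∞) : ℝ≥0∞ :=
  ∫⁻ ξ, ∫⁻ η, A ξ * (B (ξ - η) * C η)

theorem l2_comp_sub_right (f : Space d → ℝ≥0∞) (ζ : Space d) : l2 (fun ξ ↦ f (ξ - ζ)) = l2 f := by
  rw [l2, lintegral_sub_right_eq_self (fun ξ ↦ f ξ ^ (2 : ℝ)) ζ, l2]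

theorem l2_comp_sub_left (f : Space d → ℝ≥0∞) (ξ : Space d) : l2 (fun η ↦ f (ξ - η)) = l2 f := by
  rw [l2, lintegral_sub_left_eq_self (fun ξ ↦ f ξ ^ (2 : ℝ)) ξ, l2]

section Tri

variable {A B C : Space d → ℝ≥0∞} (hA : Measurable A) (hB : Measurable B) (hC : Measurable C)
include hA hB hC

theorem triForm_le_lintegral_left : triForm A B C ≤ (∫⁻ ξ, A ξ) * l2 B * l2 C := by
  have h : ∀ ξ, ∫⁻ η, A ξ * (B (ξ - η) * C η) ≤ A ξ * (l2 B * l2 C) := fun ξ ↦ by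
    rw [lintegral_const_mul _ (by fun_prop)]
    gcongr
    refine (lintegral_mul_le_l2 (by fun_prop) (by fun_prop)).trans_eq ?_
    rw [l2_comp_sub_left]
  refine (lintegral_mono h).trans_eq ?_
  rw [lintegral_mul_const _ hA, mul_assoc]

theorem triForm_le_lintegral_right : triForm A B C ≤ l2 A * l2 B * ∫⁻ η, C η := by
  rw [triForm, lintegral_lintegral_swap (by fun_prop)]
  have h : ∀ η, ∫⁻ ξ, A ξ * (B (ξ - η) * C η) ≤ l2 A * l2 B * C η := fun η ↦ by
    simp only [← mul_assoc]
    rw [lintegral_mul_const _ (by fun_prop)]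
    gcongr
    refine (lintegral_mul_le_l2 (by fun_prop) (by fun_prop)).trans_eq ?_
    rw [l2_comp_sub_right]
  refine (lintegral_mono h).trans_eq ?_
  rw [lintegral_const_mul _ hC]

theorem triForm_le_lintegral_mid : triForm A B C ≤ l2 A * (∫⁻ ζ, B ζ) * l2 C := by
  have h0 : triForm A B C = ∫⁻ ξ, ∫⁻ ζ, A ξ * (B ζ * C (ξ - ζ)) := by
    refine lintegral_congr fun ξ ↦ ?_
    rw [← lintegral_sub_left_eq_self (fun ζ ↦ A ξ * (B ζ * C (ξ - ζ))) ξ]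
    simp
  rw [h0, lintegral_lintegral_swap (by fun_prop)]
  have h : ∀ ζ, ∫⁻ ξ, A ξ * (B ζ * C (ξ - ζ)) ≤ B ζ * (l2 A * l2 C) := fun ζ ↦ by
    simp only [mul_left_comm _ (B ζ)]
    rw [lintegral_const_mul _ (by fun_prop)]
    gcongr
    refine (lintegral_mul_le_l2 (by fun_prop) (by fun_prop)).trans_eq ?_
    rw [l2_comp_sub_right]
  refine (lintegral_mono h).trans_eq ?_
  rw [lintegral_mul_const _ hB]
  ring

end Tri

theorem triForm_mono_ae {A A' B B' C C' : Space d → ℝ≥0∞} (hA : ∀ᵐ ξ, A ξ ≤ A' ξ)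
    (hB : ∀ᵐ ξ, B ξ ≤ B' ξ) (hC : ∀ᵐ ξ, C ξ ≤ C' ξ) : triForm A B C ≤ triForm A' B' C' := by
  refine lintegral_mono_ae ?_
  filter_upwards [hA] with ξ hξ
  refine lintegral_mono_ae ?_
  have := (quasiMeasurePreserving_sub_left (volume : Measure (Space d)) ξ).ae hB
  filter_upwards [hC, this] with η h1 h2
  gcongr

theorem triForm_tsum {A : Space d → ℝ≥0∞} {B C : ℤ → Space d → ℝ≥0∞} (hA : Measurable A)
    (hB : ∀ j, Measurable (B j)) (hC : ∀ m, Measurable (C m)) :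
    triForm A (fun ζ ↦ ∑' j, B j ζ) (fun η ↦ ∑' m, C m η) =
      ∑' j, ∑' m, triForm A (B j) (C m) := by
  have h : ∀ ξ η, A ξ * ((∑' j, B j (ξ - η)) * ∑' m, C m η) =
      ∑' j, ∑' m, A ξ * (B j (ξ - η) * C m η) := fun ξ η ↦ by
    rw [← ENNReal.tsum_mul_right, ← ENNReal.tsum_mul_left]
    refine tsum_congr fun j ↦ ?_
    rw [← ENNReal.tsum_mul_left, ← ENNReal.tsum_mul_left]
  simp only [triForm, h]
  have hm : ∀ ξ j, Measurable fun η ↦ ∑' m, A ξ * (B j (ξ - η) * C m η) := fun ξ j ↦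
    Measurable.tsum fun m ↦ by have := hB j; have := hC m; fun_prop
  have h1 : ∀ ξ, ∫⁻ η, ∑' j, ∑' m, A ξ * (B j (ξ - η) * C m η) =
      ∑' j, ∑' m, ∫⁻ η, A ξ * (B j (ξ - η) * C m η) := fun ξ ↦ by
    rw [lintegral_tsum fun j ↦ (hm ξ j).aemeasurable]
    refine tsum_congr fun j ↦ ?_
    rw [lintegral_tsum fun m ↦ by have := hB j; have := hC m; fun_prop]
  simp only [h1]
  have hm2 : ∀ j m, Measurable fun ξ ↦ ∫⁻ η, A ξ * (B j (ξ - η) * C m η) := fun j m ↦ by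
    have := hB j; have := hC m
    have hm : Measurable fun p : Space d × Space d ↦ A p.1 * (B j (p.1 - p.2) * C m p.2) := by
      fun_prop
    exact hm.lintegral_prod_right'
  rw [lintegral_tsum fun j ↦ (Measurable.tsum fun m ↦ hm2 j m).aemeasurable]
  refine tsum_congr fun j ↦ ?_
  rw [lintegral_tsum fun m ↦ (hm2 j m).aemeasurable]

/-- The dyadic matrix of a product: an output at frequency `2^l` is produced by a coefficient at
frequency `2^j` and a factor at frequency `2^m`, where the two largest of the three
frequencies are comparable. The `L¹` norm is put on the factor with the smallest frequency. -/
noncomputable def paraCoeff (d : ℕ) (l j m : ℤ) : ℝ≥0∞ :=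
  (if |l - m| ≤ 5 then dyadicWeight ((d : ℝ) / 2) j else 0) +
  (if |l - j| ≤ 5 ∧ m ≤ l then dyadicWeight ((d : ℝ) / 2) m else 0) +
  (if |j - m| ≤ 5 ∧ l ≤ m then dyadicWeight ((d : ℝ) / 2) l else 0)

/-- If `|ξ| ≤ |ζ| + |η|`, the annulus of `ξ` is not far outside both of those of `ζ` and `η`. -/
theorem index_le_of_annulus {l j m : ℤ} {ξ η ζ : Space d} (hξ : ξ ∈ annulus d l)
    (hζ : ζ ∈ annulus d j) (hη : η ∈ annulus d m) (h : freq ξ ≤ freq ζ + freq η) :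
    l ≤ max j m + 2 := by
  by_contra hlt
  push Not at hlt
  have hj : (2 : ℝ) ^ (j + 3) ≤ 2 ^ l := zpow_le_zpow_right₀ (by norm_num)
    (by have := le_max_left j m; omega)
  have hm : (2 : ℝ) ^ (m + 3) ≤ 2 ^ l := zpow_le_zpow_right₀ (by norm_num)
    (by have := le_max_right j m; omega)
  rw [zpow_add₀ (by norm_num)] at hj hm
  norm_num at hj hm
  have h1 := hξ.1
  have h2 := hζ.2
  have h3 := hη.2
  have : (0 : ℝ) < 2 ^ l := by positivity
  linarith

/-- The Cauchy–Schwarz inequality for three functions localized in annuli. Since `ξ = (ξ - η) +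
η`, the two largest of the three frequencies are comparable, and the smallest one carries the
`L¹` norm, which Bernstein's inequality bounds by an `L²` norm. -/
theorem exists_triForm_dyadic_le (d : ℕ) : ∃ K : ℝ≥0∞, K ≠ ⊤ ∧ ∀ (l j m : ℤ)
    (A B C : Space d → ℝ≥0∞), Measurable A → Measurable B → Measurable C →
    (∀ ξ, ξ ∉ annulus d l → A ξ = 0) → (∀ ξ, ξ ∉ annulus d j → B ξ = 0) →
    (∀ ξ, ξ ∉ annulus d m → C ξ = 0) →
    triForm A B C ≤ K * paraCoeff d l j m * (l2 A * (l2 B * l2 C)) := by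
  obtain ⟨K, hK, hb⟩ := exists_lintegral_annulus_le d
  refine ⟨K, hK, fun l j m A B C hA hB hC sA sB sC ↦ ?_⟩
  have hint : ∀ (n : ℤ) (f : Space d → ℝ≥0∞), Measurable f → (∀ ξ, ξ ∉ annulus d n → f ξ = 0) →
      ∫⁻ ξ, f ξ ≤ K * dyadicWeight ((d : ℝ) / 2) n * l2 f := by
    intro n f hf hs
    refine le_trans (le_of_eq ?_) (hb n f hf.aemeasurable)
    rw [← lintegral_indicator (measurableSet_annulus n)]
    congr 1
    funext ξ
    by_cases h : ξ ∈ annulus d n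
    · simp [h]
    · simp [h, hs ξ h]
  have mono : ∀ x : ℝ≥0∞, x ≤ paraCoeff d l j m →
      K * x * (l2 A * (l2 B * l2 C)) ≤ K * paraCoeff d l j m * (l2 A * (l2 B * l2 C)) :=
    fun x hx ↦ by gcongr
  by_cases h1 : |l - m| ≤ 5
  · refine le_trans ?_ (mono (dyadicWeight ((d : ℝ) / 2) j) ?_)
    · refine (triForm_le_lintegral_mid hA hB hC).trans ?_
      calc l2 A * (∫⁻ ζ, B ζ) * l2 C
          ≤ l2 A * (K * dyadicWeight ((d : ℝ) / 2) j * l2 B) * l2 C := by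
            gcongr; exact hint j B hB sB
        _ = _ := by ring
    · rw [paraCoeff, if_pos h1, add_assoc]; exact le_self_add
  by_cases h2 : |l - j| ≤ 5 ∧ m ≤ l
  · refine le_trans ?_ (mono (dyadicWeight ((d : ℝ) / 2) m) ?_)
    · refine (triForm_le_lintegral_right hA hB hC).trans ?_
      calc l2 A * l2 B * (∫⁻ ζ, C ζ)
          ≤ l2 A * l2 B * (K * dyadicWeight ((d : ℝ) / 2) m * l2 C) := by
            gcongr; exact hint m C hC sC
        _ = _ := by ring
    · rw [paraCoeff, if_pos h2, add_right_comm]; exact le_add_self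
  by_cases h3 : |j - m| ≤ 5 ∧ l ≤ m
  · refine le_trans ?_ (mono (dyadicWeight ((d : ℝ) / 2) l) ?_)
    · refine (triForm_le_lintegral_left hA hB hC).trans ?_
      calc (∫⁻ ζ, A ζ) * l2 B * l2 C
          ≤ (K * dyadicWeight ((d : ℝ) / 2) l * l2 A) * l2 B * l2 C := by
            gcongr; exact hint l A hA sA
        _ = _ := by ring
    · rw [paraCoeff, if_pos h3]; exact le_add_self
  -- none of the three configurations holds: the supports do not interact
  have hz : triForm A B C = 0 := by
    have : ∀ ξ η, A ξ * (B (ξ - η) * C η) = 0 := by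
      intro ξ η
      by_contra hne
      have a1 : ξ ∈ annulus d l := by by_contra h; simp [sA ξ h] at hne
      have a2 : ξ - η ∈ annulus d j := by by_contra h; simp [sB _ h] at hne
      have a3 : η ∈ annulus d m := by by_contra h; simp [sC η h] at hne
      have b1 := index_le_of_annulus a1 a2 a3 (by
        have := freq_le_add_sub ξ η; linarith)
      have b2 := index_le_of_annulus a2 a1 a3 (by
        have := freq_add_le ξ (-η); rw [freq_neg, ← sub_eq_add_neg] at this; exact this)
      have b3 := index_le_of_annulus a3 a1 a2 (by
        have := freq_le_add_sub η ξ; rwa [freq_sub_comm] at this)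
      rw [abs_le] at h1 h2 h3
      omega
    simp [triForm, this]
  rw [hz]
  exact zero_le

theorem tsum_ite_abs_sub_le (m : ℤ) (c : ℝ≥0∞) :
    ∑' l : ℤ, (if |l - m| ≤ 5 then c else 0) = 11 * c := by
  rw [tsum_eq_sum (s := Finset.Icc (m - 5) (m + 5))]
  · rw [Finset.sum_congr rfl (g := fun _ ↦ c)]
    · rw [Finset.sum_const, Int.card_Icc, show m + 5 + 1 - (m - 5) = 11 by ring]
      simp
    · intro l hl
      rw [Finset.mem_Icc] at hl
      rw [if_pos (abs_le.2 ⟨by omega, by omega⟩)]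
  · intro l hl
    rw [Finset.mem_Icc] at hl
    rw [if_neg]
    rw [abs_le]
    omega

theorem exists_tsum_dyadicWeight_le {a : ℝ} (ha : 0 < a) : ∃ G : ℝ≥0∞, G ≠ ⊤ ∧ ∀ m : ℤ,
    ∑' l : ℤ, (if l ≤ m then dyadicWeight a l else 0) ≤ G * dyadicWeight a m := by
  refine ⟨∑' n : ℕ, ENNReal.ofReal ((2 : ℝ) ^ (-a)) ^ n, ?_, fun m ↦ ?_⟩
  · rw [ENNReal.tsum_geometric]
    have : ENNReal.ofReal ((2 : ℝ) ^ (-a)) < 1 := by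
      rw [ENNReal.ofReal_lt_one]
      exact Real.rpow_lt_one_of_one_lt_of_neg (by norm_num) (by linarith)
    exact ENNReal.inv_ne_top.2 (tsub_pos_of_lt this).ne'
  · have hinj : Function.Injective fun n : ℕ ↦ m - (n : ℤ) := fun a b h ↦ by
      simp only at h; omega
    rw [← hinj.tsum_eq]
    · rw [← ENNReal.tsum_mul_right]
      refine ENNReal.tsum_le_tsum fun n ↦ ?_
      rw [if_pos (by omega), dyadicWeight, dyadicWeight,
        ← ENNReal.ofReal_pow (by positivity), ← ENNReal.ofReal_mul (by positivity)]
      refine ENNReal.ofReal_le_ofReal (le_of_eq ?_)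
      rw [← Real.rpow_natCast, ← Real.rpow_mul (by norm_num), ← Real.rpow_add (by norm_num)]
      push_cast
      ring_nf
    · intro l hl
      have : l ≤ m := by
        by_contra h
        exact hl (if_neg h)
      exact ⟨(m - l).toNat, by simp; omega⟩

/-- The product law `Ḃ^{d/2} · Ḃ^σ ⊂ Ḃ^σ`, `-d/2 < σ ≤ d/2`, at the level of dyadic indices. -/
theorem exists_tsum_paraCoeff_le {σ : ℝ} (h1 : -((d : ℝ) / 2) < σ) (h2 : σ ≤ (d : ℝ) / 2) :
    ∃ K : ℝ≥0∞, K ≠ ⊤ ∧ ∀ j m : ℤ, ∑' l : ℤ, dyadicWeight σ l * paraCoeff d l j m ≤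
      K * (dyadicWeight ((d : ℝ) / 2) j * dyadicWeight σ m) := by
  obtain ⟨G, hG, hg⟩ := exists_tsum_dyadicWeight_le (show 0 < σ + (d : ℝ) / 2 by linarith)
  set a := ENNReal.ofReal ((2 : ℝ) ^ (5 * |σ|)) with ha
  set b := ENNReal.ofReal ((2 : ℝ) ^ (5 * |(d : ℝ) / 2|)) with hb
  have hcmp : ∀ (x : ℝ) (l m : ℤ), |l - m| ≤ 5 →
      dyadicWeight x l ≤ ENNReal.ofReal ((2 : ℝ) ^ (5 * |x|)) * dyadicWeight x m := fun x l m h ↦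
    dyadicWeight_le_of_abs_sub_le x (by exact_mod_cast h)
  refine ⟨11 * a + 11 * b + G * b, by simp [ha, hb, hG, ENNReal.mul_eq_top], fun j m ↦ ?_⟩
  set P := dyadicWeight ((d : ℝ) / 2) j * dyadicWeight σ m with hP
  simp only [paraCoeff, mul_add]
  rw [ENNReal.tsum_add, ENNReal.tsum_add, add_mul, add_mul]
  refine add_le_add (add_le_add ?_ ?_) ?_
  -- the output frequency is comparable with that of the second factor
  · rw [mul_assoc, ← tsum_ite_abs_sub_le m]
    refine ENNReal.tsum_le_tsum fun l ↦ ?_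
    split_ifs with h
    · rw [hP, mul_left_comm a, mul_comm]
      gcongr
      exact hcmp σ l m h
    · simp
  -- it is comparable with that of the first factor: as `m ≤ l`, the weight is moved to `m` by means
  -- of `σ ≤ d / 2`
  · rw [mul_assoc, ← tsum_ite_abs_sub_le j]
    refine ENNReal.tsum_le_tsum fun l ↦ ?_
    by_cases h : |l - j| ≤ 5 ∧ m ≤ l
    · rw [if_pos h, if_pos h.1]
      have e1 : dyadicWeight (σ - (d : ℝ) / 2) l ≤ dyadicWeight (σ - (d : ℝ) / 2) m := by
        refine ENNReal.ofReal_le_ofReal (Real.rpow_le_rpow_of_exponent_le (by norm_num) ?_)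
        have : (m : ℝ) ≤ l := by exact_mod_cast h.2
        nlinarith
      calc dyadicWeight σ l * dyadicWeight ((d : ℝ) / 2) m
          = dyadicWeight (σ - (d : ℝ) / 2) l * dyadicWeight ((d : ℝ) / 2) l *
            dyadicWeight ((d : ℝ) / 2) m := by rw [← dyadicWeight_add, sub_add_cancel]
        _ ≤ dyadicWeight (σ - (d : ℝ) / 2) m * (b * dyadicWeight ((d : ℝ) / 2) j) *
            dyadicWeight ((d : ℝ) / 2) m := by
            gcongr
            exact hcmp _ l j h.1
        _ = b * (dyadicWeight ((d : ℝ) / 2) j *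
            (dyadicWeight (σ - (d : ℝ) / 2) m * dyadicWeight ((d : ℝ) / 2) m)) := by ring
        _ = _ := by rw [← dyadicWeight_add, sub_add_cancel]
    · rw [if_neg h]; simp
  -- both factors have comparable frequencies: the outputs `l ≤ m` add up to a geometric sum, which
  -- converges as `σ > -d / 2`
  · by_cases hjm : |j - m| ≤ 5
    · have e1 : ∀ l : ℤ, dyadicWeight σ l *
          (if |j - m| ≤ 5 ∧ l ≤ m then dyadicWeight ((d : ℝ) / 2) l else 0) =
          if l ≤ m then dyadicWeight (σ + (d : ℝ) / 2) l else 0 := fun l ↦ by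
        by_cases hl : l ≤ m
        · rw [if_pos ⟨hjm, hl⟩, if_pos hl, dyadicWeight_add]
        · rw [if_neg (fun h ↦ hl h.2), if_neg hl, mul_zero]
      simp only [e1]
      refine (hg m).trans ?_
      rw [dyadicWeight_add, hP]
      calc G * (dyadicWeight σ m * dyadicWeight ((d : ℝ) / 2) m)
          ≤ G * (dyadicWeight σ m * (b * dyadicWeight ((d : ℝ) / 2) j)) := by
            gcongr
            exact hcmp _ m j (by rwa [abs_sub_comm])
        _ = _ := by ring
    · have e1 : ∀ l : ℤ, dyadicWeight σ l *
          (if |j - m| ≤ 5 ∧ l ≤ m then dyadicWeight ((d : ℝ) / 2) l else 0) = 0 := fun l ↦ by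
        rw [if_neg (fun h ↦ hjm h.1), mul_zero]
      simp [e1]

/-- The dyadic bound, at the frequency `2^l`, for the product of two functions with dyadic
norms `w` and `y`. -/
noncomputable def paraSum (d : ℕ) (w y : ℤ → ℝ≥0∞) (l : ℤ) : ℝ≥0∞ :=
  ∑' j, ∑' m, paraCoeff d l j m * (w j * y m)

theorem paraSum_mono {w w' y y' : ℤ → ℝ≥0∞} (hw : ∀ j, w j ≤ w' j) (hy : ∀ j, y j ≤ y' j)
    (l : ℤ) : paraSum d w y l ≤ paraSum d w' y' l := by
  refine ENNReal.tsum_le_tsum fun j ↦ ENNReal.tsum_le_tsum fun m ↦ ?_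
  gcongr
  exacts [hw j, hy m]

theorem paraSum_const_mul_right (c : ℝ≥0∞) (w y : ℤ → ℝ≥0∞) (l : ℤ) :
    paraSum d w (fun m ↦ c * y m) l = c * paraSum d w y l := by
  simp only [paraSum, ← ENNReal.tsum_mul_left]
  refine tsum_congr fun j ↦ tsum_congr fun m ↦ ?_
  ring

/-- The product law `Ḃ^{d/2} · Ḃ^σ ⊂ Ḃ^σ` for `paraSum`. -/
theorem exists_tsum_paraSum_le {σ : ℝ} (h1 : -((d : ℝ) / 2) < σ) (h2 : σ ≤ (d : ℝ) / 2) :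
    ∃ K : ℝ≥0∞, K ≠ ⊤ ∧ ∀ w y : ℤ → ℝ≥0∞, ∑' l, dyadicWeight σ l * paraSum d w y l ≤
      K * ((∑' j, dyadicWeight ((d : ℝ) / 2) j * w j) * ∑' m, dyadicWeight σ m * y m) := by
  obtain ⟨K, hK, hk⟩ := exists_tsum_paraCoeff_le h1 h2
  refine ⟨K, hK, fun w y ↦ ?_⟩
  calc ∑' l, dyadicWeight σ l * paraSum d w y l
      = ∑' j, ∑' m, (∑' l, dyadicWeight σ l * paraCoeff d l j m) * (w j * y m) := by
        simp only [paraSum, ← ENNReal.tsum_mul_left, ← ENNReal.tsum_mul_right, mul_assoc]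
        rw [ENNReal.tsum_comm]
        refine tsum_congr fun j ↦ ?_
        rw [ENNReal.tsum_comm]
    _ ≤ ∑' j, ∑' m, K * (dyadicWeight ((d : ℝ) / 2) j * dyadicWeight σ m) * (w j * y m) := by
        gcongr with j m
        exact hk j m
    _ = _ := by
        rw [← ENNReal.tsum_mul_right, ← ENNReal.tsum_mul_left]
        refine tsum_congr fun j ↦ ?_
        rw [← ENNReal.tsum_mul_left, ← ENNReal.tsum_mul_left]
        refine tsum_congr fun m ↦ ?_
        ring

theorem ae_ne_zero (hd : 0 < d) : ∀ᵐ η : Space d, η ≠ 0 := by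
  have : Nonempty (Fin d) := ⟨⟨0, hd⟩⟩
  have : Nontrivial (Space d) := inferInstance
  simp [ae_iff, measure_singleton]

/-- The form which bounds commutators: at least one of the output frequency `ξ` and the input
frequency `η` lies in the annulus of index `l`. -/
theorem exists_triForm_indicator_le {χ : Space d → ℝ} (hχ : IsCutoff χ) (hd : 0 < d) :
    ∃ K : ℝ≥0∞, K ≠ ⊤ ∧ ∀ (l : ℤ) (Z W Y : Space d → ℝ≥0∞),
      Measurable Z → Measurable W → Measurable Y →
      triForm (fun ξ ↦ Z ξ * (annulus d l).indicator 1 ξ) W Y +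
          triForm Z W (fun η ↦ (annulus d l).indicator 1 η * Y η) ≤
        K * (l2 Z * paraSum d (fun j ↦ blockNorm χ j W) (fun m ↦ blockNorm χ m Y) l) := by
  obtain ⟨K, hK, hk⟩ := exists_triForm_dyadic_le d
  obtain ⟨K', hK', hb⟩ := exists_lintegral_annulus_le d
  refine ⟨K + K', by simp [hK, hK'], fun l Z W Y hZ hW hY ↦ ?_⟩
  have hφ : ∀ j, Measurable fun η ↦ ENNReal.ofReal (blockSymbol χ j η) := fun j ↦
    (hχ.continuous_blockSymbol j).measurable.ennreal_ofReal
  have hφ0 : ∀ j (f : Space d → ℝ≥0∞) ξ, ξ ∉ annulus d j →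
      ENNReal.ofReal (blockSymbol χ j ξ) * f ξ = 0 := fun j f ξ h ↦ by
    rw [hχ.blockSymbol_eq_zero h]; simp
  have h1l : Measurable ((annulus d l).indicator (1 : Space d → ℝ≥0∞)) :=
    measurable_one.indicator (measurableSet_annulus l)
  -- a function is dominated by the sum of its blocks, since the block symbols add up to `1` away
  -- from the origin
  have hdec : ∀ f : Space d → ℝ≥0∞, ∀ᵐ η, f η ≤ ∑' j, ENNReal.ofReal (blockSymbol χ j η) * f η := by
    intro f
    filter_upwards [ae_ne_zero hd] with η hη
    rw [ENNReal.tsum_mul_right]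
    exact le_mul_of_one_le_left (zero_le) (hχ.one_le_tsum_blockSymbol hη)
  have hsplit : ∀ A f g : Space d → ℝ≥0∞, Measurable A → Measurable f → Measurable g →
      triForm A f g ≤ ∑' j, ∑' m, triForm A (fun ζ ↦ ENNReal.ofReal (blockSymbol χ j ζ) * f ζ)
        (fun η ↦ ENNReal.ofReal (blockSymbol χ m η) * g η) := by
    intro A f g hA hf hg
    have e := triForm_tsum hA (B := fun j ζ ↦ ENNReal.ofReal (blockSymbol χ j ζ) * f ζ)
      (C := fun m η ↦ ENNReal.ofReal (blockSymbol χ m η) * g η)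
      (fun j ↦ (hφ j).mul hf) (fun m ↦ (hφ m).mul hg)
    rw [← e]
    exact triForm_mono_ae (ae_of_all _ fun _ ↦ le_rfl) (hdec f) (hdec g)
  rw [add_mul]
  refine add_le_add ?_ ?_
  · refine (hsplit _ _ _ (hZ.mul h1l) hW hY).trans ?_
    rw [paraSum, ← ENNReal.tsum_mul_left, ← ENNReal.tsum_mul_left]
    refine ENNReal.tsum_le_tsum fun j ↦ ?_
    rw [← ENNReal.tsum_mul_left, ← ENNReal.tsum_mul_left]
    refine ENNReal.tsum_le_tsum fun m ↦ ?_
    refine (hk l j m _ _ _ (hZ.mul h1l) ((hφ j).mul hW) ((hφ m).mul hY)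
      (fun ξ h ↦ by simp [h]) (hφ0 j W) (hφ0 m Y)).trans ?_
    calc _ ≤ K * paraCoeff d l j m * (l2 Z * (blockNorm χ j W * blockNorm χ m Y)) := by
          gcongr
          · refine l2_mono (ae_of_all _ fun ξ ↦ ?_)
            refine mul_le_of_le_one_right (zero_le) ?_
            exact indicator_le_self' (by simp) _
          · exact le_rfl
          · exact le_rfl
      _ = _ := by ring
  · refine (hsplit _ _ _ hZ hW (h1l.mul hY)).trans ?_
    rw [paraSum, ← ENNReal.tsum_mul_left, ← ENNReal.tsum_mul_left]
    refine ENNReal.tsum_le_tsum fun j ↦ ?_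
    rw [← ENNReal.tsum_mul_left, ← ENNReal.tsum_mul_left]
    refine ENNReal.tsum_le_tsum fun m ↦ ?_
    -- The frequency `η` lies in both annuli `l` and `m`, so that these are close; the output `ξ` is
    -- not localized, and the `L¹` norm is put on the middle factor.
    by_cases hlm : |l - m| ≤ 5
    · refine (triForm_le_lintegral_mid hZ ((hφ j).mul hW) ((hφ m).mul (h1l.mul hY))).trans ?_
      have e1 : ∫⁻ ζ, ENNReal.ofReal (blockSymbol χ j ζ) * W ζ ≤
          K' * dyadicWeight ((d : ℝ) / 2) j * blockNorm χ j W := by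
        refine le_trans (le_of_eq ?_) (hb j _ ((hφ j).mul hW).aemeasurable)
        rw [← lintegral_indicator (measurableSet_annulus j)]
        congr 1
        funext ξ
        by_cases h : ξ ∈ annulus d j
        · simp [h]
        · simp [h, hφ0 j W ξ h]
      have e2 : l2 (fun η ↦ ENNReal.ofReal (blockSymbol χ m η) *
          ((annulus d l).indicator 1 η * Y η)) ≤ blockNorm χ m Y := by
        refine l2_mono (ae_of_all _ fun η ↦ ?_)
        gcongr
        exact mul_le_of_le_one_left (zero_le) (indicator_le_self' (by simp) _)
      have e3 : dyadicWeight ((d : ℝ) / 2) j ≤ paraCoeff d l j m := by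
        rw [paraCoeff, if_pos hlm, add_assoc]; exact le_self_add
      calc _ ≤ l2 Z * (K' * paraCoeff d l j m * blockNorm χ j W) * blockNorm χ m Y := by
            gcongr
            · exact e1.trans (by gcongr)
            · exact e2
        _ = _ := by ring
    · have hz : ∀ η, ENNReal.ofReal (blockSymbol χ m η) * ((annulus d l).indicator 1 η * Y η) =
          0 := by
        intro η
        by_contra hne
        have a1 : η ∈ annulus d m := by by_contra h; simp [hχ.blockSymbol_eq_zero h] at hne
        have a2 : η ∈ annulus d l := by by_contra h; simp [h] at hne
        refine hlm ?_
        have b1 : l ≤ m + 2 := by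
          by_contra hlt
          push Not at hlt
          have : (2 : ℝ) ^ (m + 3) ≤ 2 ^ l := zpow_le_zpow_right₀ (by norm_num) (by omega)
          rw [zpow_add₀ (by norm_num)] at this
          norm_num at this
          have := a1.2
          have := a2.1
          have : (0 : ℝ) < 2 ^ m := by positivity
          linarith
        have b2 : m ≤ l + 2 := by
          by_contra hlt
          push Not at hlt
          have : (2 : ℝ) ^ (l + 3) ≤ 2 ^ m := zpow_le_zpow_right₀ (by norm_num) (by omega)
          rw [zpow_add₀ (by norm_num)] at this
          norm_num at this
          have := a2.2
          have := a1.1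
          have : (0 : ℝ) < 2 ^ l := by positivity
          linarith
        rw [abs_le]
        omega
      simp [triForm, hz]

/-- `L²` norms by duality. -/
theorem l2_le_of_forall_lintegral_mul_le {H : Space d → ℝ≥0∞} (hH : Measurable H) {M : ℝ≥0∞}
    (h : ∀ Z : Space d → ℝ≥0∞, Measurable Z → ∫⁻ ξ, Z ξ * H ξ ≤ l2 Z * M) : l2 H ≤ M := by
  -- the truncations of `H` have finite norm, hence can be tested against `H` and divided by
  let Z : ℕ → Space d → ℝ≥0∞ := fun n ↦
    (Metric.closedBall (0 : Space d) n).indicator fun ξ ↦ min (H ξ) n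
  have hZm : ∀ n, Measurable (Z n) := fun n ↦
    (hH.min measurable_const).indicator measurableSet_closedBall
  have hZH : ∀ n ξ, Z n ξ ≤ H ξ := fun n ξ ↦
    (indicator_le_self' (fun _ _ ↦ zero_le) _).trans (min_le_left _ _)
  have hZM : ∀ n, l2 (Z n) ≤ M := by
    intro n
    have hsq : l2 (Z n) * l2 (Z n) = ∫⁻ ξ, Z n ξ ^ (2 : ℝ) := by
      rw [l2, ← ENNReal.rpow_add_of_nonneg _ _ (by norm_num) (by norm_num)]
      norm_num
    have hle : l2 (Z n) * l2 (Z n) ≤ l2 (Z n) * M := by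
      rw [hsq]
      refine le_trans (lintegral_mono fun ξ ↦ ?_) (h (Z n) (hZm n))
      rw [ENNReal.rpow_two, pow_two]
      gcongr
      exact hZH n ξ
    have hfin : l2 (Z n) ≠ ⊤ := by
      refine ENNReal.rpow_ne_top_of_nonneg (by norm_num) (ne_of_lt ?_)
      calc ∫⁻ ξ, Z n ξ ^ (2 : ℝ)
          ≤ ∫⁻ ξ, (Metric.closedBall (0 : Space d) n).indicator (fun _ ↦ (n : ℝ≥0∞) ^ (2 : ℝ)) ξ := by
            refine lintegral_mono fun ξ ↦ ?_
            by_cases hξ : ξ ∈ Metric.closedBall (0 : Space d) n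
            · simp only [Z, indicator_of_mem hξ]
              exact ENNReal.rpow_le_rpow (min_le_right _ _) (by norm_num)
            · simp [Z, indicator_of_notMem hξ]
        _ = (n : ℝ≥0∞) ^ (2 : ℝ) * volume (Metric.closedBall (0 : Space d) n) := by
            rw [lintegral_indicator_const measurableSet_closedBall]
        _ < ⊤ := ENNReal.mul_lt_top
            (ENNReal.rpow_lt_top_of_nonneg (by norm_num) (by simp)) measure_closedBall_lt_top
    by_cases h0 : l2 (Z n) = 0
    · rw [h0]; exact zero_le
    · exact (ENNReal.mul_le_mul_iff_right h0 hfin).1 hle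
  have hmono : ∀ ξ, Monotone fun n ↦ Z n ξ ^ (2 : ℝ) := by
    intro ξ m n hmn
    refine ENNReal.rpow_le_rpow ?_ (by norm_num)
    have hc : (m : ℝ) ≤ n := by exact_mod_cast hmn
    by_cases hξ : ξ ∈ Metric.closedBall (0 : Space d) m
    · have hξ' := Metric.closedBall_subset_closedBall hc hξ
      simp only [Z, indicator_of_mem hξ, indicator_of_mem hξ']
      exact min_le_min le_rfl (by exact_mod_cast hmn)
    · simp [Z, indicator_of_notMem hξ]
  have hlim : ∀ ξ, Tendsto (fun n ↦ Z n ξ ^ (2 : ℝ)) atTop (𝓝 (H ξ ^ (2 : ℝ))) := by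
    intro ξ
    refine (ENNReal.continuous_rpow_const.tendsto _).comp ?_
    obtain ⟨N, hN⟩ := exists_nat_ge ‖ξ‖
    have h1 : Tendsto (fun n : ℕ ↦ min (H ξ) n) atTop (𝓝 (min (H ξ) ⊤)) :=
      tendsto_const_nhds.min ENNReal.tendsto_nat_nhds_top
    rw [min_top_right] at h1
    refine h1.congr' ?_
    filter_upwards [eventually_ge_atTop N] with n hn
    have : ξ ∈ Metric.closedBall (0 : Space d) n := by
      rw [mem_closedBall_zero_iff]
      exact hN.trans (by exact_mod_cast hn)
    simp only [Z, indicator_of_mem this]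
  have hl := lintegral_tendsto_of_tendsto_of_monotone (μ := volume)
    (fun n ↦ ((hZm n).pow_const (2 : ℝ)).aemeasurable) (ae_of_all _ hmono) (ae_of_all _ hlim)
  have hl2 : Tendsto (fun n ↦ l2 (Z n)) atTop (𝓝 (l2 H)) :=
    (ENNReal.continuous_rpow_const.tendsto _).comp hl
  exact le_of_tendsto' hl2 hZM

end LinearCapillary

namespace LinearCapillary

open MeasureTheory Filter Topology Set TemperedDistribution
open scoped ENNReal ContDiff SchwartzMap FourierTransform

variable {d : ℕ}

/-! ### The Fourier transform of a product -/

/-- The Fourier transform exchanges translations and modulations. -/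
theorem fourier_translate_apply (ψ : 𝓢(Space d, ℂ)) (η x : Space d) :
    (𝓕 (ψ.compSubConstCLM ℂ (-η))) x = Real.fourierChar (inner ℝ x η) • (𝓕 ψ) x := by
  rw [SchwartzMap.fourier_coe, SchwartzMap.fourier_coe, Real.fourier_eq, Real.fourier_eq,
    ← integral_add_right_eq_self (fun v ↦ Real.fourierChar (-inner ℝ v x) • ψ v) η,
    Circle.smul_def, ← integral_smul]
  refine integral_congr_ae (ae_of_all _ fun y ↦ ?_)
  simp only [SchwartzMap.compSubConstCLM_apply, Circle.smul_def, smul_smul, sub_neg_eq_add]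
  rw [← Circle.coe_mul, ← AddChar.map_add_eq_mul, inner_add_left, real_inner_comm η x]
  congr 3
  ring

/-- The action of `Ṡ_n b` on the function `Ṡ_n a` times a test function. -/
theorem lowFreq_apply_mul {χ : Space d → ℝ} (hχ : IsCutoff χ) {a b : Distr d}
    {V Y : Space d → ℂ} (ha : HasFourier a V) (hb : HasFourier b Y) (n : ℤ)
    {A : Space d → ℂ} (hA : A.HasTemperateGrowth)
    (hAa : hA.toTemperedDistribution volume = lowFreq χ n a) (ψ : 𝓢(Space d, ℂ)) :
    smulLeftCLM ℂ A (lowFreq χ n b) (𝓕 ψ) = ∫ η, ∫ ξ,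
      ψ ξ * ((lowSymbol χ n (ξ - η) : ℂ) * V (ξ - η) * ((lowSymbol χ n η : ℂ) * Y η)) := by
  set Θ : 𝓢(Space d, ℂ) := 𝓕⁻ (SchwartzMap.smulLeftCLM ℂ A (𝓕 ψ)) with hΘ
  have h1 : smulLeftCLM ℂ A (lowFreq χ n b) (𝓕 ψ) = lowFreq χ n b (𝓕 Θ) := by
    rw [smulLeftCLM_apply_apply, hΘ, FourierTransform.fourier_fourierInv_eq]
  have h2 : ∀ η, Θ η = ∫ ξ, ψ ξ * ((lowSymbol χ n (ξ - η) : ℂ) * V (ξ - η)) := by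
    intro η
    have e1 : Θ η = lowFreq χ n a (𝓕 (ψ.compSubConstCLM ℂ (-η))) := by
      rw [← hAa, Function.HasTemperateGrowth.toTemperedDistribution_apply volume hA, hΘ,
        SchwartzMap.fourierInv_coe, Real.fourierInv_eq]
      refine integral_congr_ae (ae_of_all _ fun x ↦ ?_)
      simp only [SchwartzMap.smulLeftCLM_apply_apply hA, fourier_translate_apply, Circle.smul_def,
        smul_eq_mul]
      ring
    rw [e1, lowFreq_apply_fourier, ha.apply_fourier _
      (hasCompactSupport_smulLeftCLM_left _ (hχ.hasCompactSupport_ofReal_lowSymbol n)),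
      ← integral_sub_right_eq_self _ η]
    refine integral_congr_ae (ae_of_all _ fun ξ ↦ ?_)
    simp only [SchwartzMap.smulLeftCLM_apply_apply (hχ.hasTemperateGrowth_lowSymbol n),
      SchwartzMap.compSubConstCLM_apply, smul_eq_mul, sub_neg_eq_add, sub_add_cancel]
    ring
  rw [h1, lowFreq_apply_fourier, hb.apply_fourier _
      (hasCompactSupport_smulLeftCLM_left _ (hχ.hasCompactSupport_ofReal_lowSymbol n))]
  refine integral_congr_ae (ae_of_all _ fun η ↦ ?_)
  simp only [SchwartzMap.smulLeftCLM_apply_apply (hχ.hasTemperateGrowth_lowSymbol n), h2,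
    smul_eq_mul]
  rw [mul_assoc, mul_comm, mul_assoc, ← integral_mul_const]
  refine integral_congr_ae (ae_of_all _ fun ξ ↦ ?_)
  ring

/-- The Fourier transform of a product is a convolution, when the latter converges absolutely and
locally uniformly in mean. -/
theorem HasFourier.product {χ : Space d → ℝ} (hχ : IsCutoff χ) (hd : 0 < d) {a b P : Distr d}
    {V Y : Space d → ℂ} (ha : HasFourier a V) (hb : HasFourier b Y) (hP : IsProduct χ a b P)
    (hfin : ∀ R : ℝ, ∫⁻ ξ in Metric.closedBall 0 R, ∫⁻ η, ‖V (ξ - η)‖ₑ * ‖Y η‖ₑ < ⊤) :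
    HasFourier P (fun ξ ↦ ∫ η, V (ξ - η) * Y η) := by
  have hVm := ha.measurable
  have hYm := hb.measurable
  have hm : Measurable fun p : Space d × Space d ↦ V (p.1 - p.2) * Y p.2 := by fun_prop
  have hnm : Measurable fun ξ ↦ ∫ η, V (ξ - η) * Y η :=
    (hm.stronglyMeasurable.integral_prod_right').measurable
  refine ⟨hnm, locallyIntegrable_of_lintegral_closedBall hnm fun R ↦ ?_, fun ψ hψ ↦ ?_⟩
  · refine (lintegral_mono fun ξ ↦ ?_).trans_lt (hfin R)
    refine (enorm_integral_le_lintegral_enorm _).trans_eq ?_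
    simp only [enorm_mul]
  obtain ⟨A, hA, hAa, hlim⟩ := hP
  have hlim' : Tendsto (fun n : ℕ ↦ smulLeftCLM ℂ (A n) (lowFreq χ (n : ℤ) b) (𝓕 ψ)) atTop
      (𝓝 (P (𝓕 ψ))) :=
    (PointwiseConvergenceCLM.tendsto_iff_forall_tendsto.1 hlim) (𝓕 ψ)
  simp only [fun n : ℕ ↦ lowFreq_apply_mul hχ ha hb n (hA n) (hAa n) ψ] at hlim'
  -- the integrands are dominated, uniformly in the truncation
  set D : Space d × Space d → ℂ := fun p ↦ ψ p.1 * (V (p.1 - p.2) * Y p.2) with hD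
  have hDm : Measurable D := (ψ.continuous.measurable.comp measurable_fst).mul hm
  have hDi : Integrable D (volume.prod volume) := by
    refine ⟨hDm.aestronglyMeasurable, ?_⟩
    obtain ⟨R, hR⟩ := hψ.isCompact.isBounded.subset_closedBall 0
    obtain ⟨M, hM⟩ := ψ.continuous.bounded_above_of_compact_support hψ
    rw [HasFiniteIntegral, lintegral_prod _ hDm.enorm.aemeasurable]
    have : ∀ ξ, ∫⁻ η, ‖D (ξ, η)‖ₑ ≤ (Metric.closedBall (0 : Space d) R).indicator
        (fun ξ ↦ ENNReal.ofReal M * ∫⁻ η, ‖V (ξ - η)‖ₑ * ‖Y η‖ₑ) ξ := by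
      intro ξ
      by_cases hb : ξ ∈ Metric.closedBall 0 R
      · rw [indicator_of_mem hb, ← lintegral_const_mul' _ _ ENNReal.ofReal_ne_top]
        refine lintegral_mono fun η ↦ ?_
        simp only [hD, enorm_mul]
        gcongr
        rw [← ofReal_norm]
        exact ENNReal.ofReal_le_ofReal (hM ξ)
      · have : ψ ξ = 0 := by
          by_contra h
          exact hb (hR (subset_tsupport _ h))
        simp [hD, this]
    refine (lintegral_mono this).trans_lt ?_
    rw [lintegral_indicator measurableSet_closedBall,
      lintegral_const_mul' _ _ ENNReal.ofReal_ne_top]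
    exact ENNReal.mul_lt_top ENNReal.ofReal_lt_top (hfin R)
  let Dn : ℕ → Space d × Space d → ℂ := fun n p ↦
    ((lowSymbol χ n (p.1 - p.2) * lowSymbol χ n p.2 : ℝ) : ℂ) * D p
  have hDnm : ∀ n, AEStronglyMeasurable (Dn n) (volume.prod volume) := fun n ↦ by
    have := (hχ.contDiff_lowSymbol (n : ℤ)).continuous
    have h2 : Measurable fun p : Space d × Space d ↦
        ((lowSymbol χ n (p.1 - p.2) * lowSymbol χ n p.2 : ℝ) : ℂ) := by fun_prop
    exact (h2.mul hDm).aestronglyMeasurable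
  have hDnb : ∀ n p, ‖Dn n p‖ ≤ ‖D p‖ := fun n p ↦ by
    simp only [Dn]
    rw [norm_mul, Complex.norm_real, Real.norm_eq_abs]
    refine mul_le_of_le_one_left (norm_nonneg _) ?_
    rw [abs_of_nonneg (mul_nonneg (hχ.lowSymbol_nonneg hd _ _) (hχ.lowSymbol_nonneg hd _ _))]
    exact mul_le_one₀ (hχ.lowSymbol_le_one _ _) (hχ.lowSymbol_nonneg hd _ _)
      (hχ.lowSymbol_le_one _ _)
  have hlim2 : Tendsto (fun n ↦ ∫ p, Dn n p ∂(volume.prod volume)) atTop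
      (𝓝 (∫ p, D p ∂(volume.prod volume))) := by
    refine tendsto_integral_of_dominated_convergence (fun p ↦ ‖D p‖) hDnm hDi.norm
      (fun n ↦ ae_of_all _ (hDnb n)) (ae_of_all _ fun p ↦ ?_)
    refine tendsto_const_nhds.congr' ?_
    obtain ⟨N₁, h1⟩ := hχ.exists_lowSymbol_eq_one (freq (p.1 - p.2))
    obtain ⟨N₂, h2⟩ := hχ.exists_lowSymbol_eq_one (freq p.2)
    filter_upwards [eventually_ge_atTop N₁, eventually_ge_atTop N₂] with n hn1 hn2
    simp [Dn, h1 n hn1 _ le_rfl, h2 n hn2 _ le_rfl]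
  have hDni : ∀ n, Integrable (Dn n) (volume.prod volume) := fun n ↦
    hDi.norm.mono' (hDnm n) (ae_of_all _ (hDnb n))
  have e1 : ∀ n : ℕ, ∫ p, Dn n p ∂(volume.prod volume) = ∫ η, ∫ ξ,
      ψ ξ * ((lowSymbol χ n (ξ - η) : ℂ) * V (ξ - η) * ((lowSymbol χ n η : ℂ) * Y η)) := fun n ↦ by
    rw [integral_prod_symm _ (hDni n)]
    refine integral_congr_ae (ae_of_all _ fun η ↦ integral_congr_ae (ae_of_all _ fun ξ ↦ ?_))
    simp only [Dn, hD]
    push_cast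
    ring
  have e2 : ∫ p, D p ∂(volume.prod volume) = ∫ ξ, ψ ξ * ∫ η, V (ξ - η) * Y η := by
    rw [integral_prod _ hDi]
    refine integral_congr_ae (ae_of_all _ fun ξ ↦ ?_)
    simp only [hD]
    rw [integral_const_mul]
  rw [← e2]
  simp only [e1] at hlim2
  exact tendsto_nhds_unique hlim' hlim2

end LinearCapillary

namespace LinearCapillary

open MeasureTheory Filter Topology Set TemperedDistribution
open scoped ENNReal ContDiff SchwartzMap FourierTransform ComplexConjugate

variable {d : ℕ}

/-! ### Real distributions -/

/-- The Fourier transform of a Hermitian function is real. -/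
theorem fourier_im_eq_zero {ψ : 𝓢(Space d, ℂ)} (h : ∀ η, conj (ψ (-η)) = ψ η) (x : Space d) :
    ((𝓕 ψ) x).im = 0 := by
  rw [← Complex.conj_eq_iff_im, SchwartzMap.fourier_coe, Real.fourier_eq, ← integral_conj,
    ← integral_neg_eq_self]
  refine integral_congr_ae (ae_of_all _ fun y ↦ ?_)
  simp only [Circle.smul_def, smul_eq_mul, map_mul, h, inner_neg_left, neg_neg]
  rw [← Circle.coe_inv_eq_conj, ← AddChar.map_neg_eq_inv]

/-- The Fourier transform of a real distribution is Hermitian. -/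
theorem HasFourier.ae_conj_neg {T : Distr d} {g : Space d → ℂ} (h : HasFourier T g)
    (hT : IsRealDistr T) : ∀ᵐ η, g (-η) = conj (g η) := by
  have hlc : LocallyIntegrable fun η ↦ conj (g (-η)) := by
    refine locallyIntegrable_of_lintegral_closedBall (by have := h.measurable; fun_prop) fun R ↦ ?_
    have h1 : ∫⁻ η in Metric.closedBall 0 R, ‖g η‖ₑ < ⊤ :=
      ((h.locallyIntegrable.integrableOn_isCompact (isCompact_closedBall 0 R))).2
    rw [← lintegral_indicator measurableSet_closedBall] at h1 ⊢
    rw [← lintegral_neg_eq_self] at h1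
    refine lt_of_le_of_lt (lintegral_mono fun η ↦ ?_) h1
    by_cases hη : η ∈ Metric.closedBall (0 : Space d) R
    · have : -η ∈ Metric.closedBall (0 : Space d) R := by simpa using hη
      rw [indicator_of_mem hη, indicator_of_mem this]
      simp
    · rw [indicator_of_notMem hη]; exact zero_le
  have key : ∀ ψ : 𝓢(Space d, ℂ), HasCompactSupport ψ →
      ∫ η, ψ η * g η = ∫ η, ψ η * conj (g (-η)) := by
    intro ψ hψ
    have hψ'c : HasCompactSupport fun η ↦ conj (ψ (-η)) := by
      have := hψ.comp_homeomorph (Homeomorph.neg (Space d))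
      exact this.comp_left (g := fun z : ℂ ↦ conj z) (map_zero _)
    have hψ's : ContDiff ℝ ∞ fun η ↦ conj (ψ (-η)) :=
      Complex.conjCLE.contDiff.comp (ψ.smooth'.comp contDiff_neg)
    obtain ⟨ψ', hψ'a⟩ : ∃ ψ' : 𝓢(Space d, ℂ), ∀ η, ψ' η = conj (ψ (-η)) :=
      ⟨hψ'c.toSchwartzMap hψ's, fun η ↦ rfl⟩
    have hψ'd : HasCompactSupport ψ' := by rwa [show ⇑ψ' = _ from funext hψ'a]
    -- `ψ` is split into the Hermitian functions `ψ + ψ'` and `i (ψ - ψ')`, on whose Fourier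
    -- transforms a real distribution takes real values.
    have s1 : ∀ η, conj ((ψ + ψ') (-η)) = (ψ + ψ') η := fun η ↦ by
      rw [add_apply, add_apply, hψ'a, hψ'a, map_add, neg_neg,
        Complex.conj_conj, add_comm]
    have s2 : ∀ η, conj ((Complex.I • (ψ - ψ')) (-η)) = (Complex.I • (ψ - ψ')) η := fun η ↦ by
      rw [smul_apply, smul_apply, sub_apply,
        sub_apply, hψ'a, hψ'a, smul_eq_mul, smul_eq_mul, map_mul, map_sub, neg_neg,
        Complex.conj_conj, Complex.conj_I]
      ring
    have r1 : (T (𝓕 (ψ + ψ'))).im = 0 := hT (𝓕 (ψ + ψ')) (fourier_im_eq_zero s1)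
    have r2 : (T (𝓕 (Complex.I • (ψ - ψ')))).im = 0 :=
      hT (𝓕 (Complex.I • (ψ - ψ'))) (fourier_im_eq_zero s2)
    have e : ∀ θ : 𝓢(Space d, ℂ), 𝓕 θ = FourierTransform.fourierCLM ℂ 𝓢(Space d, ℂ) θ := fun θ ↦ by
      simp
    rw [e, map_add, map_add, ← e, ← e, h.apply_fourier _ hψ, h.apply_fourier _ hψ'd] at r1
    rw [e, map_smul, map_smul, map_sub, map_sub, ← e, ← e, h.apply_fourier _ hψ,
      h.apply_fourier _ hψ'd] at r2
    have e3 : ∫ η, ψ η * g η = conj (∫ η, ψ' η * g η) := by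
      apply Complex.ext
      · simp at r2 ⊢; linarith
      · simp at r1 ⊢; linarith
    rw [e3, ← integral_conj, ← integral_neg_eq_self]
    refine integral_congr_ae (ae_of_all _ fun η ↦ ?_)
    simp [hψ'a]
  have := ae_eq_of_integral_schwartz_eq h.locallyIntegrable hlc key
  have h2 := (Measure.measurePreserving_neg (volume : Measure (Space d))).quasiMeasurePreserving.ae this
  filter_upwards [h2] with η hη
  simpa using hη

/-! ### The convection term on the Fourier side -/

/-- The Fourier transform of `v · ∇ f`, for `V` and `X` the Fourier transforms of `v` and `f`. -/
noncomputable def convFourier (V : Fin d → Space d → ℂ) (X : Space d → ℂ) (ξ : Space d) : ℂ :=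
  ∑ i, ∫ η, V i (ξ - η) * ((Complex.I * ((2 * Real.pi * η i : ℝ) : ℂ)) * X η)

theorem abs_coord_le_freq (η : Space d) (i : Fin d) : |2 * Real.pi * η i| ≤ freq η := by
  rw [freq_eq, abs_mul, abs_of_pos (by positivity)]
  gcongr
  exact PiLp.norm_apply_le η i

theorem enorm_I_coord_le (η : Space d) (i : Fin d) :
    ‖Complex.I * ((2 * Real.pi * η i : ℝ) : ℂ)‖ₑ ≤ ENNReal.ofReal (freq η) := by
  rw [← ofReal_norm, norm_mul, Complex.norm_I, one_mul, Complex.norm_real]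
  exact ENNReal.ofReal_le_ofReal (abs_coord_le_freq η i)

/-- The total size of a vector field. -/
noncomputable def vecSize (V : Fin d → Space d → ℂ) (ζ : Space d) : ℝ≥0∞ := ∑ i, ‖V i ζ‖ₑ

theorem measurable_vecSize {V : Fin d → Space d → ℂ} (hV : ∀ i, Measurable (V i)) :
    Measurable (vecSize V) := by unfold vecSize; fun_prop

theorem IsCutoff.blockNorm_freq_le {χ : Space d → ℝ} (hχ : IsCutoff χ) (l : ℤ)
    (f : Space d → ℝ≥0∞) :
    blockNorm χ l (fun η ↦ ENNReal.ofReal (freq η) * f η) ≤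
      ENNReal.ofReal (8 / 3) * (dyadicWeight 1 l * blockNorm χ l f) := by
  rw [← mul_assoc, dyadicWeight_one, ← ENNReal.ofReal_mul (by norm_num),
    ← blockNorm_const_mul l ENNReal.ofReal_ne_top]
  refine l2_mono (ae_of_all _ fun η ↦ ?_)
  by_cases h : η ∈ annulus d l
  · change _ * (ENNReal.ofReal (freq η) * f η) ≤ _ * (ENNReal.ofReal (8 / 3 * 2 ^ l) * f η)
    gcongr
    exact h.2
  · simp [hχ.blockSymbol_eq_zero h]

theorem lt_top_of_mul_lt_top_left {c a : ℝ≥0∞} (hc : c ≠ 0) (h : c * a < ⊤) :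
    a < ⊤ := by
  by_contra ha
  rw [not_lt_top_iff.1 ha, ENNReal.mul_top hc] at h
  exact h.ne rfl

section Conv

variable {χ : Space d → ℝ} {σ : ℝ}

/-- Convolution maps `Ḃ^{d/2} × Ḃ^σ` to `Ḃ^σ`, for `-d/2 < σ ≤ d/2`. -/
theorem exists_tsum_l2_conv_le (hχ : IsCutoff χ) (hd : 0 < d) (h1 : -((d : ℝ) / 2) < σ)
    (h2 : σ ≤ (d : ℝ) / 2) : ∃ K : ℝ≥0∞, K ≠ ⊤ ∧ ∀ W Y : Space d → ℝ≥0∞, Measurable W →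
    Measurable Y → ∑' l, dyadicWeight σ l *
      l2 (fun ξ ↦ (annulus d l).indicator 1 ξ * ∫⁻ η, W (ξ - η) * Y η) ≤
    K * ((∑' j, dyadicWeight ((d : ℝ) / 2) j * blockNorm χ j W) *
      ∑' j, dyadicWeight σ j * blockNorm χ j Y) := by
  obtain ⟨K, hK, hk⟩ := exists_triForm_indicator_le hχ hd
  obtain ⟨K', hK', hk'⟩ := exists_tsum_paraSum_le h1 h2
  refine ⟨K * K', ENNReal.mul_ne_top hK hK', fun W Y hW hY ↦ ?_⟩
  have hm : Measurable fun ξ ↦ ∫⁻ η, W (ξ - η) * Y η :=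
    Measurable.lintegral_prod_right' (f := fun p : Space d × Space d ↦ W (p.1 - p.2) * Y p.2)
      (by fun_prop)
  have key : ∀ l, l2 (fun ξ ↦ (annulus d l).indicator 1 ξ * ∫⁻ η, W (ξ - η) * Y η) ≤
      K * paraSum d (fun j ↦ blockNorm χ j W) (fun m ↦ blockNorm χ m Y) l := by
    intro l
    have h1l : Measurable ((annulus d l).indicator (1 : Space d → ℝ≥0∞)) :=
      measurable_one.indicator (measurableSet_annulus l)
    refine l2_le_of_forall_lintegral_mul_le (h1l.mul hm) fun Z hZ ↦ ?_
    rw [mul_left_comm]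
    refine le_trans (le_trans (le_of_eq ?_) le_self_add) (hk l Z W Y hZ hW hY)
    refine lintegral_congr fun ξ ↦ ?_
    change Z ξ * ((annulus d l).indicator 1 ξ * ∫⁻ η, W (ξ - η) * Y η) =
      ∫⁻ η, Z ξ * (annulus d l).indicator 1 ξ * (W (ξ - η) * Y η)
    rw [← mul_assoc, lintegral_const_mul _ (by fun_prop)]
  calc _ ≤ ∑' l, K * (dyadicWeight σ l *
        paraSum d (fun j ↦ blockNorm χ j W) (fun m ↦ blockNorm χ m Y) l) := by
        refine ENNReal.tsum_le_tsum fun l ↦ ?_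
        rw [mul_left_comm K]
        gcongr
        exact key l
    _ ≤ K * (K' * _) := by
        rw [ENNReal.tsum_mul_left]
        gcongr
        exact hk' _ _
    _ = _ := (mul_assoc _ _ _).symm

/-- A function of finite Besov norm, of regularity at most `d/2`, is integrable near the origin. -/
theorem lintegral_closedBall_lt_top_of_tsum_l2 (hd : 0 < d) (hχ : IsCutoff χ)
    (h2 : σ ≤ (d : ℝ) / 2) {H : Space d → ℝ≥0∞} (hH : Measurable H)
    (hf : ∑' l, dyadicWeight σ l * l2 (fun ξ ↦ (annulus d l).indicator 1 ξ * H ξ) < ⊤) (R : ℝ) :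
    ∫⁻ ξ in Metric.closedBall 0 R, H ξ < ⊤ := by
  have h1l : ∀ l, Measurable ((annulus d l).indicator (1 : Space d → ℝ≥0∞)) := fun l ↦
    measurable_one.indicator (measurableSet_annulus l)
  refine lt_of_le_of_lt ?_ (tsum_lintegral_annulus_closedBall_lt_top h2
    (fun l ↦ (h1l l).mul hH) R hf)
  simp only [← lintegral_indicator (measurableSet_closedBall.inter (measurableSet_annulus _))]
  rw [← lintegral_indicator measurableSet_closedBall, ← lintegral_tsum fun l ↦
    (((h1l l).mul hH).indicator
      (measurableSet_closedBall.inter (measurableSet_annulus l))).aemeasurable]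
  refine lintegral_mono_ae ?_
  filter_upwards [ae_ne_zero hd] with ξ hξ
  by_cases hb : ξ ∈ Metric.closedBall (0 : Space d) R
  · rw [indicator_of_mem hb]
    obtain ⟨l, hl⟩ : ∃ l : ℤ, ξ ∈ annulus d l := by
      by_contra hne
      push Not at hne
      have := hχ.one_le_tsum_blockSymbol hξ
      simp [fun l ↦ hχ.blockSymbol_eq_zero (hne l)] at this
    refine le_trans (le_of_eq ?_) (ENNReal.le_tsum l)
    rw [indicator_of_mem (mem_inter hb hl)]
    simp [hl]
  · rw [indicator_of_notMem hb]; exact zero_le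

/-- The weight `M + |ζ|` costs the norm of order `d/2`, times `M`, and the norm of order `d/2 +
1`. -/
theorem tsum_blockNorm_weight_vecSize_le (hχ : IsCutoff χ) {V : Fin d → Space d → ℂ}
    (hV : ∀ i, Measurable (V i)) (M : ℝ) :
    ∑' j, dyadicWeight ((d : ℝ) / 2) j *
      blockNorm χ j (fun ζ ↦ (ENNReal.ofReal M + ENNReal.ofReal (freq ζ)) * vecSize V ζ) ≤
    ∑ i, (ENNReal.ofReal M *
        ∑' j, dyadicWeight ((d : ℝ) / 2) j * blockNorm χ j (fun η ↦ ‖V i η‖ₑ) +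
      ENNReal.ofReal (8 / 3) *
        ∑' j, dyadicWeight ((d : ℝ) / 2 + 1) j * blockNorm χ j (fun η ↦ ‖V i η‖ₑ)) := by
  have hmf : Measurable fun ζ : Space d ↦ ENNReal.ofReal (freq ζ) :=
    measurable_freq.ennreal_ofReal
  have key : ∀ j, dyadicWeight ((d : ℝ) / 2) j *
      blockNorm χ j (fun ζ ↦ (ENNReal.ofReal M + ENNReal.ofReal (freq ζ)) * vecSize V ζ) ≤
      ∑ i, (ENNReal.ofReal M * (dyadicWeight ((d : ℝ) / 2) j * blockNorm χ j (fun η ↦ ‖V i η‖ₑ)) +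
        ENNReal.ofReal (8 / 3) *
          (dyadicWeight ((d : ℝ) / 2 + 1) j * blockNorm χ j (fun η ↦ ‖V i η‖ₑ))) := by
    intro j
    have e1 : blockNorm χ j
        (fun ζ ↦ (ENNReal.ofReal M + ENNReal.ofReal (freq ζ)) * vecSize V ζ) ≤
        ∑ i, (ENNReal.ofReal M * blockNorm χ j (fun η ↦ ‖V i η‖ₑ) +
          ENNReal.ofReal (8 / 3) * (dyadicWeight 1 j * blockNorm χ j (fun η ↦ ‖V i η‖ₑ))) := by
      simp only [vecSize, Finset.mul_sum, add_mul]
      refine (blockNorm_sum_le hχ j _ fun i ↦ ?_).trans (Finset.sum_le_sum fun i _ ↦ ?_)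
      · have := hV i; fun_prop
      · refine (blockNorm_add_le hχ j ?_ ?_).trans ?_
        · have := hV i; fun_prop
        · have := hV i; fun_prop
        · rw [blockNorm_const_mul j ENNReal.ofReal_ne_top]
          gcongr
          exact hχ.blockNorm_freq_le j _
    refine (mul_le_mul_right e1 _).trans (le_of_eq ?_)
    rw [Finset.mul_sum]
    refine Finset.sum_congr rfl fun i _ ↦ ?_
    rw [dyadicWeight_add]
    ring
  refine (ENNReal.tsum_le_tsum key).trans (le_of_eq ?_)
  rw [Summable.tsum_finsetSum fun _ _ ↦ ENNReal.summable]
  refine Finset.sum_congr rfl fun i _ ↦ ?_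
  rw [ENNReal.tsum_add, ENNReal.tsum_mul_left, ENNReal.tsum_mul_left]

/-- For a bounded output frequency the derivative `|η| ≤ |ξ| + |ξ - η|` falls on the coefficient,
so that no derivative of `X` is needed. -/
theorem enorm_conv_integrand_le {V : Fin d → Space d → ℂ} {X : Space d → ℂ} {M : ℝ}
    {ξ : Space d} (hξ : freq ξ ≤ M) (η : Space d) (i : Fin d) :
    ‖V i (ξ - η)‖ₑ * ‖(Complex.I * ((2 * Real.pi * η i : ℝ) : ℂ)) * X η‖ₑ ≤
      (ENNReal.ofReal M + ENNReal.ofReal (freq (ξ - η))) * ‖V i (ξ - η)‖ₑ * ‖X η‖ₑ := by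
  rw [enorm_mul, mul_left_comm, ← mul_assoc]
  gcongr
  refine (enorm_I_coord_le η i).trans ?_
  rw [← ENNReal.ofReal_add ((freq_nonneg ξ).trans hξ) (freq_nonneg _)]
  refine ENNReal.ofReal_le_ofReal ?_
  have := freq_le_add_sub η ξ
  rw [freq_sub_comm] at this
  linarith

variable {V : Fin d → Space d → ℂ} {X : Space d → ℂ}

theorem lintegral_conv_le {M : ℝ} {ξ : Space d} (hξ : freq ξ ≤ M) (i : Fin d) :
    ∫⁻ η, ‖V i (ξ - η)‖ₑ * ‖(Complex.I * ((2 * Real.pi * η i : ℝ) : ℂ)) * X η‖ₑ ≤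
      ∫⁻ η, (ENNReal.ofReal M + ENNReal.ofReal (freq (ξ - η))) * vecSize V (ξ - η) * ‖X η‖ₑ := by
  refine lintegral_mono fun η ↦ (enorm_conv_integrand_le hξ η i).trans ?_
  gcongr
  exact Finset.single_le_sum (f := fun i ↦ ‖V i (ξ - η)‖ₑ) (fun _ _ ↦ zero_le)
    (Finset.mem_univ i)

theorem measurable_convFourier (hV : ∀ i, Measurable (V i)) (hX : Measurable X) :
    Measurable (convFourier V X) := by
  refine Finset.measurable_fun_sum _ fun i _ ↦ ?_
  have := hV i
  have hm : Measurable fun p : Space d × Space d ↦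
      V i (p.1 - p.2) * ((Complex.I * ((2 * Real.pi * p.2 i : ℝ) : ℂ)) * X p.2) := by fun_prop
  exact (hm.stronglyMeasurable.integral_prod_right').measurable

/-- The convection term: the absolute convergence of the convolution, and a bound of its dyadic
blocks, which is rough in its dependence on the block. -/
theorem exists_convFourier_bound (hχ : IsCutoff χ) (hd : 0 < d) (h1 : -((d : ℝ) / 2) < σ)
    (h2 : σ ≤ (d : ℝ) / 2) : ∃ K : ℝ≥0∞, K ≠ ⊤ ∧ ∀ (V : Fin d → Space d → ℂ) (X : Space d → ℂ),
    (∀ i, Measurable (V i)) → Measurable X →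
    (∀ i, ∑' j, dyadicWeight ((d : ℝ) / 2) j * blockNorm χ j (fun η ↦ ‖V i η‖ₑ) < ⊤) →
    (∀ i, ∑' j, dyadicWeight ((d : ℝ) / 2 + 1) j * blockNorm χ j (fun η ↦ ‖V i η‖ₑ) < ⊤) →
    ∑' j, dyadicWeight σ j * blockNorm χ j (fun η ↦ ‖X η‖ₑ) < ⊤ →
    (∀ i, ∀ R : ℝ, ∫⁻ ξ in Metric.closedBall 0 R, ∫⁻ η,
      ‖V i (ξ - η)‖ₑ * ‖(Complex.I * ((2 * Real.pi * η i : ℝ) : ℂ)) * X η‖ₑ < ⊤) ∧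
    ∀ l, dyadicWeight σ l * blockNorm χ l (fun ξ ↦ ‖convFourier V X ξ‖ₑ) ≤
      K * (∑ i, (dyadicWeight 1 l *
          ∑' j, dyadicWeight ((d : ℝ) / 2) j * blockNorm χ j (fun η ↦ ‖V i η‖ₑ) +
        ∑' j, dyadicWeight ((d : ℝ) / 2 + 1) j * blockNorm χ j (fun η ↦ ‖V i η‖ₑ))) *
        ∑' j, dyadicWeight σ j * blockNorm χ j (fun η ↦ ‖X η‖ₑ) := by
  obtain ⟨K, hK, hk⟩ := exists_tsum_l2_conv_le (χ := χ) hχ hd h1 h2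
  refine ⟨d * (K * ENNReal.ofReal (8 / 3)),
    ENNReal.mul_ne_top (by simp) (ENNReal.mul_ne_top hK ENNReal.ofReal_ne_top),
    fun V X hV hX hf hf' hXf ↦ ?_⟩
  have hmf : Measurable fun ζ : Space d ↦ ENNReal.ofReal (freq ζ) :=
    measurable_freq.ennreal_ofReal
  have hmf' : Measurable fun p : Space d × Space d ↦ ENNReal.ofReal (freq (p.1 - p.2)) :=
    hmf.comp (measurable_fst.sub measurable_snd)
  have hA := measurable_vecSize hV
  have hW : ∀ M : ℝ, Measurable fun ζ : Space d ↦
      (ENNReal.ofReal M + ENNReal.ofReal (freq ζ)) * vecSize V ζ := fun M ↦ by fun_prop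
  have hs' := fun M : ℝ ↦ (hk _ _ (hW M) hX.enorm).trans
    (mul_le_mul_right (mul_le_mul_left (tsum_blockNorm_weight_vecSize_le hχ hV M) _) _)
  have hs := fun M : ℝ ↦ (hs' M).trans_lt (ENNReal.mul_lt_top hK.lt_top (ENNReal.mul_lt_top
    (ENNReal.sum_lt_top.2 fun i _ ↦ ENNReal.add_lt_top.2
      ⟨ENNReal.mul_lt_top ENNReal.ofReal_lt_top (hf i),
        ENNReal.mul_lt_top ENNReal.ofReal_lt_top (hf' i)⟩) hXf))
  refine ⟨fun i R ↦ ?_, fun l ↦ ?_⟩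
  · have hm : Measurable fun ξ ↦ ∫⁻ η, (ENNReal.ofReal (2 * Real.pi * R) +
        ENNReal.ofReal (freq (ξ - η))) * vecSize V (ξ - η) * ‖X η‖ₑ :=
      Measurable.lintegral_prod_right' (f := fun p : Space d × Space d ↦
        (ENNReal.ofReal (2 * Real.pi * R) +
        ENNReal.ofReal (freq (p.1 - p.2))) * vecSize V (p.1 - p.2) * ‖X p.2‖ₑ) (by fun_prop)
    refine lt_of_le_of_lt (setLIntegral_mono' measurableSet_closedBall fun ξ hξ ↦ ?_)
      (lintegral_closedBall_lt_top_of_tsum_l2 hd hχ h2 hm (hs (2 * Real.pi * R)) R)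
    rw [mem_closedBall_zero_iff] at hξ
    exact lintegral_conv_le (by rw [freq_eq]; gcongr) i
  · have hl := (ENNReal.le_tsum l).trans (hs' (8 / 3 * 2 ^ l))
    have e : ∀ a b : Fin d → ℝ≥0∞, ∑ i, (ENNReal.ofReal (8 / 3 * 2 ^ l) * a i +
        ENNReal.ofReal (8 / 3) * b i) =
        ENNReal.ofReal (8 / 3) * ∑ i, (dyadicWeight 1 l * a i + b i) := fun a b ↦ by
      rw [Finset.mul_sum, dyadicWeight_one, ENNReal.ofReal_mul (by norm_num)]
      exact Finset.sum_congr rfl fun i _ ↦ by ring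
    rw [e] at hl
    refine le_trans ?_ ((mul_le_mul_right hl (d : ℝ≥0∞)).trans (le_of_eq (by ring)))
    rw [mul_left_comm, ← l2_const_mul (by simp)]
    gcongr
    refine l2_mono (ae_of_all _ fun ξ ↦ ?_)
    by_cases h : ξ ∈ annulus d l
    · simp only [indicator_of_mem h, Pi.one_apply, one_mul]
      refine (mul_le_of_le_one_left zero_le
        (ENNReal.ofReal_le_one.2 (hχ.blockSymbol_le_one hd l ξ))).trans ?_
      refine (enorm_sum_le _ _).trans ?_
      refine (Finset.sum_le_card_nsmul _ _ _ fun i _ ↦ ?_).trans_eq (by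
        rw [Finset.card_univ, Fintype.card_fin, nsmul_eq_mul])
      refine (enorm_integral_le_lintegral_enorm _).trans ?_
      simp only [enorm_mul (V i _)]
      exact lintegral_conv_le h.2 i
    · simp [hχ.blockSymbol_eq_zero h]

theorem HasFourier.convection (hχ : IsCutoff χ) (hd : 0 < d) {v : Fin d → Distr d} {f c : Distr d}
    (hv : ∀ i, HasFourier (v i) (V i)) (hX : HasFourier f X) (hc : IsConvection χ v f c)
    (hfin : ∀ i, ∀ R : ℝ, ∫⁻ ξ in Metric.closedBall 0 R, ∫⁻ η,
      ‖V i (ξ - η)‖ₑ * ‖(Complex.I * ((2 * Real.pi * η i : ℝ) : ℂ)) * X η‖ₑ < ⊤) :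
    HasFourier c (convFourier V X) := by
  obtain ⟨P, hP, rfl⟩ := hc
  exact HasFourier.sum _ fun i _ ↦ HasFourier.product hχ hd (hv i) (hX.partialD i) (hP i) (hfin i)

end Conv

end LinearCapillary

namespace LinearCapillary

open MeasureTheory Filter Topology Set
open scoped ENNReal ComplexConjugate

variable {d : ℕ}

/-! ### The convection term in the energy balance of a dyadic block -/

theorem triForm_eq_lintegral_prod {A B C : Space d → ℝ≥0∞} (hA : Measurable A) (hB : Measurable B)
    (hC : Measurable C) :
    triForm A B C = ∫⁻ p : Space d × Space d, A p.1 * (B (p.1 - p.2) * C p.2) ∂(volume.prod volume)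
    := by
  rw [lintegral_prod _ (by fun_prop), triForm]

/-- The weight `|ξ| |V(ξ)|`. -/
noncomputable def gradSize (V : Fin d → Space d → ℂ) (ζ : Space d) : ℝ≥0∞ :=
  ENNReal.ofReal (freq ζ) * vecSize V ζ

theorem measurable_gradSize {V : Fin d → Space d → ℂ} (hV : ∀ i, Measurable (V i)) :
    Measurable (gradSize V) :=
  measurable_freq.ennreal_ofReal.mul (measurable_vecSize hV)

/-- The symbol of `V · ∇`, as a kernel on the Fourier side. -/
noncomputable def convKernel (V : Fin d → Space d → ℂ) (p : Space d × Space d) : ℂ :=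
  ∑ i, V i (p.1 - p.2) * (Complex.I * ((2 * Real.pi * p.2 i : ℝ) : ℂ))

theorem measurable_convKernel {V : Fin d → Space d → ℂ} (hV : ∀ i, Measurable (V i)) :
    Measurable (convKernel V) := by
  unfold convKernel
  refine Finset.measurable_fun_sum _ fun i _ ↦ ?_
  have := hV i
  fun_prop

theorem enorm_convKernel_le (V : Fin d → Space d → ℂ) (p : Space d × Space d) :
    ‖convKernel V p‖ₑ ≤ vecSize V (p.1 - p.2) * ENNReal.ofReal (freq p.2) := by
  refine (enorm_sum_le _ _).trans ?_
  rw [vecSize, Finset.sum_mul]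
  refine Finset.sum_le_sum fun i _ ↦ ?_
  rw [enorm_mul]
  gcongr
  exact enorm_I_coord_le _ _

/-- The antisymmetry of `V · ∇` up to `div V`, for real `V`. -/
theorem ae_enorm_convKernel_add_conj_le {V : Fin d → Space d → ℂ}
    (hVr : ∀ i, ∀ᵐ η, V i (-η) = conj (V i η)) :
    ∀ᵐ p : Space d × Space d ∂(volume.prod volume),
      ‖convKernel V p + conj (convKernel V p.swap)‖ₑ ≤ gradSize V (p.1 - p.2) := by
  have h1 : ∀ i, ∀ᵐ p : Space d × Space d ∂(volume.prod volume),
      V i (-(p.1 - p.2)) = conj (V i (p.1 - p.2)) := fun i ↦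
    (quasiMeasurePreserving_sub_of_right_invariant volume volume).ae (hVr i)
  filter_upwards [ae_all_iff.2 h1] with p hp
  have e : convKernel V p + conj (convKernel V p.swap) =
      ∑ i, V i (p.1 - p.2) * -(Complex.I * ((2 * Real.pi * (p.1 - p.2) i : ℝ) : ℂ)) := by
    rw [convKernel, convKernel, map_sum, ← Finset.sum_add_distrib]
    refine Finset.sum_congr rfl fun i _ ↦ ?_
    have := hp i
    rw [neg_sub] at this
    simp only [Prod.fst_swap, Prod.snd_swap, map_mul, this, Complex.conj_conj, Complex.conj_I,
      Complex.conj_ofReal, PiLp.sub_apply]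
    push_cast
    ring
  rw [e, gradSize, vecSize, Finset.mul_sum]
  refine (enorm_sum_le _ _).trans (Finset.sum_le_sum fun i _ ↦ ?_)
  rw [enorm_mul, enorm_neg, mul_comm]
  gcongr
  exact enorm_I_coord_le _ _

/-- The energy estimate for the convection term. The unknowns `X a` are combined with coefficients
`α a`, whose growth and Lipschitz constants are compared to the weights `m a`. The principal part
of `V · ∇` is antisymmetric, and the commutators with the symbols cost one derivative of `V`
only. -/
theorem exists_convection_energy_le {χ : Space d → ℝ} (hχ : IsCutoff χ) (hd : 0 < d) {L : ℝ}
    (hL : 0 ≤ L) : ∃ K : ℝ≥0∞, K ≠ ⊤ ∧ ∀ (l : ℤ) (ι : Type) [Fintype ι] (V : Fin d → Space d → ℂ)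
    (X : ι → Space d → ℂ) (m : ι → Space d → ℝ) (α : ι → Space d → ℂ) (c : Space d → ℂ)
    (Y : Space d → ℝ≥0∞),
    (∀ i, Measurable (V i)) → (∀ i, ∀ᵐ η, V i (-η) = conj (V i η)) → (∀ a, Measurable (X a)) →
    (∀ a, Measurable (m a)) → (∀ a, Measurable (α a)) → (∀ a η, ‖α a η‖ ≤ L * m a η) →
    (∀ a ξ η, freq η * ‖α a ξ - α a η‖ ≤ L * freq (ξ - η) * m a η) →
    (∀ ξ, c ξ = blockSymbol χ l ξ * ∑ a, α a ξ * X a ξ) →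
    (∀ ξ, Y ξ = ∑ a, ENNReal.ofReal (m a ξ) * ‖X a ξ‖ₑ) →
    (∀ a i, ∀ R : ℝ, ∫⁻ ξ in Metric.closedBall 0 R, ∫⁻ η,
      ‖V i (ξ - η)‖ₑ * ‖(Complex.I * ((2 * Real.pi * η i : ℝ) : ℂ)) * X a η‖ₑ < ⊤) →
    triForm (fun ξ ↦ ‖c ξ‖ₑ) (vecSize V) (fun ξ ↦ ‖c ξ‖ₑ) < ⊤ →
    l2 (fun ξ ↦ ‖c ξ‖ₑ) *
      paraSum d (fun j ↦ blockNorm χ j (gradSize V)) (fun j ↦ blockNorm χ j Y) l < ⊤ →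
    ‖(∫ ξ, conj (c ξ) *
        (blockSymbol χ l ξ * ∑ a, α a ξ * convFourier V (X a) ξ)).re‖ₑ ≤
      K * (l2 (fun ξ ↦ ‖c ξ‖ₑ) *
        paraSum d (fun j ↦ blockNorm χ j (gradSize V)) (fun j ↦ blockNorm χ j Y) l) := by
  obtain ⟨C, hC, hcomm⟩ := hχ.exists_commutator_bound hd
  obtain ⟨K, hK, hk⟩ := exists_triForm_indicator_le hχ hd
  set k2 : ℝ := (C + 1) * L with hk2
  refine ⟨(ENNReal.ofReal L + ENNReal.ofReal k2) * K,
    ENNReal.mul_ne_top (by simp) hK, ?_⟩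
  intro l ι _ V X m α c Y hV hVr hX hm hα hαL hαd hc hY hfin hA hP
  have hφm : Measurable fun η ↦ (blockSymbol χ l η : ℂ) :=
    (Complex.continuous_ofReal.comp (hχ.continuous_blockSymbol l)).measurable
  have hcm : Measurable c := by
    rw [show c = _ from funext hc]; fun_prop
  have hYm : Measurable Y := by
    rw [show Y = _ from funext hY]; fun_prop
  have h1l : Measurable ((annulus d l).indicator (1 : Space d → ℝ≥0∞)) :=
    measurable_one.indicator (measurableSet_annulus l)
  have hWm := measurable_gradSize hV
  have hSm := measurable_convKernel hV
  have hφ1 : ∀ ξ, blockSymbol χ l ξ ≤ (annulus d l).indicator 1 ξ := fun ξ ↦ by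
    by_cases h : ξ ∈ annulus d l
    · simpa [h] using hχ.blockSymbol_le_one hd l ξ
    · simp [h, hχ.blockSymbol_eq_zero h]
  have hi0 : ∀ ξ, (0 : ℝ) ≤ (annulus d l).indicator 1 ξ := fun ξ ↦
    indicator_nonneg (fun _ _ ↦ zero_le_one) ξ
  have hi1 : ∀ ξ, ENNReal.ofReal ((annulus d l).indicator 1 ξ) = (annulus d l).indicator 1 ξ :=
    fun ξ ↦ by by_cases h : ξ ∈ annulus d l <;> simp [h]
  have hmL : ∀ a η, 0 ≤ L * m a η := fun a η ↦ (norm_nonneg _).trans (hαL a η)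
  set B := l2 (fun ξ ↦ ‖c ξ‖ₑ) *
    paraSum d (fun j ↦ blockNorm χ j (gradSize V)) (fun j ↦ blockNorm χ j Y) l with hB
  have hkB := hk l (fun ξ ↦ ‖c ξ‖ₑ) (gradSize V) Y hcm.enorm hWm hYm
  -- the size of `c`
  have hcY : ∀ η, ‖c η‖ₑ ≤ ENNReal.ofReal L * ((annulus d l).indicator 1 η * Y η) := by
    intro η
    rw [hc, enorm_mul, mul_left_comm, ← hi1]
    gcongr
    · rw [← ofReal_norm, Complex.norm_real, Real.norm_of_nonneg (hχ.blockSymbol_nonneg l η)]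
      exact ENNReal.ofReal_le_ofReal (hφ1 η)
    · rw [hY, Finset.mul_sum]
      refine (enorm_sum_le _ _).trans (Finset.sum_le_sum fun a _ ↦ ?_)
      rw [enorm_mul, ← mul_assoc, ← ENNReal.ofReal_mul hL]
      gcongr
      rw [← ofReal_norm]
      exact ENNReal.ofReal_le_ofReal (hαL a η)
  -- the commutator kernel
  let κ : ι → Space d × Space d → ℂ := fun a p ↦
    blockSymbol χ l p.1 * α a p.1 - blockSymbol χ l p.2 * α a p.2
  have hκ : ∀ a p, freq p.2 * ‖κ a p‖ ≤ k2 * freq (p.1 - p.2) *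
      ((annulus d l).indicator 1 p.1 + (annulus d l).indicator 1 p.2) * m a p.2 := by
    rintro a ⟨ξ, η⟩
    have e : κ a (ξ, η) = ((blockSymbol χ l ξ - blockSymbol χ l η : ℝ) : ℂ) * α a η +
        (blockSymbol χ l ξ : ℂ) * (α a ξ - α a η) := by
      simp only [κ]; push_cast; ring
    have h1 : ‖κ a (ξ, η)‖ ≤ |blockSymbol χ l ξ - blockSymbol χ l η| * ‖α a η‖ +
        blockSymbol χ l ξ * ‖α a ξ - α a η‖ := by
      rw [e]
      refine (norm_add_le _ _).trans (le_of_eq ?_)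
      rw [norm_mul, norm_mul, Complex.norm_real, Complex.norm_real,
        Real.norm_of_nonneg (hχ.blockSymbol_nonneg l ξ), Real.norm_eq_abs]
    have h2 := hcomm l ξ η
    have h3 := hαd a ξ η
    have hf := freq_nonneg η
    have hf' := freq_nonneg (ξ - η)
    calc freq η * ‖κ a (ξ, η)‖
        ≤ freq η * (|blockSymbol χ l ξ - blockSymbol χ l η| * ‖α a η‖ +
          blockSymbol χ l ξ * ‖α a ξ - α a η‖) := by gcongr
      _ = (|blockSymbol χ l ξ - blockSymbol χ l η| * freq η) * ‖α a η‖ +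
          blockSymbol χ l ξ * (freq η * ‖α a ξ - α a η‖) := by ring
      _ ≤ (C * freq (ξ - η) * ((annulus d l).indicator 1 ξ + (annulus d l).indicator 1 η)) *
          (L * m a η) + (annulus d l).indicator 1 ξ * (L * freq (ξ - η) * m a η) := by
          gcongr
          · have := hi0 ξ; have := hi0 η; positivity
          · exact hαL a η
          · exact hi0 ξ
          · exact hφ1 ξ
      _ ≤ _ := by
          simp only [hk2]
          have := mul_nonneg (mul_nonneg (hmL a η) hf') (hi0 η)
          nlinarith
  -- Moving the symbols `blockSymbol χ l * α a` from `ξ` to `η`, inside `V · ∇`, gives the principal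
  -- part `Φ₁`, a quadratic form in `c`; the remainder `Φ₂` contains the commutators `κ a`.
  let Φ₁ : Space d × Space d → ℂ := fun p ↦ conj (c p.1) * (convKernel V p * c p.2)
  let Φ₂ : Space d × Space d → ℂ := fun p ↦
    conj (c p.1) * (convKernel V p * ∑ a, κ a p * X a p.2)
  have hcm1 : Measurable fun p : Space d × Space d ↦ conj (c p.1) := by fun_prop
  have hΦ₁m : Measurable Φ₁ := by
    have : Measurable fun p : Space d × Space d ↦ c p.2 := by fun_prop
    exact hcm1.mul (hSm.mul this)
  have hκm : ∀ a, Measurable (κ a) := fun a ↦ by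
    have := hα a
    simp only [κ]
    exact ((hφm.comp measurable_fst).mul (by fun_prop)).sub
      ((hφm.comp measurable_snd).mul (by fun_prop))
  have hΦ₂m : Measurable Φ₂ := by
    have : Measurable fun p : Space d × Space d ↦ ∑ a, κ a p * X a p.2 :=
      Finset.measurable_fun_sum _ fun a _ ↦ (hκm a).mul (by have := hX a; fun_prop)
    exact hcm1.mul (hSm.mul this)
  have hΦ₂le : ∫⁻ p, ‖Φ₂ p‖ₑ ∂(volume.prod volume) ≤ ENNReal.ofReal k2 * (K * B) := by
    have hpt : ∀ p, ‖Φ₂ p‖ₑ ≤ ENNReal.ofReal k2 *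
        ((‖c p.1‖ₑ * (annulus d l).indicator 1 p.1) * (gradSize V (p.1 - p.2) * Y p.2) +
        ‖c p.1‖ₑ * (gradSize V (p.1 - p.2) * ((annulus d l).indicator 1 p.2 * Y p.2))) := by
      intro p
      have hk20 : 0 ≤ k2 := by positivity
      have h1 : ENNReal.ofReal (freq p.2) * ‖∑ a, κ a p * X a p.2‖ₑ ≤
          ENNReal.ofReal k2 * (ENNReal.ofReal (freq (p.1 - p.2)) *
          (((annulus d l).indicator 1 p.1 + (annulus d l).indicator 1 p.2) * Y p.2)) := by
        rw [hY, Finset.mul_sum, Finset.mul_sum, Finset.mul_sum]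
        refine (mul_le_mul_right (enorm_sum_le _ _) _).trans ?_
        rw [Finset.mul_sum]
        refine Finset.sum_le_sum fun a _ ↦ ?_
        have h2 : ENNReal.ofReal (freq p.2) * ‖κ a p‖ₑ ≤
            ENNReal.ofReal k2 * (ENNReal.ofReal (freq (p.1 - p.2)) *
            (((annulus d l).indicator 1 p.1 + (annulus d l).indicator 1 p.2) *
              ENNReal.ofReal (m a p.2))) := by
          rw [← mul_assoc, ← mul_assoc, ← ofReal_norm, ← ENNReal.ofReal_mul (freq_nonneg _), ← hi1,
            ← hi1, ← ENNReal.ofReal_add (hi0 _) (hi0 _), ← ENNReal.ofReal_mul hk20,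
            ← ENNReal.ofReal_mul (mul_nonneg hk20 (freq_nonneg _)),
            ← ENNReal.ofReal_mul (mul_nonneg (mul_nonneg hk20 (freq_nonneg _))
              (add_nonneg (hi0 _) (hi0 _)))]
          exact ENNReal.ofReal_le_ofReal (hκ a p)
        rw [enorm_mul, ← mul_assoc]
        refine (mul_le_mul_left h2 _).trans (le_of_eq ?_)
        ring
      calc ‖Φ₂ p‖ₑ = ‖c p.1‖ₑ * (‖convKernel V p‖ₑ * ‖∑ a, κ a p * X a p.2‖ₑ) := by
            simp [Φ₂, enorm_mul]
        _ ≤ ‖c p.1‖ₑ * ((vecSize V (p.1 - p.2) * ENNReal.ofReal (freq p.2)) *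
            ‖∑ a, κ a p * X a p.2‖ₑ) := by
            gcongr; exact enorm_convKernel_le V p
        _ = ‖c p.1‖ₑ * (vecSize V (p.1 - p.2) * (ENNReal.ofReal (freq p.2) *
            ‖∑ a, κ a p * X a p.2‖ₑ)) := by ring
        _ ≤ ‖c p.1‖ₑ * (vecSize V (p.1 - p.2) * (ENNReal.ofReal k2 *
          (ENNReal.ofReal (freq (p.1 - p.2)) *
          (((annulus d l).indicator 1 p.1 + (annulus d l).indicator 1 p.2) * Y p.2)))) := by
            gcongr
        _ = _ := by rw [gradSize]; ring
    refine (lintegral_mono hpt).trans ?_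
    rw [lintegral_const_mul' _ _ ENNReal.ofReal_ne_top, lintegral_add_left (by fun_prop)]
    gcongr
    have t1 := triForm_eq_lintegral_prod
      (A := fun ξ ↦ ‖c ξ‖ₑ * (annulus d l).indicator 1 ξ) (hcm.enorm.mul h1l) hWm hYm
    have t2 := triForm_eq_lintegral_prod hcm.enorm hWm
      (C := fun η ↦ (annulus d l).indicator 1 η * Y η) (h1l.mul hYm)
    rw [t1, t2] at hkB
    exact hkB
  have hΦ₁i : Integrable Φ₁ (volume.prod volume) := by
    rw [triForm_eq_lintegral_prod hcm.enorm (measurable_vecSize hV) hcm.enorm] at hA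
    have := ENNReal.mul_lt_top (ENNReal.ofReal_lt_top (r := 8 / 3 * 2 ^ l)) hA
    rw [← lintegral_const_mul' _ _ ENNReal.ofReal_ne_top] at this
    refine ⟨hΦ₁m.aestronglyMeasurable, lt_of_le_of_lt (lintegral_mono fun p ↦ ?_) this⟩
    have h1 : ENNReal.ofReal (freq p.2) * ‖c p.2‖ₑ ≤
        ENNReal.ofReal (8 / 3 * 2 ^ l) * ‖c p.2‖ₑ := by
      by_cases h : p.2 ∈ annulus d l
      · gcongr
        exact h.2
      · simp [hc p.2, hχ.blockSymbol_eq_zero h]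
    calc ‖Φ₁ p‖ₑ = ‖c p.1‖ₑ * (‖convKernel V p‖ₑ * ‖c p.2‖ₑ) := by simp [Φ₁, enorm_mul]
      _ ≤ ‖c p.1‖ₑ * ((vecSize V (p.1 - p.2) * ENNReal.ofReal (freq p.2)) * ‖c p.2‖ₑ) := by
          gcongr; exact enorm_convKernel_le V p
      _ = ‖c p.1‖ₑ * (vecSize V (p.1 - p.2) * (ENNReal.ofReal (freq p.2) * ‖c p.2‖ₑ)) := by ring
      _ ≤ ‖c p.1‖ₑ * (vecSize V (p.1 - p.2) * (ENNReal.ofReal (8 / 3 * 2 ^ l) * ‖c p.2‖ₑ)) := by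
          gcongr
      _ = _ := by ring
  have hΦ₂i : Integrable Φ₂ (volume.prod volume) :=
    ⟨hΦ₂m.aestronglyMeasurable, hΦ₂le.trans_lt (ENNReal.mul_lt_top ENNReal.ofReal_lt_top
      (ENNReal.mul_lt_top hK.lt_top hP))⟩
  -- The principal part: its real part is symmetrized by exchanging `ξ` and `η`, so that only the
  -- divergence of the field is left.
  have hI₁ : ‖(∫ p, Φ₁ p ∂(volume.prod volume)).re‖ₑ ≤ ENNReal.ofReal L * (K * B) := by
    have hswap : Integrable (fun p ↦ conj (Φ₁ p.swap)) (volume.prod volume) := by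
      have := hΦ₁i.swap
      exact (Complex.conjCLE.toContinuousLinearMap.integrable_comp this)
    have e1 : ∫ p, (Φ₁ p + conj (Φ₁ p.swap)) ∂(volume.prod volume) =
        ((2 * (∫ p, Φ₁ p ∂(volume.prod volume)).re : ℝ) : ℂ) := by
      rw [integral_add hΦ₁i hswap, integral_conj, integral_prod_swap, Complex.add_conj]
    have e2 : ‖((2 * (∫ p, Φ₁ p ∂(volume.prod volume)).re : ℝ) : ℂ)‖ₑ ≤
        ENNReal.ofReal L * (K * B) := by
      rw [← e1]
      refine (enorm_integral_le_lintegral_enorm _).trans ?_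
      have hpt : ∀ᵐ p : Space d × Space d ∂(volume.prod volume), ‖Φ₁ p + conj (Φ₁ p.swap)‖ₑ ≤
          ENNReal.ofReal L *
          (‖c p.1‖ₑ * (gradSize V (p.1 - p.2) * ((annulus d l).indicator 1 p.2 * Y p.2))) := by
        filter_upwards [ae_enorm_convKernel_add_conj_le hVr] with p hp
        have : Φ₁ p + conj (Φ₁ p.swap) =
            conj (c p.1) * ((convKernel V p + conj (convKernel V p.swap)) * c p.2) := by
          simp [Φ₁]; ring
        rw [this, enorm_mul, enorm_mul, RCLike.enorm_conj]
        calc _ ≤ ‖c p.1‖ₑ * (gradSize V (p.1 - p.2) *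
            (ENNReal.ofReal L * ((annulus d l).indicator 1 p.2 * Y p.2))) := by
              gcongr; exact hcY _
          _ = _ := by ring
      refine (lintegral_mono_ae hpt).trans ?_
      rw [lintegral_const_mul' _ _ ENNReal.ofReal_ne_top]
      gcongr
      have t2 := triForm_eq_lintegral_prod hcm.enorm hWm
        (C := fun η ↦ (annulus d l).indicator 1 η * Y η) (h1l.mul hYm)
      rw [← t2]
      exact le_add_self.trans hkB
    refine le_trans ?_ e2
    rw [← ofReal_norm, ← ofReal_norm, Complex.norm_real]
    refine ENNReal.ofReal_le_ofReal ?_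
    rw [norm_mul]
    norm_num
    linarith [abs_nonneg (∫ p, Φ₁ p ∂(volume.prod volume)).re]
  -- Fubini's theorem identifies the sum of the two parts with the integral to be estimated; the inner
  -- integrals converge absolutely for almost every `ξ`.
  have hae : ∀ᵐ ξ, ∀ a i, ∫⁻ η,
      ‖V i (ξ - η)‖ₑ * ‖(Complex.I * ((2 * Real.pi * η i : ℝ) : ℂ)) * X a η‖ₑ < ⊤ := by
    refine ae_all_iff.2 fun a ↦ ae_all_iff.2 fun i ↦ ?_
    have hm2 : Measurable fun ξ ↦ ∫⁻ η,
        ‖V i (ξ - η)‖ₑ * ‖(Complex.I * ((2 * Real.pi * η i : ℝ) : ℂ)) * X a η‖ₑ := by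
      have := hV i; have := hX a
      exact Measurable.lintegral_prod_right' (f := fun p : Space d × Space d ↦
        ‖V i (p.1 - p.2)‖ₑ * ‖(Complex.I * ((2 * Real.pi * p.2 i : ℝ) : ℂ)) * X a p.2‖ₑ)
        (by fun_prop)
    have h1 : ∀ᵐ ξ, ∀ n : ℕ, ξ ∈ Metric.closedBall (0 : Space d) n → ∫⁻ η,
        ‖V i (ξ - η)‖ₑ * ‖(Complex.I * ((2 * Real.pi * η i : ℝ) : ℂ)) * X a η‖ₑ < ⊤ :=
      ae_all_iff.2 fun n ↦ (ae_restrict_iff' measurableSet_closedBall).1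
        (ae_lt_top hm2 (hfin a i n).ne)
    filter_upwards [h1] with ξ hξ
    obtain ⟨n, hn⟩ := exists_nat_ge ‖ξ‖
    exact hξ n (by simpa using hn)
  have hint : ∫ ξ, conj (c ξ) * (blockSymbol χ l ξ * ∑ a, α a ξ * convFourier V (X a) ξ) =
      ∫ p, Φ₁ p + Φ₂ p ∂(volume.prod volume) := by
    have h12 : Integrable (fun p ↦ Φ₁ p + Φ₂ p) (volume.prod volume) := hΦ₁i.add hΦ₂i
    rw [integral_prod _ h12]
    refine integral_congr_ae ?_
    filter_upwards [hae] with ξ hξ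
    have hi : ∀ a i, Integrable fun η ↦
        V i (ξ - η) * ((Complex.I * ((2 * Real.pi * η i : ℝ) : ℂ)) * X a η) := fun a i ↦ by
      refine ⟨?_, ?_⟩
      · have := hV i; have := hX a
        exact Measurable.aestronglyMeasurable (by fun_prop)
      · rw [HasFiniteIntegral]
        simp only [enorm_mul (V i _)]
        exact hξ a i
    have e : ∀ η, Φ₁ (ξ, η) + Φ₂ (ξ, η) = conj (c ξ) * (blockSymbol χ l ξ * ∑ a, α a ξ *
        ∑ i, V i (ξ - η) * ((Complex.I * ((2 * Real.pi * η i : ℝ) : ℂ)) * X a η)) := by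
      intro η
      simp only [Φ₁, Φ₂, κ]
      have e1 : c η + ∑ a, (blockSymbol χ l ξ * α a ξ - blockSymbol χ l η * α a η) * X a η =
          blockSymbol χ l ξ * ∑ a, α a ξ * X a η := by
        rw [hc η, Finset.mul_sum, Finset.mul_sum, ← Finset.sum_add_distrib]
        refine Finset.sum_congr rfl fun a _ ↦ ?_
        ring
      rw [← mul_add, ← mul_add, e1, mul_left_comm (convKernel V (ξ, η)), Finset.mul_sum]
      congr 2
      refine Finset.sum_congr rfl fun a _ ↦ ?_
      simp only [convKernel, Finset.sum_mul, Finset.mul_sum]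
      refine Finset.sum_congr rfl fun i _ ↦ ?_
      ring
    simp only [e]
    rw [integral_const_mul, integral_const_mul,
      integral_finsetSum _ fun a _ ↦ (integrable_finsetSum _ fun i _ ↦ hi a i).const_mul _]
    congr 2
    refine Finset.sum_congr rfl fun a _ ↦ ?_
    rw [integral_const_mul, integral_finsetSum _ fun i _ ↦ hi a i, convFourier]
  rw [hint, integral_add hΦ₁i hΦ₂i, Complex.add_re]
  refine (enorm_add_le _ _).trans ?_
  rw [add_mul, add_mul, mul_assoc, mul_assoc]
  refine add_le_add hI₁ (le_trans ?_ hΦ₂le)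
  refine le_trans ?_ (enorm_integral_le_lintegral_enorm _)
  rw [← ofReal_norm, ← ofReal_norm]
  exact ENNReal.ofReal_le_ofReal (Complex.abs_re_le_norm _)

end LinearCapillary

namespace LinearCapillary

open MeasureTheory Filter Topology Set TemperedDistribution
open scoped ENNReal ContDiff SchwartzMap FourierTransform ComplexConjugate

variable {d : ℕ}

/-! ### Measurability in time of the norms of dyadic blocks -/

instance instSecondCountableTopologyMultilinear (n : ℕ) :
    SecondCountableTopology (Space d [×n]→L[ℝ] ℂ) := by
  have : FiniteDimensional ℝ (Space d [×n]→L[ℝ] ℂ) :=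
    Module.Finite.of_injective
      (ContinuousMultilinearMap.toMultilinearMapLinear (R' := ℝ) (A := ℝ) (M₂ := ℂ))
      ContinuousMultilinearMap.toMultilinearMap_injective
  have := FiniteDimensional.proper_real (Space d [×n]→L[ℝ] ℂ)
  infer_instance

/-- The Schwartz functions supported in a compact set are separable: their derivatives lie in
second countable spaces of continuous functions. -/
theorem exists_dense_seq_schwartz {K : Set (Space d)} (hK : IsCompact K) :
    ∃ Q : ℕ → 𝓢(Space d, ℂ), (∀ n, tsupport (Q n) ⊆ K) ∧ ∀ ψ : 𝓢(Space d, ℂ), tsupport ψ ⊆ K →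
      ∃ k : ℕ → ℕ, Tendsto (fun j ↦ Q (k j)) atTop (𝓝 ψ) := by
  let S := {ψ : 𝓢(Space d, ℂ) // tsupport ψ ⊆ K}
  let J : S → (n : ℕ) → C(Space d, Space d [×n]→L[ℝ] ℂ) := fun ψ n ↦
    ⟨iteratedFDeriv ℝ n ψ.1, (ψ.1.smooth'.continuous_iteratedFDeriv (by exact_mod_cast le_top))⟩
  have : Nonempty S := ⟨⟨0, by
    have : tsupport ((0 : 𝓢(Space d, ℂ)) : Space d → ℂ) = ∅ := by
      rw [tsupport_eq_empty_iff]; rfl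
    rw [this]; exact empty_subset _⟩⟩
  obtain ⟨D, hD⟩ := TopologicalSpace.exists_dense_seq (range J)
  choose q hq using fun n ↦ (D n).2
  refine ⟨fun n ↦ (q n).1, fun n ↦ (q n).2, fun ψ hψ ↦ ?_⟩
  obtain ⟨x, hx, hlim⟩ := mem_closure_iff_seq_limit.1 (hD ⟨J ⟨ψ, hψ⟩, mem_range_self _⟩)
  choose k hk using hx
  refine ⟨k, ?_⟩
  have hJ : Tendsto (fun j ↦ J (q (k j))) atTop (𝓝 (J ⟨ψ, hψ⟩)) := by
    have := (continuous_subtype_val.tendsto _).comp hlim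
    refine this.congr fun j ↦ ?_
    rw [Function.comp_apply, ← hk, hq]
  rw [(schwartz_withSeminorms ℂ (Space d) ℂ).tendsto_nhds]
  rintro ⟨m, n⟩ ε hε
  have h1 := (tendsto_pi_nhds.1 hJ) n
  rw [ContinuousMap.tendsto_iff_forall_isCompact_tendstoUniformlyOn] at h1
  have h2 := Metric.tendstoUniformlyOn_iff.1 (h1 K hK)
  obtain ⟨R, hR0, hR⟩ := hK.isBounded.exists_pos_norm_le
  have hpos : 0 < ε / 2 / R ^ m := by positivity
  filter_upwards [h2 _ hpos] with j hj
  refine lt_of_le_of_lt (SchwartzMap.seminorm_le_bound ℂ m n _ (M := ε / 2) (by positivity)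
    fun x ↦ ?_) (by linarith)
  have hd1 : ∀ x, iteratedFDeriv ℝ n ((q (k j)).1 - ψ : 𝓢(Space d, ℂ)) x =
      iteratedFDeriv ℝ n (q (k j)).1 x - iteratedFDeriv ℝ n ψ x := by
    intro x
    exact iteratedFDeriv_sub_apply (((q (k j)).1.smooth n).contDiffAt) ((ψ.smooth n).contDiffAt)
  rw [hd1]
  by_cases hx : x ∈ K
  · have := hj x hx
    rw [dist_comm, dist_eq_norm] at this
    calc ‖x‖ ^ m * _ ≤ R ^ m * (ε / 2 / R ^ m) := by
          gcongr
          · exact hR x hx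
          · exact this.le
      _ = ε / 2 := by field_simp
  · have e : ∀ θ : 𝓢(Space d, ℂ), tsupport θ ⊆ K → iteratedFDeriv ℝ n θ x = 0 := fun θ hθ ↦ by
      by_contra h
      exact hx (hθ (support_iteratedFDeriv_subset n h))
    rw [e _ (q (k j)).2, e ψ hψ]
    rw [sub_zero, norm_zero, mul_zero]
    exact (half_pos hε).le

theorem eLpNorm_schwartz_eq (ψ : 𝓢(Space d, ℂ)) :
    eLpNorm ψ 2 volume = ‖SchwartzMap.toLpCLM ℂ ℂ 2 volume ψ‖ₑ := by
  rw [SchwartzMap.toLpCLM_apply, Lp.enorm_def]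
  exact (eLpNorm_congr_ae (ψ.coeFn_toLp 2 volume)).symm

/-- The Riesz representation theorem: a distribution whose Fourier transform is bounded in `L²`
is in `L²`. -/
theorem distrLpNorm_two_le_of_bound {T : Distr d} {M : ℝ} (hM : 0 ≤ M)
    (h : ∀ ψ : 𝓢(Space d, ℂ), ‖T (𝓕 ψ)‖ ≤ M * ‖SchwartzMap.toLpCLM ℂ ℂ 2 volume ψ‖) :
    distrLpNorm 2 T ≤ ENNReal.ofReal M := by
  let f : 𝓢(Space d, ℂ) →ₗ[ℂ] ℂ :=
    (T : 𝓢(Space d, ℂ) →ₗ[ℂ] ℂ).comp (FourierTransform.fourierCLM ℂ 𝓢(Space d, ℂ)).toLinearMap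
  let e : 𝓢(Space d, ℂ) →ₗ[ℂ] Lp ℂ 2 (volume : Measure (Space d)) :=
    (SchwartzMap.toLpCLM ℂ ℂ 2 volume).toLinearMap
  have hf : ∀ ψ, f ψ = T (𝓕 ψ) := fun ψ ↦ by simp [f]
  have he : DenseRange e := SchwartzMap.denseRange_toLpCLM (p := 2) ENNReal.ofNat_ne_top
  have hb : ∀ ψ, ‖f ψ‖ ≤ M * ‖e ψ‖ := fun ψ ↦ by rw [hf]; exact h ψ
  set Λ := f.extendOfNorm e with hΛ
  have hΛe : ∀ ψ, Λ (e ψ) = T (𝓕 ψ) := fun ψ ↦ by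
    rw [hΛ, LinearMap.extendOfNorm_eq he ⟨M, hb⟩, hf]
  have hΛn : ‖Λ‖ ≤ M := LinearMap.opNorm_extendOfNorm_le he hM hb
  set g := (InnerProductSpace.toDual ℂ (Lp ℂ 2 (volume : Measure (Space d)))).symm Λ with hg
  have hgn : ‖g‖ ≤ M := by rw [hg, LinearIsometryEquiv.norm_map]; exact hΛn
  have hgm : MemLp (fun η ↦ conj (g η)) 2 := by
    have := (Lp.memLp g).star
    exact this
  have hrep : ∀ ψ : 𝓢(Space d, ℂ), T (𝓕 ψ) = ∫ η, ψ η * conj (g η) := fun ψ ↦ by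
    rw [← hΛe, show Λ = InnerProductSpace.toDual ℂ _ g by rw [hg]; simp,
      InnerProductSpace.toDual_apply_apply, L2.inner_def]
    refine integral_congr_ae ?_
    filter_upwards [ψ.coeFn_toLp 2 volume] with η hη
    change inner ℂ (g η) (ψ.toLp 2 volume η) = _
    rw [hη]
    simp
  rw [distrLpNorm_two_eq hgm hrep]
  have : eLpNorm (fun η ↦ conj (g η)) 2 volume = ‖g‖ₑ := by
    rw [Lp.enorm_def]
    exact eLpNorm_congr_norm_ae (ae_of_all _ fun η ↦ by simp)
  rw [this, ← ofReal_norm]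
  exact ENNReal.ofReal_le_ofReal hgn

/-- The norm of a dyadic block is a countable supremum of quantities that are measurable in
time. -/
theorem exists_distrLpNorm_dyadicBlock_eq_iSup {χ : Space d → ℝ} (hχ : IsCutoff χ) (hd : 0 < d)
    (l : ℤ) : ∃ Q : ℕ → 𝓢(Space d, ℂ), ∀ T : Distr d, distrLpNorm 2 (dyadicBlock χ l T) =
      ⨆ n, ‖dyadicBlock χ l T (𝓕 (Q n))‖ₑ / ‖SchwartzMap.toLpCLM ℂ ℂ 2 volume (Q n)‖ₑ := by
  -- `θ` equals `1` on the annulus, so that the block only sees test functions with support in the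
  -- compact set `tsupport θ`; these have a countable dense subset in the Schwartz topology
  set θ : Space d → ℂ := fun η ↦ (lowSymbol χ (l + 2) η : ℂ) with hθ
  have hθt : θ.HasTemperateGrowth := hχ.hasTemperateGrowth_lowSymbol (l + 2)
  obtain ⟨Q, -, hQ⟩ := exists_dense_seq_schwartz (hχ.hasCompactSupport_ofReal_lowSymbol (l + 2))
  refine ⟨Q, fun T ↦ le_antisymm ?_ (iSup_le fun n ↦ ?_)⟩
  · set M := ⨆ n, ‖dyadicBlock χ l T (𝓕 (Q n))‖ₑ / ‖SchwartzMap.toLpCLM ℂ ℂ 2 volume (Q n)‖ₑ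
      with hM
    by_cases hMt : M = ⊤
    · rw [hMt]; exact le_top
    have hb1 : ∀ n, ‖dyadicBlock χ l T (𝓕 (Q n))‖ ≤
        M.toReal * ‖SchwartzMap.toLpCLM ℂ ℂ 2 volume (Q n)‖ := by
      intro n
      have h1 : ‖dyadicBlock χ l T (𝓕 (Q n))‖ₑ / ‖SchwartzMap.toLpCLM ℂ ℂ 2 volume (Q n)‖ₑ ≤ M :=
        le_iSup (fun n ↦ ‖dyadicBlock χ l T (𝓕 (Q n))‖ₑ /
          ‖SchwartzMap.toLpCLM ℂ ℂ 2 volume (Q n)‖ₑ) n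
      have h2 : ‖dyadicBlock χ l T (𝓕 (Q n))‖ₑ ≤ M * ‖SchwartzMap.toLpCLM ℂ ℂ 2 volume (Q n)‖ₑ := by
        by_cases h0 : ‖SchwartzMap.toLpCLM ℂ ℂ 2 volume (Q n)‖ₑ = 0
        -- if `Q n = 0` in `L²` and the numerator does not vanish, the quotient is infinite; the
        -- case `0 / 0` contributes nothing
        · by_cases h3 : ‖dyadicBlock χ l T (𝓕 (Q n))‖ₑ = 0
          · rw [h3]; exact zero_le
          · rw [h0, ENNReal.div_zero h3] at h1
            exact absurd (top_le_iff.1 h1) hMt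
        · rwa [ENNReal.div_le_iff h0 (by simp)] at h1
      have := ENNReal.toReal_mono (ENNReal.mul_ne_top hMt (by simp)) h2
      simpa using this
    have hb2 : ∀ ψ : 𝓢(Space d, ℂ), tsupport ψ ⊆ tsupport θ → ‖dyadicBlock χ l T (𝓕 ψ)‖ ≤
        M.toReal * ‖SchwartzMap.toLpCLM ℂ ℂ 2 volume ψ‖ := by
      intro ψ hψ
      obtain ⟨k, hk⟩ := hQ ψ hψ
      have l1 : Tendsto (fun j ↦ ‖dyadicBlock χ l T (𝓕 (Q (k j)))‖) atTop
          (𝓝 ‖dyadicBlock χ l T (𝓕 ψ)‖) := by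
        have hc : Continuous fun ψ : 𝓢(Space d, ℂ) ↦ ‖dyadicBlock χ l T (𝓕 ψ)‖ := by
          have h1 : Continuous fun ψ : 𝓢(Space d, ℂ) ↦
            (FourierTransform.fourierCLM ℂ 𝓢(Space d, ℂ)) ψ := map_continuous _
          have h2 : Continuous fun ψ : 𝓢(Space d, ℂ) ↦ dyadicBlock χ l T ψ :=
            ContinuousLinearMap.continuous _
          exact (h2.comp h1).norm
        exact (hc.tendsto ψ).comp hk
      have l2 : Tendsto (fun j ↦ M.toReal * ‖SchwartzMap.toLpCLM ℂ ℂ 2 volume (Q (k j))‖) atTop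
          (𝓝 (M.toReal * ‖SchwartzMap.toLpCLM ℂ ℂ 2 volume ψ‖)) :=
        ((((SchwartzMap.toLpCLM ℂ ℂ 2 (volume : Measure (Space d))).continuous.tendsto ψ).comp
          hk).norm).const_mul _
      exact le_of_tendsto_of_tendsto' l1 l2 fun j ↦ hb1 _
    rw [← ENNReal.ofReal_toReal hMt]
    refine distrLpNorm_two_le_of_bound ENNReal.toReal_nonneg fun ψ ↦ ?_
    have e1 : dyadicBlock χ l T (𝓕 ψ) =
        dyadicBlock χ l T (𝓕 (SchwartzMap.smulLeftCLM ℂ θ ψ)) := by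
      rw [dyadicBlock_apply_fourier, dyadicBlock_apply_fourier]
      congr 2
      ext η
      simp only [SchwartzMap.smulLeftCLM_apply_apply (hχ.hasTemperateGrowth_blockSymbol l),
        SchwartzMap.smulLeftCLM_apply_apply hθt]
      by_cases h : η ∈ annulus d l
      · have : lowSymbol χ (l + 2) η = 1 := hχ.lowSymbol_eq_one (by
          have h1 := h.2
          have : (0 : ℝ) < 2 ^ l := by positivity
          rw [zpow_add₀ (by norm_num)]
          norm_num
          linarith)
        simp [hθ, this]
      · simp [hχ.blockSymbol_eq_zero h]
    rw [e1]
    refine (hb2 _ ((SchwartzMap.tsupport_smulLeftCLM_subset θ ψ).trans inter_subset_right)).trans ?_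
    gcongr
    have hle : eLpNorm (SchwartzMap.smulLeftCLM ℂ θ ψ) 2 volume ≤ eLpNorm ψ 2 volume := by
      refine eLpNorm_mono fun η ↦ ?_
      rw [SchwartzMap.smulLeftCLM_apply_apply hθt, norm_smul]
      refine mul_le_of_le_one_left (norm_nonneg _) ?_
      rw [hθ, Complex.norm_real, Real.norm_of_nonneg (hχ.lowSymbol_nonneg hd _ _)]
      exact hχ.lowSymbol_le_one _ _
    rw [eLpNorm_schwartz_eq, eLpNorm_schwartz_eq] at hle
    simpa using ENNReal.toReal_mono (by simp) hle
  · by_cases hfin : distrLpNorm 2 (dyadicBlock χ l T) < ⊤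
    · obtain ⟨G, hGm, hG, -, hGψ, hGn⟩ := exists_fourier_dyadicBlock hχ hfin
      refine ENNReal.div_le_of_le_mul ?_
      rw [hGψ, ← eLpNorm_schwartz_eq, eLpNorm_two_eq_l2, hGn]
      refine (enorm_integral_le_lintegral_enorm _).trans ?_
      simp only [enorm_mul]
      rw [mul_comm]
      exact lintegral_mul_le_l2 (Q n).continuous.enorm.aemeasurable hGm.enorm.aemeasurable
    · rw [not_lt_top_iff.1 hfin]; exact le_top

theorem aemeasurable_distrLpNorm_dyadicBlock {χ : Space d → ℝ} (hχ : IsCutoff χ) (hd : 0 < d)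
    (l : ℤ) {f : ℝ → Distr d} {μ : Measure ℝ}
    (hf : ∀ ψ : 𝓢(Space d, ℂ), AEStronglyMeasurable (fun τ ↦ f τ ψ) μ) :
    AEMeasurable (fun τ ↦ distrLpNorm 2 (dyadicBlock χ l (f τ))) μ := by
  obtain ⟨Q, hQ⟩ := exists_distrLpNorm_dyadicBlock_eq_iSup hχ hd l
  simp only [hQ]
  refine AEMeasurable.iSup fun n ↦ AEMeasurable.div_const ?_ _
  simp only [dyadicBlock_apply_fourier]
  exact (hf _).enorm

theorem aemeasurable_besovNorm {χ : Space d → ℝ} (hχ : IsCutoff χ) (hd : 0 < d) (σ : ℝ)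
    {f : ℝ → Distr d} {μ : Measure ℝ}
    (hf : ∀ ψ : 𝓢(Space d, ℂ), AEStronglyMeasurable (fun τ ↦ f τ ψ) μ) :
    AEMeasurable (fun τ ↦ besovNorm χ σ (f τ)) μ :=
  AEMeasurable.tsum fun l ↦
    (aemeasurable_distrLpNorm_dyadicBlock hχ hd l hf).const_mul _

end LinearCapillary

namespace LinearCapillary

open MeasureTheory Filter Topology Set
open scoped ENNReal ComplexConjugate ContDiff

/-! ### The symbol of the pressure and capillarity terms -/

/-- The symbol `K(r) = p + k (1 - e^{-ε² r²}) / ε²`, `r = |ξ|`, of `p - (k/ε²)(φ_ε * · - ·)`. -/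
noncomputable def capSymbol (p k ε r : ℝ) : ℝ := p + k * ((1 - Real.exp (-(ε ^ 2 * r ^ 2))) / ε ^ 2)

section Symbol

variable {p k ε : ℝ} (hp : 0 < p) (hk : 0 < k) (hε : 0 < ε)
include hp hk hε

omit hp hε in
theorem le_capSymbol (r : ℝ) : p ≤ capSymbol p k ε r := by
  have h1 : Real.exp (-(ε ^ 2 * r ^ 2)) ≤ 1 := Real.exp_le_one_iff.2 (by
    have : 0 ≤ ε ^ 2 * r ^ 2 := by positivity
    linarith)
  have : 0 ≤ k * ((1 - Real.exp (-(ε ^ 2 * r ^ 2))) / ε ^ 2) :=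
    mul_nonneg hk.le (div_nonneg (by linarith) (by positivity))
  rw [capSymbol]
  linarith

omit hε in
theorem capSymbol_pos (r : ℝ) : 0 < capSymbol p k ε r := hp.trans_le (le_capSymbol hk r)

omit hp in
theorem capSymbol_le_sq (r : ℝ) : capSymbol p k ε r ≤ p + k * r ^ 2 := by
  have h1 := Real.add_one_le_exp (-(ε ^ 2 * r ^ 2))
  have h2 : (1 - Real.exp (-(ε ^ 2 * r ^ 2))) / ε ^ 2 ≤ r ^ 2 := by
    rw [div_le_iff₀ (by positivity)]
    linarith
  rw [capSymbol]
  gcongr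

omit hp in
theorem capSymbol_mono {r r' : ℝ} (hr : 0 ≤ r) (h : r ≤ r') :
    capSymbol p k ε r ≤ capSymbol p k ε r' := by
  unfold capSymbol
  gcongr

/-- The symbol grows at most quadratically, uniformly in `ε`. -/
theorem capSymbol_le_mul {r r' : ℝ} (h : r' ^ 2 ≤ 13 * r ^ 2) :
    capSymbol p k ε r' ≤ 13 * capSymbol p k ε r := by
  have h1 : 1 - 13 * (1 - Real.exp (-(ε ^ 2 * r ^ 2))) ≤ Real.exp (-(ε ^ 2 * r' ^ 2)) := by
    -- Bernoulli's inequality for the power `13` of `exp (-ε² r²)`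
    have h2 := one_add_mul_le_pow (a := Real.exp (-(ε ^ 2 * r ^ 2)) - 1)
      (by linarith [Real.exp_pos (-(ε ^ 2 * r ^ 2))]) 13
    rw [add_sub_cancel, ← Real.exp_nat_mul] at h2
    have h3 : Real.exp ((13 : ℕ) * -(ε ^ 2 * r ^ 2)) ≤ Real.exp (-(ε ^ 2 * r' ^ 2)) := by
      refine Real.exp_le_exp.2 ?_
      push_cast
      nlinarith [sq_nonneg ε]
    push_cast at h2 h3
    linarith
  have h4 : (1 - Real.exp (-(ε ^ 2 * r' ^ 2))) / ε ^ 2 ≤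
      13 * ((1 - Real.exp (-(ε ^ 2 * r ^ 2))) / ε ^ 2) := by
    rw [← mul_div_assoc]
    gcongr
    linarith
  unfold capSymbol
  nlinarith

/-- `√K` is Lipschitz, uniformly in `ε`. -/
theorem abs_sqrt_capSymbol_sub_le (r r' : ℝ) :
    |√(2 * capSymbol p k ε r) - √(2 * capSymbol p k ε r')| ≤ √(2 * k) * |r - r'| := by
  have hpos : ∀ r, 0 < 2 * capSymbol p k ε r := fun r ↦ by
    have := capSymbol_pos (ε := ε) hp hk r; linarith
  have hder : ∀ r, HasDerivAt (fun r ↦ √(2 * capSymbol p k ε r))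
      (2 * (k * (2 * r * Real.exp (-(ε ^ 2 * r ^ 2)))) / (2 * √(2 * capSymbol p k ε r))) r := by
    intro r
    have h1 : HasDerivAt (fun r : ℝ ↦ -(ε ^ 2 * r ^ 2)) (-(ε ^ 2 * (2 * r))) r := by
      simpa using! ((hasDerivAt_pow 2 r).const_mul (ε ^ 2)).neg
    have h2 : HasDerivAt (fun r ↦ 2 * capSymbol p k ε r)
        (2 * (k * ((-(Real.exp (-(ε ^ 2 * r ^ 2)) * -(ε ^ 2 * (2 * r)))) / ε ^ 2))) r :=
      ((((h1.exp.const_sub 1).div_const (ε ^ 2)).const_mul k).const_add p).const_mul 2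
    have h3 := h2.sqrt (hpos r).ne'
    convert h3 using 1
    field_simp
  have hbound : ∀ r, ‖2 * (k * (2 * r * Real.exp (-(ε ^ 2 * r ^ 2)))) /
      (2 * √(2 * capSymbol p k ε r))‖ ≤ √(2 * k) := by
    intro r
    have hs : 0 < √(2 * capSymbol p k ε r) := Real.sqrt_pos.2 (hpos r)
    rw [Real.norm_eq_abs, ← Real.sqrt_sq_eq_abs]
    refine Real.sqrt_le_sqrt ?_
    rw [div_pow, mul_pow 2 (√_), Real.sq_sqrt (hpos r).le, div_le_iff₀ (by have := hpos r; positivity)]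
    set y := ε ^ 2 * r ^ 2 with hy
    have hy0 : 0 ≤ y := by positivity
    have he : 0 < Real.exp (-y) := Real.exp_pos _
    have he1 : Real.exp (-y) ≤ 1 := Real.exp_le_one_iff.2 (by linarith)
    -- the elementary inequality `y e^{-2y} ≤ 1 - e^{-y}`
    have h5 : y * Real.exp (-y) ^ 2 ≤ 1 - Real.exp (-y) := by
      have h6 := Real.add_one_le_exp y
      have h7 : Real.exp y * Real.exp (-y) = 1 := by rw [← Real.exp_add]; simp
      nlinarith [mul_le_mul_of_nonneg_right h6 he.le, mul_nonneg hy0 he.le]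
    have h8 : r ^ 2 * Real.exp (-y) ^ 2 ≤ (1 - Real.exp (-y)) / ε ^ 2 := by
      rw [le_div_iff₀ (by positivity)]
      calc _ = y * Real.exp (-y) ^ 2 := by rw [hy]; ring
        _ ≤ _ := h5
    have h9 : k * (r ^ 2 * Real.exp (-y) ^ 2) ≤ capSymbol p k ε r := by
      rw [capSymbol]
      nlinarith
    nlinarith
  have := Convex.norm_image_sub_le_of_norm_hasDerivWithin_le (s := univ)
    (fun x _ ↦ (hder x).hasDerivWithinAt) (fun x _ ↦ hbound x) convex_univ (mem_univ r')
    (mem_univ r)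
  simpa [Real.norm_eq_abs] using this

theorem half_sq_le_capSymbol {γ r : ℝ}
    (hγ' : ∀ z : ℝ, 0 < z → z ≤ γ → 1 / 2 ≤ (1 - Real.exp (-z)) / z) (hr : 0 < r)
    (h : ε ^ 2 * r ^ 2 ≤ γ) : k / 2 * r ^ 2 ≤ capSymbol p k ε r := by
  have hz : 0 < ε ^ 2 * r ^ 2 := by positivity
  have h1 := hγ' _ hz h
  rw [le_div_iff₀ hz] at h1
  have h2 : 1 / 2 * r ^ 2 ≤ (1 - Real.exp (-(ε ^ 2 * r ^ 2))) / ε ^ 2 := by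
    rw [le_div_iff₀ (by positivity)]
    linarith
  rw [capSymbol]
  nlinarith

theorem div_sq_le_capSymbol {γ r : ℝ} (h : γ ≤ ε ^ 2 * r ^ 2) :
    k * (1 - Real.exp (-γ)) / ε ^ 2 ≤ capSymbol p k ε r := by
  have h1 : Real.exp (-(ε ^ 2 * r ^ 2)) ≤ Real.exp (-γ) := Real.exp_le_exp.2 (by linarith)
  rw [capSymbol, mul_div_assoc]
  have : k * ((1 - Real.exp (-γ)) / ε ^ 2) ≤ k * ((1 - Real.exp (-(ε ^ 2 * r ^ 2))) / ε ^ 2) := by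
    gcongr
  linarith

/-- The damping rate of the block of index `l`, up to a constant. -/
noncomputable def blockRate (p k ε : ℝ) (l : ℤ) : ℝ :=
  min ((3 / 4 * (2 : ℝ) ^ l) ^ 2) (capSymbol p k ε (3 / 4 * (2 : ℝ) ^ l))

omit hε in
theorem blockRate_pos (l : ℤ) : 0 < blockRate p k ε l :=
  lt_min (by positivity) (capSymbol_pos hp hk _)

omit hp hk in
theorem sq_le_of_le_threshold {γ : ℝ} (hγ : 0 < γ) {l : ℤ} (hl : l ≤ threshold γ ε) :
    ε ^ 2 * (2 ^ l) ^ 2 ≤ 3 / 32 * γ := by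
  have hx : 0 < γ / (outerRadius * ε ^ 2) := by unfold outerRadius; positivity
  have h1 : (l : ℝ) ≤ 1 / 2 * Real.logb 2 (γ / (outerRadius * ε ^ 2)) - 1 := by
    exact_mod_cast Int.le_floor.1 hl
  have h2 : 2 * (l : ℝ) + 2 ≤ Real.logb 2 (γ / (outerRadius * ε ^ 2)) := by linarith
  rw [Real.le_logb_iff_rpow_le (by norm_num) hx] at h2
  have h3 : (2 : ℝ) ^ (2 * (l : ℝ) + 2) = 4 * (2 ^ l) ^ 2 := by
    rw [Real.rpow_add (by norm_num), mul_comm 2 (l : ℝ), Real.rpow_mul (by norm_num),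
      Real.rpow_intCast]
    norm_num
    ring
  rw [h3, le_div_iff₀ (by unfold outerRadius; positivity), outerRadius] at h2
  linarith

omit hp hk in
theorem lt_sq_of_threshold_lt {γ : ℝ} (hγ : 0 < γ) {l : ℤ} (hl : threshold γ ε < l) :
    3 / 32 * γ ≤ ε ^ 2 * (2 ^ l) ^ 2 := by
  have hx : 0 < γ / (outerRadius * ε ^ 2) := by unfold outerRadius; positivity
  have h1 : 1 / 2 * Real.logb 2 (γ / (outerRadius * ε ^ 2)) - 1 < (l : ℝ) := Int.floor_lt.1 hl
  have h2 : Real.logb 2 (γ / (outerRadius * ε ^ 2)) < 2 * (l : ℝ) + 2 := by linarith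
  rw [Real.logb_lt_iff_lt_rpow (by norm_num) hx] at h2
  have h3 : (2 : ℝ) ^ (2 * (l : ℝ) + 2) = 4 * (2 ^ l) ^ 2 := by
    rw [Real.rpow_add (by norm_num), mul_comm 2 (l : ℝ), Real.rpow_mul (by norm_num),
      Real.rpow_intCast]
    norm_num
    ring
  rw [h3, div_lt_iff₀ (by unfold outerRadius; positivity), outerRadius] at h2
  linarith

omit hp hk hε in
/-- Below the threshold the block is damped like a parabolic equation, above it the damping is
at least `ε⁻²`. -/
theorem exists_blockRate_bounds (hp : 0 < p) (hk : 0 < k) {γ : ℝ} (hγ : 0 < γ)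
    (hγ' : ∀ z : ℝ, 0 < z → z ≤ γ → 1 / 2 ≤ (1 - Real.exp (-z)) / z) :
    ∃ C : ℝ, 0 < C ∧ ∀ (ε : ℝ), 0 < ε → ∀ l : ℤ,
      (l ≤ threshold γ ε → ((2 : ℝ) ^ l) ^ 2 ≤ C * blockRate p k ε l) ∧
      (threshold γ ε < l → 1 / ε ^ 2 ≤ C * blockRate p k ε l) := by
  -- Above the threshold `4 ^ l > γ / (4 C₀ ε²)` with `C₀ = 8 / 3`, hence `ε² (3/4 · 2 ^ l)² ≥ γ₀`.
  set γ₀ : ℝ := 27 / 512 * γ with hγ₀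
  have hγ₀p : 0 < γ₀ := by positivity
  have he : 0 < 1 - Real.exp (-γ₀) := by
    have : Real.exp (-γ₀) < 1 := Real.exp_lt_one_iff.2 (by linarith)
    linarith
  have hc : 0 < 32 / (9 * k) := by positivity
  have hc' : 0 < 1 / (k * (1 - Real.exp (-γ₀))) := by positivity
  have hc'' : 0 < 1 / γ₀ := by positivity
  refine ⟨16 / 9 + 32 / (9 * k) + 1 / γ₀ + 1 / (k * (1 - Real.exp (-γ₀))), by positivity,
    fun ε hε l ↦ ⟨fun hl ↦ ?_, fun hl ↦ ?_⟩⟩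
  · have h1 := sq_le_of_le_threshold hε hγ hl
    have h2 := half_sq_le_capSymbol hp hk hε hγ' (r := 3 / 4 * (2 : ℝ) ^ l) (by positivity)
      (by nlinarith)
    have hX : 0 < (2 : ℝ) ^ l := by positivity
    rw [blockRate]
    rcases min_cases ((3 / 4 * (2 : ℝ) ^ l) ^ 2) (capSymbol p k ε (3 / 4 * (2 : ℝ) ^ l)) with h | h
    · rw [h.1]
      have : (2 ^ l) ^ 2 = 16 / 9 * (3 / 4 * (2 : ℝ) ^ l) ^ 2 := by ring
      rw [this]
      gcongr
      linarith
    · rw [h.1]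
      have h3 := capSymbol_pos (ε := ε) hp hk (3 / 4 * (2 : ℝ) ^ l)
      calc ((2 : ℝ) ^ l) ^ 2 = 32 / (9 * k) * (k / 2 * (3 / 4 * (2 : ℝ) ^ l) ^ 2) := by
            field_simp; norm_num
        _ ≤ 32 / (9 * k) * capSymbol p k ε (3 / 4 * (2 : ℝ) ^ l) := by gcongr
        _ ≤ _ := by gcongr; linarith
  · have h1 := lt_sq_of_threshold_lt hε hγ hl
    have h0 : γ₀ ≤ ε ^ 2 * (3 / 4 * (2 : ℝ) ^ l) ^ 2 := by rw [hγ₀]; nlinarith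
    have h2 := div_sq_le_capSymbol hp hk hε h0
    rw [blockRate]
    rcases min_cases ((3 / 4 * (2 : ℝ) ^ l) ^ 2) (capSymbol p k ε (3 / 4 * (2 : ℝ) ^ l)) with h | h
    · rw [h.1]
      calc 1 / ε ^ 2 = 1 / γ₀ * (γ₀ / ε ^ 2) := by field_simp
        _ ≤ 1 / γ₀ * (3 / 4 * (2 : ℝ) ^ l) ^ 2 := by
            gcongr
            rw [div_le_iff₀ (by positivity)]
            linarith
        _ ≤ _ := by gcongr; linarith
    · rw [h.1]
      have h3 := capSymbol_pos (ε := ε) hp hk (3 / 4 * (2 : ℝ) ^ l)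
      calc 1 / ε ^ 2 = 1 / (k * (1 - Real.exp (-γ₀))) * (k * (1 - Real.exp (-γ₀)) / ε ^ 2) := by
            field_simp
        _ ≤ 1 / (k * (1 - Real.exp (-γ₀))) * capSymbol p k ε (3 / 4 * (2 : ℝ) ^ l) := by gcongr
        _ ≤ _ := by gcongr; linarith

end Symbol

/-! ### The linear system at a fixed frequency -/

section Algebra

variable {d : ℕ} (μ lam K : ℝ) (x : Fin d → ℝ) (u : Fin d → ℂ) (q : ℂ)

/-- The Fourier transform of the linear terms in the velocity equation, at the frequency `x`. -/
noncomputable def linVelocity (i : Fin d) : ℂ :=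
  -((μ * ∑ j, x j ^ 2 : ℝ) : ℂ) * u i - ((lam + μ : ℝ) : ℂ) * x i * ∑ j, x j * u j
    - Complex.I * K * x i * q

/-- The Fourier transform of `- div u`, at the frequency `x`. -/
noncomputable def linDensity : ℂ := -Complex.I * ∑ j, x j * u j

theorem sum_conj_mul_linVelocity :
    ∑ i, conj (u i) * linVelocity μ lam K x u q i =
      -((μ * (∑ j, x j ^ 2) * ∑ j, ‖u j‖ ^ 2 : ℝ) : ℂ)
        - ((lam + μ : ℝ) : ℂ) * (conj (∑ j, x j * u j) * ∑ j, x j * u j)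
        - Complex.I * K * conj (∑ j, x j * u j) * q := by
  have e1 : conj (∑ j, (x j : ℂ) * u j) = ∑ j, x j * conj (u j) := by simp [map_sum]
  rw [e1]
  set D := ∑ j, (x j : ℂ) * u j
  have e2 : ∀ i, conj (u i) * linVelocity μ lam K x u q i =
      -((μ * ∑ j, x j ^ 2 : ℝ) : ℂ) * (‖u i‖ ^ 2 : ℝ) -
        ((lam + μ : ℝ) : ℂ) * D * (x i * conj (u i)) -
        Complex.I * K * q * (x i * conj (u i)) := fun i ↦ by
    have : conj (u i) * u i = ((‖u i‖ ^ 2 : ℝ) : ℂ) := by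
      rw [Complex.conj_mul']; push_cast; rfl
    rw [linVelocity, ← this]
    ring
  simp only [e2, Finset.sum_sub_distrib, ← Finset.mul_sum]
  push_cast
  ring

theorem re_sum_conj_mul_linVelocity :
    (∑ i, conj (u i) * linVelocity μ lam K x u q i).re =
      -(μ * (∑ j, x j ^ 2) * ∑ j, ‖u j‖ ^ 2) - (lam + μ) * ‖∑ j, x j * u j‖ ^ 2
        + K * (conj (∑ j, x j * u j) * q).im := by
  rw [sum_conj_mul_linVelocity]
  set D := ∑ j, (x j : ℂ) * u j
  rw [Complex.conj_mul', ← Complex.ofReal_pow, ← Complex.ofReal_mul, ← Complex.ofReal_neg]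
  simp only [Complex.sub_re, Complex.ofReal_re, Complex.mul_re, Complex.mul_im, Complex.I_re,
    Complex.I_im, Complex.ofReal_im]
  ring

/-- The energy identity. The combination `u + i ν x q` produces the dissipation of the density. -/
theorem re_energy_identity :
    (∑ i, conj (u i) * linVelocity μ lam K x u q i).re +
      2 * K * (conj q * linDensity x u).re +
      (∑ i, conj (u i + Complex.I * (lam + 2 * μ : ℝ) * x i * q) *
        (linVelocity μ lam K x u q i +
          Complex.I * (lam + 2 * μ : ℝ) * x i * linDensity x u)).re =
      -(2 * μ * (∑ j, x j ^ 2) * ∑ j, ‖u j‖ ^ 2) - lam * ‖∑ j, x j * u j‖ ^ 2 -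
        (lam + 2 * μ) * K * (∑ j, x j ^ 2) * ‖q‖ ^ 2 := by
  set ν := lam + 2 * μ with hν
  have e1 : conj (∑ j, (x j : ℂ) * u j) = ∑ j, x j * conj (u j) := by simp [map_sum]
  have e2 : ∑ i, conj (u i + Complex.I * ν * x i * q) *
        (linVelocity μ lam K x u q i + Complex.I * ν * x i * linDensity x u) =
      ∑ i, conj (u i) * linVelocity μ lam K x u q i +
        ν * (conj (∑ j, (x j : ℂ) * u j) * ∑ j, (x j : ℂ) * u j) -
        ((ν * K * (∑ j, x j ^ 2) : ℝ) : ℂ) * (conj q * q) := by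
    have e3 : ∑ i, (x i : ℂ) * linVelocity μ lam K x u q i =
        -((ν * ∑ j, x j ^ 2 : ℝ) : ℂ) * (∑ j, (x j : ℂ) * u j) -
          Complex.I * K * ((∑ j, x j ^ 2 : ℝ) : ℂ) * q := by
      have : ∀ i, (x i : ℂ) * linVelocity μ lam K x u q i =
          -((μ * ∑ j, x j ^ 2 : ℝ) : ℂ) * (x i * u i) -
          ((lam + μ : ℝ) : ℂ) * (∑ j, x j * u j) * ((x i ^ 2 : ℝ) : ℂ) -
          Complex.I * K * q * ((x i ^ 2 : ℝ) : ℂ) := fun i ↦ by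
        rw [linVelocity]; push_cast; ring
      simp only [this, Finset.sum_sub_distrib, ← Finset.mul_sum, ← Complex.ofReal_sum]
      rw [hν]
      push_cast
      ring
    have e4 : ∀ i, conj (u i + Complex.I * ν * x i * q) *
        (linVelocity μ lam K x u q i + Complex.I * ν * x i * linDensity x u) =
        conj (u i) * linVelocity μ lam K x u q i +
        Complex.I * ν * linDensity x u * (x i * conj (u i)) -
        Complex.I * ν * conj q * (x i * linVelocity μ lam K x u q i) +
        ν ^ 2 * conj q * linDensity x u * ((x i ^ 2 : ℝ) : ℂ) := fun i ↦ by
      simp only [map_add, map_mul, Complex.conj_I, Complex.conj_ofReal]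
      push_cast
      linear_combination (-(ν : ℂ) ^ 2 * x i ^ 2 * conj q * linDensity x u) * Complex.I_sq
    simp only [e4, Finset.sum_sub_distrib, Finset.sum_add_distrib, ← Finset.mul_sum, e3, ← e1,
      ← Complex.ofReal_sum]
    rw [linDensity]
    set D := ∑ j, (x j : ℂ) * u j
    push_cast
    linear_combination (-(ν : ℂ) * D * conj D + ν * K * (∑ j, (x j : ℂ) ^ 2) * conj q * q) *
      Complex.I_sq
  rw [e2, Complex.sub_re, Complex.add_re, re_sum_conj_mul_linVelocity, linDensity]
  set D := ∑ j, (x j : ℂ) * u j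
  rw [Complex.conj_mul', Complex.conj_mul', ← Complex.ofReal_pow, ← Complex.ofReal_pow,
    ← Complex.ofReal_mul, ← Complex.ofReal_mul]
  simp only [Complex.ofReal_re, Complex.mul_re, Complex.mul_im, Complex.I_re, Complex.neg_re,
    Complex.neg_im, Complex.I_im, Complex.conj_re, Complex.conj_im]
  rw [hν]
  ring

omit μ lam K q in
theorem norm_sum_mul_sq_le :
    ‖∑ j, (x j : ℂ) * u j‖ ^ 2 ≤ (∑ j, x j ^ 2) * ∑ j, ‖u j‖ ^ 2 := by
  have h1 : ‖∑ j, (x j : ℂ) * u j‖ ≤ ∑ j, |x j| * ‖u j‖ := by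
    refine (norm_sum_le _ _).trans (le_of_eq ?_)
    refine Finset.sum_congr rfl fun j _ ↦ ?_
    rw [norm_mul, Complex.norm_real, Real.norm_eq_abs]
  calc ‖∑ j, (x j : ℂ) * u j‖ ^ 2 ≤ (∑ j, |x j| * ‖u j‖) ^ 2 := by gcongr
    _ ≤ (∑ j, |x j| ^ 2) * ∑ j, ‖u j‖ ^ 2 := Finset.sum_mul_sq_le_sq_mul_sq _ _ _
    _ = _ := by simp

/-- The dissipation controls the energy. -/
theorem energy_dissipation {c : ℝ} (hν : 0 < lam + 2 * μ) (hK : 0 < K) (hc : 0 ≤ c)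
    (h1 : 3 * c ≤ 2 * μ) (h2 : 3 * c ≤ lam + 2 * μ)
    (h3 : c * (2 + 2 * (lam + 2 * μ) ^ 2) ≤ lam + 2 * μ) {a : ℝ} (ha0 : 0 ≤ a)
    (ha : a ≤ ∑ j, x j ^ 2) (ha' : a ≤ K) :
    (∑ i, conj (u i) * linVelocity μ lam K x u q i).re +
      2 * K * (conj q * linDensity x u).re +
      (∑ i, conj (u i + Complex.I * (lam + 2 * μ : ℝ) * x i * q) *
        (linVelocity μ lam K x u q i +
          Complex.I * (lam + 2 * μ : ℝ) * x i * linDensity x u)).re ≤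
      -(c * a) * (∑ i, ‖u i‖ ^ 2 + 2 * K * ‖q‖ ^ 2 +
        ∑ i, ‖u i + Complex.I * (lam + 2 * μ : ℝ) * x i * q‖ ^ 2) := by
  rw [re_energy_identity]
  set ν := lam + 2 * μ with hν'
  set R := ∑ j, x j ^ 2 with hR
  set S := ∑ i, ‖u i‖ ^ 2 with hS
  have hR0 : 0 ≤ R := Finset.sum_nonneg fun _ _ ↦ sq_nonneg _
  have hS0 : 0 ≤ S := Finset.sum_nonneg fun _ _ ↦ sq_nonneg _
  have hD := norm_sum_mul_sq_le x u
  rw [← hR, ← hS] at hD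
  have hw : ∑ i, ‖u i + Complex.I * ν * x i * q‖ ^ 2 ≤ 2 * S + 2 * ν ^ 2 * R * ‖q‖ ^ 2 := by
    have : ∀ i, ‖u i + Complex.I * ν * x i * q‖ ^ 2 ≤
        2 * ‖u i‖ ^ 2 + 2 * ν ^ 2 * ‖q‖ ^ 2 * x i ^ 2 := fun i ↦ by
      have e : ‖Complex.I * ν * x i * q‖ ^ 2 = ν ^ 2 * ‖q‖ ^ 2 * x i ^ 2 := by
        simp only [norm_mul, Complex.norm_I, Complex.norm_real, Real.norm_eq_abs, mul_pow, sq_abs]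
        ring
      have h4 := norm_add_le (u i) (Complex.I * ν * x i * q)
      have h5 := norm_nonneg (u i + Complex.I * ν * x i * q)
      nlinarith [sq_nonneg (‖u i‖ - ‖Complex.I * ν * x i * q‖), norm_nonneg (u i),
        norm_nonneg (Complex.I * ν * x i * q)]
    refine (Finset.sum_le_sum fun i _ ↦ this i).trans (le_of_eq ?_)
    rw [Finset.sum_add_distrib, ← Finset.mul_sum, ← Finset.mul_sum]
    ring
  have hu : 3 * c * R * S ≤ 2 * μ * R * S + lam * ‖∑ j, (x j : ℂ) * u j‖ ^ 2 := by
    have hRS : 0 ≤ R * S := mul_nonneg hR0 hS0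
    -- when `lam < 0`, the divergence is bounded by `|x|² |u|²`, and `lam + 2 * μ` remains
    rcases le_total 0 lam with hl | hl
    · have := mul_nonneg hl (sq_nonneg ‖∑ j, (x j : ℂ) * u j‖)
      nlinarith
    · nlinarith [mul_le_mul_of_nonpos_left hD hl]
  have hq0 : 0 ≤ ‖q‖ ^ 2 := sq_nonneg _
  have hca : c * a * S ≤ c * R * S := by gcongr
  have hq1 : c * a * (2 * K + 2 * ν ^ 2 * R) * ‖q‖ ^ 2 ≤ ν * K * R * ‖q‖ ^ 2 := by
    refine mul_le_mul_of_nonneg_right ?_ hq0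
    have t1 : c * a * (2 * K) ≤ c * R * (2 * K) := by gcongr
    have t2 : c * a * (2 * ν ^ 2 * R) ≤ c * K * (2 * ν ^ 2 * R) := by gcongr
    have t3 : c * (2 + 2 * ν ^ 2) * (K * R) ≤ ν * (K * R) := by gcongr
    nlinarith
  have hca0 : 0 ≤ c * a := mul_nonneg hc ha0
  nlinarith [mul_le_mul_of_nonneg_left hw hca0]

/-- The parabolic smoothing of the velocity, the density being a source term. -/
theorem velocity_dissipation {c : ℝ} (h1 : c ≤ μ) (h2 : c ≤ lam + 2 * μ) (hK : 0 < K)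
    {S : ℝ} (hS : S ^ 2 = ∑ j, ‖u j‖ ^ 2) (hS0 : 0 ≤ S) {r : ℝ} (hr : r ^ 2 = ∑ j, x j ^ 2)
    (hr0 : 0 ≤ r) :
    (∑ i, conj (u i) * linVelocity μ lam K x u q i).re ≤ -(c * r ^ 2) * S ^ 2 + S * (K * (r * ‖q‖))
    := by
  rw [re_sum_conj_mul_linVelocity, ← hS, ← hr]
  have hD := norm_sum_mul_sq_le x u
  rw [← hr, ← hS] at hD
  have hD1 : ‖∑ j, (x j : ℂ) * u j‖ ≤ r * S := by
    rw [← mul_pow] at hD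
    exact (pow_le_pow_iff_left₀ (norm_nonneg _) (by positivity) two_ne_zero).1 hD
  have h3 : (conj (∑ j, (x j : ℂ) * u j) * q).im ≤ r * S * ‖q‖ := by
    refine (Complex.im_le_norm _).trans ?_
    rw [norm_mul, RCLike.norm_conj]
    gcongr
  have h4 : K * (conj (∑ j, (x j : ℂ) * u j) * q).im ≤ K * (r * S * ‖q‖) := by gcongr
  have hRS : 0 ≤ r ^ 2 * S ^ 2 := by positivity
  rcases le_total 0 (lam + μ) with hl | hl
  · have := mul_nonneg hl (sq_nonneg ‖∑ j, (x j : ℂ) * u j‖)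
    nlinarith
  · nlinarith [mul_le_mul_of_nonpos_left hD hl]

end Algebra

end LinearCapillary

namespace LinearCapillary

open MeasureTheory Filter Topology Set
open scoped ENNReal ComplexConjugate ContDiff SchwartzMap

variable {d : ℕ}

/-! ### The energy balance of a dyadic block -/

open Classical in
/-- The class in `L²` of a square integrable function, and `0` for other functions. -/
noncomputable def toL2 (f : Space d → ℂ) : Lp ℂ 2 (volume : Measure (Space d)) :=
  if h : MemLp f 2 volume then h.toLp f else 0

theorem coeFn_toL2 {f : Space d → ℂ} (h : MemLp f 2 volume) : toL2 f =ᵐ[volume] f := by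
  rw [toL2, dif_pos h]; exact h.coeFn_toLp

theorem enorm_toL2 {f : Space d → ℂ} (h : MemLp f 2 volume) : ‖toL2 f‖ₑ = l2 fun η ↦ ‖f η‖ₑ := by
  rw [Lp.enorm_def, eLpNorm_congr_ae (coeFn_toL2 h), eLpNorm_two_eq_l2]

theorem inner_toL2 {f g : Space d → ℂ} (hf : MemLp f 2 volume) (hg : MemLp g 2 volume) :
    inner ℂ (toL2 f) (toL2 g) = ∫ η, conj (f η) * g η := by
  rw [L2.inner_def]
  refine integral_congr_ae ?_
  filter_upwards [coeFn_toL2 hf, coeFn_toL2 hg] with η h1 h2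
  rw [h1, h2, RCLike.inner_apply, mul_comm]

theorem integrable_conj_mul {f g : Space d → ℂ} (hf : MemLp f 2 volume) (hg : MemLp g 2 volume) :
    Integrable fun η ↦ conj (f η) * g η := by
  have h1 : MemLp (fun η ↦ conj (f η)) 2 volume := hf.star
  exact h1.integrable_mul hg

theorem norm_integral_conj_mul_le {f g : Space d → ℂ} (hf : AEMeasurable f) (hg : AEMeasurable g) :
    ‖∫ η, conj (f η) * g η‖ₑ ≤ l2 (fun η ↦ ‖f η‖ₑ) * l2 fun η ↦ ‖g η‖ₑ := by
  refine (enorm_integral_le_lintegral_enorm _).trans ?_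
  simp only [enorm_mul, RCLike.enorm_conj]
  exact lintegral_mul_le_l2 hf.enorm hg.enorm

/-- Multiplication by a continuous function is bounded on functions supported in an annulus. -/
theorem exists_l2_mul_le {α : Space d → ℂ} (hα : Continuous α) (l : ℤ) :
    ∃ B : ℝ≥0∞, B ≠ ⊤ ∧ ∀ f : Space d → ℂ, (∀ η, η ∉ annulus d l → f η = 0) →
      l2 (fun η ↦ ‖α η * f η‖ₑ) ≤ B * l2 fun η ↦ ‖f η‖ₑ := by
  obtain ⟨B, hB⟩ := (isCompact_annulus l).exists_bound_of_continuousOn hα.continuousOn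
  refine ⟨ENNReal.ofReal B, ENNReal.ofReal_ne_top, fun f hf ↦ ?_⟩
  rw [← l2_const_mul ENNReal.ofReal_ne_top]
  refine l2_mono (ae_of_all _ fun η ↦ ?_)
  by_cases h : η ∈ annulus d l
  · rw [enorm_mul]
    gcongr
    rw [← ofReal_norm]
    exact ENNReal.ofReal_le_ofReal (hB η h)
  · simp [hf η h]

theorem memLp_mul_of_annulus {α : Space d → ℂ} (hα : Continuous α) {l : ℤ} {f : Space d → ℂ}
    (hf : MemLp f 2 volume) (hs : ∀ η, η ∉ annulus d l → f η = 0) :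
    MemLp (fun η ↦ α η * f η) 2 volume := by
  obtain ⟨B, hB, h⟩ := exists_l2_mul_le hα l
  refine ⟨hα.aestronglyMeasurable.mul hf.1, ?_⟩
  rw [eLpNorm_two_eq_l2]
  refine (h f hs).trans_lt (ENNReal.mul_lt_top hB.lt_top ?_)
  rw [← eLpNorm_two_eq_l2]
  exact hf.2

section Energy

variable {J ι : Type} [Fintype J] [Fintype ι]

/-- The energy of a family of functions of frequency. -/
noncomputable def energy (c : J → Space d → ℂ) : ℝ := ∑ j, ((l2 fun η ↦ ‖c j η‖ₑ).toReal) ^ 2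

omit [Fintype ι] in
theorem energy_nonneg (c : J → Space d → ℂ) : 0 ≤ energy c :=
  Finset.sum_nonneg fun _ _ ↦ sq_nonneg _

omit [Fintype ι] in
theorem l2_toReal_le_sqrt_energy (c : J → Space d → ℂ) (j : J) :
    (l2 fun η ↦ ‖c j η‖ₑ).toReal ≤ √(energy c) := by
  refine Real.le_sqrt_of_sq_le ?_
  exact Finset.single_le_sum (f := fun j ↦ ((l2 fun η ↦ ‖c j η‖ₑ).toReal) ^ 2)
    (fun _ _ ↦ sq_nonneg _) (Finset.mem_univ j)

omit [Fintype ι] in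
theorem energy_eq_integral {c : J → Space d → ℂ} (hc : ∀ j, MemLp (c j) 2 volume) :
    energy c = ∫ η, ∑ j, ‖c j η‖ ^ 2 := by
  rw [integral_finsetSum _ fun j _ ↦ (hc j).norm.integrable_sq, energy]
  refine Finset.sum_congr rfl fun j _ ↦ ?_
  have h1 := inner_toL2 (hc j) (hc j)
  rw [inner_self_eq_norm_sq_to_K] at h1
  have h2 : ‖toL2 (c j)‖ = (l2 fun η ↦ ‖c j η‖ₑ).toReal := by
    rw [← enorm_toL2 (hc j)]; simp
  have h3 : ((∫ η, ‖c j η‖ ^ 2 : ℝ) : ℂ) = ∫ η, conj (c j η) * c j η := by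
    rw [← integral_complex_ofReal]
    refine integral_congr_ae (ae_of_all _ fun η ↦ ?_)
    simp only [Complex.conj_mul']
    push_cast
    rfl
  rw [← h2]
  have h4 : ((‖toL2 (c j)‖ ^ 2 : ℝ) : ℂ) = ((∫ η, ‖c j η‖ ^ 2 : ℝ) : ℂ) := by
    rw [h3, ← h1]; push_cast; rfl
  exact_mod_cast h4

/-- Combinations, with smooth coefficients, of functions that evolve weakly in the frequency
annulus of index `l` are absolutely continuous in time with values in `L²`. -/
theorem block_primitive {l : ℤ} {T : ℝ} (hT : 0 ≤ T) {α : ι → Space d → ℂ}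
    (hα : ∀ a, ContDiff ℝ ∞ (α a)) {Z ρ : ι → ℝ → Space d → ℂ}
    (hZ : ∀ a, ∀ τ ∈ Icc 0 T, MemLp (Z a τ) 2 volume)
    (hZs : ∀ a τ η, η ∉ annulus d l → Z a τ η = 0)
    (hρ : ∀ᵐ τ ∂(volume.restrict (Icc 0 T)), ∀ a, MemLp (ρ a τ) 2 volume ∧
      ∀ η, η ∉ annulus d l → ρ a τ η = 0)
    {b : ℝ → ℝ≥0∞} (hb : ∫⁻ τ in Icc 0 T, b τ < ⊤)
    (hρb : ∀ᵐ τ ∂(volume.restrict (Icc 0 T)), ∀ a, l2 (fun η ↦ ‖ρ a τ η‖ₑ) ≤ b τ)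
    (hev : ∀ a, ∀ t ∈ Icc 0 T, ∀ ψ : 𝓢(Space d, ℂ), HasCompactSupport ψ →
      IntervalIntegrable (fun τ ↦ ∫ η, ψ η * ρ a τ η) volume 0 t ∧
      ∫ η, ψ η * Z a t η = (∫ η, ψ η * Z a 0 η) + ∫ τ in (0 : ℝ)..t, ∫ η, ψ η * ρ a τ η) :
    IntervalIntegrable (fun τ ↦ toL2 fun η ↦ ∑ a, α a η * ρ a τ η) volume 0 T ∧
    ∀ t ∈ Icc 0 T, toL2 (fun η ↦ ∑ a, α a η * Z a t η) = toL2 (fun η ↦ ∑ a, α a η * Z a 0 η) +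
      ∫ τ in (0 : ℝ)..t, toL2 fun η ↦ ∑ a, α a η * ρ a τ η := by
  have hαc := fun a ↦ (hα a).continuous
  choose B hB hBl using fun a ↦ exists_l2_mul_le (hαc a) l
  have hCm : ∀ τ ∈ Icc 0 T, MemLp (fun η ↦ ∑ a, α a η * Z a τ η) 2 volume := fun τ hτ ↦
    memLp_finsetSum _ fun a _ ↦ memLp_mul_of_annulus (hαc a) (hZ a τ hτ) (hZs a τ)
  have hgm : ∀ᵐ τ ∂(volume.restrict (Icc 0 T)),
      MemLp (fun η ↦ ∑ a, α a η * ρ a τ η) 2 volume := by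
    filter_upwards [hρ] with τ hτ
    exact memLp_finsetSum _ fun a _ ↦ memLp_mul_of_annulus (hαc a) (hτ a).1 (hτ a).2
  -- The coefficients are absorbed by the test functions: `g * α a` is again smooth with compact
  -- support, and such functions separate the points of `L²`.
  have htest : ∀ h ∈ {h : Lp ℂ 2 (volume : Measure (Space d)) | ∃ g : Space d → ℝ,
      ContDiff ℝ ∞ g ∧ HasCompactSupport g ∧ h =ᵐ[volume] fun x ↦ (g x : ℂ)},
      ∃ ψ : ι → 𝓢(Space d, ℂ), (∀ a, HasCompactSupport (ψ a)) ∧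
      (∀ τ ∈ Icc 0 T, inner ℂ h (toL2 (fun η ↦ ∑ a, α a η * Z a τ η)) =
        ∑ a, ∫ η, ψ a η * Z a τ η) ∧
      ∀ᵐ τ ∂(volume.restrict (Icc 0 T)), inner ℂ h (toL2 (fun η ↦ ∑ a, α a η * ρ a τ η)) =
        ∑ a, ∫ η, ψ a η * ρ a τ η := by
    rintro h ⟨g, hg, hgc, hgh⟩
    have hc : ∀ a, HasCompactSupport fun x ↦ (g x : ℂ) * α a x := fun a ↦
      (hgc.comp_left Complex.ofReal_zero).mul_right
    have hs : ∀ a, ContDiff ℝ ∞ fun x ↦ (g x : ℂ) * α a x := fun a ↦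
      (Complex.ofRealCLM.contDiff.comp hg).mul (hα a)
    have key : ∀ f : ι → Space d → ℂ, (∀ a, MemLp (f a) 2 volume) →
        (∀ a η, η ∉ annulus d l → f a η = 0) →
        inner ℂ h (toL2 (fun η ↦ ∑ a, α a η * f a η)) =
        ∑ a, ∫ η, ((hc a).toSchwartzMap (hs a)) η * f a η := by
      intro f hf hfs
      have hm := memLp_finsetSum Finset.univ
        (f := fun a η ↦ α a η * f a η) fun a _ ↦ memLp_mul_of_annulus (hαc a) (hf a) (hfs a)
      rw [L2.inner_def, ← integral_finsetSum]
      · refine integral_congr_ae ?_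
        filter_upwards [hgh, coeFn_toL2 hm] with η h1 h2
        rw [h1, h2, RCLike.inner_apply, Complex.conj_ofReal, Finset.sum_mul]
        refine Finset.sum_congr rfl fun a _ ↦ ?_
        change _ = ((g η : ℂ) * α a η) * f a η
        ring
      · intro a _
        exact integrable_mul_of_hasCompactSupport ((hf a).locallyIntegrable (by norm_num)) (hc a)
    refine ⟨fun a ↦ (hc a).toSchwartzMap (hs a), hc, fun τ hτ ↦ key _ (fun a ↦ hZ a τ hτ)
      fun a ↦ hZs a τ, ?_⟩
    filter_upwards [hρ] with τ hτ
    exact key _ (fun a ↦ (hτ a).1) fun a ↦ (hτ a).2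
  refine primitive_of_weak (b := fun τ ↦ (∑ a, B a) * b τ) eq_zero_of_inner_testFunction hT ?_ ?_
    ?_ ?_
  · rw [lintegral_const_mul' _ _ (ENNReal.sum_ne_top.2 fun a _ ↦ hB a)]
    exact ENNReal.mul_lt_top (ENNReal.sum_lt_top.2 fun a _ ↦ (hB a).lt_top) hb
  · filter_upwards [hρ, hρb, hgm] with τ h1 h2 h3
    rw [enorm_toL2 h3, Finset.sum_mul]
    refine le_trans (l2_mono (ae_of_all _ fun η ↦ enorm_sum_le _ _)) ?_
    refine (l2_sum_le _ fun a _ ↦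
      ((hαc a).aestronglyMeasurable.mul (h1 a).1.1).enorm).trans (Finset.sum_le_sum fun a _ ↦ ?_)
    exact (hBl a _ (h1 a).2).trans (by gcongr; exact h2 a)
  · intro h hh
    obtain ⟨ψ, hψ, -, h2⟩ := htest h hh
    refine AEStronglyMeasurable.congr (f := fun τ ↦ ∑ a, ∫ η, ψ a η * ρ a τ η) ?_
      (h2.mono fun τ h ↦ h.symm)
    refine Finset.aestronglyMeasurable_fun_sum _ fun a _ ↦ ?_
    have := (hev a T ⟨hT, le_rfl⟩ (ψ a) (hψ a)).1
    exact ((intervalIntegrable_iff_integrableOn_Icc_of_le hT).1 this).1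
  · intro h hh t ht
    obtain ⟨ψ, hψ, h1, h2⟩ := htest h hh
    rw [h1 t ht, h1 0 ⟨le_rfl, hT⟩]
    have e : ∫ τ in (0 : ℝ)..t, inner ℂ h (toL2 (fun η ↦ ∑ a, α a η * ρ a τ η)) =
        ∫ τ in (0 : ℝ)..t, ∑ a, ∫ η, ψ a η * ρ a τ η := by
      rw [intervalIntegral.integral_of_le ht.1, intervalIntegral.integral_of_le ht.1]
      refine integral_congr_ae (ae_restrict_of_ae_restrict_of_subset ?_ h2)
      exact Ioc_subset_Icc_self.trans (Icc_subset_Icc_right ht.2)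
    rw [e, intervalIntegral.integral_finsetSum fun a _ ↦ (hev a t ht (ψ a) (hψ a)).1,
      ← Finset.sum_add_distrib]
    exact Finset.sum_congr rfl fun a _ ↦ (hev a t ht (ψ a) (hψ a)).2

/-- The energy inequality of a block. -/
theorem block_energy {l : ℤ} {T : ℝ} (hT : 0 ≤ T) {α : J → ι → Space d → ℂ}
    (hα : ∀ j a, ContDiff ℝ ∞ (α j a)) {Z ρ : ι → ℝ → Space d → ℂ}
    (hZ : ∀ a, ∀ τ ∈ Icc 0 T, MemLp (Z a τ) 2 volume)
    (hZs : ∀ a τ η, η ∉ annulus d l → Z a τ η = 0)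
    (hρ : ∀ᵐ τ ∂(volume.restrict (Icc 0 T)), ∀ a, MemLp (ρ a τ) 2 volume ∧
      ∀ η, η ∉ annulus d l → ρ a τ η = 0)
    {b : ℝ → ℝ≥0∞} (hb : ∫⁻ τ in Icc 0 T, b τ < ⊤)
    (hρb : ∀ᵐ τ ∂(volume.restrict (Icc 0 T)), ∀ a, l2 (fun η ↦ ‖ρ a τ η‖ₑ) ≤ b τ)
    (hev : ∀ a, ∀ t ∈ Icc 0 T, ∀ ψ : 𝓢(Space d, ℂ), HasCompactSupport ψ →
      IntervalIntegrable (fun τ ↦ ∫ η, ψ η * ρ a τ η) volume 0 t ∧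
      ∫ η, ψ η * Z a t η = (∫ η, ψ η * Z a 0 η) + ∫ τ in (0 : ℝ)..t, ∫ η, ψ η * ρ a τ η)
    {c : J → ℝ → Space d → ℂ} (hc : ∀ j τ η, c j τ η = ∑ a, α j a η * Z a τ η) :
    ContinuousOn (fun t ↦ energy fun j ↦ c j t) (Icc 0 T) ∧
    ∀ {κ : ℝ}, 0 ≤ κ → ∀ {R : ℝ → ℝ}, (∀ t, 0 ≤ R t) → IntervalIntegrable R volume 0 T →
    (∀ᵐ τ ∂(volume.restrict (Icc 0 T)), ∑ j, (∫ η, conj (c j τ η) * ∑ a, α j a η * ρ a τ η).re ≤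
      -κ * energy (fun j ↦ c j τ) + √(energy fun j ↦ c j τ) * R τ) →
    ∀ t ∈ Icc 0 T, √(energy fun j ↦ c j t) + κ * ∫ τ in (0 : ℝ)..t, √(energy fun j ↦ c j τ) ≤
      √(energy fun j ↦ c j 0) + ∫ τ in (0 : ℝ)..t, R τ := by
  have hcm : ∀ j, ∀ τ ∈ Icc 0 T, MemLp (c j τ) 2 volume := fun j τ hτ ↦ by
    rw [show c j τ = _ from funext (hc j τ)]
    exact memLp_finsetSum _ fun a _ ↦ memLp_mul_of_annulus (hα j a).continuous (hZ a τ hτ) (hZs a τ)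
  have hρm : ∀ᵐ τ ∂(volume.restrict (Icc 0 T)), ∀ j,
      MemLp (fun η ↦ ∑ a, α j a η * ρ a τ η) 2 volume := by
    filter_upwards [hρ] with τ hτ j
    exact memLp_finsetSum _ fun a _ ↦ memLp_mul_of_annulus (hα j a).continuous (hτ a).1 (hτ a).2
  have hprim := fun j ↦ block_primitive hT (hα j) hZ hZs hρ hb hρb hev
  simp only [← hc] at hprim
  have hy : ∀ τ ∈ Icc 0 T, energy (fun j ↦ c j τ) = ∑ j, ‖toL2 (c j τ)‖ ^ 2 := fun τ hτ ↦ by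
    refine Finset.sum_congr rfl fun j _ ↦ ?_
    rw [← enorm_toL2 (hcm j τ hτ)]; simp
  have hcont : ContinuousOn (fun t ↦ energy fun j ↦ c j t) (Icc 0 T) := by
    have : ContinuousOn (fun t ↦ ∑ j, ‖toL2 (c j t)‖ ^ 2) (Icc 0 T) :=
      continuousOn_finsetSum _ fun j _ ↦
        (continuousOn_of_primitive hT (hprim j).1 (hprim j).2).norm.pow 2
    exact this.congr hy
  refine ⟨hcont, fun {κ} hκ {R} hR0 hR hle t ht ↦ ?_⟩
  have hsub : ∀ s ∈ Icc 0 t, s ∈ Icc 0 T := fun s hs ↦ ⟨hs.1, hs.2.trans ht.2⟩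
  have hmono : ∀ {E : Type} [NormedAddCommGroup E] [NormedSpace ℝ E] {f : ℝ → E},
      IntervalIntegrable f volume 0 T → ∀ s ∈ Icc 0 T, IntervalIntegrable f volume 0 s :=
    fun hf s hs ↦ hf.mono_set (uIcc_subset_uIcc (by simp) (by rw [uIcc_of_le hT]; exact hs))
  have hsq := fun j ↦ fun s (hs : s ∈ Icc 0 T) ↦ norm_sq_of_primitive hs.1
    ((hprim j).1.mono_set (uIcc_subset_uIcc (by simp) (by rw [uIcc_of_le hT]; exact hs)))
    (fun s' hs' ↦ (hprim j).2 s' ⟨hs'.1, hs'.2.trans hs.2⟩)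
  refine sqrt_add_integral_sqrt_le (y := fun t ↦ energy fun j ↦ c j t)
    (z := fun τ ↦ ∑ j, 2 * (inner ℂ (toL2 (c j τ)) (toL2 fun η ↦ ∑ a, α j a η * ρ a τ η)).re)
    (r := R) ht.1 hκ ?_ (hmono hR t ht) ?_ (fun _ ↦ energy_nonneg _) hR0 ?_
  · have := IntervalIntegrable.sum (μ := volume) (a := 0) (b := t) Finset.univ fun j _ ↦ (hsq j t ht).1
    simpa [Finset.sum_fn] using this
  · intro s hs
    rw [hy s (hsub s hs), hy 0 ⟨le_rfl, hT⟩,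
      intervalIntegral.integral_finsetSum fun j _ ↦ (hsq j s (hsub s hs)).1,
      ← Finset.sum_add_distrib]
    exact Finset.sum_congr rfl fun j _ ↦ (hsq j s (hsub s hs)).2
  · have h1 := (ae_restrict_iff' measurableSet_Icc).1 hle
    have h2 := (ae_restrict_iff' measurableSet_Icc).1 hρm
    filter_upwards [h1, h2] with τ h1 h2 hτ
    have hτ' := hsub τ hτ
    have := h1 hτ'
    rw [← Finset.mul_sum]
    simp only [fun j ↦ inner_toL2 (hcm j τ hτ') (h2 hτ' j), ← Complex.re_sum]
    rw [Complex.re_sum]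
    linarith

end Energy

end LinearCapillary

namespace LinearCapillary

open MeasureTheory Filter Topology Set
open scoped ENNReal ComplexConjugate ContDiff

variable {d : ℕ}

/-! ### The energy balance of one component at a fixed time -/

/-- The weight of an unknown of the system: the density, indexed by `none`, is measured together
with its gradient. -/
noncomputable def unknownWeight (a : Option (Fin d)) (η : Space d) : ℝ :=
  a.elim (1 + freq η) fun _ ↦ 1

theorem one_le_unknownWeight (a : Option (Fin d)) (η : Space d) : 1 ≤ unknownWeight a η := by
  cases a
  · exact le_add_of_nonneg_right (freq_nonneg η)
  · exact le_rfl

theorem measurable_unknownWeight (a : Option (Fin d)) :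
    Measurable (unknownWeight a : Space d → ℝ) := by
  cases a
  · exact measurable_const.add measurable_freq
  · exact measurable_const

/-- The value of `unknownWeight` on the annulus of index `l`, up to a constant. -/
noncomputable def dyadicUnknownWeight (a : Option (Fin d)) (l : ℤ) : ℝ≥0∞ :=
  a.elim (1 + dyadicWeight 1 l) fun _ ↦ 1

theorem dyadicUnknownWeight_ne_top (a : Option (Fin d)) (l : ℤ) : dyadicUnknownWeight a l ≠ ⊤ := by
  cases a
  · exact ENNReal.add_ne_top.2 ⟨ENNReal.one_ne_top, dyadicWeight_ne_top 1 l⟩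
  · exact ENNReal.one_ne_top

theorem unknownWeight_le_of_mem_annulus (a : Option (Fin d)) {l : ℤ} {η : Space d}
    (h : η ∈ annulus d l) :
    ENNReal.ofReal (unknownWeight a η) ≤ ENNReal.ofReal (8 / 3) * dyadicUnknownWeight a l := by
  have h1 : (1 : ℝ≥0∞) ≤ ENNReal.ofReal (8 / 3) := by
    rw [ENNReal.one_le_ofReal]; norm_num
  cases a
  · change ENNReal.ofReal (1 + freq η) ≤ ENNReal.ofReal (8 / 3) * (1 + dyadicWeight 1 l)
    rw [ENNReal.ofReal_add zero_le_one (freq_nonneg η), mul_add, mul_one, ENNReal.ofReal_one,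
      dyadicWeight_one, ← ENNReal.ofReal_mul (by norm_num)]
    exact add_le_add h1 (ENNReal.ofReal_le_ofReal h.2)
  · change ENNReal.ofReal 1 ≤ ENNReal.ofReal (8 / 3) * 1
    simpa using h1

/-- The weighted size `(1 + |ξ|) |q| + ∑ |u_i|` of the unknowns. -/
noncomputable def stateSize (X : Option (Fin d) → Space d → ℂ) (η : Space d) : ℝ≥0∞ :=
  ∑ a, ENNReal.ofReal (unknownWeight a η) * ‖X a η‖ₑ

theorem enorm_le_stateSize (X : Option (Fin d) → Space d → ℂ) (a : Option (Fin d)) (η : Space d) :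
    ‖X a η‖ₑ ≤ stateSize X η := by
  refine le_trans ?_ (Finset.single_le_sum
    (f := fun a ↦ ENNReal.ofReal (unknownWeight a η) * ‖X a η‖ₑ) (fun _ _ ↦ zero_le)
    (Finset.mem_univ a))
  refine le_mul_of_one_le_left zero_le ?_
  rw [ENNReal.one_le_ofReal]
  exact one_le_unknownWeight a η

/-- Coefficients of a linear combination of the unknowns whose energy can be estimated: they are
smooth, dominated by the weights of the unknowns, and vary slowly with the frequency. -/
structure IsAdmissible (L : ℝ) (α : Option (Fin d) → Space d → ℂ) : Prop where
  smooth : ∀ a, ContDiff ℝ ∞ (α a)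
  norm_le : ∀ a η, ‖α a η‖ ≤ L * unknownWeight a η
  slow : ∀ a ξ η, freq η * ‖α a ξ - α a η‖ ≤ L * freq (ξ - η) * unknownWeight a η

/-- At a fixed time, the Fourier transforms `V` of the convection field and `X` of the unknowns. -/
structure IsFourierState (χ : Space d → ℝ) (σ : ℝ) (V : Fin d → Space d → ℂ)
    (X : Option (Fin d) → Space d → ℂ) : Prop where
  measurable_field : ∀ i, Measurable (V i)
  real : ∀ i, ∀ᵐ η, V i (-η) = conj (V i η)
  field : ∀ i, ∑' j, dyadicWeight ((d : ℝ) / 2) j * blockNorm χ j (fun η ↦ ‖V i η‖ₑ) < ⊤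
  field' : ∀ i, ∑' j, dyadicWeight ((d : ℝ) / 2 + 1) j * blockNorm χ j (fun η ↦ ‖V i η‖ₑ) < ⊤
  measurable : ∀ a, Measurable (X a)
  state : ∑' j, dyadicWeight σ j * blockNorm χ j (stateSize X) < ⊤

section Balance

variable {χ : Space d → ℝ} {σ : ℝ} {V : Fin d → Space d → ℂ} {X : Option (Fin d) → Space d → ℂ}

theorem IsFourierState.unknown (h : IsFourierState χ σ V X) (a : Option (Fin d)) :
    ∑' j, dyadicWeight σ j * blockNorm χ j (fun η ↦ ‖X a η‖ₑ) < ⊤ :=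
  (ENNReal.tsum_le_tsum fun j ↦ mul_le_mul_right
    (blockNorm_mono χ j fun η ↦ enorm_le_stateSize X a η) _).trans_lt h.state

theorem IsFourierState.vecSize (hχ : IsCutoff χ) (h : IsFourierState χ σ V X) :
    ∑' j, dyadicWeight ((d : ℝ) / 2) j * blockNorm χ j (vecSize V) < ⊤ := by
  refine lt_of_le_of_lt (ENNReal.tsum_le_tsum fun j ↦ mul_le_mul_right (blockNorm_mono χ j
      (g := fun ζ ↦ (ENNReal.ofReal 1 + ENNReal.ofReal (freq ζ)) * LinearCapillary.vecSize V ζ)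
      fun η ↦ le_mul_of_one_le_left zero_le (by simp)) _)
    ((tsum_blockNorm_weight_vecSize_le hχ h.measurable_field 1).trans_lt
      (ENNReal.sum_lt_top.2 fun i _ ↦ ENNReal.add_lt_top.2
      ⟨ENNReal.mul_lt_top ENNReal.ofReal_lt_top (h.field i),
        ENNReal.mul_lt_top ENNReal.ofReal_lt_top (h.field' i)⟩))

theorem IsFourierState.gradSize (hχ : IsCutoff χ) (h : IsFourierState χ σ V X) :
    ∑' j, dyadicWeight ((d : ℝ) / 2) j * blockNorm χ j (gradSize V) < ⊤ := by
  refine lt_of_le_of_lt (ENNReal.tsum_le_tsum fun j ↦ mul_le_mul_right (blockNorm_mono χ j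
      (g := fun ζ ↦ (ENNReal.ofReal 0 + ENNReal.ofReal (freq ζ)) * LinearCapillary.vecSize V ζ)
      fun η ↦ by simp [LinearCapillary.gradSize]) _)
    ((tsum_blockNorm_weight_vecSize_le hχ h.measurable_field 0).trans_lt
      (ENNReal.sum_lt_top.2 fun i _ ↦ ENNReal.add_lt_top.2
      ⟨ENNReal.mul_lt_top ENNReal.ofReal_lt_top (h.field i),
        ENNReal.mul_lt_top ENNReal.ofReal_lt_top (h.field' i)⟩))

theorem paraSum_lt_top (h1 : -((d : ℝ) / 2) < σ) (h2 : σ ≤ (d : ℝ) / 2) {w y : ℤ → ℝ≥0∞}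
    (hw : ∑' j, dyadicWeight ((d : ℝ) / 2) j * w j < ⊤) (hy : ∑' j, dyadicWeight σ j * y j < ⊤)
    (l : ℤ) : paraSum d w y l < ⊤ := by
  obtain ⟨K, hK, hk⟩ := exists_tsum_paraSum_le h1 h2
  exact lt_top_of_mul_lt_top_left (dyadicWeight_ne_zero σ l) ((ENNReal.le_tsum l).trans_lt
    ((hk w y).trans_lt (ENNReal.mul_lt_top hK.lt_top (ENNReal.mul_lt_top hw hy))))

/-- The energy balance of a linear combination `c` of the unknowns, localized at the block `l`:
up to the contribution of the linear part `B`, the time derivative of half the square of its norm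
is controlled by the source `h` and by the gradient of the convection field. -/
theorem exists_component_balance (hχ : IsCutoff χ) (hd : 0 < d) (h1 : -((d : ℝ) / 2) < σ)
    (h2 : σ ≤ (d : ℝ) / 2) {L : ℝ} (hL : 0 ≤ L) : ∃ K : ℝ, 0 ≤ K ∧
    ∀ (l : ℤ) (V : Fin d → Space d → ℂ) (X : Option (Fin d) → Space d → ℂ),
    IsFourierState χ σ V X → ∀ α : Option (Fin d) → Space d → ℂ, IsAdmissible L α →
    ∀ h B : Option (Fin d) → Space d → ℂ, (∀ a, MemLp (h a) 2 volume) →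
    (∀ a η, η ∉ annulus d l → h a η = 0) → (∀ a, MemLp (B a) 2 volume) →
    (∀ a η, η ∉ annulus d l → B a η = 0) →
    ∀ c : Space d → ℂ, (∀ η, c η = ∑ a, α a η * (blockSymbol χ l η * X a η)) →
    MemLp c 2 volume →
    (∀ a, MemLp (fun η ↦ blockSymbol χ l η * convFourier V (X a) η) 2 volume) →
    (∫ η, conj (c η) * ∑ a, α a η *
      (h a η - blockSymbol χ l η * convFourier V (X a) η + B a η)).re ≤
    (∫ η, conj (c η) * ∑ a, α a η * B a η).re + (l2 fun η ↦ ‖c η‖ₑ).toReal *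
      (K * (paraSum d (fun j ↦ blockNorm χ j (gradSize V)) (fun j ↦ blockNorm χ j (stateSize X)) l
        + ∑ a, dyadicUnknownWeight a l * l2 fun η ↦ ‖h a η‖ₑ).toReal) := by
  obtain ⟨K₀, hK₀, hk₀⟩ := exists_convection_energy_le hχ hd hL
  obtain ⟨K₁, hK₁, hk₁⟩ := exists_triForm_indicator_le hχ hd
  obtain ⟨K₂, hK₂, hk₂⟩ := exists_convFourier_bound hχ hd h1 h2
  refine ⟨max K₀.toReal (L * (8 / 3)), le_max_of_le_left ENNReal.toReal_nonneg,
    fun l V X hs α hα h B hh hhs hB hBs c hc hcm hn ↦ ?_⟩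
  have hαc := fun a ↦ (hα.smooth a).continuous
  have hcm' : Measurable c := by
    have := hs.measurable
    have hb := (hχ.continuous_blockSymbol l).measurable
    have hα' := fun a ↦ (hαc a).measurable
    rw [show c = _ from funext hc]
    fun_prop
  have hcs : ∀ η, η ∉ annulus d l → c η = 0 := fun η hη ↦ by
    simp [hc, hχ.blockSymbol_eq_zero hη]
  have hnc : ∀ η, η ∉ annulus d l → ∀ a,
      (blockSymbol χ l η : ℂ) * convFourier V (X a) η = 0 := fun η hη a ↦ by
    simp [hχ.blockSymbol_eq_zero hη]
  -- the three contributions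
  have i1 : ∀ a, MemLp (fun η ↦ α a η * h a η) 2 volume := fun a ↦
    memLp_mul_of_annulus (hαc a) (hh a) (hhs a)
  have i2 : ∀ a, MemLp (fun η ↦ α a η * (blockSymbol χ l η * convFourier V (X a) η)) 2 volume :=
    fun a ↦ memLp_mul_of_annulus (hαc a) (hn a) fun η hη ↦ hnc η hη a
  have i3 : ∀ a, MemLp (fun η ↦ α a η * B a η) 2 volume := fun a ↦
    memLp_mul_of_annulus (hαc a) (hB a) (hBs a)
  have j1 := memLp_finsetSum Finset.univ fun a _ ↦ i1 a
  have j2 := memLp_finsetSum Finset.univ fun a _ ↦ i2 a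
  have j3 := memLp_finsetSum Finset.univ fun a _ ↦ i3 a
  have hsplit : (∫ η, conj (c η) * ∑ a, α a η *
      (h a η - blockSymbol χ l η * convFourier V (X a) η + B a η)) =
      (∫ η, conj (c η) * ∑ a, α a η * h a η)
      - (∫ η, conj (c η) * ∑ a, α a η * (blockSymbol χ l η * convFourier V (X a) η))
      + ∫ η, conj (c η) * ∑ a, α a η * B a η := by
    have k1 : Integrable fun η ↦ conj (c η) * (∑ a, α a η * h a η) - conj (c η) *
        ∑ a, α a η * (blockSymbol χ l η * convFourier V (X a) η) :=
      (integrable_conj_mul hcm j1).sub (integrable_conj_mul hcm j2)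
    rw [← integral_sub (integrable_conj_mul hcm j1) (integrable_conj_mul hcm j2),
      ← integral_add k1 (integrable_conj_mul hcm j3)]
    refine integral_congr_ae (ae_of_all _ fun η ↦ ?_)
    simp only [mul_add, mul_sub, Finset.sum_add_distrib, Finset.sum_sub_distrib]
  have hpara := paraSum_lt_top h1 h2 (hs.gradSize hχ) hs.state l
  have hcl : l2 (fun η ↦ ‖c η‖ₑ) < ⊤ := by
    rw [← eLpNorm_two_eq_l2]; exact hcm.eLpNorm_lt_top
  have hhl : ∀ a, l2 (fun η ↦ ‖h a η‖ₑ) < ⊤ := fun a ↦ by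
    rw [← eLpNorm_two_eq_l2]; exact (hh a).eLpNorm_lt_top
  have hsum : ∑ a, dyadicUnknownWeight a l * l2 (fun η ↦ ‖h a η‖ₑ) < ⊤ :=
    ENNReal.sum_lt_top.2 fun a _ ↦
      ENNReal.mul_lt_top (dyadicUnknownWeight_ne_top a l).lt_top (hhl a)
  -- the source
  have s1 : (∫ η, conj (c η) * ∑ a, α a η * h a η).re ≤ (l2 fun η ↦ ‖c η‖ₑ).toReal *
      (L * (8 / 3) * (∑ a, dyadicUnknownWeight a l * l2 fun η ↦ ‖h a η‖ₑ).toReal) := by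
    have e1 : l2 (fun η ↦ ‖∑ a, α a η * h a η‖ₑ) ≤
        ENNReal.ofReal (L * (8 / 3)) * ∑ a, dyadicUnknownWeight a l * l2 fun η ↦ ‖h a η‖ₑ := by
      refine (l2_mono (ae_of_all _ fun η ↦ enorm_sum_le _ _)).trans
        ((l2_sum_le _ fun a _ ↦ (i1 a).1.enorm).trans ?_)
      rw [Finset.mul_sum]
      refine Finset.sum_le_sum fun a _ ↦ ?_
      rw [← mul_assoc, ← l2_const_mul (ENNReal.mul_ne_top ENNReal.ofReal_ne_top
        (dyadicUnknownWeight_ne_top a l))]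
      refine l2_mono (ae_of_all _ fun η ↦ ?_)
      by_cases hη : η ∈ annulus d l
      · rw [enorm_mul]
        gcongr
        rw [ENNReal.ofReal_mul hL, mul_assoc, ← ofReal_norm]
        refine (ENNReal.ofReal_le_ofReal (hα.norm_le a η)).trans ?_
        rw [ENNReal.ofReal_mul hL]
        gcongr
        exact unknownWeight_le_of_mem_annulus a hη
      · simp [hhs a η hη]
    have e2 := (norm_integral_conj_mul_le hcm.1.aemeasurable j1.1.aemeasurable).trans
      (mul_le_mul_right e1 _)
    have e3 := ENNReal.toReal_mono (ENNReal.mul_ne_top hcl.ne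
      (ENNReal.mul_ne_top ENNReal.ofReal_ne_top hsum.ne)) e2
    rw [ENNReal.toReal_mul, ENNReal.toReal_mul, ENNReal.toReal_ofReal (by positivity),
      toReal_enorm] at e3
    exact (Complex.re_le_norm _).trans e3
  -- the convection
  have s2 : -(∫ η, conj (c η) * ∑ a, α a η *
      (blockSymbol χ l η * convFourier V (X a) η)).re ≤ (l2 fun η ↦ ‖c η‖ₑ).toReal *
      (K₀.toReal * (paraSum d (fun j ↦ blockNorm χ j (gradSize V))
        (fun j ↦ blockNorm χ j (stateSize X)) l).toReal) := by
    have hcY : ∀ η, ‖c η‖ₑ ≤ ENNReal.ofReal L * stateSize X η := fun η ↦ by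
      rw [hc, stateSize, Finset.mul_sum]
      refine (enorm_sum_le _ _).trans (Finset.sum_le_sum fun a _ ↦ ?_)
      rw [enorm_mul, ← mul_assoc, ← ENNReal.ofReal_mul hL, ← ofReal_norm (α a η),
        hχ.enorm_blockSymbol_mul]
      gcongr
      · exact hα.norm_le a η
      · exact mul_le_of_le_one_left zero_le (ENNReal.ofReal_le_one.2 (hχ.blockSymbol_le_one hd l η))
    have htri : triForm (fun ξ ↦ ‖c ξ‖ₑ) (vecSize V) (fun ξ ↦ ‖c ξ‖ₑ) < ⊤ := by
      have e1 := hk₁ l (fun ξ ↦ ‖c ξ‖ₑ) (vecSize V) (fun ξ ↦ ‖c ξ‖ₑ) hcm'.enorm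
        (measurable_vecSize hs.measurable_field) hcm'.enorm
      have e2 : (fun ξ ↦ ‖c ξ‖ₑ * (annulus d l).indicator 1 ξ) = fun ξ ↦ ‖c ξ‖ₑ := by
        funext ξ
        by_cases hξ : ξ ∈ annulus d l
        · simp [hξ]
        · simp [hcs ξ hξ]
      rw [e2] at e1
      refine (le_self_add.trans e1).trans_lt (ENNReal.mul_lt_top hK₁.lt_top
        (ENNReal.mul_lt_top hcl (paraSum_lt_top h1 h2 (hs.vecSize hχ) ?_ l)))
      refine lt_of_le_of_lt (ENNReal.tsum_le_tsum fun j ↦ mul_le_mul_right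
        (blockNorm_mono χ j hcY) _) ?_
      simp only [blockNorm_const_mul _ ENNReal.ofReal_ne_top, mul_left_comm _ (ENNReal.ofReal L)]
      rw [ENNReal.tsum_mul_left]
      exact ENNReal.mul_lt_top ENNReal.ofReal_lt_top hs.state
    have e4 := hk₀ l (Option (Fin d)) V X unknownWeight α c (stateSize X) hs.measurable_field hs.real
      hs.measurable measurable_unknownWeight (fun a ↦ (hαc a).measurable) hα.norm_le hα.slow
      (fun ξ ↦ by rw [hc, Finset.mul_sum]; exact Finset.sum_congr rfl fun a _ ↦ by ring)
      (fun ξ ↦ rfl)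
      (fun a ↦ (hk₂ V (X a) hs.measurable_field (hs.measurable a) hs.field hs.field'
        (hs.unknown a)).1) htri (ENNReal.mul_lt_top hcl hpara)
    have e5 := ENNReal.toReal_mono (ENNReal.mul_ne_top hK₀
      (ENNReal.mul_lt_top hcl hpara).ne) e4
    rw [ENNReal.toReal_mul, ENNReal.toReal_mul, toReal_enorm, Real.norm_eq_abs] at e5
    have e6 : (∫ η, conj (c η) * ∑ a, α a η * (blockSymbol χ l η * convFourier V (X a) η)) =
        ∫ ξ, conj (c ξ) * (blockSymbol χ l ξ * ∑ a, α a ξ * convFourier V (X a) ξ) := by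
      refine integral_congr_ae (ae_of_all _ fun η ↦ ?_)
      simp only [Finset.mul_sum]
      exact Finset.sum_congr rfl fun a _ ↦ by ring
    rw [e6]
    refine (neg_le_abs _).trans (e5.trans (le_of_eq (by ring)))
  rw [hsplit, Complex.add_re, Complex.sub_re, ENNReal.toReal_add hpara.ne hsum.ne]
  have hc0 : 0 ≤ (l2 fun η ↦ ‖c η‖ₑ).toReal := ENNReal.toReal_nonneg
  set P := (paraSum d (fun j ↦ blockNorm χ j (gradSize V))
        (fun j ↦ blockNorm χ j (stateSize X)) l).toReal with hP
  set S := (∑ a, dyadicUnknownWeight a l * l2 fun η ↦ ‖h a η‖ₑ).toReal with hS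
  have hP0 : 0 ≤ P := ENNReal.toReal_nonneg
  have hS0 : 0 ≤ S := ENNReal.toReal_nonneg
  have t1 : L * (8 / 3) * S ≤ max K₀.toReal (L * (8 / 3)) * S :=
    mul_le_mul_of_nonneg_right (le_max_right _ _) hS0
  have t2 : K₀.toReal * P ≤ max K₀.toReal (L * (8 / 3)) * P :=
    mul_le_mul_of_nonneg_right (le_max_left _ _) hP0
  have t3 := mul_le_mul_of_nonneg_left t1 hc0
  have t4 := mul_le_mul_of_nonneg_left t2 hc0
  rw [mul_add, mul_add]
  linarith

end Balance

end LinearCapillary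

namespace LinearCapillary

open MeasureTheory Filter Topology Set
open scoped ENNReal ComplexConjugate ContDiff LineDeriv Laplacian

variable {d : ℕ}

/-! ### The linear part of the system -/

/-- The linear part of the system, for the unknowns `q` (index `none`) and `u` (index `some i`). -/
noncomputable def linOp (μ lam p k ε : ℝ) (f : Option (Fin d) → Distr d) (a : Option (Fin d)) :
    Distr d :=
  a.elim (-divergence fun i ↦ f (some i)) fun i ↦
    viscosity μ lam (fun i ↦ f (some i)) i - (p : ℂ) • partialD i (f none)
      + ((k / ε ^ 2 : ℝ) : ℂ) • partialD i (capillaryConv ε (f none) - f none)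

/-- The symbol of `linOp`, applied to a vector `z`. -/
noncomputable def linPart (μ lam p k ε : ℝ) (η : Space d) (z : Option (Fin d) → ℂ)
    (a : Option (Fin d)) : ℂ :=
  a.elim (linDensity (fun i ↦ 2 * Real.pi * η i) fun i ↦ z (some i))
    (linVelocity μ lam (capSymbol p k ε (freq η)) (fun i ↦ 2 * Real.pi * η i)
      (fun i ↦ z (some i)) (z none))

theorem sum_coord_sq (η : Space d) : ∑ i, (2 * Real.pi * η i) ^ 2 = freq η ^ 2 := by
  rw [freq_eq, mul_pow, EuclideanSpace.real_norm_sq_eq, Finset.mul_sum]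
  exact Finset.sum_congr rfl fun i _ ↦ by ring

theorem HasFourier.linOp {f : Option (Fin d) → Distr d} {X : Option (Fin d) → Space d → ℂ}
    (h : ∀ a, HasFourier (f a) (X a)) (μ lam p k ε : ℝ) (a : Option (Fin d)) :
    HasFourier (linOp μ lam p k ε f a) fun η ↦ linPart μ lam p k ε η (fun b ↦ X b η) a := by
  cases a with
  | none =>
    have e : LinearCapillary.linOp μ lam p k ε f none =
        (-1 : ℂ) • LinearCapillary.divergence fun i ↦ f (some i) :=
      (neg_one_smul ℂ (LinearCapillary.divergence fun i ↦ f (some i))).symm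
    rw [e]
    refine (congrArg (HasFourier _) (funext fun η ↦ ?_)).mp
      ((HasFourier.divergence fun i ↦ h (some i)).const_smul (-1))
    simp only [linPart, linDensity, Option.elim, Finset.mul_sum]
    exact Finset.sum_congr rfl fun i _ ↦ by ring
  | some i =>
    have h1 := ((h (some i)).laplacian.const_smul μ).add
      (((HasFourier.divergence fun i ↦ h (some i)).partialD i).const_smul ((lam + μ : ℝ) : ℂ))
    have h2 := ((h none).partialD i).const_smul p
    have h3 := (((((h none).capillaryConv ε).sub (h none)).partialD i)).const_smul
      ((k / ε ^ 2 : ℝ) : ℂ)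
    refine (congrArg (HasFourier _) (funext fun η ↦ ?_)).mp ((h1.sub h2).add h3)
    simp only [linPart, linVelocity, Option.elim, sum_coord_sq, capSymbol]
    have e : ∑ j, (Complex.I * ((2 * Real.pi * η j : ℝ) : ℂ)) * X (some j) η =
        Complex.I * ∑ j, ((2 * Real.pi * η j : ℝ) : ℂ) * X (some j) η := by
      rw [Finset.mul_sum]; exact Finset.sum_congr rfl fun j _ ↦ by ring
    rw [e]
    push_cast
    linear_combination (((lam : ℂ) + μ) * (2 * Real.pi * η i) *
      ∑ j, (2 * Real.pi * (η j : ℂ)) * X (some j) η) * Complex.I_sq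

/-- The entries of the matrix of `linPart`. -/
noncomputable def linMatrix (μ lam p k ε : ℝ) (a b : Option (Fin d)) (η : Space d) : ℂ :=
  linPart μ lam p k ε η (fun j ↦ if b = j then 1 else 0) a

theorem isLinearMap_linPart (μ lam p k ε : ℝ) (η : Space d) (a : Option (Fin d)) :
    IsLinearMap ℂ fun z ↦ linPart μ lam p k ε η z a := by
  constructor
  · intro z z'
    cases a
    · simp only [linPart, linDensity, Option.elim, Pi.add_apply, mul_add, Finset.sum_add_distrib]
    · simp only [linPart, linVelocity, Option.elim, Pi.add_apply, mul_add, Finset.sum_add_distrib]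
      ring
  · intro c z
    cases a
    · simp only [linPart, linDensity, Option.elim, Pi.smul_apply, smul_eq_mul, mul_left_comm _ c,
        ← Finset.mul_sum]
    · simp only [linPart, linVelocity, Option.elim, Pi.smul_apply, smul_eq_mul, mul_left_comm _ c,
        ← Finset.mul_sum]
      ring

theorem linPart_eq_sum (μ lam p k ε : ℝ) (η : Space d) (z : Option (Fin d) → ℂ)
    (a : Option (Fin d)) :
    linPart μ lam p k ε η z a = ∑ b, linMatrix μ lam p k ε a b η * z b := by
  have := LinearMap.pi_apply_eq_sum_univ (isLinearMap_linPart μ lam p k ε η a).mk' z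
  simp only [IsLinearMap.mk'_apply] at this
  rw [this]
  exact Finset.sum_congr rfl fun b _ ↦ by rw [smul_eq_mul, mul_comm]; rfl

theorem continuous_linMatrix (μ lam p k ε : ℝ) (a b : Option (Fin d)) :
    Continuous (linMatrix μ lam p k ε a b : Space d → ℂ) := by
  have hf : Continuous fun η : Space d ↦ freq η := continuous_freq
  unfold linMatrix linPart
  cases a <;> simp only [linDensity, linVelocity, Option.elim, capSymbol] <;> fun_prop

theorem linPart_smul (μ lam p k ε : ℝ) (η : Space d) (c : ℂ) (z : Option (Fin d) → ℂ)
    (a : Option (Fin d)) :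
    linPart μ lam p k ε η (fun b ↦ c * z b) a = c * linPart μ lam p k ε η z a :=
  (isLinearMap_linPart μ lam p k ε η a).map_smul c z

section Lin

variable {l : ℤ} {Z : Option (Fin d) → Space d → ℂ}

theorem memLp_linPart (hZ : ∀ a, MemLp (Z a) 2 volume) (hZs : ∀ a η, η ∉ annulus d l → Z a η = 0)
    (μ lam p k ε : ℝ) (a : Option (Fin d)) :
    MemLp (fun η ↦ linPart μ lam p k ε η (fun b ↦ Z b η) a) 2 volume := by
  simp only [linPart_eq_sum]
  exact memLp_finsetSum _ fun b _ ↦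
    memLp_mul_of_annulus (continuous_linMatrix μ lam p k ε a b) (hZ b) (hZs b)

theorem linPart_eq_zero (hZs : ∀ a η, η ∉ annulus d l → Z a η = 0) (μ lam p k ε : ℝ)
    (a : Option (Fin d)) {η : Space d} (hη : η ∉ annulus d l) :
    linPart μ lam p k ε η (fun b ↦ Z b η) a = 0 := by
  simp [linPart_eq_sum, hZs _ _ hη]

theorem exists_l2_linPart_le (l : ℤ) (μ lam p k ε : ℝ) : ∃ B : ℝ≥0∞, B ≠ ⊤ ∧
    ∀ Z : Option (Fin d) → Space d → ℂ, (∀ a, MemLp (Z a) 2 volume) →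
    (∀ a η, η ∉ annulus d l → Z a η = 0) → ∀ a,
    l2 (fun η ↦ ‖linPart μ lam p k ε η (fun b ↦ Z b η) a‖ₑ) ≤
      B * ∑ b, l2 fun η ↦ ‖Z b η‖ₑ := by
  choose B hB hb using fun a b ↦
    exists_l2_mul_le (continuous_linMatrix (d := d) μ lam p k ε a b) l
  refine ⟨∑ a, ∑ b, B a b, ENNReal.sum_ne_top.2 fun a _ ↦ ENNReal.sum_ne_top.2 fun b _ ↦ hB a b,
    fun Z hZ hZs a ↦ ?_⟩
  simp only [linPart_eq_sum]
  refine (l2_mono (ae_of_all _ fun η ↦ enorm_sum_le _ _)).trans ((l2_sum_le _ fun b _ ↦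
    ((memLp_mul_of_annulus (continuous_linMatrix μ lam p k ε a b) (hZ b) (hZs b)).1.enorm)).trans ?_)
  rw [Finset.mul_sum]
  refine Finset.sum_le_sum fun b _ ↦ (hb a b (Z b) (hZs b)).trans ?_
  gcongr
  exact (Finset.single_le_sum (f := fun b ↦ B a b) (fun _ _ ↦ zero_le) (Finset.mem_univ b)).trans
    (Finset.single_le_sum (f := fun a ↦ ∑ b, B a b) (fun _ _ ↦ zero_le) (Finset.mem_univ a))

end Lin

/-! ### The components of the energy -/

/-- The coefficients of the linear combination `θ(D) q + ∑ b_j u_j` of the unknowns. -/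
noncomputable def combination (θ : Space d → ℂ) (b : Fin d → ℂ) (a : Option (Fin d))
    (η : Space d) : ℂ :=
  a.elim (θ η) b

theorem sum_combination_mul (θ : Space d → ℂ) (b : Fin d → ℂ) (η : Space d)
    (z : Option (Fin d) → ℂ) :
    ∑ a, combination θ b a η * z a = θ η * z none + ∑ j, b j * z (some j) := by
  rw [Fintype.sum_option]; rfl

/-- The combination `θ(D) q + u_i`. -/
theorem sum_combination_single_mul (θ : Space d → ℂ) (i : Fin d) (η : Space d)
    (z : Option (Fin d) → ℂ) :
    ∑ a, combination θ (Pi.single i 1) a η * z a = θ η * z none + z (some i) := by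
  rw [sum_combination_mul]
  simp [Pi.single_apply]

/-- A combination is admissible when `θ` is smooth and Lipschitz: the weight `1 + |η|` of the
density pays for the factor `|η|` in the slow variation. -/
theorem isAdmissible_combination {L : ℝ} {θ : Space d → ℂ} {b : Fin d → ℂ}
    (hθ : ContDiff ℝ ∞ θ) (h1 : ∀ η, ‖θ η‖ ≤ L * (1 + freq η))
    (h2 : ∀ ξ η, ‖θ ξ - θ η‖ ≤ L * freq (ξ - η)) (hb : ∀ j, ‖b j‖ ≤ L) (hL : 0 ≤ L) :
    IsAdmissible L (combination θ b) where
  smooth a := by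
    cases a
    · exact hθ
    · exact contDiff_const
  norm_le a η := by
    cases a with
    | none => exact h1 η
    | some j => exact (hb j).trans (le_of_eq (mul_one L).symm)
  slow a ξ η := by
    have h0 := freq_nonneg η
    have h0' := mul_nonneg hL (freq_nonneg (ξ - η))
    cases a with
    | none =>
      change freq η * ‖θ ξ - θ η‖ ≤ L * freq (ξ - η) * (1 + freq η)
      have := mul_le_mul_of_nonneg_left (h2 ξ η) h0
      linarith
    | some j =>
      change freq η * ‖b j - b j‖ ≤ L * freq (ξ - η) * 1
      simpa using h0'

/-- The components `√(2K) q`, `u_i` and `w_i = u_i + i ν ξ_i q` of the energy. The last one is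
the Fourier transform of the effective velocity `u + ν ∇q`, whose presence makes the density
decay. -/
noncomputable def energyCoeff (ν p k ε : ℝ) (j : Option (Fin d ⊕ Fin d)) :
    Option (Fin d) → Space d → ℂ :=
  j.elim (combination (fun η ↦ (√(2 * capSymbol p k ε (freq η)) : ℝ)) 0)
    (Sum.elim (fun i ↦ combination 0 (Pi.single i 1))
      fun i ↦ combination (fun η ↦ Complex.I * ν * (2 * Real.pi * η i : ℝ)) (Pi.single i 1))

/-- The components `u_i` of the energy of the velocity. -/
noncomputable def velocityCoeff (i : Fin d) : Option (Fin d) → Space d → ℂ :=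
  combination 0 (Pi.single i 1)

/-- A bound for the coefficients of the energy. -/
noncomputable def coeffBound (ν p k : ℝ) : ℝ := √(2 * p) + √(2 * k) + ν + 1

theorem contDiff_capSymbol_freq (p k ε : ℝ) :
    ContDiff ℝ ∞ fun η : Space d ↦ capSymbol p k ε (freq η) := by
  have : ContDiff ℝ ∞ fun η : Space d ↦ freq η ^ 2 := by
    simp only [freq]
    exact (contDiff_norm_sq ℝ).comp (contDiff_const_smul _)
  unfold capSymbol
  exact contDiff_const.add (contDiff_const.mul
    ((contDiff_const.sub (contDiff_const.mul this).neg.exp).div_const _))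

section Coeff

variable {ν p k ε : ℝ}

theorem one_le_coeffBound (hν : 0 < ν) : 1 ≤ coeffBound ν p k := by
  have := Real.sqrt_nonneg (2 * p); have := Real.sqrt_nonneg (2 * k)
  unfold coeffBound; linarith

theorem norm_single_le (i j : Fin d) : ‖(Pi.single i 1 : Fin d → ℂ) j‖ ≤ 1 := by
  rw [Pi.single_apply]; split_ifs <;> simp

theorem isAdmissible_velocityCoeff {L : ℝ} (hL : 1 ≤ L) (i : Fin d) :
    IsAdmissible L (velocityCoeff i) :=
  isAdmissible_combination contDiff_const
    (fun η ↦ by simpa using mul_nonneg (zero_le_one.trans hL) (by linarith [freq_nonneg η]))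
    (fun ξ η ↦ by simpa using mul_nonneg (zero_le_one.trans hL) (freq_nonneg _))
    (fun j ↦ (norm_single_le i j).trans hL) (zero_le_one.trans hL)

/-- The bound does not depend on `ε`, because `√K` is Lipschitz uniformly in `ε`. -/
theorem isAdmissible_energyCoeff (hν : 0 < ν) (hp : 0 < p) (hk : 0 < k) (hε : 0 < ε)
    (j : Option (Fin d ⊕ Fin d)) :
    IsAdmissible (coeffBound ν p k) (energyCoeff (d := d) ν p k ε j) := by
  have hL := one_le_coeffBound (p := p) (k := k) hν
  have s1 := Real.sqrt_nonneg (2 * p)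
  have s2 := Real.sqrt_nonneg (2 * k)
  have l1 : √(2 * p) ≤ coeffBound ν p k := by unfold coeffBound; linarith
  have l2 : √(2 * k) ≤ coeffBound ν p k := by unfold coeffBound; linarith
  have l3 : ν ≤ coeffBound ν p k := by unfold coeffBound; linarith
  rcases j with _ | i | i
  · refine isAdmissible_combination ?_ (fun η ↦ ?_) (fun ξ η ↦ ?_)
      (fun j ↦ by simpa using zero_le_one.trans hL) (zero_le_one.trans hL)
    · refine Complex.ofRealCLM.contDiff.comp (ContDiff.sqrt
        (contDiff_const.mul (contDiff_capSymbol_freq p k ε)) fun η ↦ ?_)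
      have := capSymbol_pos (ε := ε) hp hk (freq η)
      positivity
    · rw [Complex.norm_real, Real.norm_of_nonneg (Real.sqrt_nonneg _)]
      have h1 := capSymbol_le_sq (p := p) hk hε (freq η)
      have h0 := freq_nonneg η
      calc √(2 * capSymbol p k ε (freq η)) ≤ √((√(2 * p) + √(2 * k) * freq η) ^ 2) := by
            refine Real.sqrt_le_sqrt ?_
            have e1 := Real.sq_sqrt (by positivity : 0 ≤ 2 * p)
            have e2 := Real.sq_sqrt (by positivity : 0 ≤ 2 * k)
            have e3 : 0 ≤ √(2 * p) * √(2 * k) * freq η := by positivity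
            have : (√(2 * p) + √(2 * k) * freq η) ^ 2 =
              2 * p + 2 * k * freq η ^ 2 + 2 * (√(2 * p) * √(2 * k) * freq η) := by
                rw [← e1, ← e2]
                simp only [Real.sqrt_sq s1, Real.sqrt_sq s2]
                ring
            rw [this]; linarith
        _ = √(2 * p) + √(2 * k) * freq η := Real.sqrt_sq (by positivity)
        _ ≤ coeffBound ν p k * (1 + freq η) := by
            have := mul_le_mul_of_nonneg_right l2 h0
            linarith
    · rw [← Complex.ofReal_sub, Complex.norm_real, Real.norm_eq_abs]
      refine (abs_sqrt_capSymbol_sub_le hp hk hε _ _).trans ?_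
      refine mul_le_mul l2 ?_ (abs_nonneg _) (zero_le_one.trans hL)
      have a1 := freq_le_add_sub ξ η
      have a2 := freq_le_add_sub η ξ
      rw [freq_sub_comm η ξ] at a2
      rw [abs_le]; constructor <;> linarith
  · exact isAdmissible_velocityCoeff hL i
  · refine isAdmissible_combination ?_ (fun η ↦ ?_) (fun ξ η ↦ ?_)
      (fun j ↦ (norm_single_le i j).trans hL) (zero_le_one.trans hL)
    · refine contDiff_const.mul (Complex.ofRealCLM.contDiff.comp (contDiff_const.mul ?_))
      exact (EuclideanSpace.proj (𝕜 := ℝ) i).contDiff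
    · rw [norm_mul, norm_mul, Complex.norm_I, one_mul, Complex.norm_real, Complex.norm_real,
        Real.norm_of_nonneg hν.le, Real.norm_eq_abs]
      have := abs_coord_le_freq η i
      exact mul_le_mul l3 (this.trans (by linarith)) (abs_nonneg _) (zero_le_one.trans hL)
    · have e : Complex.I * ν * ((2 * Real.pi * ξ i : ℝ) : ℂ) -
          Complex.I * ν * ((2 * Real.pi * η i : ℝ) : ℂ) =
          Complex.I * ν * ((2 * Real.pi * (ξ - η) i : ℝ) : ℂ) := by
        rw [PiLp.sub_apply]; push_cast; ring
      rw [e, norm_mul, norm_mul, Complex.norm_I, one_mul, Complex.norm_real, Complex.norm_real,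
        Real.norm_of_nonneg hν.le, Real.norm_eq_abs]
      exact mul_le_mul l3 (abs_coord_le_freq _ i) (abs_nonneg _) (zero_le_one.trans hL)

end Coeff

end LinearCapillary

namespace LinearCapillary

open MeasureTheory Filter Topology Set
open scoped ENNReal ComplexConjugate ContDiff

variable {d : ℕ}

/-! ### Dissipation in a dyadic block -/

section Dissipation

variable {μ lam p k ε : ℝ} {l : ℤ} {Z : Option (Fin d) → Space d → ℂ}

theorem memLp_combination {J : Type} {L : ℝ} {α : J → Option (Fin d) → Space d → ℂ}
    (hα : ∀ j, IsAdmissible L (α j)) (hZ : ∀ a, MemLp (Z a) 2 volume)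
    (hZs : ∀ a η, η ∉ annulus d l → Z a η = 0) (j : J) :
    MemLp (fun η ↦ ∑ a, α j a η * Z a η) 2 volume :=
  memLp_finsetSum _ fun a _ ↦ memLp_mul_of_annulus ((hα j).smooth a).continuous (hZ a) (hZs a)

/-- Sums over the components of the energy, written out. -/
theorem sum_energyCoeff (ν : ℝ) (η : Space d) (z : Option (Fin d) → ℂ)
    (Φ : ℂ → ℝ) :
    ∑ j, Φ (∑ a, energyCoeff ν p k ε j a η * z a) =
      Φ ((√(2 * capSymbol p k ε (freq η)) : ℝ) * z none) + (∑ i, Φ (z (some i)) +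
        ∑ i, Φ (z (some i) + Complex.I * ν * (2 * Real.pi * η i : ℝ) * z none)) := by
  rw [Fintype.sum_option, Fintype.sum_sum_type]
  simp only [energyCoeff, Option.elim, Sum.elim_inl, Sum.elim_inr, sum_combination_single_mul,
    sum_combination_mul, Pi.zero_apply, zero_mul, zero_add, Finset.sum_const_zero, add_zero]
  simp only [add_comm (Complex.I * _ * _ * _)]

theorem re_sum_energyCoeff_linPart_le {c : ℝ} (hν : 0 < lam + 2 * μ) (hp : 0 < p) (hk : 0 < k)
    (hε : 0 < ε) (hc : 0 ≤ c) (h1 : 3 * c ≤ 2 * μ) (h2 : 3 * c ≤ lam + 2 * μ)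
    (h3 : c * (2 + 2 * (lam + 2 * μ) ^ 2) ≤ lam + 2 * μ) {η : Space d} (hη : η ∈ annulus d l)
    (z : Option (Fin d) → ℂ) :
    ∑ j, (conj (∑ a, energyCoeff (lam + 2 * μ) p k ε j a η * z a) *
        ∑ a, energyCoeff (lam + 2 * μ) p k ε j a η * linPart μ lam p k ε η z a).re ≤
      -(c * blockRate p k ε l) *
        ∑ j, ‖∑ a, energyCoeff (lam + 2 * μ) p k ε j a η * z a‖ ^ 2 := by
  have hl : 0 < 3 / 4 * (2 : ℝ) ^ l := by positivity
  have hK := capSymbol_pos (ε := ε) hp hk (freq η)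
  have key := energy_dissipation μ lam (capSymbol p k ε (freq η)) (fun i ↦ 2 * Real.pi * η i)
    (fun i ↦ z (some i)) (z none) hν hK hc h1 h2 h3 (blockRate_pos hp hk l).le
    (by rw [sum_coord_sq]
        exact (min_le_left _ _).trans (pow_le_pow_left₀ hl.le hη.1 2))
    ((min_le_right _ _).trans (capSymbol_mono hk hε hl.le hη.1))
  rw [sum_energyCoeff _ _ _ fun w ↦ ‖w‖ ^ 2]
  rw [Fintype.sum_option, Fintype.sum_sum_type]
  simp only [energyCoeff, Option.elim, Sum.elim_inl, Sum.elim_inr, sum_combination_single_mul,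
    sum_combination_mul, Pi.zero_apply, zero_mul, zero_add, Finset.sum_const_zero, add_zero]
  have e1 : ∀ w : ℂ, (conj ((√(2 * capSymbol p k ε (freq η)) : ℝ) * z none) *
      ((√(2 * capSymbol p k ε (freq η)) : ℝ) * w)).re =
      2 * capSymbol p k ε (freq η) * (conj (z none) * w).re := fun w ↦ by
    rw [map_mul, Complex.conj_ofReal, mul_mul_mul_comm, ← Complex.ofReal_mul,
      Real.mul_self_sqrt (by positivity), Complex.re_ofReal_mul]
  have e2 : ‖((√(2 * capSymbol p k ε (freq η)) : ℝ) : ℂ) * z none‖ ^ 2 =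
      2 * capSymbol p k ε (freq η) * ‖z none‖ ^ 2 := by
    rw [norm_mul, Complex.norm_real, Real.norm_of_nonneg (Real.sqrt_nonneg _), mul_pow,
      Real.sq_sqrt (by positivity)]
  rw [e1, e2, ← Complex.re_sum, ← Complex.re_sum]
  simp only [linPart, Option.elim, add_comm (Complex.I * _ * _ * _)] at key ⊢
  refine le_trans (le_of_eq ?_) (key.trans (le_of_eq ?_))
  · ring
  · ring

theorem sum_re_integral {J : Type} [Fintype J] {F : J → Space d → ℂ}
    (hF : ∀ j, Integrable (F j)) : Integrable (fun η ↦ ∑ j, (F j η).re) ∧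
      ∑ j, (∫ η, F j η).re = ∫ η, ∑ j, (F j η).re := by
  have h : ∀ j, Integrable fun η ↦ (F j η).re := fun j ↦ (hF j).re
  refine ⟨integrable_finsetSum _ fun j _ ↦ h j, ?_⟩
  rw [integral_finsetSum _ fun j _ ↦ h j]
  exact Finset.sum_congr rfl fun j _ ↦ (integral_re (hF j)).symm

/-- The linear part makes the energy of a block decay at the rate `blockRate`. -/
theorem energy_linPart_le {c : ℝ} (hν : 0 < lam + 2 * μ) (hp : 0 < p) (hk : 0 < k)
    (hε : 0 < ε) (hc : 0 ≤ c) (h1 : 3 * c ≤ 2 * μ) (h2 : 3 * c ≤ lam + 2 * μ)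
    (h3 : c * (2 + 2 * (lam + 2 * μ) ^ 2) ≤ lam + 2 * μ) (hZ : ∀ a, MemLp (Z a) 2 volume)
    (hZs : ∀ a η, η ∉ annulus d l → Z a η = 0) :
    ∑ j, (∫ η, conj (∑ a, energyCoeff (lam + 2 * μ) p k ε j a η * Z a η) *
        ∑ a, energyCoeff (lam + 2 * μ) p k ε j a η *
          linPart μ lam p k ε η (fun b ↦ Z b η) a).re ≤
      -(c * blockRate p k ε l) *
        energy fun j η ↦ ∑ a, energyCoeff (lam + 2 * μ) p k ε j a η * Z a η := by
  have hα := isAdmissible_energyCoeff (d := d) hν hp hk hε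
  have m1 := memLp_combination hα hZ hZs
  have m2 := memLp_combination hα (memLp_linPart hZ hZs μ lam p k ε)
    (fun a η hη ↦ linPart_eq_zero hZs μ lam p k ε a hη)
  have i1 := fun j ↦ integrable_conj_mul (m1 j) (m2 j)
  rw [energy_eq_integral m1, ← integral_const_mul]
  obtain ⟨i2, e⟩ := sum_re_integral i1
  rw [e]
  refine integral_mono i2
    ((integrable_finsetSum _ fun j _ ↦ (m1 j).norm.integrable_sq).const_mul _) fun η ↦ ?_
  by_cases hη : η ∈ annulus d l
  · exact re_sum_energyCoeff_linPart_le hν hp hk hε hc h1 h2 h3 hη fun b ↦ Z b η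
  · simp [hZs _ _ hη]

theorem integral_sqrt_mul_sqrt_le {A B : Space d → ℝ} (hA : Integrable A) (hB : Integrable B)
    (hA0 : ∀ η, 0 ≤ A η) (hB0 : ∀ η, 0 ≤ B η) :
    Integrable (fun η ↦ √(A η) * √(B η)) ∧
      ∫ η, √(A η) * √(B η) ≤ √(∫ η, A η) * √(∫ η, B η) := by
  have hm : ∀ {A : Space d → ℝ}, Integrable A → (∀ η, 0 ≤ A η) →
      MemLp (fun η ↦ √(A η)) (ENNReal.ofReal 2) volume := fun {A} hA hA0 ↦ by
    rw [show ENNReal.ofReal 2 = 2 by norm_num, memLp_two_iff_integrable_sq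
      (Real.continuous_sqrt.comp_aestronglyMeasurable hA.1)]
    exact hA.congr (ae_of_all _ fun η ↦ (Real.sq_sqrt (hA0 η)).symm)
  have h := integral_mul_le_Lp_mul_Lq_of_nonneg Real.HolderConjugate.two_two
    (ae_of_all _ fun η ↦ Real.sqrt_nonneg (A η)) (ae_of_all _ fun η ↦ Real.sqrt_nonneg (B η))
    (hm hA hA0) (hm hB hB0)
  have e : ∀ {A : Space d → ℝ}, (∀ η, 0 ≤ A η) →
      (∫ η, √(A η) ^ (2 : ℝ)) ^ (1 / 2 : ℝ) = √(∫ η, A η) := fun {A} hA0 ↦ by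
    rw [Real.sqrt_eq_rpow (∫ η, A η)]
    congr 2
    exact funext fun η ↦ by rw [Real.rpow_two, Real.sq_sqrt (hA0 η)]
  rw [e hA0, e hB0] at h
  refine ⟨?_, h⟩
  have h2 : ENNReal.ofReal 2 = 2 := by norm_num
  exact (h2 ▸ hm hA hA0).integrable_mul (h2 ▸ hm hB hB0)

/-- The component `w - u` of the energy is the gradient of the density. -/
theorem freq_sq_mul_le_sum_energyCoeff (ν p k ε : ℝ) (η : Space d) (z : Option (Fin d) → ℂ) :
    ν ^ 2 * (freq η * ‖z none‖) ^ 2 ≤ 2 * ∑ j, ‖∑ a, energyCoeff ν p k ε j a η * z a‖ ^ 2 := by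
  have e2 : ∑ i, ‖Complex.I * ν * (2 * Real.pi * η i : ℝ) * z none‖ ^ 2 =
      ν ^ 2 * (freq η * ‖z none‖) ^ 2 := by
    simp only [norm_mul, Complex.norm_I, Complex.norm_real, one_mul, mul_pow,
      Real.norm_eq_abs, sq_abs]
    rw [← Finset.sum_mul, ← Finset.mul_sum]
    simp only [← mul_pow]
    rw [sum_coord_sq, mul_pow, mul_pow]
    ring
  rw [← e2, sum_energyCoeff _ _ _ fun w ↦ ‖w‖ ^ 2, mul_add, mul_add, Finset.mul_sum,
    Finset.mul_sum, ← Finset.sum_add_distrib]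
  refine le_trans (Finset.sum_le_sum fun i _ ↦ ?_) (le_add_of_nonneg_left (by positivity))
  set w := z (some i) + Complex.I * ν * (2 * Real.pi * η i : ℝ) * z none with hw
  have e3 : Complex.I * ν * (2 * Real.pi * η i : ℝ) * z none = w - z (some i) := by
    rw [hw]; ring
  rw [e3]
  have := norm_sub_le w (z (some i))
  nlinarith [sq_nonneg (‖w‖ - ‖z (some i)‖), norm_nonneg (w - z (some i)), norm_nonneg w,
    norm_nonneg (z (some i))]

theorem re_sum_velocity_linPart_le {c : ℝ} (hν : 0 < lam + 2 * μ) (hp : 0 < p) (hk : 0 < k)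
    (hε : 0 < ε) (hc : 0 ≤ c) (h1 : c ≤ μ) (h2 : c ≤ lam + 2 * μ) {η : Space d}
    (hη : η ∈ annulus d l) (z : Option (Fin d) → ℂ) :
    ∑ i, (conj (z (some i)) * linPart μ lam p k ε η z (some i)).re ≤
      -(c * (3 / 4 * 2 ^ l) ^ 2) * ∑ i, ‖z (some i)‖ ^ 2 +
      13 * capSymbol p k ε (3 / 4 * 2 ^ l) * (√2 / (lam + 2 * μ)) *
        (√(∑ i, ‖z (some i)‖ ^ 2) *
          √(∑ j, ‖∑ a, energyCoeff (lam + 2 * μ) p k ε j a η * z a‖ ^ 2)) := by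
  set ν := lam + 2 * μ with hνdef
  have hl : 0 < 3 / 4 * (2 : ℝ) ^ l := by positivity
  have hK := capSymbol_pos (ε := ε) hp hk (freq η)
  set S := ∑ i, ‖z (some i)‖ ^ 2 with hS
  have hS0 : 0 ≤ S := Finset.sum_nonneg fun _ _ ↦ sq_nonneg _
  set N := ∑ j, ‖∑ a, energyCoeff ν p k ε j a η * z a‖ ^ 2 with hN
  have hN0 : 0 ≤ N := Finset.sum_nonneg fun _ _ ↦ sq_nonneg _
  have key := velocity_dissipation μ lam (capSymbol p k ε (freq η)) (fun i ↦ 2 * Real.pi * η i)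
    (fun i ↦ z (some i)) (z none) h1 h2 hK (S := √S) (Real.sq_sqrt hS0) (Real.sqrt_nonneg _)
    (r := freq η) (sum_coord_sq η).symm (freq_nonneg η)
  rw [Real.sq_sqrt hS0, Complex.re_sum] at key
  refine key.trans (add_le_add ?_ ?_)
  · have := pow_le_pow_left₀ hl.le hη.1 2
    have := mul_le_mul_of_nonneg_left this (mul_nonneg hc hS0)
    linarith
  -- `13` exceeds the squared ratio `(8/3)² / (3/4)²` of the radii of the annulus
  · have hKl : capSymbol p k ε (freq η) ≤ 13 * capSymbol p k ε (3 / 4 * 2 ^ l) := by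
      refine capSymbol_le_mul hp hk hε ?_
      have := pow_le_pow_left₀ (freq_nonneg η) hη.2 2
      have h2 : 0 ≤ ((2 : ℝ) ^ l) ^ 2 := sq_nonneg _
      calc freq η ^ 2 ≤ (8 / 3 * 2 ^ l) ^ 2 := this
        _ ≤ _ := by rw [mul_pow, mul_pow]; linarith
    have hq : freq η * ‖z none‖ ≤ √2 / ν * √N := by
      have e1 := freq_sq_mul_le_sum_energyCoeff ν p k ε η z
      rw [div_mul_eq_mul_div, le_div_iff₀ hν, ← Real.sqrt_mul (by norm_num)]
      refine Real.le_sqrt_of_sq_le ?_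
      linarith [mul_pow (freq η * ‖z none‖) ν 2]
    have hS1 := Real.sqrt_nonneg S
    calc √S * (capSymbol p k ε (freq η) * (freq η * ‖z none‖))
        ≤ √S * ((13 * capSymbol p k ε (3 / 4 * 2 ^ l)) * (√2 / ν * √N)) := by
          have := freq_nonneg η
          have := hK.le.trans hKl
          gcongr
      _ = _ := by ring

/-- The decay of the velocity at the parabolic rate; the pressure and capillarity terms are
treated as a source controlled by the energy of the block. -/
theorem velocity_linPart_le {c : ℝ} (hν : 0 < lam + 2 * μ) (hp : 0 < p) (hk : 0 < k)
    (hε : 0 < ε) (hc : 0 ≤ c) (h1 : c ≤ μ) (h2 : c ≤ lam + 2 * μ)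
    (hZ : ∀ a, MemLp (Z a) 2 volume) (hZs : ∀ a η, η ∉ annulus d l → Z a η = 0) :
    ∑ i, (∫ η, conj (∑ a, velocityCoeff i a η * Z a η) *
        ∑ a, velocityCoeff i a η * linPart μ lam p k ε η (fun b ↦ Z b η) a).re ≤
      -(c * (3 / 4 * 2 ^ l) ^ 2) * (energy fun i η ↦ ∑ a, velocityCoeff i a η * Z a η) +
      √(energy fun i η ↦ ∑ a, velocityCoeff i a η * Z a η) *
        (13 * capSymbol p k ε (3 / 4 * 2 ^ l) * (√2 / (lam + 2 * μ)) *
          √(energy fun j η ↦ ∑ a, energyCoeff (lam + 2 * μ) p k ε j a η * Z a η)) := by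
  have hα := isAdmissible_energyCoeff (d := d) hν hp hk hε
  have m1 := memLp_combination hα hZ hZs
  have e0 : ∀ (z : Option (Fin d) → ℂ) (η : Space d) (i : Fin d),
      ∑ a, velocityCoeff i a η * z a = z (some i) := fun z η i ↦ by
    rw [velocityCoeff, sum_combination_single_mul]; simp
  simp only [e0 (fun a ↦ Z a _), e0 (fun a ↦ linPart μ lam p k ε _ (fun b ↦ Z b _) a)]
  have m2 := memLp_linPart hZ hZs μ lam p k ε
  have i1 := fun i : Fin d ↦ integrable_conj_mul (hZ (some i)) (m2 (some i))
  obtain ⟨i2, e⟩ := sum_re_integral i1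
  have n1 : Integrable fun η ↦ ∑ i : Fin d, ‖Z (some i) η‖ ^ 2 :=
    integrable_finsetSum _ fun i _ ↦ (hZ (some i)).norm.integrable_sq
  have n2 : Integrable fun η ↦
      ∑ j, ‖∑ a, energyCoeff (lam + 2 * μ) p k ε j a η * Z a η‖ ^ 2 :=
    integrable_finsetSum _ fun j _ ↦ (m1 j).norm.integrable_sq
  obtain ⟨n3, cs⟩ := integral_sqrt_mul_sqrt_le n1 n2
    (fun η ↦ Finset.sum_nonneg fun _ _ ↦ sq_nonneg _)
    (fun η ↦ Finset.sum_nonneg fun _ _ ↦ sq_nonneg _)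
  rw [energy_eq_integral m1, energy_eq_integral fun i ↦ hZ (some i)]
  rw [e]
  have hl : 0 < 3 / 4 * (2 : ℝ) ^ l := by positivity
  have hK := capSymbol_pos (ε := ε) hp hk (3 / 4 * 2 ^ l)
  refine (integral_mono (g := fun η ↦ -(c * (3 / 4 * 2 ^ l) ^ 2) * ∑ i, ‖Z (some i) η‖ ^ 2 +
      13 * capSymbol p k ε (3 / 4 * 2 ^ l) * (√2 / (lam + 2 * μ)) *
        (√(∑ i, ‖Z (some i) η‖ ^ 2) *
          √(∑ j, ‖∑ a, energyCoeff (lam + 2 * μ) p k ε j a η * Z a η‖ ^ 2)))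
    i2 ((n1.const_mul _).add (n3.const_mul _))
    fun η ↦ ?_).trans ?_
  · by_cases hη : η ∈ annulus d l
    · exact re_sum_velocity_linPart_le hν hp hk hε hc h1 h2 hη fun b ↦ Z b η
    · simp [hZs _ _ hη]
  · rw [integral_add (n1.const_mul _) (n3.const_mul _), integral_const_mul, integral_const_mul]
    refine add_le_add le_rfl ?_
    refine (mul_le_mul_of_nonneg_left cs (by positivity)).trans (le_of_eq (by ring))

end Dissipation

end LinearCapillary

namespace LinearCapillary

open MeasureTheory Filter Topology Set
open scoped ENNReal ComplexConjugate ContDiff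

variable {d : ℕ}

/-! ### Sizes of the dyadic blocks of the unknowns -/

/-- The size `(1 + 2^l) ‖Δ̇_l q‖ + ∑ ‖Δ̇_l u_i‖` of the block `l` of the unknowns. -/
noncomputable def blockSize (χ : Space d → ℝ) (f : Option (Fin d) → Distr d) (l : ℤ) : ℝ≥0∞ :=
  ∑ a, dyadicUnknownWeight a l * distrLpNorm 2 (dyadicBlock χ l (f a))

/-- The size `∑ ‖Δ̇_l ∂_j v_i‖` of the block `l` of the gradient of a vector field. -/
noncomputable def gradBlock (χ : Space d → ℝ) (v : Fin d → Distr d) (l : ℤ) : ℝ≥0∞ :=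
  ∑ j, ∑ i, distrLpNorm 2 (dyadicBlock χ l (partialD j (v i)))

theorem one_le_dyadicUnknownWeight (a : Option (Fin d)) (l : ℤ) :
    1 ≤ dyadicUnknownWeight a l := by
  cases a
  · exact le_self_add
  · exact le_rfl

theorem distrLpNorm_le_blockSize (χ : Space d → ℝ) (f : Option (Fin d) → Distr d) (l : ℤ)
    (a : Option (Fin d)) : distrLpNorm 2 (dyadicBlock χ l (f a)) ≤ blockSize χ f l :=
  (le_mul_of_one_le_left zero_le (one_le_dyadicUnknownWeight a l)).trans
    (Finset.single_le_sum
      (f := fun a ↦ dyadicUnknownWeight a l * distrLpNorm 2 (dyadicBlock χ l (f a)))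
      (fun _ _ ↦ zero_le) (Finset.mem_univ a))

theorem tsum_gradBlock (χ : Space d → ℝ) (v : Fin d → Distr d) :
    ∑' l, dyadicWeight ((d : ℝ) / 2) l * gradBlock χ v l = besovNormGrad χ ((d : ℝ) / 2) v := by
  simp only [gradBlock, Finset.mul_sum, besovNormGrad, besovNorm]
  rw [Summable.tsum_finsetSum fun _ _ ↦ ENNReal.summable]
  exact Finset.sum_congr rfl fun j _ ↦ Summable.tsum_finsetSum fun _ _ ↦ ENNReal.summable

theorem tsum_blockSize (χ : Space d → ℝ) (σ : ℝ) (f : Option (Fin d) → Distr d) :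
    ∑' l, dyadicWeight σ l * blockSize χ f l =
      besovNorm χ σ (f none) + besovNorm χ (σ + 1) (f none) +
        besovNormVec χ σ fun i ↦ f (some i) := by
  simp only [blockSize, Fintype.sum_option, dyadicUnknownWeight, Option.elim, one_mul, mul_add,
    add_mul, Finset.mul_sum, besovNormVec, besovNorm, dyadicWeight_add, ← mul_assoc]
  rw [ENNReal.tsum_add, ENNReal.tsum_add]
  congr 1
  exact Summable.tsum_finsetSum fun _ _ ↦ ENNReal.summable

section Compare

variable {χ : Space d → ℝ} {f : Option (Fin d) → Distr d} {X : Option (Fin d) → Space d → ℂ}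

theorem blockNorm_stateSize_le (hχ : IsCutoff χ) (hX : ∀ a, HasFourier (f a) (X a)) (l : ℤ) :
    blockNorm χ l (stateSize X) ≤ ENNReal.ofReal (8 / 3) * blockSize χ f l := by
  have hm := fun a ↦ (measurable_unknownWeight (d := d) a).ennreal_ofReal.mul
    (hX a).measurable.enorm
  refine (blockNorm_sum_le hχ l _ hm).trans ?_
  rw [blockSize, Finset.mul_sum]
  refine Finset.sum_le_sum fun a _ ↦ ?_
  rw [(hX a).distrLpNorm_dyadicBlock hχ, ← mul_assoc, ← blockNorm_const_mul l
    (ENNReal.mul_ne_top ENNReal.ofReal_ne_top (dyadicUnknownWeight_ne_top a l))]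
  refine l2_mono (ae_of_all _ fun η ↦ ?_)
  by_cases h : η ∈ annulus d l
  · have := unknownWeight_le_of_mem_annulus a h
    change _ * (ENNReal.ofReal (unknownWeight a η) * ‖X a η‖ₑ) ≤
      _ * (ENNReal.ofReal (8 / 3) * dyadicUnknownWeight a l * ‖X a η‖ₑ)
    gcongr
  · simp [hχ.blockSymbol_eq_zero h]

theorem freq_le_sum_abs (η : Space d) : freq η ≤ ∑ j, |2 * Real.pi * η j| := by
  refine (sq_le_sq₀ (freq_nonneg η) (Finset.sum_nonneg fun _ _ ↦ abs_nonneg _)).1 ?_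
  rw [← sum_coord_sq]
  simp only [← sq_abs (2 * Real.pi * η _)]
  exact Finset.sum_sq_le_sq_sum_of_nonneg fun _ _ ↦ abs_nonneg _

theorem blockNorm_gradSize_le (hχ : IsCutoff χ) {v : Fin d → Distr d} {V : Fin d → Space d → ℂ}
    (hV : ∀ i, HasFourier (v i) (V i)) (l : ℤ) :
    blockNorm χ l (gradSize V) ≤ gradBlock χ v l := by
  have h : ∀ η, gradSize V η ≤
      ∑ j, ∑ i, ‖(Complex.I * ((2 * Real.pi * η j : ℝ) : ℂ)) * V i η‖ₑ := fun η ↦ by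
    have h1 : ENNReal.ofReal (freq η) ≤
        ∑ j, ‖Complex.I * ((2 * Real.pi * η j : ℝ) : ℂ)‖ₑ := by
      refine (ENNReal.ofReal_le_ofReal (freq_le_sum_abs η)).trans (le_of_eq ?_)
      rw [ENNReal.ofReal_sum_of_nonneg fun _ _ ↦ abs_nonneg _]
      refine Finset.sum_congr rfl fun j _ ↦ ?_
      rw [← ofReal_norm, norm_mul, Complex.norm_I, one_mul, Complex.norm_real, Real.norm_eq_abs]
    rw [gradSize, vecSize]
    refine (mul_le_mul_left h1 _).trans (le_of_eq ?_)
    simp only [enorm_mul (Complex.I * _), Finset.sum_mul_sum]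
  refine (blockNorm_mono χ l h).trans ?_
  have hm := fun j i ↦ ((hV i).partialD j).measurable.enorm
  refine (blockNorm_sum_le hχ l _ fun j ↦ Finset.measurable_fun_sum _ fun i _ ↦ hm j i).trans
    (Finset.sum_le_sum fun j _ ↦ (blockNorm_sum_le hχ l _ (hm j)).trans
      (Finset.sum_le_sum fun i _ ↦ ?_))
  rw [((hV i).partialD j).distrLpNorm_dyadicBlock hχ]

/-- Bernstein's inequality for the gradient. -/
theorem distrLpNorm_partialD_le (hχ : IsCutoff χ) {T : Distr d} {g : Space d → ℂ}
    (h : HasFourier T g) (j : Fin d) (l : ℤ) :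
    distrLpNorm 2 (dyadicBlock χ l (partialD j T)) ≤
      ENNReal.ofReal (8 / 3) * (dyadicWeight 1 l * distrLpNorm 2 (dyadicBlock χ l T)) := by
  rw [(h.partialD j).distrLpNorm_dyadicBlock hχ, h.distrLpNorm_dyadicBlock hχ]
  refine (blockNorm_mono χ l fun η ↦ ?_).trans (hχ.blockNorm_freq_le l _)
  rw [enorm_mul]
  gcongr
  exact enorm_I_coord_le η j

theorem besovNormGrad_le (hχ : IsCutoff χ) {v : Fin d → Distr d} {V : Fin d → Space d → ℂ}
    (hV : ∀ i, HasFourier (v i) (V i)) (σ : ℝ) :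
    besovNormGrad χ σ v ≤ d * (ENNReal.ofReal (8 / 3) * besovNormVec χ (σ + 1) v) := by
  rw [besovNormGrad]
  refine (Finset.sum_le_card_nsmul _ _ _ fun j _ ↦ ?_).trans_eq (by
    rw [Finset.card_univ, Fintype.card_fin, nsmul_eq_mul])
  rw [besovNormVec, Finset.mul_sum]
  refine Finset.sum_le_sum fun i _ ↦ ?_
  rw [besovNorm, besovNorm, ← ENNReal.tsum_mul_left]
  refine ENNReal.tsum_le_tsum fun l ↦ (mul_le_mul_right
    (distrLpNorm_partialD_le hχ (hV i) j l) _).trans (le_of_eq ?_)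
  rw [dyadicWeight_add]
  ring

end Compare

/-! ### Comparison of the energy with the sizes of the blocks -/

theorem l2_le_of_sq_le {J : Type} [Fintype J] {c : J → Space d → ℂ}
    (hc : ∀ j, MemLp (c j) 2 volume) {g : Space d → ℂ} {C : ℝ} (hC : 0 ≤ C)
    (h : ∀ η, ‖g η‖ ^ 2 ≤ C ^ 2 * ∑ j, ‖c j η‖ ^ 2) :
    l2 (fun η ↦ ‖g η‖ₑ) ≤ ENNReal.ofReal (C * √(energy c)) := by
  have hi : Integrable fun η ↦ ∑ j, ‖c j η‖ ^ 2 :=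
    integrable_finsetSum _ fun j _ ↦ (hc j).norm.integrable_sq
  have h1 : ∫⁻ η, ‖g η‖ₑ ^ (2 : ℝ) ≤ ENNReal.ofReal (C ^ 2 * energy c) := by
    rw [energy_eq_integral hc, ← integral_const_mul, ofReal_integral_eq_lintegral_ofReal
      (hi.const_mul _) (ae_of_all _ fun η ↦ mul_nonneg (sq_nonneg C)
        (Finset.sum_nonneg fun _ _ ↦ sq_nonneg _))]
    refine lintegral_mono fun η ↦ ?_
    rw [← ofReal_norm, ENNReal.ofReal_rpow_of_nonneg (norm_nonneg _) (by norm_num), Real.rpow_two]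
    exact ENNReal.ofReal_le_ofReal (h η)
  refine (ENNReal.rpow_le_rpow h1 (by norm_num)).trans (le_of_eq ?_)
  rw [ENNReal.ofReal_rpow_of_nonneg (mul_nonneg (sq_nonneg C) (energy_nonneg c)) (by norm_num),
    ← Real.sqrt_eq_rpow, Real.sqrt_mul (sq_nonneg C), Real.sqrt_sq hC]

theorem sqrt_energy_le_sum {J : Type} [Fintype J] (c : J → Space d → ℂ) :
    √(energy c) ≤ ∑ j, (l2 fun η ↦ ‖c j η‖ₑ).toReal := by
  refine Real.sqrt_le_iff.2 ⟨Finset.sum_nonneg fun _ _ ↦ ENNReal.toReal_nonneg, ?_⟩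
  exact Finset.sum_sq_le_sq_sum_of_nonneg fun _ _ ↦ ENNReal.toReal_nonneg

/-- The unknowns control the energy. -/
theorem sqrt_energy_le {J : Type} [Fintype J] {L : ℝ} (hL : 0 ≤ L)
    {α : J → Option (Fin d) → Space d → ℂ} (hα : ∀ j, IsAdmissible L (α j)) {l : ℤ}
    {Z : Option (Fin d) → Space d → ℂ} (hZ : ∀ a, MemLp (Z a) 2 volume)
    (hZs : ∀ a η, η ∉ annulus d l → Z a η = 0) :
    ENNReal.ofReal √(energy fun j η ↦ ∑ a, α j a η * Z a η) ≤
      Fintype.card J * ENNReal.ofReal (L * (8 / 3)) *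
        ∑ a, dyadicUnknownWeight a l * l2 fun η ↦ ‖Z a η‖ₑ := by
  refine (ENNReal.ofReal_le_ofReal (sqrt_energy_le_sum _)).trans ?_
  rw [ENNReal.ofReal_sum_of_nonneg fun _ _ ↦ ENNReal.toReal_nonneg, mul_assoc]
  refine (Finset.sum_le_card_nsmul _ _ _ fun j _ ↦ ?_).trans_eq (by
    rw [Finset.card_univ, nsmul_eq_mul])
  refine ENNReal.ofReal_toReal_le.trans ?_
  refine (l2_mono (ae_of_all _ fun η ↦ enorm_sum_le _ _)).trans ((l2_sum_le _ fun a _ ↦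
    (memLp_mul_of_annulus ((hα j).smooth a).continuous (hZ a) (hZs a)).1.enorm).trans ?_)
  rw [Finset.mul_sum]
  refine Finset.sum_le_sum fun a _ ↦ ?_
  rw [← mul_assoc, ← l2_const_mul (ENNReal.mul_ne_top ENNReal.ofReal_ne_top
    (dyadicUnknownWeight_ne_top a l))]
  refine l2_mono (ae_of_all _ fun η ↦ ?_)
  by_cases hη : η ∈ annulus d l
  · rw [enorm_mul]
    gcongr
    rw [ENNReal.ofReal_mul hL, mul_assoc, ← ofReal_norm]
    refine (ENNReal.ofReal_le_ofReal ((hα j).norm_le a η)).trans ?_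
    rw [ENNReal.ofReal_mul hL]
    gcongr
    exact unknownWeight_le_of_mem_annulus a hη
  · simp [hZs a η hη]

section Energy

variable {ν p k ε : ℝ} {l : ℤ} {Z : Option (Fin d) → Space d → ℂ}

/-- The energy controls the unknowns. -/
theorem sum_weight_l2_le_sqrt_energy (hν : 0 < ν) (hp : 0 < p) (hk : 0 < k) (hε : 0 < ε)
    (hZ : ∀ a, MemLp (Z a) 2 volume) (hZs : ∀ a η, η ∉ annulus d l → Z a η = 0) :
    ∑ a, dyadicUnknownWeight a l * l2 (fun η ↦ ‖Z a η‖ₑ) ≤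
      ENNReal.ofReal ((1 / √(2 * p) + 4 / 3 * (√2 / ν) + d) *
        √(energy fun j η ↦ ∑ a, energyCoeff ν p k ε j a η * Z a η)) := by
  have hα := isAdmissible_energyCoeff (d := d) hν hp hk hε
  have m1 := memLp_combination hα hZ hZs
  set e := √(energy fun j η ↦ ∑ a, energyCoeff ν p k ε j a η * Z a η) with he
  have he0 : 0 ≤ e := Real.sqrt_nonneg _
  have hsp : 0 < √(2 * p) := Real.sqrt_pos.2 (by positivity)
  have hpw := fun η ↦ sum_energyCoeff (p := p) (k := k) (ε := ε) ν η (fun b ↦ Z b η)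
    fun w ↦ ‖w‖ ^ 2
  -- the density is controlled by `√(2K) q`, as `K ≥ p`, and its gradient by `w - u = i ν ξ q`
  have a1 : l2 (fun η ↦ ‖Z none η‖ₑ) ≤ ENNReal.ofReal (1 / √(2 * p) * e) := by
    refine l2_le_of_sq_le m1 (by positivity) fun η ↦ ?_
    have hK := le_capSymbol (p := p) (ε := ε) hk (freq η)
    have hK2 : 0 ≤ 2 * capSymbol p k ε (freq η) := by linarith
    rw [hpw η, div_pow, one_pow, Real.sq_sqrt (by positivity), norm_mul, Complex.norm_real,
      Real.norm_of_nonneg (Real.sqrt_nonneg _), mul_pow, Real.sq_sqrt hK2]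
    have h1 : 2 * p * ‖Z none η‖ ^ 2 ≤ 2 * capSymbol p k ε (freq η) * ‖Z none η‖ ^ 2 := by gcongr
    rw [one_div, le_inv_mul_iff₀ (by positivity)]
    exact h1.trans (le_add_of_nonneg_right (add_nonneg (Finset.sum_nonneg fun _ _ ↦ sq_nonneg _)
      (Finset.sum_nonneg fun _ _ ↦ sq_nonneg _)))
  have a2 : dyadicWeight 1 l * l2 (fun η ↦ ‖Z none η‖ₑ) ≤
      ENNReal.ofReal (4 / 3 * (√2 / ν) * e) := by
    rw [← l2_const_mul (dyadicWeight_ne_top 1 l), dyadicWeight_one]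
    have : ∀ η, ENNReal.ofReal (2 ^ l) * ‖Z none η‖ₑ = ‖((2 ^ l : ℝ) : ℂ) * Z none η‖ₑ := fun η ↦ by
      rw [enorm_mul, ← ofReal_norm (((2 ^ l : ℝ) : ℂ)), Complex.norm_real,
        Real.norm_of_nonneg (by positivity)]
    simp only [this]
    refine l2_le_of_sq_le m1 (by positivity) fun η ↦ ?_
    by_cases hη : η ∈ annulus d l
    · have h1 := freq_sq_mul_le_sum_energyCoeff ν p k ε η fun b ↦ Z b η
      have h2 : (3 / 4 * 2 ^ l * ‖Z none η‖) ^ 2 ≤ (freq η * ‖Z none η‖) ^ 2 := by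
        have := hη.1
        gcongr
      have h3 := mul_le_mul_of_nonneg_left h2 (sq_nonneg ν)
      have hC : ∀ N : ℝ, (4 / 3 * (√2 / ν)) ^ 2 * N = 16 / 9 * (2 * N) / ν ^ 2 := fun N ↦ by
        rw [mul_pow, div_pow √2, Real.sq_sqrt (by norm_num)]; ring
      rw [norm_mul, Complex.norm_real, Real.norm_of_nonneg (by positivity : (0 : ℝ) ≤ 2 ^ l), hC,
        le_div_iff₀ (by positivity)]
      have h4 : (3 / 4 * (2 : ℝ) ^ l * ‖Z none η‖) ^ 2 = 9 / 16 * (2 ^ l * ‖Z none η‖) ^ 2 := by ring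
      rw [h4] at h3
      linarith
    · rw [hZs _ _ hη, mul_zero, norm_zero, zero_pow two_ne_zero]
      positivity
  have a3 : ∀ i : Fin d, l2 (fun η ↦ ‖Z (some i) η‖ₑ) ≤ ENNReal.ofReal e := fun i ↦ by
    rw [← one_mul e]
    refine l2_le_of_sq_le m1 zero_le_one fun η ↦ ?_
    rw [hpw η, one_pow, one_mul]
    refine (Finset.single_le_sum (f := fun i ↦ ‖Z (some i) η‖ ^ 2) (fun _ _ ↦ sq_nonneg _)
      (Finset.mem_univ i)).trans ?_
    refine (le_add_of_nonneg_right (Finset.sum_nonneg fun _ _ ↦ sq_nonneg _)).trans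
      (le_add_of_nonneg_left (sq_nonneg _))
  rw [Fintype.sum_option, add_mul, add_mul, ENNReal.ofReal_add (by positivity) (by positivity),
    ENNReal.ofReal_add (by positivity) (by positivity)]
  change (1 + dyadicWeight 1 l) * _ + ∑ i : Fin d, 1 * l2 (fun η ↦ ‖Z (some i) η‖ₑ) ≤ _
  rw [add_mul, one_mul]
  refine add_le_add (add_le_add a1 a2) ?_
  simp only [one_mul]
  refine (Finset.sum_le_card_nsmul _ _ _ fun i _ ↦ a3 i).trans_eq ?_
  rw [Finset.card_univ, Fintype.card_fin, nsmul_eq_mul, ENNReal.ofReal_mul (by positivity),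
    ENNReal.ofReal_natCast]

end Energy

end LinearCapillary

namespace LinearCapillary

open MeasureTheory Filter Topology Set TemperedDistribution
open scoped ENNReal ComplexConjugate ContDiff SchwartzMap FourierTransform

variable {d : ℕ}

/-! ### The evolution of a dyadic block -/

/-- Solutions `f = (q, u)` of the system with source `H = (F, G)` on a bounded time interval
`[0, T]`, with the regularity used in the energy estimates; `N` is the convection term, and the unknowns are
bounded in `Ḃ^σ`, with one more derivative for the density. -/
structure IsRegularSolution (χ : Space d → ℝ) (σ μ lam p k ε T : ℝ) (v : ℝ → Fin d → Distr d)
    (f H N : ℝ → Option (Fin d) → Distr d) : Prop where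
  nonneg : 0 ≤ T
  field_measurable : ∀ i, ∀ ψ : 𝓢(Space d, ℂ),
    AEStronglyMeasurable (fun τ ↦ v τ i ψ) (volume.restrict (Icc 0 T))
  real : ∀ᵐ τ ∂(volume.restrict (Icc 0 T)), ∀ i, IsRealDistr (v τ i)
  sh : ∀ᵐ τ ∂(volume.restrict (Icc 0 T)), ∀ i, IsSh χ (v τ i)
  field : ∫⁻ τ in Icc 0 T, besovNormVec χ ((d : ℝ) / 2) (v τ) < ⊤
  field' : ∫⁻ τ in Icc 0 T, besovNormVec χ ((d : ℝ) / 2 + 1) (v τ) < ⊤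
  state_sh : ∀ τ ∈ Icc 0 T, ∀ a, IsSh χ (f τ a)
  state : (⨆ τ ∈ Icc 0 T, ∑' l, dyadicWeight σ l * blockSize χ (f τ) l) < ⊤
  source_measurable : ∀ a, ∀ ψ : 𝓢(Space d, ℂ),
    AEStronglyMeasurable (fun τ ↦ H τ a ψ) (volume.restrict (Icc 0 T))
  source : ∀ l, ∫⁻ τ in Icc 0 T, blockSize χ (H τ) l < ⊤
  convection : ∀ᵐ τ ∂(volume.restrict (Icc 0 T)), ∀ a, IsConvection χ (v τ) (f τ a) (N τ a)
  evolution : ∀ a, ∀ t ∈ Icc 0 T, ∀ ψ : 𝓢(Space d, ℂ),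
    IntervalIntegrable (fun τ ↦ (H τ a - N τ a + linOp μ lam p k ε (f τ) a) ψ) volume 0 t ∧
    f t a ψ = f 0 a ψ + ∫ τ in (0 : ℝ)..t, (H τ a - N τ a + linOp μ lam p k ε (f τ) a) ψ

theorem aemeasurable_blockSize {χ : Space d → ℝ} (hχ : IsCutoff χ) (hd : 0 < d) (l : ℤ)
    {f : ℝ → Option (Fin d) → Distr d} {m : Measure ℝ}
    (hf : ∀ a, ∀ ψ : 𝓢(Space d, ℂ), AEStronglyMeasurable (fun τ ↦ f τ a ψ) m) :
    AEMeasurable (fun τ ↦ blockSize χ (f τ) l) m :=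
  Finset.aemeasurable_fun_sum _ fun a _ ↦
    (aemeasurable_distrLpNorm_dyadicBlock hχ hd l (hf a)).const_mul _

theorem aemeasurable_besovNormVec {χ : Space d → ℝ} (hχ : IsCutoff χ) (hd : 0 < d) (σ : ℝ)
    {v : ℝ → Fin d → Distr d} {m : Measure ℝ}
    (hv : ∀ i, ∀ ψ : 𝓢(Space d, ℂ), AEStronglyMeasurable (fun τ ↦ v τ i ψ) m) :
    AEMeasurable (fun τ ↦ besovNormVec χ σ (v τ)) m :=
  Finset.aemeasurable_fun_sum _ fun i _ ↦ aemeasurable_besovNorm hχ hd σ (hv i)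

namespace IsRegularSolution

variable {χ : Space d → ℝ} {σ μ lam p k ε T : ℝ} {v : ℝ → Fin d → Distr d}
  {f H N : ℝ → Option (Fin d) → Distr d} (h : IsRegularSolution χ σ μ lam p k ε T v f H N)
include h

theorem tsum_lt_top {τ : ℝ} (hτ : τ ∈ Icc 0 T) :
    ∑' l, dyadicWeight σ l * blockSize χ (f τ) l < ⊤ :=
  (le_iSup₂ (f := fun τ (_ : τ ∈ Icc 0 T) ↦ ∑' l, dyadicWeight σ l * blockSize χ (f τ) l)
    τ hτ).trans_lt h.state

theorem measurable_state (a : Option (Fin d)) (ψ : 𝓢(Space d, ℂ)) :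
    AEStronglyMeasurable (fun τ ↦ f τ a ψ) (volume.restrict (Icc 0 T)) :=
  (continuousOn_of_primitive h.nonneg (h.evolution a T ⟨h.nonneg, le_rfl⟩ ψ).1
    fun t ht ↦ (h.evolution a t ht ψ).2).aestronglyMeasurable measurableSet_Icc

/-- The Fourier transforms of the unknowns and of the convection field. -/
theorem exists_fourier (hχ : IsCutoff χ) (hd : 0 < d) (h1 : -((d : ℝ) / 2) < σ)
    (h2 : σ ≤ (d : ℝ) / 2) :
    ∃ (V : ℝ → Fin d → Space d → ℂ) (X : ℝ → Option (Fin d) → Space d → ℂ),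
    (∀ τ ∈ Icc 0 T, ∀ a, HasFourier (f τ a) (X τ a)) ∧
    ∀ᵐ τ ∂(volume.restrict (Icc 0 T)), (∀ i, HasFourier (v τ i) (V τ i)) ∧
      IsFourierState χ σ (V τ) (X τ) ∧
      (∀ i, ∑' j, dyadicWeight ((d : ℝ) / 2) j * blockNorm χ j (fun η ↦ ‖V τ i η‖ₑ) =
        besovNorm χ ((d : ℝ) / 2) (v τ i)) ∧
      (∀ i, ∑' j, dyadicWeight ((d : ℝ) / 2 + 1) j * blockNorm χ j (fun η ↦ ‖V τ i η‖ₑ) =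
        besovNorm χ ((d : ℝ) / 2 + 1) (v τ i)) ∧
      ∀ a, HasFourier (N τ a) (convFourier (V τ) (X τ a)) := by
  have hX : ∀ τ a, ∃ g, τ ∈ Icc 0 T → HasFourier (f τ a) g := fun τ a ↦ by
    by_cases hτ : τ ∈ Icc 0 T
    · obtain ⟨g, hg⟩ := exists_hasFourier hχ h2 (h.state_sh τ hτ a)
        ((ENNReal.tsum_le_tsum fun l ↦ mul_le_mul_right
          (distrLpNorm_le_blockSize χ (f τ) l a) _).trans_lt (h.tsum_lt_top hτ))
      exact ⟨g, fun _ ↦ hg⟩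
    · exact ⟨0, fun h' ↦ absurd h' hτ⟩
  have hV : ∀ τ i, ∃ g, IsSh χ (v τ i) → besovNorm χ ((d : ℝ) / 2) (v τ i) < ⊤ →
      HasFourier (v τ i) g := fun τ i ↦ by
    by_cases hc : IsSh χ (v τ i) ∧ besovNorm χ ((d : ℝ) / 2) (v τ i) < ⊤
    · obtain ⟨g, hg⟩ := exists_hasFourier hχ le_rfl hc.1 hc.2
      exact ⟨g, fun _ _ ↦ hg⟩
    · exact ⟨0, fun h' h'' ↦ absurd ⟨h', h''⟩ hc⟩
  choose X hX using hX
  choose V hV using hV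
  obtain ⟨K, -, hK⟩ := exists_convFourier_bound (χ := χ) hχ hd h1 h2
  refine ⟨V, X, fun τ hτ a ↦ hX τ a hτ, ?_⟩
  have m1 := aemeasurable_besovNormVec hχ hd ((d : ℝ) / 2) h.field_measurable
  have m2 := aemeasurable_besovNormVec hχ hd ((d : ℝ) / 2 + 1) h.field_measurable
  filter_upwards [h.real, h.sh, h.convection, ae_lt_top' m1 h.field.ne, ae_lt_top' m2 h.field'.ne,
    ae_restrict_mem measurableSet_Icc] with τ hr hsh hc hf1 hf2 hτ
  have hv1 := fun i ↦ (ENNReal.sum_lt_top.1 hf1) i (Finset.mem_univ i)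
  have hv2 := fun i ↦ (ENNReal.sum_lt_top.1 hf2) i (Finset.mem_univ i)
  have hVF := fun i ↦ hV τ i (hsh i) (hv1 i)
  have e : ∀ (s : ℝ) i, ∑' j, dyadicWeight s j * blockNorm χ j (fun η ↦ ‖V τ i η‖ₑ) =
      besovNorm χ s (v τ i) := fun s i ↦ by
    simp only [besovNorm, (hVF i).distrLpNorm_dyadicBlock hχ]
  have hst : IsFourierState χ σ (V τ) (X τ) :=
    { measurable_field := fun i ↦ (hVF i).measurable
      real := fun i ↦ (hVF i).ae_conj_neg (hr i)
      field := fun i ↦ by rw [e]; exact hv1 i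
      field' := fun i ↦ by rw [e]; exact hv2 i
      measurable := fun a ↦ (hX τ a hτ).measurable
      state := by
        refine lt_of_le_of_lt (ENNReal.tsum_le_tsum fun l ↦ mul_le_mul_right
          (blockNorm_stateSize_le hχ (fun a ↦ hX τ a hτ) l) _) ?_
        simp only [mul_left_comm _ (ENNReal.ofReal (8 / 3))]
        rw [ENNReal.tsum_mul_left]
        exact ENNReal.mul_lt_top ENNReal.ofReal_lt_top (h.tsum_lt_top hτ) }
  refine ⟨hVF, hst, e _, e _, fun a ↦ ?_⟩
  exact HasFourier.convection hχ hd hVF (hX τ a hτ) (hc a)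
    (hK (V τ) (X τ a) hst.measurable_field (hst.measurable a) hst.field hst.field'
      (hst.unknown a)).1

/-- The Fourier transforms of the dyadic blocks of the source. -/
theorem exists_fourier_source (hχ : IsCutoff χ) (hd : 0 < d) (l : ℤ) :
    ∃ g : ℝ → Option (Fin d) → Space d → ℂ, ∀ᵐ τ ∂(volume.restrict (Icc 0 T)), ∀ a,
      MemLp (g τ a) 2 volume ∧ (∀ η, η ∉ annulus d l → g τ a η = 0) ∧
      (∀ ψ : 𝓢(Space d, ℂ), dyadicBlock χ l (H τ a) (𝓕 ψ) = ∫ η, ψ η * g τ a η) ∧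
      distrLpNorm 2 (dyadicBlock χ l (H τ a)) = l2 fun η ↦ ‖g τ a η‖ₑ := by
  have hg : ∀ τ a, ∃ g : Space d → ℂ, distrLpNorm 2 (dyadicBlock χ l (H τ a)) < ⊤ →
      MemLp g 2 volume ∧ (∀ η, η ∉ annulus d l → g η = 0) ∧
      (∀ ψ : 𝓢(Space d, ℂ), dyadicBlock χ l (H τ a) (𝓕 ψ) = ∫ η, ψ η * g η) ∧
      distrLpNorm 2 (dyadicBlock χ l (H τ a)) = l2 fun η ↦ ‖g η‖ₑ := fun τ a ↦ by
    by_cases hc : distrLpNorm 2 (dyadicBlock χ l (H τ a)) < ⊤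
    · obtain ⟨g, -, h'⟩ := exists_fourier_dyadicBlock hχ hc
      exact ⟨g, fun _ ↦ h'⟩
    · exact ⟨0, fun h' ↦ absurd h' hc⟩
  choose g hg using hg
  refine ⟨g, ?_⟩
  filter_upwards [ae_lt_top' (aemeasurable_blockSize hχ hd l h.source_measurable) (h.source l).ne]
    with τ hτ a
  exact hg τ a ((distrLpNorm_le_blockSize χ (H τ) l a).trans_lt hτ)

/-- The equation satisfied by the Fourier transform of a dyadic block. -/
theorem block_evolution (hχ : IsCutoff χ) {l : ℤ} {V : ℝ → Fin d → Space d → ℂ}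
    {X g : ℝ → Option (Fin d) → Space d → ℂ}
    (hX : ∀ τ ∈ Icc 0 T, ∀ a, HasFourier (f τ a) (X τ a))
    (hN : ∀ᵐ τ ∂(volume.restrict (Icc 0 T)), ∀ a,
      HasFourier (N τ a) (convFourier (V τ) (X τ a)))
    (hg : ∀ᵐ τ ∂(volume.restrict (Icc 0 T)), ∀ a, MemLp (g τ a) 2 volume ∧
      ∀ ψ : 𝓢(Space d, ℂ), dyadicBlock χ l (H τ a) (𝓕 ψ) = ∫ η, ψ η * g τ a η)
    (a : Option (Fin d)) {t : ℝ} (ht : t ∈ Icc 0 T) {ψ : 𝓢(Space d, ℂ)}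
    (hψ : HasCompactSupport ψ) :
    IntervalIntegrable (fun τ ↦ ∫ η, ψ η * (g τ a η -
      blockSymbol χ l η * convFourier (V τ) (X τ a) η +
      linPart μ lam p k ε η (fun b ↦ blockSymbol χ l η * X τ b η) a)) volume 0 t ∧
    ∫ η, ψ η * (blockSymbol χ l η * X t a η) = (∫ η, ψ η * (blockSymbol χ l η * X 0 a η)) +
      ∫ τ in (0 : ℝ)..t, ∫ η, ψ η * (g τ a η -
        blockSymbol χ l η * convFourier (V τ) (X τ a) η +
        linPart μ lam p k ε η (fun b ↦ blockSymbol χ l η * X τ b η) a) := by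
  set Ψ : 𝓢(Space d, ℂ) := SchwartzMap.smulLeftCLM ℂ (fun η ↦ (blockSymbol χ l η : ℂ)) ψ with hΨ
  have hΨc : HasCompactSupport Ψ := hasCompactSupport_smulLeftCLM hψ
  have hΨa : ∀ η, Ψ η = blockSymbol χ l η * ψ η := fun η ↦
    SchwartzMap.smulLeftCLM_apply_apply (hχ.hasTemperateGrowth_blockSymbol l) _ _
  have hf : ∀ τ ∈ Icc 0 T, f τ a (𝓕 Ψ) = ∫ η, ψ η * (blockSymbol χ l η * X τ a η) := by
    intro τ hτ
    rw [(hX τ hτ a).apply_fourier Ψ hΨc]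
    exact integral_congr_ae (ae_of_all _ fun η ↦ by simp only [hΨa]; ring)
  have hrhs : ∀ᵐ τ ∂(volume.restrict (Icc 0 T)),
      (H τ a - N τ a + linOp μ lam p k ε (f τ) a) (𝓕 Ψ) = ∫ η, ψ η * (g τ a η -
      blockSymbol χ l η * convFourier (V τ) (X τ a) η +
      linPart μ lam p k ε η (fun b ↦ blockSymbol χ l η * X τ b η) a) := by
    filter_upwards [hN, hg, ae_restrict_mem measurableSet_Icc] with τ hN hg hτ
    have hL := HasFourier.linOp (hX τ hτ) μ lam p k ε a
    have i1 : Integrable fun η ↦ ψ η * g τ a η :=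
      ((ψ.memLp 2 volume).integrable_mul (hg a).1 :)
    have i2 := (hN a).integrable_mul hΨc
    have i3 := hL.integrable_mul hΨc
    have e1 : H τ a (𝓕 Ψ) = ∫ η, ψ η * g τ a η := by
      rw [← (hg a).2 ψ, dyadicBlock_apply_fourier]
    rw [add_apply, sub_apply, e1,
      (hN a).apply_fourier Ψ hΨc, hL.apply_fourier Ψ hΨc, ← integral_sub i1 i2]
    have i4 : Integrable fun η ↦ ψ η * g τ a η - Ψ η * convFourier (V τ) (X τ a) η := i1.sub i2
    rw [← integral_add i4 i3]
    refine integral_congr_ae (ae_of_all _ fun η ↦ ?_)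
    simp only [hΨa, linPart_smul]
    ring
  have hsub : uIoc 0 t ⊆ Icc 0 T := by
    rw [uIoc_of_le ht.1]; exact fun x hx ↦ ⟨hx.1.le, hx.2.trans ht.2⟩
  have hae := ae_restrict_of_ae_restrict_of_subset hsub hrhs
  obtain ⟨q1, q2⟩ := h.evolution a t ht (𝓕 Ψ)
  refine ⟨q1.congr_ae hae, ?_⟩
  rw [hf t ht, hf 0 ⟨le_rfl, h.nonneg⟩] at q2
  rw [q2]
  congr 1
  exact intervalIntegral.integral_congr_ae_restrict hae

end IsRegularSolution

end LinearCapillary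

namespace LinearCapillary

open MeasureTheory Filter Topology Set TemperedDistribution
open scoped ENNReal ComplexConjugate ContDiff SchwartzMap FourierTransform LineDeriv

variable {d : ℕ}

/-! ### The estimate of a dyadic block -/

/-- The source in the estimate of the block `l`: the contribution of the convection and the size
of the source of the system. -/
noncomputable def blockSource (χ : Space d → ℝ) (v : Fin d → Distr d)
    (f H : Option (Fin d) → Distr d) (l : ℤ) : ℝ≥0∞ :=
  paraSum d (gradBlock χ v) (blockSize χ f) l + blockSize χ H l

theorem aemeasurable_gradBlock {χ : Space d → ℝ} (hχ : IsCutoff χ) (hd : 0 < d) (l : ℤ)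
    {v : ℝ → Fin d → Distr d} {m : Measure ℝ}
    (hv : ∀ i, ∀ ψ : 𝓢(Space d, ℂ), AEStronglyMeasurable (fun τ ↦ v τ i ψ) m) :
    AEMeasurable (fun τ ↦ gradBlock χ (v τ) l) m := by
  refine Finset.aemeasurable_fun_sum _ fun j _ ↦ Finset.aemeasurable_fun_sum _ fun i _ ↦
    aemeasurable_distrLpNorm_dyadicBlock hχ hd l (f := fun τ ↦ partialD j (v τ i)) fun ψ ↦ ?_
  simp only [partialD, TemperedDistribution.lineDerivOp_apply_apply]
  exact hv i _

theorem aemeasurable_paraSum {m : Measure ℝ} {w y : ℝ → ℤ → ℝ≥0∞}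
    (hw : ∀ j, AEMeasurable (fun τ ↦ w τ j) m) (hy : ∀ j, AEMeasurable (fun τ ↦ y τ j) m) (l : ℤ) :
    AEMeasurable (fun τ ↦ paraSum d (w τ) (y τ) l) m :=
  AEMeasurable.tsum fun j ↦ AEMeasurable.tsum fun k ↦ ((hw j).mul (hy k)).const_mul _

theorem toReal_intervalIntegrable {Φ : ℝ → ℝ≥0∞} {T : ℝ} (hT : 0 ≤ T)
    (hm : AEMeasurable Φ (volume.restrict (Icc 0 T))) (h : ∫⁻ τ in Icc 0 T, Φ τ < ⊤) :
    IntervalIntegrable (fun τ ↦ (Φ τ).toReal) volume 0 T := by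
  rw [intervalIntegrable_iff_integrableOn_Icc_of_le hT]
  exact integrable_toReal_of_lintegral_ne_top hm h.ne

namespace IsRegularSolution

section

variable {χ : Space d → ℝ} {σ μ lam p k ε T : ℝ} {v : ℝ → Fin d → Distr d}
  {f H N : ℝ → Option (Fin d) → Distr d} (h : IsRegularSolution χ σ μ lam p k ε T v f H N)
include h

theorem aemeasurable_blockSource (hχ : IsCutoff χ) (hd : 0 < d) (l : ℤ) :
    AEMeasurable (fun τ ↦ blockSource χ (v τ) (f τ) (H τ) l) (volume.restrict (Icc 0 T)) :=
  (aemeasurable_paraSum (fun j ↦ aemeasurable_gradBlock hχ hd j h.field_measurable)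
    (fun j ↦ aemeasurable_blockSize hχ hd j h.measurable_state) l).add
    (aemeasurable_blockSize hχ hd l h.source_measurable)

theorem ae_besovNormGrad_le (hχ : IsCutoff χ) (hd : 0 < d) :
    ∀ᵐ τ ∂(volume.restrict (Icc 0 T)), besovNormGrad χ ((d : ℝ) / 2) (v τ) ≤
      d * (ENNReal.ofReal (8 / 3) * besovNormVec χ ((d : ℝ) / 2 + 1) (v τ)) := by
  filter_upwards [h.sh, ae_lt_top' (aemeasurable_besovNormVec hχ hd ((d : ℝ) / 2)
    h.field_measurable) h.field.ne] with τ hsh hf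
  choose V hV using fun i ↦ exists_hasFourier hχ le_rfl (hsh i)
    ((ENNReal.sum_lt_top.1 hf) i (Finset.mem_univ i))
  exact besovNormGrad_le hχ hV _

theorem lintegral_besovNormGrad_lt_top (hχ : IsCutoff χ) (hd : 0 < d) :
    ∫⁻ τ in Icc 0 T, besovNormGrad χ ((d : ℝ) / 2) (v τ) < ⊤ := by
  refine (lintegral_mono_ae (h.ae_besovNormGrad_le hχ hd)).trans_lt ?_
  rw [lintegral_const_mul' _ _ (by simp), lintegral_const_mul' _ _ ENNReal.ofReal_ne_top]
  exact ENNReal.mul_lt_top (by simp) (ENNReal.mul_lt_top ENNReal.ofReal_lt_top h.field')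

theorem lintegral_blockSource_lt_top (hχ : IsCutoff χ) (hd : 0 < d) (h1 : -((d : ℝ) / 2) < σ)
    (h2 : σ ≤ (d : ℝ) / 2) (l : ℤ) :
    ∫⁻ τ in Icc 0 T, blockSource χ (v τ) (f τ) (H τ) l < ⊤ := by
  obtain ⟨K, hK, hk⟩ := exists_tsum_paraSum_le (d := d) h1 h2
  unfold blockSource
  rw [lintegral_add_right' _ (aemeasurable_blockSize hχ hd l h.source_measurable)]
  refine ENNReal.add_lt_top.2 ⟨?_, h.source l⟩
  refine lt_top_of_mul_lt_top_left (dyadicWeight_ne_zero σ l) ?_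
  rw [← lintegral_const_mul' _ _ (dyadicWeight_ne_top σ l)]
  refine (setLIntegral_mono' (g := fun τ ↦ (K * ⨆ τ ∈ Icc 0 T, ∑' l, dyadicWeight σ l *
    blockSize χ (f τ) l) * besovNormGrad χ ((d : ℝ) / 2) (v τ)) measurableSet_Icc
    fun τ hτ ↦ ?_).trans_lt ?_
  · refine (ENNReal.le_tsum l).trans ((hk (gradBlock χ (v τ)) (blockSize χ (f τ))).trans ?_)
    rw [tsum_gradBlock, mul_comm (besovNormGrad _ _ _), ← mul_assoc]
    gcongr
    exact le_iSup₂ (f := fun τ (_ : τ ∈ Icc 0 T) ↦ ∑' l, dyadicWeight σ l * blockSize χ (f τ) l)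
      τ hτ
  · rw [lintegral_const_mul' _ _ (ENNReal.mul_lt_top hK.lt_top h.state).ne]
    exact ENNReal.mul_lt_top (ENNReal.mul_lt_top hK.lt_top h.state)
      (h.lintegral_besovNormGrad_lt_top hχ hd)

end

/-- The energy estimate of a block, for the energy given by admissible linear combinations of
the unknowns, in terms of the dissipation of the linear part. -/
theorem exists_sqrt_energy_estimate {χ : Space d → ℝ} {σ : ℝ} (hχ : IsCutoff χ) (hd : 0 < d)
    (h1 : -((d : ℝ) / 2) < σ) (h2 : σ ≤ (d : ℝ) / 2) {L : ℝ} (hL : 0 ≤ L) : ∃ K : ℝ, 0 ≤ K ∧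
    ∀ (μ lam p k ε T : ℝ) (v : ℝ → Fin d → Distr d) (f H N : ℝ → Option (Fin d) → Distr d),
    IsRegularSolution χ σ μ lam p k ε T v f H N → ∀ l : ℤ,
    ∃ Z : Option (Fin d) → ℝ → Space d → ℂ,
    (∀ a, ∀ τ ∈ Icc 0 T, MemLp (Z a τ) 2 volume) ∧
    (∀ a τ η, η ∉ annulus d l → Z a τ η = 0) ∧
    (∀ a, ∀ τ ∈ Icc 0 T, distrLpNorm 2 (dyadicBlock χ l (f τ a)) = l2 fun η ↦ ‖Z a τ η‖ₑ) ∧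
    ∀ (J : Type) [Fintype J] (α : J → Option (Fin d) → Space d → ℂ),
    (∀ j, IsAdmissible L (α j)) →
    ContinuousOn (fun τ ↦ energy fun j η ↦ ∑ a, α j a η * Z a τ η) (Icc 0 T) ∧
    ∀ κ : ℝ, 0 ≤ κ → ∀ D : ℝ → ℝ, (∀ τ, 0 ≤ D τ) → IntervalIntegrable D volume 0 T →
    (∀ τ ∈ Icc 0 T, ∑ j, (∫ η, conj (∑ a, α j a η * Z a τ η) * ∑ a, α j a η *
        linPart μ lam p k ε η (fun b ↦ Z b τ η) a).re ≤
      -κ * (energy fun j η ↦ ∑ a, α j a η * Z a τ η) +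
        √(energy fun j η ↦ ∑ a, α j a η * Z a τ η) * D τ) →
    ∀ t ∈ Icc 0 T, √(energy fun j η ↦ ∑ a, α j a η * Z a t η) +
      κ * ∫ τ in (0 : ℝ)..t, √(energy fun j η ↦ ∑ a, α j a η * Z a τ η) ≤
      √(energy fun j η ↦ ∑ a, α j a η * Z a 0 η) + ∫ τ in (0 : ℝ)..t,
        (Fintype.card J * K * (blockSource χ (v τ) (f τ) (H τ) l).toReal + D τ) := by
  obtain ⟨K₁, hK₁, hk₁⟩ := exists_component_balance hχ hd h1 h2 hL
  obtain ⟨K₂, hK₂, hk₂⟩ := exists_convFourier_bound (χ := χ) hχ hd h1 h2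
  refine ⟨K₁ * (8 / 3), by positivity, fun μ lam p k ε T v f H N h l ↦ ?_⟩
  obtain ⟨V, X, hX, hae⟩ := h.exists_fourier hχ hd h1 h2
  obtain ⟨g, hg⟩ := h.exists_fourier_source hχ hd l
  obtain ⟨B, hB, hBl⟩ := exists_l2_linPart_le (d := d) l μ lam p k ε
  -- The Fourier transforms of the blocks, extended by `0` outside `[0, T]`, where the solution is
  -- not given.
  set Z : Option (Fin d) → ℝ → Space d → ℂ := fun a τ ↦
    if τ ∈ Icc 0 T then fun η ↦ blockSymbol χ l η * X τ a η else 0 with hZdef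
  have hZe : ∀ a, ∀ τ ∈ Icc 0 T, Z a τ = fun η ↦ blockSymbol χ l η * X τ a η := fun a τ hτ ↦
    if_pos hτ
  have hnorm : ∀ a, ∀ τ ∈ Icc 0 T,
      distrLpNorm 2 (dyadicBlock χ l (f τ a)) = l2 fun η ↦ ‖Z a τ η‖ₑ := fun a τ hτ ↦ by
    rw [hZe a τ hτ, (hX τ hτ a).distrLpNorm_dyadicBlock hχ, hχ.blockNorm_eq_eLpNorm,
      eLpNorm_two_eq_l2]
  have hstate : ∀ a, ∀ τ ∈ Icc 0 T, dyadicWeight σ l * distrLpNorm 2 (dyadicBlock χ l (f τ a)) ≤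
      ⨆ τ ∈ Icc 0 T, ∑' l, dyadicWeight σ l * blockSize χ (f τ) l := fun a τ hτ ↦
    (mul_le_mul_right (distrLpNorm_le_blockSize χ (f τ) l a) _).trans ((ENNReal.le_tsum l).trans
      (le_iSup₂ (f := fun τ (_ : τ ∈ Icc 0 T) ↦ ∑' l, dyadicWeight σ l * blockSize χ (f τ) l)
        τ hτ))
  have hZ : ∀ a, ∀ τ ∈ Icc 0 T, MemLp (Z a τ) 2 volume := fun a τ hτ ↦ by
    refine ⟨?_, ?_⟩
    · rw [hZe a τ hτ]
      exact ((hχ.hasTemperateGrowth_blockSymbol l).1.continuous.measurable.mul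
        (hX τ hτ a).measurable).aestronglyMeasurable
    · rw [eLpNorm_two_eq_l2, ← hnorm a τ hτ]
      exact lt_top_of_mul_lt_top_left (dyadicWeight_ne_zero σ l)
        ((hstate a τ hτ).trans_lt h.state)
  have hZs : ∀ a τ η, η ∉ annulus d l → Z a τ η = 0 := fun a τ η hη ↦ by
    by_cases hτ : τ ∈ Icc 0 T
    · simp [hZe a τ hτ, hχ.blockSymbol_eq_zero hη]
    · simp only [hZdef, if_neg hτ, Pi.zero_apply]
  refine ⟨Z, hZ, hZs, hnorm, fun J _ α hα ↦ ?_⟩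
  set ρ : Option (Fin d) → ℝ → Space d → ℂ := fun a τ η ↦ g τ a η -
    blockSymbol χ l η * convFourier (V τ) (X τ a) η +
    linPart μ lam p k ε η (fun b ↦ Z b τ η) a with hρdef
  set M := ⨆ τ ∈ Icc 0 T, ∑' l, dyadicWeight σ l * blockSize χ (f τ) l with hM
  -- the convection term is square integrable, with an integrable bound in time
  have hconv : ∀ᵐ τ ∂(volume.restrict (Icc 0 T)), ∀ a,
      MemLp (fun η ↦ blockSymbol χ l η * convFourier (V τ) (X τ a) η) 2 volume ∧
      l2 (fun η ↦ ‖blockSymbol χ l η * convFourier (V τ) (X τ a) η‖ₑ) ≤ dyadicWeight (-σ) l *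
        (K₂ * (dyadicWeight 1 l * besovNormVec χ ((d : ℝ) / 2) (v τ) +
          besovNormVec χ ((d : ℝ) / 2 + 1) (v τ)) * M) := by
    filter_upwards [hae, ae_restrict_mem measurableSet_Icc,
      ae_lt_top' (aemeasurable_besovNormVec hχ hd ((d : ℝ) / 2) h.field_measurable) h.field.ne,
      ae_lt_top' (aemeasurable_besovNormVec hχ hd ((d : ℝ) / 2 + 1) h.field_measurable)
        h.field'.ne] with τ hτ hτm hf1 hf2 a
    obtain ⟨hV, hs, e1, e2, hN⟩ := hτ
    have b1 := (hk₂ (V τ) (X τ a) hs.measurable_field (hs.measurable a) hs.field hs.field'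
      (hs.unknown a)).2 l
    simp only [e1, e2, Finset.sum_add_distrib, ← Finset.mul_sum] at b1
    have b2 : ∑' j, dyadicWeight σ j * blockNorm χ j (fun η ↦ ‖X τ a η‖ₑ) ≤ M := by
      simp only [← (hX τ hτm a).distrLpNorm_dyadicBlock hχ]
      exact (ENNReal.tsum_le_tsum fun j ↦ mul_le_mul_right
        (distrLpNorm_le_blockSize χ (f τ) j a) _).trans
        (le_iSup₂ (f := fun τ (_ : τ ∈ Icc 0 T) ↦ ∑' l, dyadicWeight σ l * blockSize χ (f τ) l)
        τ hτm)
    have b3 : l2 (fun η ↦ ‖blockSymbol χ l η * convFourier (V τ) (X τ a) η‖ₑ) ≤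
        dyadicWeight (-σ) l * (K₂ * (dyadicWeight 1 l * besovNormVec χ ((d : ℝ) / 2) (v τ) +
          besovNormVec χ ((d : ℝ) / 2 + 1) (v τ)) * M) := by
      rw [← eLpNorm_two_eq_l2, ← hχ.blockNorm_eq_eLpNorm]
      rw [← one_mul (blockNorm _ _ _), ← dyadicWeight_neg_mul σ l, mul_assoc]
      refine mul_le_mul_right (b1.trans ?_) _
      exact mul_le_mul_right b2 _
    refine ⟨⟨((hχ.hasTemperateGrowth_blockSymbol l).1.continuous.measurable.mul
      (measurable_convFourier hs.measurable_field (hs.measurable a))).aestronglyMeasurable, ?_⟩, b3⟩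
    rw [eLpNorm_two_eq_l2]
    refine b3.trans_lt (ENNReal.mul_lt_top (dyadicWeight_ne_top _ l).lt_top (ENNReal.mul_lt_top
      (ENNReal.mul_lt_top hK₂.lt_top (ENNReal.add_lt_top.2 ⟨ENNReal.mul_lt_top
        (dyadicWeight_ne_top 1 l).lt_top hf1, hf2⟩)) h.state))
  have hlin : ∀ τ ∈ Icc 0 T, ∀ a,
      MemLp (fun η ↦ linPart μ lam p k ε η (fun b ↦ Z b τ η) a) 2 volume := fun τ hτ a ↦
    memLp_linPart (fun b ↦ hZ b τ hτ) (fun b η hη ↦ hZs b τ η hη) μ lam p k ε a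
  have hlins : ∀ τ a η, η ∉ annulus d l → linPart μ lam p k ε η (fun b ↦ Z b τ η) a = 0 :=
    fun τ a η hη ↦ linPart_eq_zero (fun b η hη ↦ hZs b τ η hη) μ lam p k ε a hη
  have hρ : ∀ᵐ τ ∂(volume.restrict (Icc 0 T)), ∀ a, MemLp (ρ a τ) 2 volume ∧
      ∀ η, η ∉ annulus d l → ρ a τ η = 0 := by
    filter_upwards [hconv, hg, ae_restrict_mem measurableSet_Icc] with τ hc hg hτ a
    refine ⟨((hg a).1.sub (hc a).1).add (hlin τ hτ a), fun η hη ↦ ?_⟩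
    simp [hρdef, (hg a).2.1 η hη, hχ.blockSymbol_eq_zero hη, hlins τ a η hη]
  -- Integrability of the time derivative `ρ`. The bound `b` depends on the block and is not used
  -- quantitatively.
  set b : ℝ → ℝ≥0∞ := fun τ ↦ blockSize χ (H τ) l + dyadicWeight (-σ) l *
        (K₂ * (dyadicWeight 1 l * besovNormVec χ ((d : ℝ) / 2) (v τ) +
          besovNormVec χ ((d : ℝ) / 2 + 1) (v τ)) * M) +
      B * ∑ _b : Option (Fin d), dyadicWeight (-σ) l * M with hb
  have hbi : ∫⁻ τ in Icc 0 T, b τ < ⊤ := by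
    have m1 := aemeasurable_besovNormVec hχ hd ((d : ℝ) / 2) h.field_measurable
    have m2 := aemeasurable_besovNormVec hχ hd ((d : ℝ) / 2 + 1) h.field_measurable
    have m3 := aemeasurable_blockSize hχ hd l h.source_measurable
    have c1 := dyadicWeight_ne_top (-σ) l
    have c2 := dyadicWeight_ne_top 1 l
    rw [hb, lintegral_add_right _ measurable_const, lintegral_add_left' m3,
      lintegral_const_mul' _ _ c1, lintegral_mul_const' _ _ h.state.ne, lintegral_const_mul' _ _ hK₂,
      lintegral_add_right' _ m2, lintegral_const_mul' _ _ c2]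
    refine ENNReal.add_lt_top.2 ⟨ENNReal.add_lt_top.2 ⟨h.source l, ?_⟩, ?_⟩
    · exact ENNReal.mul_lt_top c1.lt_top (ENNReal.mul_lt_top (ENNReal.mul_lt_top hK₂.lt_top
        (ENNReal.add_lt_top.2 ⟨ENNReal.mul_lt_top c2.lt_top h.field, h.field'⟩)) h.state)
    · rw [lintegral_const]
      exact ENNReal.mul_lt_top (ENNReal.mul_lt_top hB.lt_top (ENNReal.sum_lt_top.2 fun _ _ ↦
        ENNReal.mul_lt_top c1.lt_top h.state)) (by simp)
  have hρb : ∀ᵐ τ ∂(volume.restrict (Icc 0 T)), ∀ a, l2 (fun η ↦ ‖ρ a τ η‖ₑ) ≤ b τ := by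
    filter_upwards [hconv, hg, ae_restrict_mem measurableSet_Icc] with τ hc hg hτ a
    have t1 : ∀ η, ‖ρ a τ η‖ₑ ≤ (‖g τ a η‖ₑ + ‖blockSymbol χ l η * convFourier (V τ) (X τ a) η‖ₑ)
        + ‖linPart μ lam p k ε η (fun b ↦ Z b τ η) a‖ₑ := fun η ↦
      (enorm_add_le _ _).trans (add_le_add enorm_sub_le le_rfl)
    refine (l2_mono (ae_of_all _ t1)).trans ((l2_add_le ((hg a).1.1.enorm.add (hc a).1.1.enorm)
      (hlin τ hτ a).1.enorm).trans (add_le_add ((l2_add_le (hg a).1.1.enorm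
        (hc a).1.1.enorm).trans (add_le_add ?_ (hc a).2)) ?_))
    · rw [← (hg a).2.2.2]
      exact distrLpNorm_le_blockSize χ (H τ) l a
    · refine (hBl (fun b η ↦ Z b τ η) (fun b ↦ hZ b τ hτ) (fun b η hη ↦ hZs b τ η hη) a).trans ?_
      refine mul_le_mul_right (Finset.sum_le_sum fun b _ ↦ ?_) _
      rw [← hnorm b τ hτ, ← one_mul (distrLpNorm _ _), ← dyadicWeight_neg_mul σ l, mul_assoc]
      exact mul_le_mul_right (hstate b τ hτ) _
  have hev : ∀ a, ∀ t ∈ Icc 0 T, ∀ ψ : 𝓢(Space d, ℂ), HasCompactSupport ψ →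
      IntervalIntegrable (fun τ ↦ ∫ η, ψ η * ρ a τ η) volume 0 t ∧
      ∫ η, ψ η * Z a t η = (∫ η, ψ η * Z a 0 η) + ∫ τ in (0 : ℝ)..t, ∫ η, ψ η * ρ a τ η := by
    intro a t ht ψ hψ
    obtain ⟨e1, e2⟩ := h.block_evolution hχ hX (hae.mono fun τ hτ ↦ hτ.2.2.2.2)
      (hg.mono fun τ hτ a ↦ ⟨(hτ a).1, (hτ a).2.2.1⟩) a ht hψ
    have hcongr : EqOn (fun τ ↦ ∫ η, ψ η * (g τ a η -
        blockSymbol χ l η * convFourier (V τ) (X τ a) η +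
        linPart μ lam p k ε η (fun b ↦ blockSymbol χ l η * X τ b η) a))
        (fun τ ↦ ∫ η, ψ η * ρ a τ η) (uIcc 0 t) := fun τ hτ ↦ by
      rw [uIcc_of_le ht.1] at hτ
      simp only [hρdef, hZe _ τ ⟨hτ.1, hτ.2.trans ht.2⟩]
    rw [hZe a t ht, hZe a 0 ⟨le_rfl, h.nonneg⟩]
    refine ⟨e1.congr fun τ hτ ↦ hcongr (uIoc_subset_uIcc hτ), ?_⟩
    rw [e2, intervalIntegral.integral_congr hcongr]
  obtain ⟨hcont, hest⟩ := block_energy (l := l) h.nonneg (α := α) (fun j a ↦ (hα j).smooth a)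
    hZ hZs hρ hbi hρb hev (c := fun j τ η ↦ ∑ a, α j a η * Z a τ η) fun _ _ _ ↦ rfl
  refine ⟨hcont, fun κ hκ D hD0 hD hdis ↦ hest hκ ?_ ?_ ?_⟩
  · intro τ
    have := hD0 τ
    positivity
  · exact ((toReal_intervalIntegrable h.nonneg (h.aemeasurable_blockSource hχ hd l)
      (h.lintegral_blockSource_lt_top hχ hd h1 h2 l)).const_mul _).add hD
  filter_upwards [hae, hconv, hg, ae_restrict_mem measurableSet_Icc,
    ae_lt_top' (h.aemeasurable_blockSource hχ hd l)
      (h.lintegral_blockSource_lt_top hχ hd h1 h2 l).ne] with τ hτ hc hg hτm hfin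
  obtain ⟨hV, hs, -, -, -⟩ := hτ
  have hpara : paraSum d (fun j ↦ blockNorm χ j (gradSize (V τ)))
      (fun j ↦ blockNorm χ j (stateSize (X τ))) l + ∑ a, dyadicUnknownWeight a l *
        l2 (fun η ↦ ‖g τ a η‖ₑ) ≤
      ENNReal.ofReal (8 / 3) * blockSource χ (v τ) (f τ) (H τ) l := by
    rw [blockSource, mul_add, ← paraSum_const_mul_right]
    refine add_le_add (paraSum_mono (blockNorm_gradSize_le hχ hV)
      (blockNorm_stateSize_le hχ (hX τ hτm)) l) ?_
    simp only [← (hg _).2.2.2]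
    exact le_mul_of_one_le_left zero_le (by rw [ENNReal.one_le_ofReal]; norm_num)
  have hpr := ENNReal.toReal_mono (ENNReal.mul_ne_top ENNReal.ofReal_ne_top hfin.ne) hpara
  rw [ENNReal.toReal_mul, ENNReal.toReal_ofReal (by norm_num)] at hpr
  have hmem := memLp_combination hα (fun a ↦ hZ a τ hτm) (fun a η hη ↦ hZs a τ η hη)
  -- the quantitative estimate comes from the energy balance of each component
  have hj := fun j ↦ hk₁ l (V τ) (X τ) hs (α j) (hα j) (g τ)
    (fun a η ↦ linPart μ lam p k ε η (fun b ↦ Z b τ η) a) (fun a ↦ (hg a).1) (fun a ↦ (hg a).2.1)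
    (hlin τ hτm) (hlins τ) (fun η ↦ ∑ a, α j a η * Z a τ η)
    (fun η ↦ by simp only [hZe _ τ hτm]) (hmem j) (fun a ↦ (hc a).1)
  set E := energy fun j η ↦ ∑ a, α j a η * Z a τ η with hE
  refine (Finset.sum_le_sum fun j _ ↦ (hj j).trans (add_le_add le_rfl
    (mul_le_mul (l2_toReal_le_sqrt_energy (fun j η ↦ ∑ a, α j a η * Z a τ η) j)
      (mul_le_mul_of_nonneg_left hpr hK₁) (by positivity) (Real.sqrt_nonneg _)))).trans ?_
  rw [Finset.sum_add_distrib, Finset.sum_const, Finset.card_univ, nsmul_eq_mul]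
  refine (add_le_add (hdis τ hτm) le_rfl).trans (le_of_eq ?_)
  ring

end IsRegularSolution

end LinearCapillary

namespace LinearCapillary

open MeasureTheory Filter Topology Set
open scoped ENNReal ComplexConjugate

variable {d : ℕ}

/-! ### Decay and smoothing of a dyadic block -/

theorem ofReal_intervalIntegral {g : ℝ → ℝ} {t : ℝ} (ht : 0 ≤ t)
    (hg : IntervalIntegrable g volume 0 t) (h0 : ∀ τ, 0 ≤ g τ) :
    ENNReal.ofReal (∫ τ in (0 : ℝ)..t, g τ) = ∫⁻ τ in Icc 0 t, ENNReal.ofReal (g τ) := by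
  rw [intervalIntegrable_iff_integrableOn_Icc_of_le ht] at hg
  rw [intervalIntegral.integral_of_le ht, ← integral_Icc_eq_integral_Ioc,
    ofReal_integral_eq_lintegral_ofReal hg (ae_of_all _ h0)]

/-- A common constant for the dissipation of the energy and of the velocity. -/
theorem exists_dissipation_constant {μ ν : ℝ} (hμ : 0 < μ) (hν : 0 < ν) : ∃ c : ℝ, 0 < c ∧
    3 * c ≤ 2 * μ ∧ 3 * c ≤ ν ∧ c * (2 + 2 * ν ^ 2) ≤ ν ∧ c ≤ μ ∧ c ≤ ν := by
  refine ⟨min (min (μ / 3) (ν / 3)) (ν / (2 + 2 * ν ^ 2)), by positivity, ?_, ?_, ?_, ?_, ?_⟩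
  · linarith [min_le_left (min (μ / 3) (ν / 3)) (ν / (2 + 2 * ν ^ 2)), min_le_left (μ / 3) (ν / 3)]
  · linarith [min_le_left (min (μ / 3) (ν / 3)) (ν / (2 + 2 * ν ^ 2)),
      min_le_right (μ / 3) (ν / 3)]
  · rw [← le_div_iff₀ (by positivity)]
    exact min_le_right _ _
  · linarith [min_le_left (min (μ / 3) (ν / 3)) (ν / (2 + 2 * ν ^ 2)), min_le_left (μ / 3) (ν / 3)]
  · linarith [min_le_left (min (μ / 3) (ν / 3)) (ν / (2 + 2 * ν ^ 2)),
      min_le_right (μ / 3) (ν / 3)]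

/-- The combination of the energy estimate, with rate `min(x, K)`, and of the estimate of the
velocity, with rate `x` and source `K e`: the source is absorbed, as either `K ≤ x`, and `K e` is
integrable by the former, or the former gives the parabolic rate by itself. -/
theorem velocity_absorb {c x K q E₁ E₂ A : ℝ} (hc : 0 < c) (hq : 0 ≤ q)
    (h1 : c * (min x K * E₁) ≤ A)
    (h2 : c * x * E₂ ≤ A + 13 * K * q * E₁) (h21 : E₂ ≤ E₁) (hE₂ : 0 ≤ E₂) (hA : 0 ≤ A) :
    x * E₂ ≤ 1 / c * (1 + 13 * q / c) * A := by
  have hq' : 0 ≤ 13 * q / c := by positivity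
  rcases le_total K x with h | h
  · rw [min_eq_right h] at h1
    have h3 : K * E₁ ≤ A / c := by rw [le_div_iff₀ hc]; linarith
    have h4 := mul_le_mul_of_nonneg_left h3 (by positivity : 0 ≤ 13 * q)
    have h5 : c * (x * E₂) ≤ (1 + 13 * q / c) * A := by
      have : (1 + 13 * q / c) * A = A + 13 * q * (A / c) := by ring
      rw [this]; linarith
    rw [mul_assoc, one_div, le_inv_mul_iff₀ hc]
    exact h5
  · rw [min_eq_left h] at h1
    rw [mul_assoc, one_div, le_inv_mul_iff₀ hc]
    rcases le_total 0 x with hx | hx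
    · have := mul_le_mul_of_nonneg_left h21 (mul_nonneg hc.le hx)
      have := mul_nonneg hq' hA
      linarith
    · have h6 : x * E₂ ≤ 0 := mul_nonpos_of_nonpos_of_nonneg hx hE₂
      have h7 : c * (x * E₂) ≤ 0 := mul_nonpos_of_nonneg_of_nonpos hc.le h6
      have := mul_nonneg hq' hA
      linarith

/-- The estimate of the block `l` of the solution: the block decays at the rate `blockRate`, and its
velocity at the parabolic rate. -/
theorem exists_block_estimate {χ : Space d → ℝ} {σ : ℝ} (hχ : IsCutoff χ) (hd : 0 < d)
    (h1 : -((d : ℝ) / 2) < σ) (h2 : σ ≤ (d : ℝ) / 2) {μ lam p k : ℝ} (hμ : 0 < μ)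
    (hν : 0 < lam + 2 * μ) (hp : 0 < p) (hk : 0 < k) : ∃ C : ℝ≥0∞, C ≠ ⊤ ∧
    ∀ (ε : ℝ), 0 < ε → ∀ (T : ℝ) (v : ℝ → Fin d → Distr d) (f H N : ℝ → Option (Fin d) → Distr d),
    IsRegularSolution χ σ μ lam p k ε T v f H N → ∀ l : ℤ, ∀ t ∈ Icc 0 T,
    blockSize χ (f t) l
      + ENNReal.ofReal (blockRate p k ε l) * (∫⁻ τ in Icc 0 t, blockSize χ (f τ) l)
      + ENNReal.ofReal ((2 ^ l) ^ 2) *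
        (∫⁻ τ in Icc 0 t, ∑ i, distrLpNorm 2 (dyadicBlock χ l (f τ (some i)))) ≤
    C * (blockSize χ (f 0) l + ∫⁻ τ in Icc 0 t, blockSource χ (v τ) (f τ) (H τ) l) := by
  obtain ⟨c, hc, c1, c2, c3, c4, c5⟩ := exists_dissipation_constant hμ hν
  set ν := lam + 2 * μ with hνdef
  have hL := one_le_coeffBound (p := p) (k := k) hν
  have hL0 : 0 ≤ coeffBound ν p k := zero_le_one.trans hL
  obtain ⟨K, hK, hest⟩ := IsRegularSolution.exists_sqrt_energy_estimate hχ hd h1 h2 hL0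
  set n : ℝ := Fintype.card (Option (Fin d ⊕ Fin d)) + Fintype.card (Fin d) with hn
  set C₁ : ℝ := 1 / √(2 * p) + 4 / 3 * (√2 / ν) + d with hC₁
  set C₃ : ℝ := 1 / c * (1 + 13 * (√2 / ν) / c) with hC₃
  set C₂ : ℝ≥0∞ := Fintype.card (Option (Fin d ⊕ Fin d)) *
    ENNReal.ofReal (coeffBound ν p k * (8 / 3)) with hC₂
  have hC₁0 : 0 ≤ C₁ := by positivity
  have hC₃0 : 0 ≤ C₃ := by positivity
  set P : ℝ≥0∞ := ENNReal.ofReal C₁ + ENNReal.ofReal (C₁ / c) + d * ENNReal.ofReal (16 / 9 * C₃)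
    with hP
  refine ⟨P * (C₂ + ENNReal.ofReal (n * K)), ENNReal.mul_ne_top (by simp [hP, ENNReal.mul_eq_top])
    (by simp [hC₂, ENNReal.mul_eq_top]), fun ε hε T v f H N h l t ht ↦ ?_⟩
  obtain ⟨Z, hZ, hZs, hnorm, hE⟩ := hest μ lam p k ε T v f H N h l
  have h0 : (0 : ℝ) ∈ Icc 0 T := ⟨le_rfl, h.nonneg⟩
  have hαe := isAdmissible_energyCoeff (d := d) hν hp hk hε
  obtain ⟨cont₁, est₁⟩ := hE _ (energyCoeff ν p k ε) hαe
  obtain ⟨cont₂, est₂⟩ := hE _ velocityCoeff fun i ↦ isAdmissible_velocityCoeff hL i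
  set e₁ : ℝ → ℝ := fun τ ↦ √(energy fun j η ↦ ∑ a, energyCoeff ν p k ε j a η * Z a τ η) with he₁
  set e₂ : ℝ → ℝ := fun τ ↦ √(energy fun j η ↦ ∑ a, velocityCoeff j a η * Z a τ η) with he₂
  have e₁0 : ∀ τ, 0 ≤ e₁ τ := fun τ ↦ Real.sqrt_nonneg _
  have e₂0 : ∀ τ, 0 ≤ e₂ τ := fun τ ↦ Real.sqrt_nonneg _
  have he21 : ∀ τ, e₂ τ ≤ e₁ τ := fun τ ↦ by
    refine Real.sqrt_le_sqrt ?_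
    simp only [energy, Fintype.sum_option, Fintype.sum_sum_type]
    exact (le_add_of_nonneg_right (Finset.sum_nonneg fun _ _ ↦ sq_nonneg _)).trans
      (le_add_of_nonneg_left (sq_nonneg _))
  have hii : ∀ {g : ℝ → ℝ}, ContinuousOn g (Icc 0 T) → ∀ s ∈ Icc 0 T,
      IntervalIntegrable g volume 0 s := fun hg s hs ↦
    (hg.mono (by rw [uIcc_of_le hs.1]; exact Icc_subset_Icc_right hs.2)).intervalIntegrable
  have ie₁ : ∀ s ∈ Icc 0 T, IntervalIntegrable e₁ volume 0 s :=
    hii (Real.continuous_sqrt.comp_continuousOn cont₁)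
  have ie₂ : ∀ s ∈ Icc 0 T, IntervalIntegrable e₂ volume 0 s :=
    hii (Real.continuous_sqrt.comp_continuousOn cont₂)
  have hΦ := toReal_intervalIntegrable h.nonneg (h.aemeasurable_blockSource hχ hd l)
    (h.lintegral_blockSource_lt_top hχ hd h1 h2 l)
  set Φ : ℝ → ℝ := fun τ ↦ (blockSource χ (v τ) (f τ) (H τ) l).toReal with hΦdef
  have hΦ0 : ∀ τ, 0 ≤ Φ τ := fun τ ↦ ENNReal.toReal_nonneg
  have hΦt : IntervalIntegrable Φ volume 0 t :=
    hΦ.mono_set (uIcc_subset_uIcc (by simp) (by rw [uIcc_of_le h.nonneg]; exact ht))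
  set a := blockRate p k ε l with ha
  have ha0 : 0 ≤ a := (blockRate_pos hp hk l).le
  set Kl := capSymbol p k ε (3 / 4 * 2 ^ l) with hKl
  have hKl0 : 0 < Kl := capSymbol_pos hp hk _
  -- the two energy estimates
  have A₁ := est₁ (c * a) (by positivity) (fun _ ↦ 0) (fun _ ↦ le_rfl) intervalIntegrable_const (fun τ hτ ↦ by
    rw [mul_zero, add_zero]
    exact energy_linPart_le hν hp hk hε hc.le c1 c2 c3 (fun a ↦ hZ a τ hτ)
      fun a η hη ↦ hZs a τ η hη) t ht
  have A₂ := est₂ (c * (3 / 4 * 2 ^ l) ^ 2) (by positivity)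
    (fun τ ↦ 13 * Kl * (√2 / ν) * e₁ τ) (fun τ ↦ mul_nonneg (by positivity) (e₁0 τ))
    ((ie₁ T ⟨h.nonneg, le_rfl⟩).const_mul _) (fun τ hτ ↦
      velocity_linPart_le hν hp hk hε hc.le c4 c5 (fun a ↦ hZ a τ hτ)
      fun a η hη ↦ hZs a τ η hη) t ht
  simp only [add_zero] at A₁
  rw [intervalIntegral.integral_const_mul] at A₁
  rw [intervalIntegral.integral_add (hΦt.const_mul _) ((ie₁ t ht).const_mul _),
    intervalIntegral.integral_const_mul, intervalIntegral.integral_const_mul] at A₂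
  change e₁ t + c * a * (∫ τ in (0 : ℝ)..t, e₁ τ) ≤ e₁ 0 + _ * ∫ τ in (0 : ℝ)..t, Φ τ at A₁
  change e₂ t + c * (3 / 4 * 2 ^ l) ^ 2 * (∫ τ in (0 : ℝ)..t, e₂ τ) ≤
    e₂ 0 + (_ * (∫ τ in (0 : ℝ)..t, Φ τ) + _ * ∫ τ in (0 : ℝ)..t, e₁ τ) at A₂
  have hI0 : 0 ≤ ∫ τ in (0 : ℝ)..t, Φ τ := intervalIntegral.integral_nonneg ht.1 fun τ _ ↦ hΦ0 τ
  have hI1 : 0 ≤ ∫ τ in (0 : ℝ)..t, e₁ τ := intervalIntegral.integral_nonneg ht.1 fun τ _ ↦ e₁0 τ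
  have hI2 : 0 ≤ ∫ τ in (0 : ℝ)..t, e₂ τ := intervalIntegral.integral_nonneg ht.1 fun τ _ ↦ e₂0 τ
  have hI21 : ∫ τ in (0 : ℝ)..t, e₂ τ ≤ ∫ τ in (0 : ℝ)..t, e₁ τ :=
    intervalIntegral.integral_mono_on ht.1 (ie₂ t ht) (ie₁ t ht) fun τ _ ↦ he21 τ
  set A : ℝ := e₁ 0 + n * K * ∫ τ in (0 : ℝ)..t, Φ τ with hA
  have hA0 : 0 ≤ A := by have := e₁0 0; positivity
  have n1 : (Fintype.card (Option (Fin d ⊕ Fin d)) : ℝ) ≤ n := by rw [hn]; linarith [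
    (Nat.cast_nonneg (Fintype.card (Fin d)) : (0 : ℝ) ≤ _)]
  have n2 : (Fintype.card (Fin d) : ℝ) ≤ n := by rw [hn]; linarith [
    (Nat.cast_nonneg (Fintype.card (Option (Fin d ⊕ Fin d))) : (0 : ℝ) ≤ _)]
  have B₁ : e₁ t + c * a * (∫ τ in (0 : ℝ)..t, e₁ τ) ≤ A :=
    A₁.trans (add_le_add le_rfl (mul_le_mul_of_nonneg_right
      (mul_le_mul_of_nonneg_right n1 hK) hI0))
  have B₂ : c * (3 / 4 * 2 ^ l) ^ 2 * (∫ τ in (0 : ℝ)..t, e₂ τ) ≤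
      A + 13 * Kl * (√2 / ν) * ∫ τ in (0 : ℝ)..t, e₁ τ := by
    have := mul_le_mul_of_nonneg_right (mul_le_mul_of_nonneg_right n2 hK) hI0
    linarith [e₂0 t, he21 0]
  have D₁ : e₁ t ≤ A := by
    have : 0 ≤ c * a * ∫ τ in (0 : ℝ)..t, e₁ τ := by positivity
    linarith
  have D₂ : a * (∫ τ in (0 : ℝ)..t, e₁ τ) ≤ 1 / c * A := by
    rw [one_div, le_inv_mul_iff₀ hc]
    linarith [e₁0 t]
  have D₃ : (2 ^ l) ^ 2 * (∫ τ in (0 : ℝ)..t, e₂ τ) ≤ 16 / 9 * C₃ * A := by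
    have := velocity_absorb (q := √2 / ν) hc (by positivity)
      (by linarith [e₁0 t] : c * (a * ∫ τ in (0 : ℝ)..t, e₁ τ) ≤ A) B₂ hI21 hI2 hA0
    have e : (3 / 4 * (2 : ℝ) ^ l) ^ 2 = 9 / 16 * (2 ^ l) ^ 2 := by ring
    rw [e] at this
    linarith
  -- comparison with the sizes of the blocks
  have s₁ : ∀ τ ∈ Icc 0 T, blockSize χ (f τ) l ≤ ENNReal.ofReal (C₁ * e₁ τ) := fun τ hτ ↦ by
    rw [blockSize]
    simp only [hnorm _ τ hτ]
    exact sum_weight_l2_le_sqrt_energy hν hp hk hε (fun a ↦ hZ a τ hτ) fun a η hη ↦ hZs a τ η hη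
  have s₂ : ∀ τ ∈ Icc 0 T, ∑ i, distrLpNorm 2 (dyadicBlock χ l (f τ (some i))) ≤
      d * ENNReal.ofReal (e₂ τ) := fun τ hτ ↦ by
    refine (Finset.sum_le_card_nsmul _ _ _ fun i _ ↦ ?_).trans_eq (by
      rw [Finset.card_univ, Fintype.card_fin, nsmul_eq_mul])
    have hlt : l2 (fun η ↦ ‖Z (some i) τ η‖ₑ) ≠ ⊤ := by
      rw [← eLpNorm_two_eq_l2]; exact (hZ (some i) τ hτ).eLpNorm_lt_top.ne
    rw [hnorm _ τ hτ, ← ENNReal.ofReal_toReal hlt]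
    refine ENNReal.ofReal_le_ofReal ?_
    have := l2_toReal_le_sqrt_energy (fun j η ↦ ∑ a, velocityCoeff j a η * Z a τ η) i
    simpa only [he₂, velocityCoeff, sum_combination_single_mul, Pi.zero_apply, zero_mul, zero_add]
      using this
  have s₀ : ENNReal.ofReal (e₁ 0) ≤ C₂ * blockSize χ (f 0) l := by
    refine (sqrt_energy_le hL0 hαe (fun a ↦ hZ a 0 h0) fun a η hη ↦ hZs a 0 η hη).trans ?_
    rw [blockSize]
    simp only [hnorm _ 0 h0]
    exact le_rfl
  have sA : ENNReal.ofReal A ≤ (C₂ + ENNReal.ofReal (n * K)) *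
      (blockSize χ (f 0) l + ∫⁻ τ in Icc 0 t, blockSource χ (v τ) (f τ) (H τ) l) := by
    have hn0 : 0 ≤ n * K := by positivity
    rw [hA, ENNReal.ofReal_add (e₁0 0) (by positivity), ENNReal.ofReal_mul hn0,
      ofReal_intervalIntegral ht.1 hΦt hΦ0]
    rw [add_mul C₂, mul_add C₂, mul_add (ENNReal.ofReal (n * K))]
    refine add_le_add (s₀.trans le_self_add) (le_trans ?_ le_add_self)
    gcongr with τ
    exact ENNReal.ofReal_toReal_le
  have hsub : ∀ τ ∈ Icc 0 t, τ ∈ Icc 0 T := fun τ hτ ↦ ⟨hτ.1, hτ.2.trans ht.2⟩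
  have F₁ : blockSize χ (f t) l ≤ ENNReal.ofReal C₁ * ENNReal.ofReal A := by
    refine (s₁ t ht).trans ?_
    rw [ENNReal.ofReal_mul hC₁0]
    gcongr
  have F₂ : ENNReal.ofReal a * (∫⁻ τ in Icc 0 t, blockSize χ (f τ) l) ≤
      ENNReal.ofReal (C₁ / c) * ENNReal.ofReal A := by
    refine (mul_le_mul_right (setLIntegral_mono' measurableSet_Icc fun τ hτ ↦
      s₁ τ (hsub τ hτ)) _).trans ?_
    simp only [ENNReal.ofReal_mul hC₁0]
    rw [lintegral_const_mul' _ _ ENNReal.ofReal_ne_top, ← ofReal_intervalIntegral ht.1 (ie₁ t ht) e₁0,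
      mul_left_comm, ← ENNReal.ofReal_mul ha0, ← ENNReal.ofReal_mul hC₁0,
      ← ENNReal.ofReal_mul (by positivity)]
    refine ENNReal.ofReal_le_ofReal ?_
    have := mul_le_mul_of_nonneg_left D₂ hC₁0
    calc _ ≤ _ := this
      _ = _ := by ring
  have F₃ : ENNReal.ofReal ((2 ^ l) ^ 2) *
      (∫⁻ τ in Icc 0 t, ∑ i, distrLpNorm 2 (dyadicBlock χ l (f τ (some i)))) ≤
      d * ENNReal.ofReal (16 / 9 * C₃) * ENNReal.ofReal A := by
    refine (mul_le_mul_right (setLIntegral_mono' measurableSet_Icc fun τ hτ ↦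
      s₂ τ (hsub τ hτ)) _).trans ?_
    rw [lintegral_const_mul' _ _ (by simp), ← ofReal_intervalIntegral ht.1 (ie₂ t ht) e₂0,
      mul_left_comm, ← ENNReal.ofReal_mul (by positivity), mul_assoc,
      ← ENNReal.ofReal_mul (by positivity)]
    gcongr
  calc _ ≤ ENNReal.ofReal C₁ * ENNReal.ofReal A + ENNReal.ofReal (C₁ / c) * ENNReal.ofReal A +
        d * ENNReal.ofReal (16 / 9 * C₃) * ENNReal.ofReal A := add_le_add (add_le_add F₁ F₂) F₃
    _ = P * ENNReal.ofReal A := by rw [hP, add_mul, add_mul]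
    _ ≤ _ := by rw [mul_assoc]; gcongr

end LinearCapillary

namespace LinearCapillary

open MeasureTheory Filter Topology Set
open scoped ENNReal

variable {d : ℕ}

/-! ### Summation over the blocks -/

namespace IsRegularSolution

variable {χ : Space d → ℝ} {σ μ lam p k ε T : ℝ} {v : ℝ → Fin d → Distr d}
  {f H N : ℝ → Option (Fin d) → Distr d} (h : IsRegularSolution χ σ μ lam p k ε T v f H N)
include h

/-- The contribution of the convection is, after summation, at most the product of the norms of
`∇v` and of the solution. -/
theorem tsum_lintegral_blockSource_le (hχ : IsCutoff χ) (hd : 0 < d) {K : ℝ≥0∞} (hK : K ≠ ⊤)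
    (hk : ∀ w y : ℤ → ℝ≥0∞, ∑' l, dyadicWeight σ l * paraSum d w y l ≤
      K * ((∑' j, dyadicWeight ((d : ℝ) / 2) j * w j) * ∑' m, dyadicWeight σ m * y m))
    {t : ℝ} (ht : t ∈ Icc 0 T) :
    ∑' l, dyadicWeight σ l * ∫⁻ τ in Icc 0 t, blockSource χ (v τ) (f τ) (H τ) l ≤
      K * (∫⁻ τ in Icc 0 t, besovNormGrad χ ((d : ℝ) / 2) (v τ) *
        ∑' l, dyadicWeight σ l * blockSize χ (f τ) l) +
      ∑' l, dyadicWeight σ l * ∫⁻ τ in Icc 0 t, blockSize χ (H τ) l := by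
  have hsub : volume.restrict (Icc 0 t) ≤ volume.restrict (Icc 0 T) :=
    Measure.restrict_mono (Icc_subset_Icc_right ht.2) le_rfl
  have hp : ∀ l, AEMeasurable (fun τ ↦ paraSum d (gradBlock χ (v τ)) (blockSize χ (f τ)) l)
      (volume.restrict (Icc 0 t)) := fun l ↦
    (aemeasurable_paraSum (fun j ↦ aemeasurable_gradBlock hχ hd j h.field_measurable)
      (fun j ↦ aemeasurable_blockSize hχ hd j h.measurable_state) l).mono_measure hsub
  simp only [blockSource]
  simp_rw [lintegral_add_left' (hp _), mul_add]
  rw [ENNReal.tsum_add]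
  refine add_le_add ?_ le_rfl
  simp_rw [← lintegral_const_mul' _ _ (dyadicWeight_ne_top σ _)]
  rw [← lintegral_tsum fun l ↦ (hp l).const_mul _, ← lintegral_const_mul' _ _ hK]
  refine lintegral_mono fun τ ↦ (hk _ _).trans_eq ?_
  rw [tsum_gradBlock]

theorem aemeasurable_tsum_blockSize (hχ : IsCutoff χ) (hd : 0 < d) :
    AEMeasurable (fun τ ↦ ∑' l, dyadicWeight σ l * blockSize χ (f τ) l)
      (volume.restrict (Icc 0 T)) :=
  AEMeasurable.tsum fun l ↦ (aemeasurable_blockSize hχ hd l h.measurable_state).const_mul _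

theorem aemeasurable_besovNormGrad (hχ : IsCutoff χ) (hd : 0 < d) :
    AEMeasurable (fun τ ↦ besovNormGrad χ ((d : ℝ) / 2) (v τ)) (volume.restrict (Icc 0 T)) := by
  simp only [← tsum_gradBlock]
  exact AEMeasurable.tsum fun l ↦ (aemeasurable_gradBlock hχ hd l h.field_measurable).const_mul _

/-- Gronwall's inequality for the norm of the solution. -/
theorem tsum_blockSize_le (hχ : IsCutoff χ) (hd : 0 < d) {c K : ℝ} (hc : 0 < c) (hK : 0 < K)
    {A : ℝ≥0∞} (hA : A ≠ ⊤)
    (hle : ∀ t ∈ Icc 0 T, ∑' l, dyadicWeight σ l * blockSize χ (f t) l ≤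
      ENNReal.ofReal c * (A + ENNReal.ofReal K * ∫⁻ τ in Icc 0 t,
        besovNormGrad χ ((d : ℝ) / 2) (v τ) * ∑' l, dyadicWeight σ l * blockSize χ (f τ) l))
    {t : ℝ} (ht : t ∈ Icc 0 T) :
    ∑' l, dyadicWeight σ l * blockSize χ (f t) l ≤ ENNReal.ofReal (2 * c * Real.exp (2 * (c * K) *
      (∫⁻ τ in Icc 0 T, besovNormGrad χ ((d : ℝ) / 2) (v τ)).toReal)) * A := by
  set g : ℝ → ℝ≥0∞ := fun τ ↦ besovNormGrad χ ((d : ℝ) / 2) (v τ) with hg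
  set M : ℝ → ℝ≥0∞ := fun τ ↦ ∑' l, dyadicWeight σ l * blockSize χ (f τ) l with hM
  have hMfin : ∀ τ ∈ Icc 0 T, M τ < ⊤ := fun τ hτ ↦ h.tsum_lt_top hτ
  have hgm : AEMeasurable g (volume.restrict (Icc 0 T)) := h.aemeasurable_besovNormGrad hχ hd
  have hMm : AEMeasurable M (volume.restrict (Icc 0 T)) := h.aemeasurable_tsum_blockSize hχ hd
  have hgi : ∫⁻ τ in Icc 0 T, g τ < ⊤ := h.lintegral_besovNormGrad_lt_top hχ hd
  have hMle : ∀ τ ∈ Icc 0 T, M τ ≤ ⨆ τ ∈ Icc 0 T, M τ := fun τ hτ ↦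
    le_iSup₂ (f := fun τ (_ : τ ∈ Icc 0 T) ↦ M τ) τ hτ
  have hgM : ∫⁻ τ in Icc 0 T, g τ * M τ < ⊤ := by
    refine (setLIntegral_mono' measurableSet_Icc fun τ hτ ↦
      mul_le_mul_right (hMle τ hτ) (g τ)).trans_lt ?_
    rw [lintegral_mul_const' _ _ h.state.ne]
    exact ENNReal.mul_lt_top hgi h.state
  have iV : IntervalIntegrable (fun τ ↦ (g τ).toReal) volume 0 T :=
    toReal_intervalIntegrable h.nonneg hgm hgi
  have iVX : IntervalIntegrable (fun τ ↦ (g τ).toReal * (M τ).toReal) volume 0 T := by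
    simp only [← ENNReal.toReal_mul]
    exact toReal_intervalIntegrable h.nonneg (hgm.mul hMm) hgM
  have hsub : ∀ s ∈ Icc 0 T, uIcc 0 s ⊆ uIcc 0 T := fun s hs ↦
    uIcc_subset_uIcc (by simp) (by rw [uIcc_of_le h.nonneg]; exact hs)
  have hconv : ∀ s ∈ Icc 0 T, ∫⁻ τ in Icc 0 s, g τ * M τ =
      ENNReal.ofReal (∫ τ in (0 : ℝ)..s, (g τ).toReal * (M τ).toReal) := fun s hs ↦ by
    rw [ofReal_intervalIntegral hs.1 (iVX.mono_set (hsub s hs)) fun τ ↦ by positivity]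
    refine lintegral_congr_ae ?_
    filter_upwards [ae_restrict_of_ae_restrict_of_subset (Icc_subset_Icc_right hs.2)
      (ae_lt_top' hgm hgi.ne), ae_restrict_mem measurableSet_Icc] with τ hτ hτs
    rw [ENNReal.ofReal_mul ENNReal.toReal_nonneg, ENNReal.ofReal_toReal hτ.ne,
      ENNReal.ofReal_toReal (hMfin τ ⟨hτs.1, hτs.2.trans hs.2⟩).ne]
  have key := gronwall_integral (X := fun τ ↦ (M τ).toReal) (V := fun τ ↦ (g τ).toReal)
    (A := c * A.toReal) (C := c * K) (M := (⨆ τ ∈ Icc 0 T, M τ).toReal) (by positivity)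
    (by positivity) iV (fun _ ↦ ENNReal.toReal_nonneg) (fun _ _ ↦ ENNReal.toReal_nonneg)
    (fun τ hτ ↦ ENNReal.toReal_mono h.state.ne (hMle τ hτ))
    hMm.ennreal_toReal.aestronglyMeasurable (fun s hs ↦ by
      have hI : 0 ≤ ∫ τ in (0 : ℝ)..s, (g τ).toReal * (M τ).toReal :=
        intervalIntegral.integral_nonneg hs.1 fun τ _ ↦ by positivity
      have := hle s hs
      rw [hconv s hs, ← ENNReal.ofReal_toReal hA, ← ENNReal.ofReal_mul hK.le,
        ← ENNReal.ofReal_add ENNReal.toReal_nonneg (by positivity),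
        ← ENNReal.ofReal_mul hc.le] at this
      refine (ENNReal.toReal_le_of_le_ofReal (by positivity) this).trans_eq ?_
      ring) t ht
  have hint : ∫ τ in (0 : ℝ)..t, (g τ).toReal ≤ (∫⁻ τ in Icc 0 T, g τ).toReal := by
    have h1 : ENNReal.ofReal (∫ τ in (0 : ℝ)..t, (g τ).toReal) ≤ ∫⁻ τ in Icc 0 T, g τ := by
      rw [ofReal_intervalIntegral ht.1 (iV.mono_set (hsub t ht)) fun τ ↦ ENNReal.toReal_nonneg]
      exact (lintegral_mono fun τ ↦ ENNReal.ofReal_toReal_le).trans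
        (lintegral_mono_set (Icc_subset_Icc_right ht.2))
    exact (ENNReal.ofReal_le_iff_le_toReal hgi.ne).1 h1
  have key' : (M t).toReal ≤ 2 * c * Real.exp (2 * (c * K) * (∫⁻ τ in Icc 0 T, g τ).toReal) *
      A.toReal := by
    refine key.trans ?_
    rw [mul_right_comm (2 * c), ← mul_assoc 2 c]
    gcongr
  change M t ≤ _
  rw [← ENNReal.ofReal_toReal (hMfin t ht).ne, ← ENNReal.ofReal_toReal hA,
    ← ENNReal.ofReal_mul (by positivity)]
  exact ENNReal.ofReal_le_ofReal key'

end IsRegularSolution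

/-- The a priori estimate of the solution, in terms of its dyadic blocks. -/
theorem exists_tsum_blockSize_estimate {χ : Space d → ℝ} {σ : ℝ} (hχ : IsCutoff χ) (hd : 0 < d)
    (h1 : -((d : ℝ) / 2) < σ) (h2 : σ ≤ (d : ℝ) / 2) {μ lam p k : ℝ} (hμ : 0 < μ)
    (hν : 0 < lam + 2 * μ) (hp : 0 < p) (hk : 0 < k) : ∃ C : ℝ, 0 < C ∧
    ∀ (ε : ℝ), 0 < ε → ∀ (T : ℝ) (v : ℝ → Fin d → Distr d) (f H N : ℝ → Option (Fin d) → Distr d),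
    IsRegularSolution χ σ μ lam p k ε T v f H N →
    ∑' l, dyadicWeight σ l * ((⨆ t ∈ Icc 0 T, blockSize χ (f t) l)
      + ENNReal.ofReal (blockRate p k ε l) * (∫⁻ τ in Icc 0 T, blockSize χ (f τ) l)
      + ENNReal.ofReal ((2 ^ l) ^ 2) *
        (∫⁻ τ in Icc 0 T, ∑ i, distrLpNorm 2 (dyadicBlock χ l (f τ (some i))))) ≤
    ENNReal.ofReal (C * Real.exp (C *
        (∫⁻ τ in Icc 0 T, besovNormGrad χ ((d : ℝ) / 2) (v τ)).toReal)) *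
      (∑' l, dyadicWeight σ l * blockSize χ (f 0) l +
        ∑' l, dyadicWeight σ l * ∫⁻ τ in Icc 0 T, blockSize χ (H τ) l) := by
  obtain ⟨C₀, hC₀, hest⟩ := exists_block_estimate hχ hd h1 h2 hμ hν hp hk
  obtain ⟨K₀, hK₀, hpara⟩ := exists_tsum_paraSum_le (d := d) h1 h2
  set c : ℝ := C₀.toReal + 1 with hc
  set K : ℝ := K₀.toReal + 1 with hK
  have hc0 : 0 < c := by positivity
  have hKp : 0 < K := by positivity
  have hCc : C₀ ≤ ENNReal.ofReal c := by
    rw [← ENNReal.ofReal_toReal hC₀]; exact ENNReal.ofReal_le_ofReal (by linarith)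
  have hKK : K₀ ≤ ENNReal.ofReal K := by
    rw [← ENNReal.ofReal_toReal hK₀]; exact ENNReal.ofReal_le_ofReal (by linarith)
  refine ⟨2 * c + 4 * (c * K), by positivity, fun ε hε T v f H N h ↦ ?_⟩
  have hTT : T ∈ Icc 0 T := ⟨h.nonneg, le_rfl⟩
  set S := ∑' l, dyadicWeight σ l * ∫⁻ τ in Icc 0 T, blockSize χ (H τ) l with hS
  set A := ∑' l, dyadicWeight σ l * blockSize χ (f 0) l + S with hAdef
  set I := (∫⁻ τ in Icc 0 T, besovNormGrad χ ((d : ℝ) / 2) (v τ)).toReal with hI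
  have hI0 : 0 ≤ I := ENNReal.toReal_nonneg
  -- infinite data make the right side infinite, since the exponential is positive
  rcases eq_or_ne A ⊤ with hA | hA
  · rw [hA, ENNReal.mul_top (by rw [Ne, ENNReal.ofReal_eq_zero, not_le]; positivity)]
    exact le_top
  set g : ℝ → ℝ≥0∞ := fun τ ↦ besovNormGrad χ ((d : ℝ) / 2) (v τ) with hg
  set M : ℝ → ℝ≥0∞ := fun τ ↦ ∑' l, dyadicWeight σ l * blockSize χ (f τ) l with hM
  have hsrc : ∀ t ∈ Icc 0 T, ∑' l, dyadicWeight σ l * (blockSize χ (f 0) l +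
      ∫⁻ τ in Icc 0 t, blockSource χ (v τ) (f τ) (H τ) l) ≤
      A + ENNReal.ofReal K * ∫⁻ τ in Icc 0 t, g τ * M τ := fun t ht ↦ by
    simp_rw [mul_add]
    rw [ENNReal.tsum_add]
    refine (add_le_add le_rfl (h.tsum_lintegral_blockSource_le hχ hd hK₀ hpara ht)).trans ?_
    rw [hAdef, add_assoc, add_comm S]
    refine add_le_add le_rfl (add_le_add (mul_le_mul_left hKK _)
      (ENNReal.tsum_le_tsum fun l ↦ mul_le_mul_right
        (lintegral_mono_set (Icc_subset_Icc_right ht.2)) _))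
  have hblock : ∀ t ∈ Icc 0 T, ∀ l, blockSize χ (f t) l ≤ C₀ * (blockSize χ (f 0) l +
      ∫⁻ τ in Icc 0 t, blockSource χ (v τ) (f τ) (H τ) l) := fun t ht l ↦
    le_trans (le_self_add.trans le_self_add) (hest ε hε T v f H N h l t ht)
  have hMle : ∀ t ∈ Icc 0 T, M t ≤ ENNReal.ofReal (2 * c * Real.exp (2 * (c * K) * I)) * A := by
    refine fun t ht ↦ h.tsum_blockSize_le hχ hd hc0 hKp hA (fun t ht ↦ ?_) ht
    calc _ ≤ ∑' l, C₀ * (dyadicWeight σ l * (blockSize χ (f 0) l +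
          ∫⁻ τ in Icc 0 t, blockSource χ (v τ) (f τ) (H τ) l)) := ENNReal.tsum_le_tsum fun l ↦ by
          rw [mul_left_comm]
          exact mul_le_mul_right (hblock t ht l) _
      _ ≤ _ := by
          rw [ENNReal.tsum_mul_left]
          exact mul_le_mul' hCc (hsrc t ht)
  have hgM : ∫⁻ τ in Icc 0 T, g τ * M τ ≤
      ENNReal.ofReal I * (ENNReal.ofReal (2 * c * Real.exp (2 * (c * K) * I)) * A) := by
    refine (setLIntegral_mono' measurableSet_Icc fun τ hτ ↦
      mul_le_mul_right (hMle τ hτ) (g τ)).trans_eq ?_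
    rw [lintegral_mul_const' _ _ (ENNReal.mul_ne_top ENNReal.ofReal_ne_top hA), hI,
      ENNReal.ofReal_toReal (h.lintegral_besovNormGrad_lt_top hχ hd).ne]
  -- the Gronwall bound inserted in the source gives a factor `1 + x eˣ ≤ e²ˣ`, with `x = 2 c K I`
  have hreal : 2 * c * (1 + K * (I * (2 * c * Real.exp (2 * (c * K) * I)))) ≤
      (2 * c + 4 * (c * K)) * Real.exp ((2 * c + 4 * (c * K)) * I) := by
    set x := 2 * (c * K) * I with hx
    have hx0 : 0 ≤ x := by positivity
    have e1 : x + 1 ≤ Real.exp x := Real.add_one_le_exp x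
    have e2 : 1 ≤ Real.exp x := Real.one_le_exp hx0
    have e3 : 1 + K * (I * (2 * c * Real.exp x)) ≤ Real.exp (x + x) := by
      rw [Real.exp_add]
      have : K * (I * (2 * c * Real.exp x)) = x * Real.exp x := by rw [hx]; ring
      rw [this]
      nlinarith
    have e4 : Real.exp (x + x) ≤ Real.exp ((2 * c + 4 * (c * K)) * I) := by
      refine Real.exp_le_exp.2 ?_
      have : 0 ≤ 2 * c * I := by positivity
      rw [hx]
      linarith
    have hcK : 0 ≤ 4 * (c * K) := by positivity
    exact mul_le_mul (by linarith) (e3.trans e4) (by positivity) (by positivity)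
  calc _ ≤ ∑' l, 2 * C₀ * (dyadicWeight σ l * (blockSize χ (f 0) l +
        ∫⁻ τ in Icc 0 T, blockSource χ (v τ) (f τ) (H τ) l)) := ENNReal.tsum_le_tsum fun l ↦ by
        rw [mul_left_comm, mul_assoc 2, two_mul, add_assoc]
        refine mul_le_mul_right (add_le_add (iSup₂_le fun t ht ↦ (hblock t ht l).trans ?_) ?_) _
        · refine mul_le_mul_right (add_le_add le_rfl ?_) _
          exact lintegral_mono_set (Icc_subset_Icc_right ht.2)
        · refine le_trans ?_ (hest ε hε T v f H N h l T hTT)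
          rw [add_assoc]
          exact le_add_self
    _ ≤ 2 * ENNReal.ofReal c * (A + ENNReal.ofReal K * (ENNReal.ofReal I *
        (ENNReal.ofReal (2 * c * Real.exp (2 * (c * K) * I)) * A))) := by
        rw [ENNReal.tsum_mul_left]
        exact mul_le_mul' (mul_le_mul_right hCc 2) ((hsrc T hTT).trans
          (add_le_add le_rfl (mul_le_mul_right hgM _)))
    _ = ENNReal.ofReal (2 * c * (1 + K * (I * (2 * c * Real.exp (2 * (c * K) * I))))) * A := by
        have hE : 0 ≤ 2 * c * Real.exp (2 * (c * K) * I) := by positivity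
        generalize 2 * c * Real.exp (2 * (c * K) * I) = E at hE
        rw [ENNReal.ofReal_mul (by positivity : 0 ≤ 2 * c), ENNReal.ofReal_mul zero_le_two,
          ENNReal.ofReal_add zero_le_one (by positivity), ENNReal.ofReal_mul hKp.le,
          ENNReal.ofReal_mul hI0, ENNReal.ofReal_one, ENNReal.ofReal_ofNat]
        ring
    _ ≤ _ := mul_le_mul_left (ENNReal.ofReal_le_ofReal hreal) _

end LinearCapillary

namespace LinearCapillary

open MeasureTheory Filter Topology Set TemperedDistribution
open scoped ENNReal SchwartzMap

variable {d : ℕ}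

/-! ### From the weak formulation to the estimate in Besov spaces -/

/-- The family of the unknowns `(q, u)`, or of the sources `(F, G)`, of the system. -/
def unknowns (q : ℝ → Distr d) (u : ℝ → Fin d → Distr d) (τ : ℝ) (a : Option (Fin d)) : Distr d :=
  a.elim (q τ) (u τ)

theorem Icc_subset_timeInterval {T : ℝ≥0∞} {t : ℝ} (ht : t ∈ timeInterval T) :
    Icc 0 t ⊆ timeInterval T := fun _ hτ ↦
  ⟨hτ.1, (ENNReal.ofReal_le_ofReal hτ.2).trans_lt ht.2⟩

theorem lintegral_lt_top_of_sq {x : ℝ → ℝ≥0∞} {t : ℝ} (h : ∫⁻ τ in Icc 0 t, x τ ^ 2 < ⊤) :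
    ∫⁻ τ in Icc 0 t, x τ < ⊤ := by
  have hle : ∀ τ, x τ ≤ 1 + x τ ^ 2 := fun τ ↦ by
    rcases le_total (x τ) 1 with h1 | h1
    · exact h1.trans le_self_add
    · exact (le_self_pow₀ h1 two_ne_zero).trans le_add_self
  refine (lintegral_mono hle).trans_lt ?_
  rw [lintegral_add_left measurable_const, lintegral_const]
  exact ENNReal.add_lt_top.2 ⟨by simp, h⟩

/-- A solution in the sense of `IsSolution` has the regularity used in the energy estimates, once
the source is integrable in each block. That `v` is integrable in `Ḃ^{d/2}` follows from
square integrability, on a bounded interval. -/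
theorem IsSolution.exists_isRegularSolution {χ : Space d → ℝ} {μ lam p k ε s : ℝ} {T : ℝ≥0∞}
    {v : ℝ → Fin d → Distr d} {F : ℝ → Distr d} {G : ℝ → Fin d → Distr d}
    {q : ℝ → Distr d} {u : ℝ → Fin d → Distr d} (hv : IsConvectionField χ T v)
    (hF : WeaklyMeasurable T F) (hG : ∀ i, WeaklyMeasurable T fun τ ↦ G τ i)
    (h : IsSolution χ μ lam p k ε s T v F G q u) {t : ℝ} (ht : t ∈ timeInterval T)
    (hs : ∀ l, ∫⁻ τ in Icc 0 t, blockSize χ (unknowns F G τ) l < ⊤) :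
    ∃ N, IsRegularSolution χ (s - 1) μ lam p k ε t v (unknowns q u) (unknowns F G) N := by
  have hsub := Icc_subset_timeInterval ht
  have hmono : volume.restrict (Icc 0 t) ≤ volume.restrict (timeInterval T) :=
    Measure.restrict_mono hsub le_rfl
  obtain ⟨N₀, hN₀, hq⟩ := h.mass
  choose N₁ hN₁ hu using h.momentum
  refine ⟨fun τ a ↦ a.elim (N₀ τ) fun i ↦ N₁ i τ, ?_⟩
  exact
    { nonneg := ht.1
      field_measurable := fun i ψ ↦ (hv.measurable i ψ).mono_measure hmono
      real := ae_restrict_of_ae_restrict_of_subset hsub hv.real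
      sh := ae_restrict_of_ae_restrict_of_subset hsub hv.sh
      field := lintegral_lt_top_of_sq ((lintegral_mono_set hsub).trans_lt hv.square_integrable)
      field' := (lintegral_mono_set hsub).trans_lt hv.integrable
      state_sh := fun τ hτ a ↦ by
        cases a with
        | none => exact h.density_low.1 τ (hsub hτ)
        | some i => exact (h.velocity i).1 τ (hsub hτ)
      state := by
        refine lt_of_le_of_lt (iSup₂_le fun τ hτ ↦ ?_) (ENNReal.add_lt_top.2 ⟨ENNReal.add_lt_top.2
          ⟨h.density_low.2 t ht, h.density_high.2 t ht⟩,
          ENNReal.sum_lt_top.2 fun i (_ : i ∈ Finset.univ) ↦ (h.velocity i).2 t ht⟩)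
        rw [tsum_blockSize, sub_add_cancel]
        refine add_le_add (add_le_add ?_ ?_) (Finset.sum_le_sum fun i _ ↦ ?_)
        · exact le_iSup₂ (f := fun τ (_ : τ ∈ Icc 0 t) ↦ besovNorm χ (s - 1) (q τ)) τ hτ
        · exact le_iSup₂ (f := fun τ (_ : τ ∈ Icc 0 t) ↦ besovNorm χ s (q τ)) τ hτ
        · exact le_iSup₂ (f := fun τ (_ : τ ∈ Icc 0 t) ↦ besovNorm χ (s - 1) (u τ i)) τ hτ
      source_measurable := fun a ψ ↦ by
        cases a with
        | none => exact (hF ψ).mono_measure hmono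
        | some i => exact (hG i ψ).mono_measure hmono
      source := hs
      convection := by
        have h1 : ∀ᵐ τ ∂(volume.restrict (timeInterval T)), ∀ i,
            IsConvection χ (v τ) (u τ i) (N₁ i τ) := ae_all_iff.2 hN₁
        filter_upwards [ae_restrict_of_ae_restrict_of_subset hsub hN₀,
          ae_restrict_of_ae_restrict_of_subset hsub h1] with τ h0 h1 a
        cases a with
        | none => exact h0
        | some i => exact h1 i
      evolution := fun a τ hτ ψ ↦ by
        cases a with
        | none =>
          have := hq τ (hsub hτ) ψ
          simp only [sub_eq_add_neg] at this ⊢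
          exact this
        | some i =>
          have e : ∀ τ, G τ i - N₁ i τ + linOp μ lam p k ε (unknowns q u τ) (some i) =
              G τ i - N₁ i τ + viscosity μ lam (u τ) i - (p : ℂ) • partialD i (q τ)
                + ((k / ε ^ 2 : ℝ) : ℂ) • partialD i (capillaryConv ε (q τ) - q τ) := fun τ ↦ by
            change _ + (viscosity μ lam (u τ) i - (p : ℂ) • partialD i (q τ) +
              ((k / ε ^ 2 : ℝ) : ℂ) • partialD i (capillaryConv ε (q τ) - q τ)) = _
            abel
          have := hu i τ (hsub hτ) ψ
          simp only [← e] at this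
          exact this }

section Norms

variable {χ : Space d → ℝ} {q : ℝ → Distr d} {u : ℝ → Fin d → Distr d} {t : ℝ}

theorem tildeNorm_one (s t : ℝ) (f : ℝ → Distr d) : tildeNorm χ 1 s t f =
    ∑' l, dyadicWeight s l * ∫⁻ τ in Icc 0 t, distrLpNorm 2 (dyadicBlock χ l (f τ)) := by
  simp only [tildeNorm, eLpNorm_one_eq_lintegral_enorm, enorm_eq_self]

theorem tsum_lintegral_blockSize (hχ : IsCutoff χ) (hd : 0 < d) (σ : ℝ) {F : ℝ → Distr d}
    {G : ℝ → Fin d → Distr d}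
    (hF : ∀ ψ : 𝓢(Space d, ℂ), AEStronglyMeasurable (fun τ ↦ F τ ψ) (volume.restrict (Icc 0 t)))
    (hG : ∀ i, ∀ ψ : 𝓢(Space d, ℂ),
      AEStronglyMeasurable (fun τ ↦ G τ i ψ) (volume.restrict (Icc 0 t))) :
    ∑' l, dyadicWeight σ l * ∫⁻ τ in Icc 0 t, blockSize χ (unknowns F G τ) l =
      tildeNorm χ 1 σ t F + tildeNorm χ 1 (σ + 1) t F + tildeNormVec χ 1 σ t G := by
  have hm := fun l ↦ aemeasurable_distrLpNorm_dyadicBlock hχ hd l hF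
  have hm' := fun l i ↦ aemeasurable_distrLpNorm_dyadicBlock hχ hd l (hG i)
  simp only [tildeNormVec, tildeNorm_one, dyadicWeight_add]
  rw [← Summable.tsum_finsetSum fun _ _ ↦ ENNReal.summable, ← ENNReal.tsum_add, ← ENNReal.tsum_add]
  refine tsum_congr fun l ↦ ?_
  simp only [blockSize, Fintype.sum_option, dyadicUnknownWeight, Option.elim, one_mul, unknowns]
  rw [lintegral_add_left' ((hm l).const_mul _), lintegral_finsetSum' _ fun i _ ↦ hm' l i,
    lintegral_const_mul' _ _ (ENNReal.add_ne_top.2 ⟨by simp, dyadicWeight_ne_top 1 l⟩),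
    mul_add, Finset.mul_sum, add_mul, one_mul, mul_add, mul_assoc]

theorem tildeNorm_top_le (σ : ℝ) {g : ℝ → Distr d} {m : ℤ → ℝ≥0∞} {σ' : ℝ}
    (h : ∀ l, ∀ τ ∈ Icc 0 t, dyadicWeight σ' l * distrLpNorm 2 (dyadicBlock χ l (g τ)) ≤ m l) :
    tildeNorm χ ⊤ (σ + σ') t g ≤ ∑' l, dyadicWeight σ l * m l := by
  refine ENNReal.tsum_le_tsum fun l ↦ ?_
  rw [dyadicWeight_add, mul_assoc, eLpNorm_exponent_top, eLpNormEssSup_eq_essSup_enorm,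
    ← ENNReal.essSup_const_mul]
  refine mul_le_mul_right (essSup_le_of_ae_le _ ?_) _
  filter_upwards [ae_restrict_mem measurableSet_Icc] with τ hτ
  exact h l τ hτ

theorem dyadicWeight_le_dyadicUnknownWeight (l : ℤ) :
    dyadicWeight 1 l ≤ dyadicUnknownWeight (none : Option (Fin d)) l := le_add_self

theorem weight_mul_le_blockSize (q : Distr d) (u : Fin d → Distr d) (l : ℤ) :
    dyadicWeight 1 l * distrLpNorm 2 (dyadicBlock χ l q) ≤ blockSize χ (fun a ↦ a.elim q u) l :=
  (mul_le_mul_left (dyadicWeight_le_dyadicUnknownWeight l) _).trans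
    (Finset.single_le_sum (f := fun a : Option (Fin d) ↦ dyadicUnknownWeight a l *
      distrLpNorm 2 (dyadicBlock χ l (a.elim q u))) (fun _ _ ↦ zero_le) (Finset.mem_univ none))

/-- The hybrid norms of the density are controlled by the damping of the blocks. The hypothesis `hr`
holds for `r = 0` and `r = 1`, as the block size contains `q` and its gradient. Above the threshold
the weight is that of the gradient, whatever `r`. -/
theorem tildeHybridNorm_le {p k γ ε C : ℝ} (hC : ∀ l : ℤ,
      (l ≤ threshold γ ε → ((2 : ℝ) ^ l) ^ 2 ≤ C * blockRate p k ε l) ∧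
      (threshold γ ε < l → 1 / ε ^ 2 ≤ C * blockRate p k ε l)) (hC0 : 0 ≤ C) (σ r : ℝ)
    (hr : ∀ l (q : Distr d) u, dyadicWeight r l * distrLpNorm 2 (dyadicBlock χ l q) ≤
      blockSize χ (fun a ↦ a.elim q u) l) :
    tildeHybridNorm χ γ ε 1 (σ + 1 + 1 + r) (σ + 1) t q ≤
      ENNReal.ofReal C * ∑' l, dyadicWeight σ l * (ENNReal.ofReal (blockRate p k ε l) *
        ∫⁻ τ in Icc 0 t, blockSize χ (unknowns q u τ) l) := by
  rw [← ENNReal.tsum_mul_left]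
  refine ENNReal.tsum_le_tsum fun l ↦ ?_
  have hint : ∀ r' : ℝ, (∀ l (q : Distr d) u,
      dyadicWeight r' l * distrLpNorm 2 (dyadicBlock χ l q) ≤
      blockSize χ (fun a ↦ a.elim q u) l) → dyadicWeight r' l *
      ∫⁻ τ in Icc 0 t, distrLpNorm 2 (dyadicBlock χ l (q τ)) ≤
      ∫⁻ τ in Icc 0 t, blockSize χ (unknowns q u τ) l := fun r' hr' ↦ by
    rw [← lintegral_const_mul' _ _ (dyadicWeight_ne_top r' l)]
    exact lintegral_mono fun τ ↦ hr' l (q τ) (u τ)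
  rw [mul_left_comm (ENNReal.ofReal C), ← mul_assoc (ENNReal.ofReal C), ← ENNReal.ofReal_mul hC0]
  simp only [eLpNorm_one_eq_lintegral_enorm, enorm_eq_self]
  rw [hybridWeight]
  split_ifs with hl
  · have e : dyadicWeight 1 l * dyadicWeight 1 l = ENNReal.ofReal ((2 ^ l) ^ 2) := by
      rw [dyadicWeight_one, ← ENNReal.ofReal_mul (by positivity), sq]
    rw [dyadicWeight_add, dyadicWeight_add, dyadicWeight_add, mul_assoc (dyadicWeight σ l), e,
      mul_assoc, mul_assoc]
    exact mul_le_mul_right (mul_le_mul' (ENNReal.ofReal_le_ofReal ((hC l).1 hl)) (hint r hr)) _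
  · rw [dyadicWeight_add, mul_left_comm, mul_assoc (dyadicWeight σ l),
      mul_assoc (ENNReal.ofReal _)]
    exact mul_le_mul_right (mul_le_mul' (ENNReal.ofReal_le_ofReal ((hC l).2 (not_le.1 hl)))
      (hint 1 fun l q u ↦ weight_mul_le_blockSize q u l)) _

/-- All the norms on the left of the estimate are controlled by those of the dyadic blocks. -/
theorem norms_le {p k γ ε C : ℝ} (hC : ∀ l : ℤ,
      (l ≤ threshold γ ε → ((2 : ℝ) ^ l) ^ 2 ≤ C * blockRate p k ε l) ∧
      (threshold γ ε < l → 1 / ε ^ 2 ≤ C * blockRate p k ε l)) (hC0 : 0 ≤ C) (σ : ℝ) :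
    tildeNormVec χ ⊤ σ t u + tildeNorm χ ⊤ σ t q + tildeNorm χ ⊤ (σ + 1) t q
      + tildeNormVec χ 1 (σ + 2) t u
      + tildeHybridNorm χ γ ε 1 (σ + 2) (σ + 1) t q
      + tildeHybridNorm χ γ ε 1 (σ + 3) (σ + 1) t q ≤
    ENNReal.ofReal (2 * d + 2 + 2 * C) *
      ∑' l, dyadicWeight σ l * ((⨆ τ ∈ Icc 0 t, blockSize χ (unknowns q u τ) l)
        + ENNReal.ofReal (blockRate p k ε l) * (∫⁻ τ in Icc 0 t, blockSize χ (unknowns q u τ) l)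
        + ENNReal.ofReal ((2 ^ l) ^ 2) * (∫⁻ τ in Icc 0 t,
            ∑ i, distrLpNorm 2 (dyadicBlock χ l (unknowns q u τ (some i))))) := by
  set S := ∑' l, dyadicWeight σ l * ((⨆ τ ∈ Icc 0 t, blockSize χ (unknowns q u τ) l)
        + ENNReal.ofReal (blockRate p k ε l) * (∫⁻ τ in Icc 0 t, blockSize χ (unknowns q u τ) l)
        + ENNReal.ofReal ((2 ^ l) ^ 2) * (∫⁻ τ in Icc 0 t,
            ∑ i, distrLpNorm 2 (dyadicBlock χ l (unknowns q u τ (some i))))) with hS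
  have hsup : ∀ l, ∀ τ ∈ Icc 0 t, blockSize χ (unknowns q u τ) l ≤
      ⨆ τ ∈ Icc 0 t, blockSize χ (unknowns q u τ) l := fun l τ hτ ↦
    le_iSup₂ (f := fun τ (_ : τ ∈ Icc 0 t) ↦ blockSize χ (unknowns q u τ) l) τ hτ
  have hS₁ : ∑' l, dyadicWeight σ l * ⨆ τ ∈ Icc 0 t, blockSize χ (unknowns q u τ) l ≤ S :=
    ENNReal.tsum_le_tsum fun l ↦ mul_le_mul_right (le_self_add.trans le_self_add) _
  have h₀ : ∀ l (q : Distr d) u, dyadicWeight 0 l * distrLpNorm 2 (dyadicBlock χ l q) ≤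
      blockSize χ (fun a ↦ a.elim q u) l := fun l q u ↦ by
    rw [dyadicWeight_zero, one_mul]
    exact distrLpNorm_le_blockSize χ (fun a ↦ a.elim q u) l none
  have b1 : tildeNormVec χ ⊤ σ t u ≤ d * S := by
    refine (Finset.sum_le_card_nsmul _ _ S fun i _ ↦ le_trans ?_ hS₁).trans_eq (by simp)
    have := tildeNorm_top_le (χ := χ) (t := t) (g := fun τ ↦ u τ i) (σ' := 0) σ
      (m := fun l ↦ ⨆ τ ∈ Icc 0 t, blockSize χ (unknowns q u τ) l) fun l τ hτ ↦ by
        rw [dyadicWeight_zero, one_mul]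
        exact (distrLpNorm_le_blockSize χ (unknowns q u τ) l (some i)).trans (hsup l τ hτ)
    rwa [add_zero] at this
  have b2 : tildeNorm χ ⊤ σ t q ≤ S := by
    refine le_trans ?_ hS₁
    have := tildeNorm_top_le (χ := χ) (t := t) (g := q) (σ' := 0) σ
      (m := fun l ↦ ⨆ τ ∈ Icc 0 t, blockSize χ (unknowns q u τ) l) fun l τ hτ ↦
        (h₀ l (q τ) (u τ)).trans (hsup l τ hτ)
    rwa [add_zero] at this
  have b3 : tildeNorm χ ⊤ (σ + 1) t q ≤ S := by
    refine le_trans ?_ hS₁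
    exact tildeNorm_top_le (m := fun l ↦ ⨆ τ ∈ Icc 0 t, blockSize χ (unknowns q u τ) l) σ
      fun l τ hτ ↦ (weight_mul_le_blockSize (q τ) (u τ) l).trans (hsup l τ hτ)
  have b4 : tildeNormVec χ 1 (σ + 2) t u ≤ d * S := by
    refine (Finset.sum_le_card_nsmul _ _ S fun i _ ↦ ?_).trans_eq (by simp)
    rw [tildeNorm_one]
    refine ENNReal.tsum_le_tsum fun l ↦ ?_
    have e : dyadicWeight 2 l = ENNReal.ofReal ((2 ^ l) ^ 2) := by
      rw [← one_add_one_eq_two, dyadicWeight_add, dyadicWeight_one,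
        ← ENNReal.ofReal_mul (by positivity), sq]
      norm_num
    rw [dyadicWeight_add, mul_assoc, e]
    refine mul_le_mul_right (le_trans (mul_le_mul_right (lintegral_mono fun τ ↦ ?_) _)
      le_add_self) _
    exact Finset.single_le_sum (f := fun i ↦ distrLpNorm 2 (dyadicBlock χ l (u τ i)))
      (fun _ _ ↦ zero_le) (Finset.mem_univ i)
  have hS₂ : ENNReal.ofReal C * ∑' l, dyadicWeight σ l * (ENNReal.ofReal (blockRate p k ε l) *
      ∫⁻ τ in Icc 0 t, blockSize χ (unknowns q u τ) l) ≤ ENNReal.ofReal C * S :=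
    mul_le_mul_right (ENNReal.tsum_le_tsum fun l ↦
      mul_le_mul_right (le_add_self.trans le_self_add) _) _
  have b5 : tildeHybridNorm χ γ ε 1 (σ + 2) (σ + 1) t q ≤ ENNReal.ofReal C * S := by
    rw [show σ + 2 = σ + 1 + 1 + 0 by ring]
    exact (tildeHybridNorm_le hC hC0 σ 0 h₀).trans hS₂
  have b6 : tildeHybridNorm χ γ ε 1 (σ + 3) (σ + 1) t q ≤ ENNReal.ofReal C * S := by
    rw [show σ + 3 = σ + 1 + 1 + 1 by ring]
    exact (tildeHybridNorm_le hC hC0 σ 1 fun l q u ↦ weight_mul_le_blockSize q u l).trans hS₂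
  refine (add_le_add (add_le_add (add_le_add (add_le_add (add_le_add b1 b2) b3) b4) b5) b6).trans
    (le_of_eq ?_)
  rw [ENNReal.ofReal_add (by positivity) (by positivity),
    ENNReal.ofReal_add (by positivity) zero_le_two, ENNReal.ofReal_mul zero_le_two,
    ENNReal.ofReal_mul zero_le_two, ENNReal.ofReal_natCast, ENNReal.ofReal_ofNat]
  ring

end Norms

end LinearCapillary

theorem mainTheorem3 (d : ℕ) (χ : Space d → ℝ) (hχ : IsCutoff χ)
    (γ : ℝ) (hγ : 0 < γ) (hγ' : ∀ z : ℝ, 0 < z → z ≤ γ → 1 / 2 ≤ (1 - Real.exp (-z)) / z)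
    (s : ℝ) (hs : 1 - (d : ℝ) / 2 < s) (hs' : s ≤ 1 + (d : ℝ) / 2)
    (μ lam p k : ℝ) (hμ : 0 < μ) (hν : 0 < lam + 2 * μ) (hp : 0 < p) (hk : 0 < k) :
    ∃ C : ℝ, 0 < C ∧
      ∀ (ε : ℝ), 0 < ε → ∀ (T : ℝ≥0∞), 0 < T →
      ∀ (v : ℝ → Fin d → Distr d), IsConvectionField χ T v →
      ∀ (F : ℝ → Distr d) (G : ℝ → Fin d → Distr d),
      WeaklyMeasurable T F → (∀ i, WeaklyMeasurable T (fun τ ↦ G τ i)) →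
      ∀ (q : ℝ → Distr d) (u : ℝ → Fin d → Distr d),
      IsSolution χ μ lam p k ε s T v F G q u →
      ∀ t ∈ timeInterval T,
        tildeNormVec χ ∞ (s - 1) t u + tildeNorm χ ∞ (s - 1) t q + tildeNorm χ ∞ s t q
          + tildeNormVec χ 1 (s + 1) t u
          + tildeHybridNorm χ γ ε 1 (s + 1) s t q + tildeHybridNorm χ γ ε 1 (s + 2) s t q
        ≤ ENNReal.ofReal (C * Real.exp (C * (∫⁻ τ in Set.Icc 0 t,
              (besovNormGrad χ ((d : ℝ) / 2) (v τ)
                + besovNormVec χ ((d : ℝ) / 2) (v τ) ^ 2)).toReal))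
          * (besovNormVec χ (s - 1) (u 0) + besovNorm χ (s - 1) (q 0) + besovNorm χ s (q 0)
            + tildeNorm χ 1 (s - 1) t F + tildeNorm χ 1 s t F
            + tildeNormVec χ 1 (s - 1) t G) := by
  -- the range of `s` is empty for `d = 0`
  have hd : 0 < d := Nat.pos_of_ne_zero fun h0 ↦ by
    subst h0
    norm_num at hs hs'
    linarith
  obtain ⟨C₁, hC₁, hest⟩ := exists_tsum_blockSize_estimate (σ := s - 1) hχ hd (by linarith)
    (by linarith) hμ hν hp hk
  obtain ⟨C₂, hC₂, hrate⟩ := exists_blockRate_bounds hp hk hγ hγ'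
  set P : ℝ := 2 * d + 2 + 2 * C₂ with hP
  have hP1 : 1 ≤ P := by
    have : (0 : ℝ) ≤ d := Nat.cast_nonneg d
    rw [hP]; linarith
  have hP0 : 0 < P := zero_lt_one.trans_le hP1
  refine ⟨P * C₁, by positivity, fun ε hε T _ v hv F G hF hG q u hsol t ht ↦ ?_⟩
  have hsub := Icc_subset_timeInterval ht
  have hmono : volume.restrict (Set.Icc 0 t) ≤ volume.restrict (timeInterval T) :=
    Measure.restrict_mono hsub le_rfl
  have hsource := tsum_lintegral_blockSize hχ hd (s - 1) (fun ψ ↦ (hF ψ).mono_measure hmono)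
    fun i ψ ↦ (hG i ψ).mono_measure hmono
  have hinit := tsum_blockSize χ (s - 1) (unknowns q u 0)
  rw [sub_add_cancel] at hsource hinit
  set R := ∑' l, dyadicWeight (s - 1) l * ∫⁻ τ in Set.Icc 0 t, blockSize χ (unknowns F G τ) l
    with hR
  have hdata : besovNormVec χ (s - 1) (u 0) + besovNorm χ (s - 1) (q 0) + besovNorm χ s (q 0)
      + tildeNorm χ 1 (s - 1) t F + tildeNorm χ 1 s t F + tildeNormVec χ 1 (s - 1) t G =
      ∑' l, dyadicWeight (s - 1) l * blockSize χ (unknowns q u 0) l + R := by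
    rw [hinit, hsource]
    change _ = besovNorm χ (s - 1) (q 0) + besovNorm χ s (q 0) + besovNormVec χ (s - 1) (u 0) + _
    ring
  rw [hdata]
  -- a source of infinite norm makes the right side infinite, since the exponential is positive
  rcases eq_or_ne R ⊤ with hRt | hRt
  · rw [hRt, add_top, ENNReal.mul_top (by rw [Ne, ENNReal.ofReal_eq_zero, not_le]; positivity)]
    exact le_top
  obtain ⟨N, hreg⟩ := hsol.exists_isRegularSolution hv hF hG ht fun l ↦
    lt_top_of_mul_lt_top_left (dyadicWeight_ne_zero (s - 1) l)
      ((ENNReal.le_tsum l).trans_lt hRt.lt_top)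
  -- the exponent on the right is finite, so that it dominates that of the estimate also after
  -- `toReal`
  have hint : (∫⁻ τ in Set.Icc 0 t, besovNormGrad χ ((d : ℝ) / 2) (v τ)).toReal ≤
      (∫⁻ τ in Set.Icc 0 t, (besovNormGrad χ ((d : ℝ) / 2) (v τ)
        + besovNormVec χ ((d : ℝ) / 2) (v τ) ^ 2)).toReal := by
    refine ENNReal.toReal_mono ?_ (lintegral_mono fun τ ↦ le_self_add)
    rw [lintegral_add_left' (hreg.aemeasurable_besovNormGrad hχ hd)]
    exact ENNReal.add_ne_top.2 ⟨(hreg.lintegral_besovNormGrad_lt_top hχ hd).ne,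
      ((lintegral_mono_set hsub).trans_lt hv.square_integrable).ne⟩
  have hnorms := norms_le (χ := χ) (q := q) (u := u) (t := t) (hrate ε hε) hC₂.le (s - 1)
  rw [sub_add_cancel, show s - 1 + 2 = s + 1 by ring, show s - 1 + 3 = s + 2 by ring] at hnorms
  refine hnorms.trans ((mul_le_mul_right (hest ε hε t v _ _ N hreg) _).trans ?_)
  rw [← mul_assoc, ← ENNReal.ofReal_mul hP0.le, ← mul_assoc]
  refine mul_le_mul_left (ENNReal.ofReal_le_ofReal ?_) _
  gcongr
  exact le_mul_of_one_le_left hC₁.le hP1
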